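/- **Setting.** Consider the triangular lattice with one family of lattice lines horizontal. A lozenge is the union of two unit triangles sharing an edge; it is *right-tilting* if it has two horizontal sides and two sides of polar direction $\pi/3$, *left-tilting* if it has two horizontal sides and two of direction $2\pi/3$, and *vertical* if it has no horizontal side. Lengths along non-horizontal lattice lines are counted in unit edges, heights in altitudes of unit triangles. Let $x,y,z,t\ge 0$ be integers and let $\mathbf a=(a_1,\dots,a_m)$, $\mathbf b=(b_1,\dots,b_n)$ be (possibly empty) sequences of non-negative integers. Put $o_a=a_1+a_3+\cdots$, $e_a=a_2+a_4+\cdots$, $o_b=b_1+b_3+\cdots$, $e_b=b_2+b_4+\cdots$. *$P$-region.* $P_{x,y,z,t}(\mathbf a;\mathbf b)$ is obtained from the hexagon with side-lengths (clockwise from the northwest side) $x+y+o_a+o_b,\ z+e_a+e_b,\ y+t+o_a+o_b,\ x+y+e_a+e_b,\ z+o_a+o_b,\ y+t+e_a+e_b$ by removing two ferns (strings of contiguous equilateral triangles, alternately pointing up and down, each with one side on a common horizontal axis). The axis meets the northwest side $x$ units above the western vertex and the northeast side $t$ units above the eastern vertex. The left fern starts at the left end of the axis and has, from left to right, lobes of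 sizes $a_1,\dots,a_m$; the right fern starts at the right end and has, from right to left, lobes of sizes $b_1,\dots,b_n$. Odd-indexed lobes of both ferns point up and even-indexed lobes point down. *$Q$-region.* $Q_{x,y,z,t}(\mathbf a;\mathbf b)$ is obtained in the same way from the hexagon with side-lengths $x+y+t+o_a+e_b,\ z+e_a+o_b,\ y+o_a+e_b,\ x+y+t+e_a+o_b,\ z+o_a+e_b,\ y+e_a+o_b$; the axis meets the northwest side $x$ units above the western vertex and the southeast side $t$ units below the eastern vertex; the odd-indexed lobes of the left fern point up and its even-indexed lobes down, while the odd-indexed lobes of the right fern point down and its even-indexed lobes up. *Weights.* Let $q$ be an indeterminate. Under $\mathrm{wt}_1$ (resp. $\mathrm{wt}_2$) a right-tilting (resp. left-tilting) lozenge whose top side is at height $h$ above the bottom side of the hexagon has weight $q^h$, and all other lozenges have weight $1$; the weight of a tiling is the product of the weights of its lozenges. $\operatorname{M}_i(R)$ is the sum of the $\mathrm{wt}_i$-weights of all lozenge tilings of $R$. *Augmented box.* View the triangular lattice as the projection of the cubic lattice $\mathbb Z^3$ along $(1,1,1)$, the coordinate directions $\mathbf e_1,\mathbf e_2,\mathbf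 e_3$ projecting to the unit steps of polar directions $0,\ 2\pi/3,\ -2\pi/3$; moving in these directions is moving up. Each lozenge tiling of a $P$- or $Q$-region lifts to a stepped surface in which every lozenge becomes a unit square and every unit edge of the boundary contour (the hexagon's boundary together with the sides of the ferns) becomes a unit edge of $\mathbb Z^3$. The part of the contour above the axis and the part below it are lifted separately where they meet at a point of a fern, and agree on the segment of the axis between the ferns, including its endpoints. The top left corner of the hexagon is lifted to the origin. The augmented box of the region is the set of unit cubes that lie between the lowest and the highest of these surfaces; it is finite. A *monotone stack* fitting in a set $B$ of unit cubes is a finite set $\pi\subseteq B$ such that, for every cube $c\in\pi$ and $k\in\{1,2,3\}$, if $c-\mathbf e_k$ belongs to $B$ then it belongs to $\pi$. Its volume $|\pi|$ is its number of cubes. *Exponents.* For integers $0\le c\le d$ put $\left\langle{d\atop c}\right\rangle=(c+1)+(c+2)+\cdots+d$. Let $\Delta=x+y+t+e_a+e_b$ and $\square=x+y+e_a+o_b$. Define $$\begin{aligned}A^{(1)}={}&\sum_{i=1}^{\lfloor\frac{m+1}2\rfloor}a_{2i-1}\left\langle{x+\sum_{j=1}^{i-1}a_{2j}\atop 0}\right\rangle+z\left\langle{x+y+e_a\atop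 0}\right\rangle+\sum_{i=1}^{\lfloor\frac{n+1}2\rfloor}b_{2i-1}\left\langle{x+y+e_a+e_b-\sum_{j=1}^{i-1}b_{2j}\atop 0}\right\rangle\\&+\sum_{i=1}^{\lfloor\frac m2\rfloor}a_{2i}\left\langle{\Delta+y+o_a+o_b-\sum_{j=1}^{i}a_{2j-1}\atop\Delta}\right\rangle+z\left\langle{\Delta+o_b\atop\Delta}\right\rangle+\sum_{i=1}^{\lfloor\frac n2\rfloor}b_{2i}\left\langle{\Delta+\sum_{j=1}^{i}b_{2j-1}\atop\Delta}\right\rangle,\end{aligned}$$ $$\begin{aligned}A^{(2)}={}&\sum_{i=1}^{\lfloor\frac{m+1}2\rfloor}a_{2i-1}\left\langle{y+t+e_a+e_b-\sum_{j=1}^{i-1}a_{2j}\atop 0}\right\rangle+z\left\langle{y+t+e_b\atop 0}\right\rangle+\sum_{i=1}^{\lfloor\frac{n+1}2\rfloor}b_{2i-1}\left\langle{t+\sum_{j=1}^{i-1}b_{2j}\atop 0}\right\rangle\\&+\sum_{i=1}^{\lfloor\frac m2\rfloor}a_{2i}\left\langle{\Delta+\sum_{j=1}^{i}a_{2j-1}\atop\Delta}\right\rangle+z\left\langle{\Delta+o_a\atop\Delta}\right\rangle+\sum_{i=1}^{\lfloor\frac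 n2\rfloor}b_{2i}\left\langle{\Delta+y+o_a+o_b-\sum_{j=1}^{i}b_{2j-1}\atop\Delta}\right\rangle,\end{aligned}$$ $$\begin{aligned}B^{(1)}={}&\sum_{i=1}^{\lfloor\frac{m+1}2\rfloor}a_{2i-1}\left\langle{x+\sum_{j=1}^{i-1}a_{2j}\atop 0}\right\rangle+z\left\langle{x+y+e_a\atop 0}\right\rangle+\sum_{i=1}^{\lfloor\frac n2\rfloor}b_{2i}\left\langle{x+y+e_a+o_b-\sum_{j=1}^{i}b_{2j-1}\atop 0}\right\rangle\\&+\sum_{i=1}^{\lfloor\frac m2\rfloor}a_{2i}\left\langle{\square+y+t+o_a+e_b-\sum_{j=1}^{i}a_{2j-1}\atop\square}\right\rangle+z\left\langle{\square+t+e_b\atop\square}\right\rangle+\sum_{i=1}^{\lfloor\frac{n+1}2\rfloor}b_{2i-1}\left\langle{\square+t+\sum_{j=1}^{i-1}b_{2j}\atop\square}\right\rangle,\end{aligned}$$ $$\begin{aligned}B^{(2)}={}&\sum_{i=1}^{\lfloor\frac{m+1}2\rfloor}a_{2i-1}\left\langle{y+e_a+o_b-\sum_{j=1}^{i-1}a_{2j}\atop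 0}\right\rangle+z\left\langle{y+o_b\atop 0}\right\rangle+\sum_{i=1}^{\lfloor\frac n2\rfloor}b_{2i}\left\langle{\sum_{j=1}^{i}b_{2j-1}\atop 0}\right\rangle\\&+\sum_{i=1}^{\lfloor\frac m2\rfloor}a_{2i}\left\langle{\square+\sum_{j=1}^{i}a_{2j-1}\atop\square}\right\rangle+z\left\langle{\square+o_a\atop\square}\right\rangle+\sum_{i=1}^{\lfloor\frac{n+1}2\rfloor}b_{2i-1}\left\langle{\square+y+o_a+e_b-\sum_{j=1}^{i-1}b_{2j}\atop\square}\right\rangle.\end{aligned}$$ **Lemma (label ratio).** For all non-negative integers $x,y,z,t$ and all finite sequences $\mathbf a,\mathbf b$ of non-negative integers, as polynomials in $q$, $$\operatorname{M}_1(P_{x,y,z,t}(\mathbf a;\mathbf b))=q^{A^{(1)}}\sum_\pi q^{|\pi|},\qquad \operatorname{M}_2(P_{x,y,z,t}(\mathbf a;\mathbf b))=q^{A^{(2)}}\sum_\pi q^{|\pi|},$$ $$\operatorname{M}_1(Q_{x,y,z,t}(\mathbf a;\mathbf b))=q^{B^{(1)}}\sum_\pi q^{|\pi|},\qquad \operatorname{M}_2(Q_{x,y,z,t}(\mathbf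 a;\mathbf b))=q^{B^{(2)}}\sum_\pi q^{|\pi|},$$ where in each equation the sum runs over all monotone stacks $\pi$ of unit cubes fitting in the augmented box of the region on the left-hand side. -/

import Mathlib

open Polynomial

namespace LozengeTiling

/-! ### The triangular lattice, regions and lozenge tilings -/

/-- A vertex of the triangular lattice: `(i, j)` stands for the point `i + j * exp (π i / 3)`, so
that `j` is the height, measured in altitudes of unit triangles. -/
abbrev Vertex := ℤ × ℤ

/-- A unit triangle. The up-pointing one has vertices `(i, j), (i + 1, j), (i, j + 1)`, the
down-pointing one `(i + 1, j), (i, j + 1), (i + 1, j + 1)`. -/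
structure UnitTriangle where
  up : Bool
  i : ℤ
  j : ℤ
  deriving DecidableEq

def UnitTriangle.vertices (τ : UnitTriangle) : Finset Vertex :=
  if τ.up then {(τ.i, τ.j), (τ.i + 1, τ.j), (τ.i, τ.j + 1)}
  else {(τ.i + 1, τ.j), (τ.i, τ.j + 1), (τ.i + 1, τ.j + 1)}

/-- A right-tilting lozenge has two horizontal sides and two sides of direction `π / 3`, a
left-tilting one has two horizontal sides and two sides of direction `2 π / 3`, a vertical one has
no horizontal side. -/
inductive LozengeKind where
  | right
  | left
  | vertical
  deriving DecidableEq

/-- A lozenge, recorded by its kind and the position of its up-pointing unit triangle. -/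
structure Lozenge where
  kind : LozengeKind
  i : ℤ
  j : ℤ
  deriving DecidableEq

def Lozenge.upTriangle (l : Lozenge) : UnitTriangle := ⟨true, l.i, l.j⟩

def Lozenge.downTriangle (l : Lozenge) : UnitTriangle :=
  match l.kind with
  | .right => ⟨false, l.i, l.j⟩
  | .left => ⟨false, l.i - 1, l.j⟩
  | .vertical => ⟨false, l.i, l.j - 1⟩

def Lozenge.triangles (l : Lozenge) : Finset UnitTriangle := {l.upTriangle, l.downTriangle}

/-- The endpoints of the short diagonal of a lozenge. -/
def Lozenge.diagonal (l : Lozenge) : Finset Vertex :=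
  l.upTriangle.vertices ∩ l.downTriangle.vertices

/-- The lozenges contained in a region (a finite set of unit triangles). -/
def lozengesIn (R : Finset UnitTriangle) : Finset Lozenge :=
  R.biUnion fun τ =>
    ({⟨.right, τ.i, τ.j⟩, ⟨.left, τ.i, τ.j⟩, ⟨.vertical, τ.i, τ.j⟩} : Finset Lozenge).filter
      fun l => l.triangles ⊆ R

/-- The lozenge tilings of a region: the sets of lozenges contained in the region that cover each
of its unit triangles exactly once. -/
def tilings (R : Finset UnitTriangle) : Finset (Finset Lozenge) :=
  (lozengesIn R).powerset.filter fun T => ∀ τ ∈ R, (T.filter fun l => τ ∈ l.triangles).card = 1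

/-! ### The two weights. All hexagons below have their bottom side at height `0`. -/

/-- The weight `wt₁` of a lozenge: `q ^ h` for a right-tilting lozenge whose top side is at height
`h`, and `1` for the other lozenges. The indeterminate `X` plays the role of `q`. -/
noncomputable def wt₁ (l : Lozenge) : ℤ[X] :=
  match l.kind with
  | .right => X ^ (l.j + 1).toNat
  | _ => 1

/-- The weight `wt₂` of a lozenge: `q ^ h` for a left-tilting lozenge whose top side is at height
`h`, and `1` for the other lozenges. -/
noncomputable def wt₂ (l : Lozenge) : ℤ[X] :=
  match l.kind with
  | .left => X ^ (l.j + 1).toNat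
  | _ => 1

/-- The tiling generating function for the weight `wt₁`. -/
noncomputable def M₁ (R : Finset UnitTriangle) : ℤ[X] := ∑ T ∈ tilings R, ∏ l ∈ T, wt₁ l

/-- The tiling generating function for the weight `wt₂`. -/
noncomputable def M₂ (R : Finset UnitTriangle) : ℤ[X] := ∑ T ∈ tilings R, ∏ l ∈ T, wt₂ l

/-! ### Hexagons with two removed ferns -/

/-- A lobe: an equilateral triangle of side `size`, one side of which lies on the fern axis and
starts at first coordinate `left`; it points up (and lies above the axis) or down (and lies below
the axis). -/
structure Lobe where
  up : Bool
  left : ℤ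
  size : ℕ

/-- A lattice hexagon with lobes removed along a common horizontal axis. The side-lengths are
listed clockwise from the northwest side; the bottom side is the segment from `(0, 0)` to
`(s, 0)`. The axis is at height `axis`. The ferns leave free the segment of the axis between the
first coordinates `tipL` (right end of the left fern) and `tipR` (left end of the right fern). -/
structure IntrudedHexagon where
  nw : ℕ
  n : ℕ
  ne : ℕ
  se : ℕ
  s : ℕ
  sw : ℕ
  axis : ℕ
  tipL : ℤ
  tipR : ℤ
  lobes : List Lobe

namespace IntrudedHexagon

variable (G : IntrudedHexagon)

/-- The vertex `v` lies in the closed hexagon. -/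
def Contains (v : Vertex) : Prop :=
  -(G.sw : ℤ) ≤ v.1 ∧ v.1 ≤ G.s ∧ 0 ≤ v.2 ∧ v.2 ≤ G.sw + G.nw ∧ 0 ≤ v.1 + v.2 ∧
    v.1 + v.2 ≤ G.s + G.se

instance : DecidablePred G.Contains := fun v => by unfold Contains; infer_instance

/-- The vertex `v` lies in the closed lobe `l`. -/
def LobeContains (l : Lobe) (v : Vertex) : Prop :=
  if l.up then l.left ≤ v.1 ∧ (G.axis : ℤ) ≤ v.2 ∧ v.1 + v.2 ≤ l.left + G.axis + l.size
  else v.1 ≤ l.left + l.size ∧ v.2 ≤ (G.axis : ℤ) ∧ l.left + G.axis ≤ v.1 + v.2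

instance (l : Lobe) : DecidablePred (G.LobeContains l) := fun v => by
  unfold LobeContains; infer_instance

/-- The region: the unit triangles of the hexagon that do not lie in a lobe. -/
noncomputable def region : Finset UnitTriangle :=
  ((Finset.univ ×ˢ Finset.Icc (-(G.sw : ℤ)) G.s ×ˢ Finset.Icc (0 : ℤ) (G.sw + G.nw)).image
      fun p : Bool × ℤ × ℤ => (⟨p.1, p.2.1, p.2.2⟩ : UnitTriangle)).filter
    fun τ => (∀ v ∈ τ.vertices, G.Contains v) ∧
      ∀ l ∈ G.lobes, ¬ ∀ v ∈ τ.vertices, G.LobeContains l v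

end IntrudedHexagon

/-- The entry `l_i` of a sequence `l = (l_1, …, l_m)`. -/
def entry (l : List ℕ) (i : ℕ) : ℕ := l.getD (i - 1) 0

/-- `l_1 + l_3 + l_5 + ⋯` -/
def oddSum (l : List ℕ) : ℕ := ∑ i ∈ Finset.Icc 1 ((l.length + 1) / 2), entry l (2 * i - 1)

/-- `l_2 + l_4 + l_6 + ⋯` -/
def evenSum (l : List ℕ) : ℕ := ∑ i ∈ Finset.Icc 1 (l.length / 2), entry l (2 * i)

/-- The lobes, from left to right and of alternating orientations, of the fern that starts at
first coordinate `p` with a lobe that points up if `u` is true and down otherwise. -/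
def leftFern : ℤ → Bool → List ℕ → List Lobe
  | _, _, [] => []
  | p, u, c :: l => ⟨u, p, c⟩ :: leftFern (p + c) (!u) l

/-- The same with lobes listed from right to left, starting from the right end `p`. -/
def rightFern : ℤ → Bool → List ℕ → List Lobe
  | _, _, [] => []
  | p, u, c :: l => ⟨u, p - c, c⟩ :: rightFern (p - c) (!u) l

/-- The hexagon and the ferns of the region `P_{x,y,z,t}(a; b)`. The axis is `x` units above the
western vertex along the northwest side and `t` units above the eastern vertex along the northeast
side; the first lobe of either fern points up. -/
def pHexagon (x y z t : ℕ) (a b : List ℕ) : IntrudedHexagon where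
  nw := x + y + oddSum a + oddSum b
  n := z + evenSum a + evenSum b
  ne := y + t + oddSum a + oddSum b
  se := x + y + evenSum a + evenSum b
  s := z + oddSum a + oddSum b
  sw := y + t + evenSum a + evenSum b
  axis := x + y + t + evenSum a + evenSum b
  tipL := -((y + t + evenSum a + evenSum b : ℕ) : ℤ) + a.sum
  tipR := ((z + oddSum a + oddSum b : ℕ) : ℤ) - t - b.sum
  lobes := leftFern (-((y + t + evenSum a + evenSum b : ℕ) : ℤ)) true a ++
    rightFern (((z + oddSum a + oddSum b : ℕ) : ℤ) - t) true b

/-- The hexagon and the ferns of the region `Q_{x,y,z,t}(a; b)`. The axis is `x` units above the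
western vertex along the northwest side and `t` units below the eastern vertex along the southeast
side; the first lobe of the left fern points up, the first (rightmost) lobe of the right fern
points down. -/
def qHexagon (x y z t : ℕ) (a b : List ℕ) : IntrudedHexagon where
  nw := x + y + t + oddSum a + evenSum b
  n := z + evenSum a + oddSum b
  ne := y + oddSum a + evenSum b
  se := x + y + t + evenSum a + oddSum b
  s := z + oddSum a + evenSum b
  sw := y + evenSum a + oddSum b
  axis := x + y + evenSum a + oddSum b
  tipL := -((y + evenSum a + oddSum b : ℕ) : ℤ) + a.sum
  tipR := ((z + oddSum a + evenSum b : ℕ) : ℤ) - b.sum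
  lobes := leftFern (-((y + evenSum a + oddSum b : ℕ) : ℤ)) true a ++
    rightFern ((z + oddSum a + evenSum b : ℕ) : ℤ) false b

/-! ### Stepped surfaces, augmented boxes and monotone stacks -/

/-- A vertex of the cubic lattice, also used for the unit cube `[c, c + (1, 1, 1)]`. -/
abbrev Cell := Fin 3 → ℤ

/-- The polar directions `0`, `2 π / 3`, `-2 π / 3` in the triangular lattice. They are the
projections of the three coordinate directions of the cubic lattice, along which one moves up. -/
def dir : Fin 3 → Vertex := ![(1, 0), (-1, 1), (0, -1)]

/-- The unit step of the cubic lattice that projects to `dir k`. -/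
def step (k : Fin 3) : Cell := Pi.single k 1

namespace IntrudedHexagon

variable (G : IntrudedHexagon)

/-- Whether a unit triangle lies above the fern axis. -/
def above (τ : UnitTriangle) : Bool := decide ((G.axis : ℤ) ≤ τ.j)

/-- The edge from `u` to `u + dir k` lies on the boundary of the hexagon. -/
def IsHexagonEdge (u : Vertex) (k : Fin 3) : Prop :=
  G.Contains u ∧ G.Contains (u + dir k) ∧
    (k = 0 ∧ (u.2 = 0 ∨ u.2 = G.sw + G.nw) ∨
      k = 1 ∧ (u.1 + u.2 = 0 ∨ u.1 + u.2 = G.s + G.se) ∨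
      k = 2 ∧ (u.1 = -(G.sw : ℤ) ∨ u.1 = G.s))

/-- The edges of the boundary contour. The contour runs along the hexagon and around the ferns;
its part above the axis (`side = true`) and its part below the axis (`side = false`) are kept
apart, since a vertex on a fern is in general visited by both of them, at different heights. The
side of a lobe that lies on the axis belongs to the part opposite to the lobe. -/
inductive IsContourEdge : Bool → Vertex → Fin 3 → Prop
  | top (u : Vertex) : G.IsHexagonEdge u 0 → u.2 = G.sw + G.nw → IsContourEdge true u 0
  | bottom (u : Vertex) : G.IsHexagonEdge u 0 → u.2 = 0 → IsContourEdge false u 0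
  | slantedAbove (u : Vertex) (k : Fin 3) : k ≠ 0 → G.IsHexagonEdge u k →
      (G.axis : ℤ) ≤ u.2 → (G.axis : ℤ) ≤ (u + dir k).2 → IsContourEdge true u k
  | slantedBelow (u : Vertex) (k : Fin 3) : k ≠ 0 → G.IsHexagonEdge u k →
      u.2 ≤ (G.axis : ℤ) → (u + dir k).2 ≤ (G.axis : ℤ) → IsContourEdge false u k
  | lobeAxis (l : Lobe) (u : Vertex) : l ∈ G.lobes →
      G.LobeContains l u → G.LobeContains l (u + dir 0) →
      u.2 = G.axis → IsContourEdge (!l.up) u 0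
  | lobeRising (l : Lobe) (u : Vertex) : l ∈ G.lobes →
      G.LobeContains l u → G.LobeContains l (u + dir 2) →
      u.1 = (if l.up then l.left else l.left + l.size) → IsContourEdge l.up u 2
  | lobeFalling (l : Lobe) (u : Vertex) : l ∈ G.lobes →
      G.LobeContains l u → G.LobeContains l (u + dir 1) →
      u.1 + u.2 = l.left + G.axis + (if l.up then (l.size : ℤ) else 0) → IsContourEdge l.up u 1

/-- `σ` is the stepped surface in the cubic lattice that projects to the tiling `T`: every lozenge
of `T` is lifted to a unit square and every edge of the contour to a unit edge of the cubic
lattice, and the top left corner of the hexagon is lifted to the origin. Here `σ true v` and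
`σ false v` are the lifts of `v` as a vertex of the part of the region above and below the axis;
they agree on the segment of the axis that is left free by the ferns. -/
structure IsSteppedSurface (T : Finset Lozenge) (σ : Bool → Vertex → Cell) : Prop where
  topLeft : σ true (-(G.sw : ℤ), G.sw + G.nw) = 0
  lozenge : ∀ l ∈ T, ∀ τ ∈ l.triangles, ∀ (u : Vertex) (k : Fin 3),
    u ∈ τ.vertices → u + dir k ∈ τ.vertices → ¬ (u ∈ l.diagonal ∧ u + dir k ∈ l.diagonal) →
      σ (G.above τ) (u + dir k) = σ (G.above τ) u + step k
  contour : ∀ (side : Bool) (u : Vertex) (k : Fin 3), G.IsContourEdge side u k →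
    σ side (u + dir k) = σ side u + step k
  glue : ∀ i : ℤ, G.tipL ≤ i → i ≤ G.tipR → σ true (i, (G.axis : ℤ)) = σ false (i, (G.axis : ℤ))

/-- All six unit triangles around the vertex `v` belong to the region. -/
def IsInterior (v : Vertex) : Prop := ∀ τ : UnitTriangle, v ∈ τ.vertices → τ ∈ G.region

/-- The lift of an interior vertex (on the axis the two lifts agree). -/
def lift (σ : Bool → Vertex → Cell) (v : Vertex) : Cell := σ (decide ((G.axis : ℤ) ≤ v.2)) v

/-- The cube `c`, projecting onto the unit hexagon centred at `v`, lies below the surface `σ`: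
its top corner `c + (1, 1, 1)` is at or below the point of the surface over `v`. -/
def CubeBelow (σ : Bool → Vertex → Cell) (v : Vertex) (c : Cell) : Prop :=
  ∃ r : ℤ, 1 ≤ r ∧ G.lift σ v = c + fun _ => r

/-- The cube `c`, projecting onto the unit hexagon centred at `v`, lies above the surface `σ`:
its bottom corner `c` is at or above the point of the surface over `v`. -/
def CubeAbove (σ : Bool → Vertex → Cell) (v : Vertex) (c : Cell) : Prop :=
  ∃ r : ℤ, r ≤ 0 ∧ G.lift σ v = c + fun _ => r

/-- The augmented box: the unit cubes between the lowest and the highest stepped surfaces that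
project to tilings of the region, that is, the cubes below some of these surfaces and above some
of them. -/
def augmentedBox : Set Cell :=
  {c | ∃ v, G.IsInterior v ∧
    (∃ T ∈ tilings G.region, ∃ σ, G.IsSteppedSurface T σ ∧ G.CubeBelow σ v c) ∧
    (∃ T ∈ tilings G.region, ∃ σ, G.IsSteppedSurface T σ ∧ G.CubeAbove σ v c)}

end IntrudedHexagon

/-- A monotone stack of unit cubes fitting in a solid `B`: a finite set of cubes of `B` without a
free cell of `B` directly next to one of its cubes on the lower side, in any of the three
directions. (Direction `1` is that of the columns, and directions `0` and `2` are those in which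
the heights of neighbouring columns decrease weakly. In an `a × b × c` box these are the diagrams
of the plane partitions.) -/
def IsMonotoneStack (B : Set Cell) (π : Finset Cell) : Prop :=
  (∀ c ∈ π, c ∈ B) ∧ ∀ c ∈ π, ∀ k : Fin 3, c - step k ∈ B → c - step k ∈ π

/-- The volume generating function `∑ q ^ |π|` over the monotone stacks `π` fitting in `B`. -/
noncomputable def volumeGF (B : Set Cell) : ℤ[X] :=
  ∑ᶠ (π : Finset Cell) (_ : IsMonotoneStack B π), X ^ π.card

/-! ### The exponents -/

/-- `(c + 1) + (c + 2) + ⋯ + d`. -/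
def bracket (d c : ℕ) : ℕ := ∑ k ∈ Finset.Ioc c d, k

/-- `l_1 + l_3 + ⋯ + l_{2 i - 1}` -/
def oddPartial (l : List ℕ) (i : ℕ) : ℕ := ∑ j ∈ Finset.Icc 1 i, entry l (2 * j - 1)

/-- `l_2 + l_4 + ⋯ + l_{2 i}` -/
def evenPartial (l : List ℕ) (i : ℕ) : ℕ := ∑ j ∈ Finset.Icc 1 i, entry l (2 * j)

/-- `∑ l_{2 i - 1} f(i)` over the odd positions of the sequence `l`. -/
def sumOdd (l : List ℕ) (f : ℕ → ℕ) : ℕ :=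
  ∑ i ∈ Finset.Icc 1 ((l.length + 1) / 2), entry l (2 * i - 1) * f i

/-- `∑ l_{2 i} f(i)` over the even positions of the sequence `l`. -/
def sumEven (l : List ℕ) (f : ℕ → ℕ) : ℕ :=
  ∑ i ∈ Finset.Icc 1 (l.length / 2), entry l (2 * i) * f i

/-! In the following definitions every subtraction is one of a partial sum from the full sum. -/

def expA₁ (x y z t : ℕ) (a b : List ℕ) : ℕ :=
  let Δ := x + y + t + evenSum a + evenSum b
  sumOdd a (fun i => bracket (x + evenPartial a (i - 1)) 0)
    + z * bracket (x + y + evenSum a) 0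
    + sumOdd b (fun i => bracket (x + y + evenSum a + evenSum b - evenPartial b (i - 1)) 0)
    + sumEven a (fun i => bracket (Δ + y + oddSum a + oddSum b - oddPartial a i) Δ)
    + z * bracket (Δ + oddSum b) Δ
    + sumEven b (fun i => bracket (Δ + oddPartial b i) Δ)

def expA₂ (x y z t : ℕ) (a b : List ℕ) : ℕ :=
  let Δ := x + y + t + evenSum a + evenSum b
  sumOdd a (fun i => bracket (y + t + evenSum a + evenSum b - evenPartial a (i - 1)) 0)
    + z * bracket (y + t + evenSum b) 0
    + sumOdd b (fun i => bracket (t + evenPartial b (i - 1)) 0)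
    + sumEven a (fun i => bracket (Δ + oddPartial a i) Δ)
    + z * bracket (Δ + oddSum a) Δ
    + sumEven b (fun i => bracket (Δ + y + oddSum a + oddSum b - oddPartial b i) Δ)

def expB₁ (x y z t : ℕ) (a b : List ℕ) : ℕ :=
  let E := x + y + evenSum a + oddSum b
  sumOdd a (fun i => bracket (x + evenPartial a (i - 1)) 0)
    + z * bracket (x + y + evenSum a) 0
    + sumEven b (fun i => bracket (x + y + evenSum a + oddSum b - oddPartial b i) 0)
    + sumEven a (fun i => bracket (E + y + t + oddSum a + evenSum b - oddPartial a i) E)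
    + z * bracket (E + t + evenSum b) E
    + sumOdd b (fun i => bracket (E + t + evenPartial b (i - 1)) E)

def expB₂ (x y z _t : ℕ) (a b : List ℕ) : ℕ :=
  let E := x + y + evenSum a + oddSum b
  sumOdd a (fun i => bracket (y + evenSum a + oddSum b - evenPartial a (i - 1)) 0)
    + z * bracket (y + oddSum b) 0
    + sumEven b (fun i => bracket (oddPartial b i) 0)
    + sumEven a (fun i => bracket (E + oddPartial a i) E)
    + z * bracket (E + oddSum a) E
    + sumOdd b (fun i => bracket (E + y + oddSum a + evenSum b - evenPartial b (i - 1)) E)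

end LozengeTiling
open LozengeTiling

/-! Cut the region along the axis of the ferns. In each half, record for every row of triangles the
positions of the vertical lozenges. Once the lobes and the part of the half plane outside the
hexagon are filled with forced lozenges, consecutive rows interlace, and minus the number of
vertical lozenges to the left of a point is the height of the stepped surface there. A tiling thus
becomes a pair of interlacing chains, the one below the axis being rotated by π. Their bottom rows
are `U ∪ S` and the reflection of `D ∪ S`: `U` and `D` are the segments of the prolonged axis
blocked above and below it, and `S` is the set of the `y` vertical lozenges that cross the free
segment. This is a bijection onto `Model` (`chains_mem_model`, `exists_chains_eq`, `chains_injOn`).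

Pushing `S` to the left end of the free segment and taking extremal chains gives the lowest surface
in both halves at once, and pushing it to the right gives the highest (`ht_bounds`). A stepped
surface is determined at the interior vertices by its tiling (`lift_eq`), so the augmented box
consists of the cubes between these two surfaces (`mem_augmentedBox`). Monotone stacks in it are
exactly the sets of cubes between the lowest surface and another one (`exists_stack_eq`,
`stack_injOn`). Hence the volume generating function is the sum over tilings of `q ^ (vol -
vol_min)` (`volumeGF_eq`).

The indicators of right- and left-tilting lozenges are differences of heights. Summation by parts
then shows that the exponent of `wt₁` is the volume plus a constant, and that of `wt₂` is minus the
volume plus a constant (`expo_sub`). For `M₁` the constant is read off at the lowest tiling. For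
`M₂` it is read off at the highest one, which yields the sum of `q ^ (vol_max - vol)`. It remains to
know that the volume generating function is palindromic.

For fixed `S` the chains over a given bottom row, weighted by volume, sum to a Vandermonde product
(`gtSum_mul`). The volume generating function therefore splits into palindromic factors and a sum
over `S` that depends only on the free segment and on the union `U ∪ D`, not on how the ferns
distribute it between the two sides (`sum_vol`). The same sum, up to translation, arises from a
hexagon without ferns, and there rotation by π proves the symmetry (`palindromic_hexagon`).

Finally, the extremal chains are explicit. The weights of the lozenges in the extremal tilings can
be grouped by the empty positions of the bottom rows, each contributing a bracket in the number of
particles on one side of it (`sum_right_low`, `sum_left_high`, `sum_right_high`, `sum_left_low`).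
Sorting the empty positions by lobes gives the four exponents. -/

namespace LozengeTiling
/-! ### Rows of particles and interlacing chains -/

/-- The number of elements of `A` smaller than `i`. -/
def below (A : Finset ℤ) (i : ℤ) : ℤ := ((A.filter (· < i)).card : ℤ)

lemma below_nonneg (A : Finset ℤ) (i : ℤ) : 0 ≤ below A i := by unfold below; positivity

lemma below_le_card (A : Finset ℤ) (i : ℤ) : below A i ≤ A.card := by
  unfold below; exact_mod_cast Finset.card_filter_le _ _

lemma below_succ (A : Finset ℤ) (i : ℤ) :
    below A (i + 1) = below A i + if i ∈ A then 1 else 0 := by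
  unfold below
  have h : A.filter (· < i + 1) = A.filter (· < i) ∪ (if i ∈ A then {i} else ∅) := by
    ext p
    split_ifs with hi
    · simp only [Finset.mem_filter, Finset.mem_union, Finset.mem_singleton]
      constructor
      · rintro ⟨h1, h2⟩
        by_cases h3 : p = i
        · exact Or.inr h3
        · exact Or.inl ⟨h1, by omega⟩
      · rintro (⟨h1, h2⟩ | rfl)
        · exact ⟨h1, by omega⟩
        · exact ⟨hi, by omega⟩
    · simp only [Finset.mem_filter, Finset.mem_union, Finset.notMem_empty, or_false]
      constructor
      · rintro ⟨h1, h2⟩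
        refine ⟨h1, ?_⟩
        rcases eq_or_ne p i with rfl | h3
        · exact absurd h1 hi
        · omega
      · rintro ⟨h1, h2⟩
        exact ⟨h1, by omega⟩
  rw [h, Finset.card_union_of_disjoint]
  · split_ifs <;> simp
  · split_ifs <;> simp

lemma below_eq_zero {A : Finset ℤ} {i : ℤ} (h : ∀ p ∈ A, i ≤ p) : below A i = 0 := by
  unfold below
  rw [Finset.filter_eq_empty_iff.2]
  · simp
  · intro p hp
    have := h p hp
    omega

lemma below_eq_card {A : Finset ℤ} {i : ℤ} (h : ∀ p ∈ A, p < i) : below A i = A.card := by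
  unfold below
  rw [Finset.filter_true_of_mem h]

lemma below_union {A B : Finset ℤ} (h : Disjoint A B) (i : ℤ) :
    below (A ∪ B) i = below A i + below B i := by
  unfold below
  rw [Finset.filter_union, Finset.card_union_of_disjoint]
  · simp
  · exact Finset.disjoint_filter_filter h

lemma below_Ico (a b i : ℤ) (h : a ≤ b) : below (Finset.Ico a b) i = max 0 (min i b - a) := by
  unfold below
  have : (Finset.Ico a b).filter (· < i) = Finset.Ico a (min i b) := by
    ext p; simp only [Finset.mem_filter, Finset.mem_Ico, lt_min_iff]; omega
  rw [this, Int.card_Ico]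
  omega

/-- The height profile of a row of particles `A`. -/
def row (A : Finset ℤ) (i : ℤ) : ℤ := -below A i

lemma row_succ (A : Finset ℤ) (i : ℤ) : row A (i + 1) = row A i - if i ∈ A then 1 else 0 := by
  unfold row; rw [below_succ]; ring

lemma row_nonpos (A : Finset ℤ) (i : ℤ) : row A i ≤ 0 := by
  have := below_nonneg A i; unfold row; omega

lemma neg_card_le_row (A : Finset ℤ) (i : ℤ) : -(A.card : ℤ) ≤ row A i := by
  have := below_le_card A i; unfold row; omega

lemma row_injective {A B : Finset ℤ} (h : row A = row B) : A = B := by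
  ext p
  have h1 := row_succ A p
  have h2 := row_succ B p
  rw [h] at h1
  rw [h1] at h2
  split_ifs at h2 <;> first | omega | simp_all

/-- The reflected set of particles. -/
def refl (A : Finset ℤ) : Finset ℤ := A.image fun p => -1 - p

@[simp] lemma mem_refl {A : Finset ℤ} {p : ℤ} : p ∈ refl A ↔ -1 - p ∈ A := by
  unfold refl
  simp only [Finset.mem_image]
  constructor
  · rintro ⟨a, ha, rfl⟩; simpa using ha
  · intro h; exact ⟨_, h, by ring⟩

@[simp] lemma refl_refl (A : Finset ℤ) : refl (refl A) = A := by ext p; simp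

@[simp] lemma card_refl (A : Finset ℤ) : (refl A).card = A.card :=
  Finset.card_image_of_injective _ fun a b h => by simpa using h

lemma refl_union (A B : Finset ℤ) : refl (A ∪ B) = refl A ∪ refl B := by ext; simp

/-- A particle `p` stands for the segment from `p` to `p + 1`, which rotation carries to the one
starting at `-1 - p`. Being left of `i` after the rotation means starting at or to the right of `-i`
before it. -/
lemma below_refl (A : Finset ℤ) (i : ℤ) : below (refl A) i = A.card - below A (-i) := by
  have h : (refl A).filter (· < i) = refl (A.filter fun p => ¬ p < -i) := by
    ext p; simp only [Finset.mem_filter, mem_refl]; constructor <;> rintro ⟨h, h'⟩ <;>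
      exact ⟨h, by omega⟩
  have h2 := Finset.card_filter_add_card_filter_not (s := A) (· < -i)
  unfold below
  rw [h, card_refl]
  omega

/-- Interlacing chains of rows: the heights of a stepped surface over a half plane. -/
structure Chain (n : ℕ) (N : ℕ → ℤ → ℤ) : Prop where
  anti : ∀ k i, N k (i + 1) ≤ N k i
  up : ∀ k i, N k i ≤ N (k + 1) i
  diag : ∀ k i, N (k + 1) i ≤ N k (i + 1) + 1
  top : ∀ k, n ≤ k → ∀ i, N k i = 0

namespace Chain
variable {n : ℕ} {N : ℕ → ℤ → ℤ} (h : Chain n N)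
include h

lemma le_add (k l : ℕ) (i : ℤ) : N k i ≤ N (k + l) i := by
  induction l with
  | zero => simp
  | succ l ih => exact ih.trans (h.up _ _)

lemma diag_add (k l : ℕ) (i : ℤ) : N (k + l) i ≤ N k (i + l) + l := by
  induction l generalizing i with
  | zero => simp
  | succ l ih =>
    have h1 := h.diag (k + l) i
    have h2 := ih (i + 1)
    have h3 : i + 1 + (l : ℤ) = i + ((l + 1 : ℕ) : ℤ) := by push_cast; ring
    rw [h3] at h2
    push_cast at h2 ⊢
    rw [← add_assoc]
    linarith

lemma slope (k : ℕ) (i : ℤ) : N k i ≤ N k (i + 1) + 1 := (h.up k i).trans (h.diag k i)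

lemma slope_add (k l : ℕ) (i : ℤ) : N k i ≤ N k (i + l) + l := by
  induction l with
  | zero => simp
  | succ l ih =>
    have h1 := h.slope k (i + l)
    have e : i + ((l + 1 : ℕ) : ℤ) = i + l + 1 := by push_cast; ring
    rw [e]
    push_cast
    linarith

lemma nonpos (k : ℕ) (i : ℤ) : N k i ≤ 0 := by
  have := h.le_add k n i
  rwa [h.top (k + n) (by omega)] at this

lemma neg_le (k : ℕ) (i : ℤ) : -((n - k : ℕ) : ℤ) ≤ N k i := by
  have := h.diag_add k (n - k) (i - (n - k : ℕ))
  rw [h.top _ (by omega)] at this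
  simp only [sub_add_cancel] at this
  linarith

lemma eq_zero_of_left {i : ℤ} (h0 : N 0 i = 0) (k : ℕ) : N k i = 0 := by
  have h1 := h.le_add 0 k i
  have h2 := h.nonpos k i
  simp only [zero_add] at h1
  omega

lemma eq_of_right {k : ℕ} {i : ℤ} (h0 : N 0 (i + k) = -(n : ℤ)) : N k i = -((n - k : ℕ) : ℤ) := by
  have h1 := h.diag_add 0 k i
  have h2 := h.neg_le k i
  simp only [zero_add] at h1
  rw [h0] at h1
  rcases le_total n k with hk | hk
  · rw [h.top k hk] ; simp [hk]
  · omega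

/-- A fully occupied segment forces the whole triangle standing on it: within the triangle `le_add`
and `diag_add` bound the height from both sides by the same linear function. This is how removed
lobes are treated as frozen parts of a chain. -/
lemma eq_of_block {a b : ℤ} (hab : N 0 b = N 0 a - (b - a)) {k : ℕ} {i : ℤ} (hi : a ≤ i)
    (hk : i + k ≤ b) : N k i = N 0 a - (i - a) := by
  have h1 := h.diag_add 0 k i
  have h2 := h.le_add 0 k i
  have h3 := h.slope_add 0 (i - a).toNat a
  have h4 := h.slope_add 0 (b - (i + k)).toNat (i + k)
  have h5 := h.slope_add 0 k i
  have e1 : ((i - a).toNat : ℤ) = i - a := by omega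
  have e2 : ((b - (i + k)).toNat : ℤ) = b - (i + k) := by omega
  rw [e1] at h3
  rw [e2] at h4
  simp only [zero_add] at h1 h2
  have e3 : a + (i - a) = i := by ring
  have e4 : i + k + (b - (i + k)) = b := by ring
  rw [e3] at h3
  rw [e4] at h4
  omega

end Chain

/-- The interlacing chains with bottom row `A`. -/
def Pat (A : Finset ℤ) : Set (ℕ → ℤ → ℤ) := {N | Chain A.card N ∧ N 0 = row A}

/-- The lowest chain with bottom row `A`. -/
def low (A : Finset ℤ) (k : ℕ) (i : ℤ) : ℤ := max (row A i) (-((A.card - k : ℕ) : ℤ))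

/-- The highest chain with bottom row `A`. -/
def high (A : Finset ℤ) (k : ℕ) (i : ℤ) : ℤ := min 0 (row A (i + k) + k)

lemma low_mem_Pat (A : Finset ℤ) : low A ∈ Pat A := by
  refine ⟨⟨fun k i => ?_, fun k i => ?_, fun k i => ?_, fun k hk i => ?_⟩, ?_⟩
  · have := row_succ A i
    unfold low
    split_ifs at this <;> omega
  · unfold low; omega
  · have := row_succ A i
    unfold low
    split_ifs at this <;> omega
  · have := row_nonpos A i
    unfold low; omega
  · ext i
    have := neg_card_le_row A i
    unfold low; simpa using this

lemma high_mem_Pat (A : Finset ℤ) : high A ∈ Pat A := by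
  refine ⟨⟨fun k i => ?_, fun k i => ?_, fun k i => ?_, fun k hk i => ?_⟩, ?_⟩
  · have := row_succ A (i + k)
    have e : i + 1 + (k : ℤ) = i + k + 1 := by ring
    unfold high
    rw [e]
    split_ifs at this <;> omega
  · have := row_succ A (i + k)
    have e : i + ((k + 1 : ℕ) : ℤ) = i + k + 1 := by push_cast; ring
    unfold high
    rw [e]
    push_cast
    split_ifs at this <;> omega
  · have e : i + ((k + 1 : ℕ) : ℤ) = i + 1 + k := by push_cast; ring
    unfold high
    rw [e]
    push_cast
    omega
  · have := neg_card_le_row A (i + k)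
    unfold high; omega
  · ext i
    have := row_nonpos A i
    unfold high; simpa using this

/-- The two terms in the maximum defining `low` are lower bounds for every chain. Only an inequality
between bottom rows is required, because the surfaces to be compared have different lozenges on the
axis; the same holds for `le_high`. -/
lemma low_le {A : Finset ℤ} {n : ℕ} {N : ℕ → ℤ → ℤ} (h : Chain n N) (hn : n = A.card)
    (h0 : ∀ i, row A i ≤ N 0 i) (k : ℕ) (i : ℤ) : low A k i ≤ N k i := by
  have h1 := h.le_add 0 k i
  have h2 := h.neg_le k i
  have h3 := h0 i
  simp only [zero_add] at h1
  unfold low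
  subst hn
  omega

lemma le_high {A : Finset ℤ} {n : ℕ} {N : ℕ → ℤ → ℤ} (h : Chain n N)
    (h0 : ∀ i, N 0 i ≤ row A i) (k : ℕ) (i : ℤ) : N k i ≤ high A k i := by
  have h1 := h.diag_add 0 k i
  have h2 := h.nonpos k i
  have h3 := h0 (i + k)
  simp only [zero_add] at h1
  unfold high
  omega

/-- A profile with slopes `0` and `-1` that vanishes on the left and is constant on the right is
the profile of a row of particles. -/
lemma exists_row {r : ℤ → ℤ} (h1 : ∀ i, r (i + 1) ≤ r i) (h2 : ∀ i, r i ≤ r (i + 1) + 1)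
    {lo hi : ℤ} {n : ℕ} (hlo : ∀ i ≤ lo, r i = 0) (hhi : ∀ i, hi ≤ i → r i = -(n : ℤ)) :
    ∃ A : Finset ℤ, A ⊆ Finset.Ico lo hi ∧ A.card = n ∧ row A = r := by
  classical
  set A := (Finset.Ico lo hi).filter fun p => r (p + 1) = r p - 1 with hA
  have hs : ∀ i, r (i + 1) = r i - if i ∈ A then 1 else 0 := by
    intro i
    have a1 := h1 i
    have a2 := h2 i
    by_cases hi' : lo ≤ i ∧ i < hi
    · have : i ∈ A ↔ r (i + 1) = r i - 1 := by simp [hA, hi']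
      simp only [this]
      split_ifs <;> omega
    · have : i ∉ A := by simp only [hA, Finset.mem_filter, Finset.mem_Ico]; tauto
      simp only [this, if_false]
      rcases not_and_or.1 hi' with h | h
      · rw [hlo i (by omega), hlo (i + 1) (by omega)]; rfl
      · rw [hhi i (by omega), hhi (i + 1) (by omega)]; ring
  have hAsub : A ⊆ Finset.Ico lo hi := Finset.filter_subset _ _
  have hrow : row A = r := by
    have hl : ∀ i ≤ lo, row A i = r i := by
      intro i hi'
      rw [hlo i hi']
      unfold row
      rw [below_eq_zero, neg_zero]
      intro p hp
      have := Finset.mem_Ico.1 (hAsub hp)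
      omega
    funext i
    rcases le_total i lo with h | h
    · exact hl i h
    · induction i, h using Int.leInduction with
      | base => exact hl lo le_rfl
      | succ i hi' ih => rw [row_succ, ih, hs]
  refine ⟨A, hAsub, ?_, hrow⟩
  have := congrFun hrow (max lo hi)
  unfold row at this
  rw [below_eq_card] at this
  · rw [hhi _ (le_max_right _ _)] at this
    omega
  · intro p hp
    have := Finset.mem_Ico.1 (hAsub hp)
    omega

lemma row_block {A : Finset ℤ} {a b : ℤ} (hab : a ≤ b) (h : ∀ p, a ≤ p → p < b → p ∈ A) :
    row A b = row A a - (b - a) := by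
  induction b, hab using Int.leInduction with
  | base => ring
  | succ b hb ih =>
    rw [row_succ, ih fun p h1 h2 => h p h1 (by omega), if_pos (h b hb (by omega))]
    ring

end LozengeTiling

namespace LozengeTiling
/-! ### Half-plane regions bounded by an axis -/

/-- A trapezoid standing on the segment of the axis from `lo` to `hi`, cut at height `n`, with the
triangles standing on the segments `[a, b]` of the relation `block` removed. -/
structure Strip where
  n : ℕ
  lo : ℤ
  hi : ℤ
  block : ℤ → ℤ → Prop

namespace Strip
variable (S : Strip)

/-- The up-pointing triangle `(i, k)` belongs to the strip region. -/
def UpIn (k : ℕ) (i : ℤ) : Prop :=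
  k < S.n ∧ S.lo ≤ i ∧ i + 1 + k ≤ S.hi ∧ ∀ a b, S.block a b → ¬ (a ≤ i ∧ i + 1 + k ≤ b)

/-- The down-pointing triangle `(i, k)` belongs to the strip region. -/
def DnIn (k : ℕ) (i : ℤ) : Prop :=
  k < S.n ∧ S.lo ≤ i ∧ i + 2 + k ≤ S.hi ∧ ∀ a b, S.block a b → ¬ (a ≤ i ∧ i + 2 + k ≤ b)

/-- The top side of the trapezoid has non-negative length, and the removed triangles lie inside the
trapezoid, not reaching above its top. -/
structure Valid : Prop where
  wide : (S.n : ℤ) ≤ S.hi - S.lo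
  block_le : ∀ a b, S.block a b → b - a ≤ S.n
  lo_le : ∀ a b, S.block a b → S.lo ≤ a
  le_hi : ∀ a b, S.block a b → b ≤ S.hi

/-- A tiling of a strip region: `r`, `l`, `v` are the indicators of the up-pointing triangles
covered by right-tilting, left-tilting and vertical lozenges. -/
structure Tiling (r l v : ℕ → ℤ → ℤ) : Prop where
  up : ∀ k i, S.UpIn k i → r k i + l k i + v k i = 1
  down : ∀ k i, S.DnIn k i → r k i + l k (i + 1) + v (k + 1) i = 1
  r_supp : ∀ k i, ¬ (S.UpIn k i ∧ S.DnIn k i) → r k i = 0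
  l_supp : ∀ k i, ¬ (S.UpIn k i ∧ S.DnIn k (i - 1)) → l k i = 0
  v_supp : ∀ k i, ¬ (S.UpIn (k + 1) i ∧ S.DnIn k i) → v (k + 1) i = 0
  v_supp_zero : ∀ i, ¬ S.UpIn 0 i → v 0 i = 0
  r_nonneg : ∀ k i, 0 ≤ r k i
  l_nonneg : ∀ k i, 0 ≤ l k i
  v_nonneg : ∀ k i, 0 ≤ v k i

/-- A chain of rows that is frozen outside the strip region. -/
structure Compat (N : ℕ → ℤ → ℤ) : Prop extends Chain S.n N where
  left : ∀ i ≤ S.lo, N 0 i = 0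
  right : ∀ i, S.hi ≤ i → N 0 i = -(S.n : ℤ)
  blocks : ∀ a b, S.block a b → a ≤ b → N 0 b = N 0 a - (b - a)

variable {S}

section ofTiling

open Classical in
/-- The indicator of the vertical lozenges, with the removed triangles filled by them. -/
noncomputable def fillV (S : Strip) (v : ℕ → ℤ → ℤ) (k : ℕ) (i : ℤ) : ℤ :=
  if k < S.n then
    if S.UpIn k i then v k i else if i < S.lo then 0 else if S.hi < i + 1 + k then 0 else 1
  else 0

-- Outside the strip region the rows are completed by forced lozenges: right-tilting ones to the
-- left of the trapezoid, left-tilting ones to its right, vertical ones in the removed triangles.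
open Classical in
noncomputable def fillL (S : Strip) (l : ℕ → ℤ → ℤ) (k : ℕ) (i : ℤ) : ℤ :=
  if S.UpIn k i then l k i else if i < S.lo then 0 else if S.hi < i + 1 + k then 1 else 0

open Classical in
noncomputable def fillR (S : Strip) (r : ℕ → ℤ → ℤ) (k : ℕ) (i : ℤ) : ℤ :=
  if S.UpIn k i then r k i else if i < S.lo then 1 else 0

/-- The heights of a tiling of a strip region. -/
noncomputable def heights (S : Strip) (v : ℕ → ℤ → ℤ) (k : ℕ) (i : ℤ) : ℤ :=
  -∑ p ∈ Finset.Ico S.lo i, fillV S v k p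

variable {r l v : ℕ → ℤ → ℤ} (hS : S.Valid) (h : S.Tiling r l v)
include hS h

omit hS in
lemma fill_up (k : ℕ) (hk : k < S.n) (i : ℤ) : fillR S r k i + fillL S l k i + fillV S v k i = 1 := by
  unfold fillR fillL fillV
  simp only [hk, if_true]
  by_cases h1 : S.UpIn k i
  · simp only [h1, if_true]; exact h.up k i h1
  · simp only [h1, if_false]; split_ifs <;> simp

omit hS in
lemma fill_of_down {k : ℕ} {i : ℤ} (hd : S.DnIn k i) : fillR S r k i = r k i ∧
    fillL S l k (i + 1) = l k (i + 1) ∧ fillV S v (k + 1) i = v (k + 1) i := by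
  have hd' := hd
  obtain ⟨-, d1, d2, d3⟩ := hd
  refine ⟨?_, ?_, ?_⟩
  · unfold fillR
    split_ifs with h1 h2
    · rfl
    · omega
    · exact (h.r_supp k i (by tauto)).symm
  · unfold fillL
    split_ifs with h1 h2 h3
    · rfl
    · omega
    · omega
    · exact (h.l_supp k (i + 1) (by tauto)).symm
  · unfold fillV
    split_ifs with h0 h1 h2 h3
    · rfl
    · omega
    · push_cast at h3; omega
    · exfalso
      apply h1
      refine ⟨h0, d1, by push_cast; omega, fun a b hb hc => d3 a b hb ⟨hc.1, ?_⟩⟩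
      have := hc.2
      push_cast at this
      omega
    · exact (h.v_supp k i (fun hc => h0 hc.1.1)).symm

/-- The completed rows still cover every down-pointing triangle once. A triangle outside the region
receives nothing from the lozenges of the tiling, by the support conditions, and exactly one lozenge
from the three kinds of filling. -/
lemma fill_down (k : ℕ) (hk : k < S.n) (i : ℤ) :
    fillR S r k i + fillL S l k (i + 1) + fillV S v (k + 1) i = 1 := by
  have hw := hS.wide
  by_cases hd : S.DnIn k i
  · obtain ⟨e1, e2, e3⟩ := fill_of_down h hd
    rw [e1, e2, e3]
    exact h.down k i hd
  · have e1 : S.UpIn k i → r k i = 0 := fun _ => h.r_supp k i (by tauto)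
    have e2 : l k (i + 1) = 0 := h.l_supp k (i + 1) (by simpa using fun _ => hd)
    have e3 : v (k + 1) i = 0 := h.v_supp k i (by tauto)
    have r1 : S.lo ≤ i → fillR S r k i = 0 := by
      intro hi
      unfold fillR
      split_ifs with h1 h2
      · exact e1 h1
      · omega
      · rfl
    rcases lt_or_ge i S.lo with hi | hi
    · have : fillR S r k i = 1 := by
        unfold fillR
        rw [if_neg (fun hc => by have := hc.2.1; omega), if_pos hi]
      have : fillL S l k (i + 1) = 0 := by
        unfold fillL
        split_ifs with h1 h2 h3
        · exact e2
        · rfl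
        · omega
        · rfl
      have : fillV S v (k + 1) i = 0 := by
        unfold fillV
        split_ifs with h1 h2
        · have := h2.2.1; omega
        all_goals rfl
      omega
    · rcases lt_or_ge S.hi (i + 2 + k) with hi2 | hi2
      · have : fillL S l k (i + 1) = 1 := by
          unfold fillL
          rw [if_neg (fun hc => by have := hc.2.2.1; omega), if_neg (by omega), if_pos (by omega)]
        have : fillV S v (k + 1) i = 0 := by
          unfold fillV
          split_ifs with h1 h2 h3
          · have := h2.2.2.1; push_cast at this; omega
          · rfl
          · rfl
          · push_cast at *; omega
          · rfl
        have := r1 hi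
        omega
      · have : ∃ a b, S.block a b ∧ a ≤ i ∧ i + 2 + k ≤ b := by
          by_contra hc
          push Not at hc
          exact hd ⟨hk, hi, hi2, fun a b hb h3 => by have := hc a b hb h3.1; omega⟩
        obtain ⟨a, b, hb, ha1, hb1⟩ := this
        have hbl := hS.block_le a b hb
        have : fillL S l k (i + 1) = 0 := by
          unfold fillL
          rw [if_neg (fun hc => hc.2.2.2 a b hb (by omega)), if_neg (by omega), if_neg (by omega)]
        have : fillV S v (k + 1) i = 1 := by
          unfold fillV
          rw [if_pos (by omega), if_neg (fun hc => hc.2.2.2 a b hb (by push_cast; omega)),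
            if_neg (by omega), if_neg (by push_cast; omega)]
        have := r1 hi
        omega

omit hS h in
lemma heights_of_le {k : ℕ} {i : ℤ} (hi : i ≤ S.lo) : heights S v k i = 0 := by
  unfold heights
  rw [Finset.Ico_eq_empty (by omega)]; simp

omit hS h in
lemma heights_succ (k : ℕ) (i : ℤ) : heights S v k (i + 1) = heights S v k i - fillV S v k i := by
  rcases lt_or_ge i S.lo with hi | hi
  · rw [heights_of_le (by omega), heights_of_le (by omega)]
    unfold fillV
    split_ifs with h1 h2
    · have := h2.2.1; omega
    · rfl
    · rfl
  · unfold heights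
    rw [← Finset.insert_Ico_right_eq_Ico_add_one hi, Finset.sum_insert (by simp)]
    ring

omit hS in
lemma fillL_nonneg (k : ℕ) (i : ℤ) : 0 ≤ fillL S l k i := by
  have := h.l_nonneg k i
  unfold fillL; split_ifs <;> omega

omit hS in
lemma fillR_nonneg (k : ℕ) (i : ℤ) : 0 ≤ fillR S r k i := by
  have := h.r_nonneg k i
  unfold fillR; split_ifs <;> omega

omit hS in
lemma fillV_nonneg (k : ℕ) (i : ℤ) : 0 ≤ fillV S v k i := by
  have := h.v_nonneg k i
  unfold fillV; split_ifs <;> omega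

/-- Comparing `fill_up` with `fill_down`, the right-tilting term cancels: the numbers of vertical
lozenges in rows `k` and `k + 1` differ at `i` by a difference of left-tilting indicators. This
telescopes from the left end, where there is no left-tilting lozenge. -/
lemma heights_up {k : ℕ} (hk : k < S.n) (i : ℤ) :
    heights S v (k + 1) i = heights S v k i + fillL S l k i := by
  have hleft : ∀ i, i ≤ S.lo → fillL S l k i = 0 := by
    intro i hi
    rcases hi.lt_or_eq with hi | rfl
    · unfold fillL
      rw [if_neg (fun hc => by have := hc.2.1; omega), if_pos hi]
    · have h1 := fill_down hS h k hk (S.lo - 1)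
      have h2 : fillR S r k (S.lo - 1) = 1 := by
        unfold fillR
        rw [if_neg (fun hc => by have := hc.2.1; omega), if_pos (by omega)]
      have h3 := fillL_nonneg h k S.lo
      have h4 := fillV_nonneg h (k + 1) (S.lo - 1)
      simp only [sub_add_cancel] at h1
      omega
  rcases le_total i S.lo with hi | hi
  · rw [heights_of_le hi, heights_of_le hi, hleft i hi]; rfl
  · induction i, hi using Int.leInduction with
    | base => rw [heights_of_le le_rfl, heights_of_le le_rfl, hleft _ le_rfl]; rfl
    | succ i hi ih =>
      rw [heights_succ, heights_succ, ih]
      have h1 := fill_down hS h k hk i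
      have h2 := fill_up h k hk i
      omega

omit hS h in
lemma heights_top {k : ℕ} (hk : S.n ≤ k) (i : ℤ) : heights S v k i = 0 := by
  unfold heights fillV
  simp [not_lt.2 hk]

lemma heights_diag {k : ℕ} (hk : k < S.n) (i : ℤ) :
    heights S v (k + 1) i = heights S v k (i + 1) + 1 - fillR S r k i := by
  have h1 := heights_up hS h hk i
  have h2 := heights_succ (S := S) (v := v) k i
  have h3 := fill_up h k hk i
  omega

lemma compat_heights : S.Compat (heights S v) := by
  have hw := hS.wide
  -- Downward induction from the top row, with `j` the distance to it: right of the trapezoid every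
  -- triangle is covered by a left-tilting lozenge, so the height falls by one per row.
  have hright : ∀ (j k : ℕ) (i : ℤ), k + j = S.n → S.hi ≤ i + k → heights S v k i = -(j : ℤ) := by
    intro j
    induction j with
    | zero => intro k i hk _; rw [heights_top (by omega)]; simp
    | succ j ih =>
      intro k i hk hi
      have h1 := heights_up hS h (show k < S.n by omega) i
      have h2 := ih (k + 1) i (by omega) (by push_cast; omega)
      have h3 : fillL S l k i = 1 := by
        unfold fillL
        rw [if_neg (fun hc => by have := hc.2.2.1; omega), if_neg (by omega), if_pos (by omega)]
      push_cast
      omega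
  refine { anti := fun k i => ?_, up := fun k i => ?_, diag := fun k i => ?_,
           top := fun k hk i => heights_top hk i, left := fun i hi => heights_of_le hi,
           right := fun i hi => hright _ 0 i (by omega) (by simpa using hi), blocks := ?_ }
  · have := heights_succ (S := S) (v := v) k i
    have := fillV_nonneg h k i
    omega
  · rcases lt_or_ge k S.n with hk | hk
    · have := heights_up hS h hk i
      have := fillL_nonneg h k i
      omega
    · rw [heights_top hk, heights_top (by omega)]
  · rcases lt_or_ge k S.n with hk | hk
    · have := heights_diag hS h hk i
      have := fillR_nonneg h k i
      omega
    · rw [heights_top hk, heights_top (by omega)]; simp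
  · intro a b hb hab
    have h1 := hS.block_le a b hb
    have h2 := hS.lo_le a b hb
    have h3 := hS.le_hi a b hb
    suffices H : ∀ c, a ≤ c → c ≤ b → heights S v 0 c = heights S v 0 a - (c - a) from H b hab le_rfl
    intro c hac
    induction c, hac using Int.leInduction with
    | base => intro _; ring
    | succ c hc ih =>
      intro hcb
      rw [heights_succ, ih (by omega)]
      have : fillV S v 0 c = 1 := by
        unfold fillV
        rw [if_pos (by omega), if_neg (fun hh => hh.2.2.2 a b hb (by push_cast; omega)),
          if_neg (by omega), if_neg (by push_cast; omega)]
      omega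

lemma r_eq {k : ℕ} {i : ℤ} (hu : S.UpIn k i) :
    r k i = heights S v k (i + 1) + 1 - heights S v (k + 1) i := by
  have := heights_diag hS h hu.1 i
  unfold fillR at this
  rw [if_pos hu] at this
  omega

lemma l_eq {k : ℕ} {i : ℤ} (hu : S.UpIn k i) :
    l k i = heights S v (k + 1) i - heights S v k i := by
  have := heights_up hS h hu.1 i
  unfold fillL at this
  rw [if_pos hu] at this
  omega

omit hS h in
lemma v_eq {k : ℕ} {i : ℤ} (hu : S.UpIn k i) :
    v k i = heights S v k i - heights S v k (i + 1) := by
  have := heights_succ (S := S) (v := v) k i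
  unfold fillV at this
  rw [if_pos hu.1, if_pos hu] at this
  omega

/-- The same differences read off at a down-pointing triangle. Since the lower half is rotated,
up-pointing triangles of the hexagon below the axis are down-pointing in the strip, so both forms
are needed. -/
lemma eq_of_down {k : ℕ} {i : ℤ} (hd : S.DnIn k i) :
    r k i = heights S v k (i + 1) + 1 - heights S v (k + 1) i ∧
    l k (i + 1) = heights S v (k + 1) (i + 1) - heights S v k (i + 1) ∧
    v (k + 1) i = heights S v (k + 1) i - heights S v (k + 1) (i + 1) := by
  obtain ⟨e1, e2, e3⟩ := fill_of_down h hd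
  have h1 := heights_diag hS h hd.1 i
  have h2 := heights_up hS h hd.1 (i + 1)
  have h3 := heights_succ (S := S) (v := v) (k + 1) i
  omega

end ofTiling

section ofHeights
variable {N : ℕ → ℤ → ℤ} (hS : S.Valid) (h : S.Compat N)

open Classical in
noncomputable def indR (S : Strip) (N : ℕ → ℤ → ℤ) (k : ℕ) (i : ℤ) : ℤ :=
  if S.UpIn k i then N k (i + 1) + 1 - N (k + 1) i else 0

open Classical in
noncomputable def indL (S : Strip) (N : ℕ → ℤ → ℤ) (k : ℕ) (i : ℤ) : ℤ :=
  if S.UpIn k i then N (k + 1) i - N k i else 0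

open Classical in
noncomputable def indV (S : Strip) (N : ℕ → ℤ → ℤ) (k : ℕ) (i : ℤ) : ℤ :=
  if S.UpIn k i then N k i - N k (i + 1) else 0

include h

lemma Compat.left' (k : ℕ) {i : ℤ} (hi : i ≤ S.lo) : N k i = 0 :=
  h.toChain.eq_zero_of_left (h.left i hi) k

lemma Compat.right' {k : ℕ} {i : ℤ} (hi : S.hi ≤ i + k) : N k i = -((S.n - k : ℕ) : ℤ) :=
  h.toChain.eq_of_right (h.right _ hi)

lemma Compat.block' {a b : ℤ} (hb : S.block a b) {k : ℕ} {i : ℤ} (hi : a ≤ i) (hk : i + k ≤ b) :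
    N k i = N 0 a - (i - a) :=
  h.toChain.eq_of_block (h.blocks a b hb (by omega)) hi hk

/-- Outside the region the triangles of a half plane are frozen. -/
lemma Compat.frozen {k : ℕ} {i : ℤ} (hk : k < S.n) (hu : ¬ S.UpIn k i) :
    (i < S.lo ∧ N k i = N (k + 1) i ∧ N k (i + 1) = N k i) ∨
    (S.hi < i + 1 + k ∧ N (k + 1) i = N k i + 1 ∧ N k (i + 1) = N k i) ∨
    ((∃ a b, S.block a b ∧ a ≤ i ∧ i + 1 + k ≤ b) ∧ N (k + 1) i = N k i ∧
      N k (i + 1) = N k i - 1) := by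
  rcases lt_or_ge i S.lo with hi | hi
  · left
    rw [h.left' k hi.le, h.left' (k + 1) hi.le, h.left' k (by omega)]
    simp [hi]
  rcases lt_or_ge S.hi (i + 1 + k) with hi2 | hi2
  · right; left
    rw [h.right' (k := k) (i := i) (by omega), h.right' (k := k + 1) (i := i) (by push_cast; omega),
      h.right' (k := k) (i := i + 1) (by omega)]
    omega
  · right; right
    have : ∃ a b, S.block a b ∧ a ≤ i ∧ i + 1 + k ≤ b := by
      by_contra hc
      push Not at hc
      exact hu ⟨hk, hi, hi2, fun a b hb h3 => by have := hc a b hb h3.1; omega⟩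
    obtain ⟨a, b, hb, ha1, hb1⟩ := this
    refine ⟨⟨a, b, hb, ha1, hb1⟩, ?_, ?_⟩
    · rw [h.block' hb ha1 (k := k + 1) (by push_cast; omega), h.block' hb ha1 (by omega)]
    · rw [h.block' hb (i := i + 1) (by omega) (by omega), h.block' hb ha1 (by omega)]
      ring

/-- The counterpart of `Compat.frozen` for down-pointing triangles. It shows that no lozenge of a
compatible chain sticks out of the region. -/
lemma down_frozen {k : ℕ} {i : ℤ} (hk : k < S.n) (hu : ¬ S.DnIn k i) :
    (i < S.lo ∧ N (k + 1) i = N k (i + 1) ∧ N (k + 1) (i + 1) = N k (i + 1)) ∨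
    (S.hi < i + 2 + k ∧ N (k + 1) i = N k (i + 1) + 1 ∧ N (k + 1) (i + 1) = N k (i + 1) + 1) ∨
    ((∃ a b, S.block a b ∧ a ≤ i ∧ i + 2 + k ≤ b) ∧ N (k + 1) i = N k (i + 1) + 1 ∧
      N (k + 1) (i + 1) = N k (i + 1)) := by
  rcases lt_or_ge i S.lo with hi | hi
  · left
    rw [h.left' k (i := i + 1) hi, h.left' (k + 1) hi.le, h.left' (k + 1) (i := i + 1) hi]
    simp [hi]
  rcases lt_or_ge S.hi (i + 2 + k) with hi2 | hi2
  · right; left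
    rw [h.right' (k := k) (i := i + 1) (by omega), h.right' (k := k + 1) (i := i) (by push_cast; omega),
      h.right' (k := k + 1) (i := i + 1) (by push_cast; omega)]
    omega
  · right; right
    have : ∃ a b, S.block a b ∧ a ≤ i ∧ i + 2 + k ≤ b := by
      by_contra hc
      push Not at hc
      exact hu ⟨hk, hi, hi2, fun a b hb h3 => by have := hc a b hb h3.1; omega⟩
    obtain ⟨a, b, hb, ha1, hb1⟩ := this
    refine ⟨⟨a, b, hb, ha1, hb1⟩, ?_, ?_⟩
    · rw [h.block' hb ha1 (k := k + 1) (by push_cast; omega),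
        h.block' hb (i := i + 1) (by omega) (by omega)]; ring
    · rw [h.block' hb (i := i + 1) (k := k + 1) (by omega) (by push_cast; omega),
        h.block' hb (i := i + 1) (by omega) (by omega)]

/-- Converse of `compat_heights`. The three height differences at a triangle add up to one
identically, and they are non-negative by the chain inequalities. The frozen values outside the
region rule out lozenges that cross its boundary. -/
lemma tiling_of_heights : S.Tiling (indR S N) (indL S N) (indV S N) := by
  have hc := h.toChain
  have R0 : ∀ k i, 0 ≤ indR S N k i := fun k i => by
    have := hc.diag k i; unfold indR; split_ifs <;> omega
  have L0 : ∀ k i, 0 ≤ indL S N k i := fun k i => by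
    have := hc.up k i; unfold indL; split_ifs <;> omega
  have V0 : ∀ k i, 0 ≤ indV S N k i := fun k i => by
    have := hc.anti k i; unfold indV; split_ifs <;> omega
  refine ⟨fun k i hu => ?_, fun k i hd => ?_, fun k i hn => ?_, fun k i hn => ?_, fun k i hn => ?_,
    fun i hn => ?_, R0, L0, V0⟩
  · unfold indR indL indV
    simp only [hu, if_true]; ring
  · obtain ⟨hk, d1, d2, d3⟩ := hd
    have e1 : indR S N k i = N k (i + 1) + 1 - N (k + 1) i := by
      unfold indR
      split_ifs with hu
      · rfl
      · rcases h.frozen hk hu with h1 | h1 | h1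
        · omega
        · omega
        · omega
    have e2 : indL S N k (i + 1) = N (k + 1) (i + 1) - N k (i + 1) := by
      unfold indL
      split_ifs with hu
      · rfl
      · rcases h.frozen hk hu with h1 | h1 | h1 <;> omega
    have e3 : indV S N (k + 1) i = N (k + 1) i - N (k + 1) (i + 1) := by
      unfold indV
      split_ifs with hu
      · rfl
      · rcases Nat.lt_or_ge (k + 1) S.n with hk1 | hk1
        · rcases h.frozen hk1 hu with h1 | h1 | ⟨⟨a, b, hb, ha1, hb1⟩, h2⟩
          · omega
          · push_cast at h1; omega
          · push_cast at hb1
            exact absurd ⟨ha1, by omega⟩ (d3 a b hb)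
        · rw [hc.top _ hk1, hc.top _ hk1]; rfl
    rw [e1, e2, e3]; ring
  · unfold indR
    split_ifs with hu
    · rcases down_frozen h hu.1 (fun hd => hn ⟨hu, hd⟩) with h1 | h1 | h1
      · have := hu.2.1; omega
      · omega
      · omega
    · rfl
  · unfold indL
    split_ifs with hu
    · have := down_frozen h hu.1 (fun hd => hn ⟨hu, hd⟩)
      simp only [sub_add_cancel] at this
      rcases this with h1 | h1 | ⟨⟨a, b, hb, ha1, hb1⟩, h2⟩
      · omega
      · have := hu.2.2.1; omega
      · omega
    · rfl
  · unfold indV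
    split_ifs with hu
    · rcases down_frozen h (Nat.lt_of_succ_lt hu.1) (fun hd => hn ⟨hu, hd⟩) with
        h1 | h1 | ⟨⟨a, b, hb, ha1, hb1⟩, h2⟩
      · omega
      · omega
      · exact absurd ⟨ha1, by push_cast; omega⟩ (hu.2.2.2 a b hb)
    · rfl
  · unfold indV
    rw [if_neg hn]

/-- The heights over a strip region are determined by the vertical lozenges. -/
lemma Compat.ext {N' : ℕ → ℤ → ℤ} (h' : S.Compat N')
    (hv : ∀ k i, S.UpIn k i → N k i - N k (i + 1) = N' k i - N' k (i + 1)) : N = N' := by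
  funext k i
  rcases Nat.lt_or_ge k S.n with hk | hk
  · rcases le_total i S.lo with hi | hi
    · rw [h.left' k hi, h'.left' k hi]
    · induction i, hi using Int.leInduction with
      | base => rw [h.left' k le_rfl, h'.left' k le_rfl]
      | succ i hi ih =>
        by_cases hu : S.UpIn k i
        · have := hv k i hu; omega
        · rcases lt_or_ge S.hi (i + 1 + k) with h1 | h1
          · rw [h.right' (by omega), h'.right' (by omega)]
          · rcases h.frozen hk hu with h2 | h2 | h2 <;> rcases h'.frozen hk hu with h3 | h3 | h3 <;>
              omega
  · rw [h.toChain.top k hk, h'.toChain.top k hk]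

/-- Two chains only differ in the interior of the region. -/
lemma Compat.interior {N' : ℕ → ℤ → ℤ} (h' : S.Compat N') {k : ℕ} {i : ℤ} (hne : N k i ≠ N' k i)
    (hb0 : ∀ a b, S.block a b → N 0 a = N' 0 a) :
    k < S.n ∧ S.lo < i ∧ i + k < S.hi ∧ ∀ a b, S.block a b → ¬ (a ≤ i ∧ i + k ≤ b) := by
  refine ⟨?_, ?_, ?_, ?_⟩
  · by_contra hc
    exact hne (by rw [h.toChain.top k (by omega), h'.toChain.top k (by omega)])
  · by_contra hc
    exact hne (by rw [h.left' k (by omega), h'.left' k (by omega)])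
  · by_contra hc
    exact hne (by rw [h.right' (by omega), h'.right' (by omega)])
  · rintro a b hb ⟨h1, h2⟩
    exact hne (by rw [h.block' hb h1 h2, h'.block' hb h1 h2, hb0 a b hb])

end ofHeights
end Strip
end LozengeTiling

namespace LozengeTiling
/-! ### Intruded hexagons and the two strips of their regions -/

namespace IntrudedHexagon
variable (G : IntrudedHexagon)

/-- The right end, at the level of the axis, of the line through the northeast side. -/
def neEnd : ℤ := (G.s : ℤ) + G.se - G.axis

/-- The part of the region above the axis. -/
def upper : Strip where
  n := G.sw + G.nw - G.axis
  lo := -(G.sw : ℤ)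
  hi := G.neEnd
  block a b := (∃ l ∈ G.lobes, l.up = true ∧ a = l.left ∧ b = l.left + l.size) ∨
    (a = G.s ∧ b = G.neEnd)

/-- The part of the region below the axis, rotated by `π` about the point `(0, axis)`. -/
def lower : Strip where
  n := G.axis
  lo := -(G.s : ℤ)
  hi := G.axis
  block a b := (∃ l ∈ G.lobes, l.up = false ∧ a = -(l.left + l.size) ∧ b = -l.left) ∨
    (a = G.sw ∧ b = G.axis) ∨ (a = -(G.s : ℤ) ∧ b = -G.neEnd)

/-- The sets `U` and `D` of unit segments of the axis (given by their left ends) are those covered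
by the lobes above and below the axis, where the axis is prolonged up to the lines through the
sides of the hexagon, and `y` is the number of vertical lozenges that cross the axis. -/
structure Spec (U D : Finset ℤ) (y : ℕ) : Prop where
  height : U.card + y + G.axis = G.sw + G.nw
  axis_eq : D.card + y = G.axis
  sw_le : G.sw ≤ G.axis
  tips : G.tipL + y ≤ G.tipR
  le_tipL : -(G.sw : ℤ) ≤ G.tipL
  tipR_le : G.tipR ≤ G.s
  tipR_le' : G.tipR ≤ G.neEnd
  disj : Disjoint U D
  mem_or : ∀ p, (p ∈ U ∨ p ∈ D) ↔
    (-(G.axis : ℤ) ≤ p ∧ p < G.tipL) ∨ (G.tipR ≤ p ∧ (p < G.s ∨ p < G.neEnd))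
  lobe_range : ∀ l ∈ G.lobes, (-(G.sw : ℤ) ≤ l.left ∧ l.left + l.size ≤ G.tipL) ∨
    (G.tipR ≤ l.left ∧ l.left + l.size ≤ G.s ∧ l.left + l.size ≤ G.neEnd)
  lobe_up : ∀ l ∈ G.lobes, l.up = true → ∀ p, l.left ≤ p → p < l.left + l.size → p ∈ U
  lobe_down : ∀ l ∈ G.lobes, l.up = false → ∀ p, l.left ≤ p → p < l.left + l.size → p ∈ D
  U_lobe : ∀ p ∈ U, p < G.s → ∃ l ∈ G.lobes, l.up = true ∧ l.left ≤ p ∧ p < l.left + l.size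
  D_lobe : ∀ p ∈ D, -(G.sw : ℤ) ≤ p → p < G.neEnd →
    ∃ l ∈ G.lobes, l.up = false ∧ l.left ≤ p ∧ p < l.left + l.size
  U_range : ∀ p ∈ U, -(G.sw : ℤ) ≤ p ∧ p < G.neEnd
  D_range : ∀ p ∈ D, -(G.axis : ℤ) ≤ p ∧ p < G.s

variable {G}

lemma mem_region {τ : UnitTriangle} : τ ∈ G.region ↔ (∀ v ∈ τ.vertices, G.Contains v) ∧
    ∀ l ∈ G.lobes, ¬ ∀ v ∈ τ.vertices, G.LobeContains l v := by
  unfold region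
  rw [Finset.mem_filter]
  refine ⟨fun h => h.2, fun h => ⟨?_, h⟩⟩
  obtain ⟨u, i, j⟩ := τ
  simp only [Finset.mem_image, Finset.mem_product, Finset.mem_univ, true_and, Finset.mem_Icc]
  refine ⟨(u, i, j), ?_, rfl⟩
  have h := h.1
  unfold Contains UnitTriangle.vertices at h
  cases u <;> simp at h ⊢ <;> omega

lemma up_mem_region {i j : ℤ} : (⟨true, i, j⟩ : UnitTriangle) ∈ G.region ↔
    (-(G.sw : ℤ) ≤ i ∧ i + 1 ≤ G.s ∧ 0 ≤ j ∧ j + 1 ≤ G.sw + G.nw ∧ 0 ≤ i + j ∧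
      i + j + 1 ≤ G.s + G.se) ∧
    ∀ l ∈ G.lobes, (l.up = true → ¬ (l.left ≤ i ∧ G.axis ≤ j ∧ i + j + 1 ≤ l.left + G.axis + l.size))
      ∧ (l.up = false → ¬ (i + 1 ≤ l.left + l.size ∧ j + 1 ≤ G.axis ∧ l.left + G.axis ≤ i + j)) := by
  rw [mem_region]
  unfold Contains LobeContains UnitTriangle.vertices
  refine and_congr ?_ (forall₂_congr fun l _ => ?_)
  · simp; omega
  · cases hl : l.up <;> simp <;> omega

lemma down_mem_region {i j : ℤ} : (⟨false, i, j⟩ : UnitTriangle) ∈ G.region ↔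
    (-(G.sw : ℤ) ≤ i ∧ i + 1 ≤ G.s ∧ 0 ≤ j ∧ j + 1 ≤ G.sw + G.nw ∧ 0 ≤ i + j + 1 ∧
      i + j + 2 ≤ G.s + G.se) ∧
    ∀ l ∈ G.lobes, (l.up = true → ¬ (l.left ≤ i ∧ G.axis ≤ j ∧ i + j + 2 ≤ l.left + G.axis + l.size))
      ∧ (l.up = false →
        ¬ (i + 1 ≤ l.left + l.size ∧ j + 1 ≤ G.axis ∧ l.left + G.axis ≤ i + j + 1)) := by
  rw [mem_region]
  unfold Contains LobeContains UnitTriangle.vertices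
  refine and_congr ?_ (forall₂_congr fun l _ => ?_)
  · simp; omega
  · cases hl : l.up <;> simp <;> omega

lemma row_range {τ : UnitTriangle} (h : τ ∈ G.region) : 0 ≤ τ.j ∧ τ.j < G.sw + G.nw := by
  obtain ⟨u, i, j⟩ := τ
  cases u
  · have := (down_mem_region.1 h).1; simp only; omega
  · have := (up_mem_region.1 h).1; simp only; omega

namespace Spec
variable {U D : Finset ℤ} {y : ℕ} (hG : G.Spec U D y)
include hG

lemma upper_n : G.upper.n = U.card + y := by
  have := hG.height
  simp only [upper]; omega

lemma lower_n : G.lower.n = D.card + y := hG.axis_eq.symm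

/-- Besides the lobes there is one further block. If the axis runs below the eastern vertex, the
trapezoid spanned by the prolonged northeast side exceeds the hexagon by the triangle standing on
the segment from `s` to `neEnd`. Otherwise this block is degenerate. Below the axis the analogous
blocks lie beyond the western vertex and, in the opposite case, beyond the northeast side. -/
lemma upper_block {a b : ℤ} (h : G.upper.block a b) : ∀ p, a ≤ p → p < b → p ∈ U := by
  rcases h with ⟨l, hl, h1, rfl, rfl⟩ | ⟨rfl, rfl⟩
  · exact hG.lobe_up l hl h1
  · intro p h1 h2
    have := hG.tipR_le
    rcases (hG.mem_or p).2 (Or.inr ⟨by omega, Or.inr h2⟩) with h | h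
    · exact h
    · have := hG.D_range p h; omega

lemma lower_block {a b : ℤ} (h : G.lower.block a b) : ∀ p, a ≤ p → p < b → p ∈ refl D := by
  have a1 := hG.tipR_le
  have a2 := hG.tipR_le'
  have a3 := hG.le_tipL
  rcases h with ⟨l, hl, h1, rfl, rfl⟩ | ⟨rfl, rfl⟩ | ⟨rfl, rfl⟩
  · intro p h2 h3
    rw [mem_refl]
    exact hG.lobe_down l hl h1 _ (by omega) (by omega)
  · intro p h1 h2
    rw [mem_refl]
    rcases (hG.mem_or (-1 - p)).2 (Or.inl ⟨by omega, by omega⟩) with h | h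
    · have := hG.U_range _ h; omega
    · exact h
  · intro p h1 h2
    rw [mem_refl]
    rcases (hG.mem_or (-1 - p)).2 (Or.inr ⟨by omega, Or.inl (by omega)⟩) with h | h
    · have := hG.U_range _ h; omega
    · exact h

omit hG in
lemma _root_.LozengeTiling.interval_le_card {A : Finset ℤ} {a b : ℤ}
    (h : ∀ p, a ≤ p → p < b → p ∈ A) : b - a ≤ A.card := by
  have h1 : Finset.Ico a b ⊆ A := fun p hp => h p (Finset.mem_Ico.1 hp).1 (Finset.mem_Ico.1 hp).2
  have h2 := Finset.card_le_card h1
  rw [Int.card_Ico] at h2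
  omega

lemma free_disjoint {S : Finset ℤ} (hS : S ⊆ Finset.Ico G.tipL G.tipR) :
    Disjoint U S ∧ Disjoint D S := by
  constructor <;> rw [Finset.disjoint_left] <;> intro p hp hp' <;>
    have h1 := Finset.mem_Ico.1 (hS hp')
  · have := (hG.mem_or p).1 (Or.inl hp); omega
  · have := (hG.mem_or p).1 (Or.inr hp); omega

lemma card_union {S : Finset ℤ} (hS : S ⊆ Finset.Ico G.tipL G.tipR) (hy : S.card = y) :
    (U ∪ S).card = G.upper.n ∧ (refl (D ∪ S)).card = G.lower.n := by
  obtain ⟨h1, h2⟩ := hG.free_disjoint hS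
  rw [card_refl, Finset.card_union_of_disjoint h1, Finset.card_union_of_disjoint h2, hG.upper_n,
    hG.lower_n, hy]
  exact ⟨rfl, rfl⟩

/-- The base of the trapezoid contains the `n` distinct segments of `U ∪ S` for any admissible `S`,
here the leftmost one, so it is at least `n` long. A block consists of elements of `U`, so it is no
larger than `n`. -/
lemma upper_valid : G.upper.Valid := by
  have a1 := hG.tipR_le
  have a2 := hG.tipR_le'
  have a3 := hG.le_tipL
  have a4 := hG.tips
  refine ⟨?_, fun a b h => ?_, fun a b h => ?_, fun a b h => ?_⟩
  · have hS : Finset.Ico G.tipL (G.tipL + y) ⊆ Finset.Ico G.tipL G.tipR :=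
      Finset.Ico_subset_Ico le_rfl a4
    rw [← (hG.card_union hS (by simp)).1]
    have : U ∪ Finset.Ico G.tipL (G.tipL + y) ⊆ Finset.Ico (-(G.sw : ℤ)) G.neEnd := by
      intro p hp
      rw [Finset.mem_Ico]
      rcases Finset.mem_union.1 hp with h | h
      · exact hG.U_range p h
      · have := Finset.mem_Ico.1 h; omega
    have := Finset.card_le_card this
    rw [Int.card_Ico] at this
    simp only [upper]
    omega
  · have := interval_le_card (hG.upper_block h)
    rw [hG.upper_n]; push_cast; omega
  · simp only [upper] at h ⊢
    rcases h with ⟨l, hl, h1, rfl, rfl⟩ | ⟨rfl, rfl⟩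
    · have := hG.lobe_range l hl; omega
    · omega
  · simp only [upper] at h ⊢
    rcases h with ⟨l, hl, h1, rfl, rfl⟩ | ⟨rfl, rfl⟩
    · have := hG.lobe_range l hl; omega
    · omega

lemma lower_valid : G.lower.Valid := by
  have a1 := hG.tipR_le
  have a2 := hG.tipR_le'
  have a3 := hG.le_tipL
  have a4 := hG.tips
  have a5 := hG.sw_le
  refine ⟨?_, fun a b h => ?_, fun a b h => ?_, fun a b h => ?_⟩
  · have hS : Finset.Ico G.tipL (G.tipL + y) ⊆ Finset.Ico G.tipL G.tipR :=
      Finset.Ico_subset_Ico le_rfl a4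
    rw [← (hG.card_union hS (by simp)).2]
    have : refl (D ∪ Finset.Ico G.tipL (G.tipL + y)) ⊆ Finset.Ico (-(G.s : ℤ)) G.axis := by
      intro p hp
      rw [mem_refl] at hp
      rw [Finset.mem_Ico]
      rcases Finset.mem_union.1 hp with h | h
      · have := hG.D_range _ h; omega
      · have := Finset.mem_Ico.1 h; omega
    have := Finset.card_le_card this
    rw [Int.card_Ico] at this
    simp only [lower]
    omega
  · have := interval_le_card (hG.lower_block h)
    rw [card_refl] at this
    rw [hG.lower_n]; push_cast; omega
  · simp only [lower] at h ⊢
    rcases h with ⟨l, hl, h1, rfl, rfl⟩ | ⟨rfl, rfl⟩ | ⟨rfl, rfl⟩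
    · have := hG.lobe_range l hl; omega
    · omega
    · omega
  · simp only [lower] at h ⊢
    rcases h with ⟨l, hl, h1, rfl, rfl⟩ | ⟨rfl, rfl⟩ | ⟨rfl, rfl⟩
    · have := hG.lobe_range l hl; omega
    · omega
    · omega

lemma upIn_upper {i : ℤ} {k : ℕ} :
    (⟨true, i, G.axis + k⟩ : UnitTriangle) ∈ G.region ↔ G.upper.UpIn k i := by
  have a0 := hG.height
  have a5 := hG.sw_le
  rw [up_mem_region]
  simp only [Strip.UpIn, upper]
  constructor
  · rintro ⟨h1, h2⟩
    refine ⟨by omega, by omega, by unfold neEnd; omega, ?_⟩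
    rintro a b (⟨l, hl, hu, rfl, rfl⟩ | ⟨rfl, rfl⟩) h3
    · have := (h2 l hl).1 hu; omega
    · omega
  · rintro ⟨h1, h2, h3, h4⟩
    have h5 := h4 G.s G.neEnd (Or.inr ⟨rfl, rfl⟩)
    unfold neEnd at h3 h5
    refine ⟨by omega, fun l hl => ⟨fun hu => ?_, fun _ => by omega⟩⟩
    have := h4 _ _ (Or.inl ⟨l, hl, hu, rfl, rfl⟩)
    omega

lemma dnIn_upper {i : ℤ} {k : ℕ} :
    (⟨false, i, G.axis + k⟩ : UnitTriangle) ∈ G.region ↔ G.upper.DnIn k i := by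
  have a0 := hG.height
  have a5 := hG.sw_le
  rw [down_mem_region]
  simp only [Strip.DnIn, upper]
  constructor
  · rintro ⟨h1, h2⟩
    refine ⟨by omega, by omega, by unfold neEnd; omega, ?_⟩
    rintro a b (⟨l, hl, hu, rfl, rfl⟩ | ⟨rfl, rfl⟩) h3
    · have := (h2 l hl).1 hu; omega
    · omega
  · rintro ⟨h1, h2, h3, h4⟩
    have h5 := h4 G.s G.neEnd (Or.inr ⟨rfl, rfl⟩)
    unfold neEnd at h3 h5
    refine ⟨by omega, fun l hl => ⟨fun hu => ?_, fun _ => by omega⟩⟩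
    have := h4 _ _ (Or.inl ⟨l, hl, hu, rfl, rfl⟩)
    omega

/-- The rotation by π about `(0, axis)` sends `(i, axis + k)` to `(-i, axis - k)`. An up-pointing
triangle becomes the down-pointing one recorded by `(-i - 1, axis - 1 - k)`. -/
lemma upIn_lower {i : ℤ} {k : ℕ} :
    (⟨false, -i - 1, G.axis - 1 - k⟩ : UnitTriangle) ∈ G.region ↔ G.lower.UpIn k i := by
  have a0 := hG.height
  have a5 := hG.sw_le
  rw [down_mem_region]
  simp only [Strip.UpIn, lower]
  constructor
  · rintro ⟨h1, h2⟩
    refine ⟨by omega, by omega, by omega, ?_⟩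
    rintro a b (⟨l, hl, hu, rfl, rfl⟩ | ⟨rfl, rfl⟩ | ⟨rfl, rfl⟩) h3
    · have := (h2 l hl).2 hu; omega
    · omega
    · unfold neEnd at h3; omega
  · rintro ⟨h1, h2, h3, h4⟩
    have h5 := h4 _ _ (Or.inr (Or.inl ⟨rfl, rfl⟩))
    have h6 := h4 _ _ (Or.inr (Or.inr ⟨rfl, rfl⟩))
    unfold neEnd at h6
    refine ⟨by omega, fun l hl => ⟨fun _ => by omega, fun hu => ?_⟩⟩
    have := h4 _ _ (Or.inl ⟨l, hl, hu, rfl, rfl⟩)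
    omega

lemma dnIn_lower {i : ℤ} {k : ℕ} :
    (⟨true, -i - 1, G.axis - 1 - k⟩ : UnitTriangle) ∈ G.region ↔ G.lower.DnIn k i := by
  have a0 := hG.height
  have a5 := hG.sw_le
  rw [up_mem_region]
  simp only [Strip.DnIn, lower]
  constructor
  · rintro ⟨h1, h2⟩
    refine ⟨by omega, by omega, by omega, ?_⟩
    rintro a b (⟨l, hl, hu, rfl, rfl⟩ | ⟨rfl, rfl⟩ | ⟨rfl, rfl⟩) h3
    · have := (h2 l hl).2 hu; omega
    · omega
    · unfold neEnd at h3; omega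
  · rintro ⟨h1, h2, h3, h4⟩
    have h5 := h4 _ _ (Or.inr (Or.inl ⟨rfl, rfl⟩))
    have h6 := h4 _ _ (Or.inr (Or.inr ⟨rfl, rfl⟩))
    unfold neEnd at h6
    refine ⟨by omega, fun l hl => ⟨fun _ => by omega, fun hu => ?_⟩⟩
    have := h4 _ _ (Or.inl ⟨l, hl, hu, rfl, rfl⟩)
    omega

/-- The axis segments adjacent to triangles of the region on both sides are the free ones. -/
lemma free_iff {p : ℤ} : (G.upper.UpIn 0 p ∧ G.lower.UpIn 0 (-1 - p)) ↔
    (0 < G.upper.n ∧ 0 < G.lower.n ∧ G.tipL ≤ p ∧ p < G.tipR) := by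
  have a1 := hG.tipR_le
  have a2 := hG.tipR_le'
  have a3 := hG.le_tipL
  have a5 := hG.sw_le
  constructor
  · rintro ⟨⟨h1, h2, h3, h4⟩, ⟨h5, h6, h7, h8⟩⟩
    refine ⟨h1, h5, ?_⟩
    by_contra hc
    have hr : p < G.neEnd ∧ p < G.s ∧ -(G.sw : ℤ) ≤ p := by
      simp only [upper, lower] at h2 h3 h6 h7; omega
    rcases (hG.mem_or p).2 (by omega) with h | h
    · obtain ⟨l, hl, hu, hl1, hl2⟩ := hG.U_lobe p h hr.2.1
      exact h4 _ _ (Or.inl ⟨l, hl, hu, rfl, rfl⟩) (by push_cast; omega)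
    · obtain ⟨l, hl, hu, hl1, hl2⟩ := hG.D_lobe p h hr.2.2 hr.1
      exact h8 _ _ (Or.inl ⟨l, hl, hu, rfl, rfl⟩) (by push_cast; omega)
  · rintro ⟨h1, h2, h3, h4⟩
    refine ⟨⟨h1, by simp only [upper]; omega, by simp only [upper]; push_cast; omega, ?_⟩,
      ⟨h2, by simp only [lower]; omega, by simp only [lower]; push_cast; omega, ?_⟩⟩
    · intro a b hb h5
      have := (hG.mem_or p).1 (Or.inl (hG.upper_block hb p h5.1 (by have := h5.2; push_cast at this; omega)))
      omega
    · intro a b hb h5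
      have := hG.lower_block hb (-1 - p) h5.1 (by have := h5.2; push_cast at this; omega)
      rw [mem_refl] at this
      have := (hG.mem_or _).1 (Or.inr this)
      omega

end Spec
end IntrudedHexagon
end LozengeTiling

namespace LozengeTiling
/-! ### Tilings and chains -/

/-- The indicator of a lozenge in a set of lozenges. -/
def ind (T : Finset Lozenge) (l : Lozenge) : ℤ := if l ∈ T then 1 else 0

lemma ind_nonneg (T : Finset Lozenge) (l : Lozenge) : 0 ≤ ind T l := by
  unfold ind; split_ifs <;> simp

lemma ind_eq_zero {T : Finset Lozenge} {l : Lozenge} : ind T l = 0 ↔ l ∉ T := by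
  unfold ind; split_ifs <;> simp_all

lemma mem_lozengesIn {R : Finset UnitTriangle} {l : Lozenge} :
    l ∈ lozengesIn R ↔ l.upTriangle ∈ R ∧ l.downTriangle ∈ R := by
  unfold lozengesIn Lozenge.triangles
  simp only [Finset.mem_biUnion, Finset.mem_filter, Finset.insert_subset_iff,
    Finset.singleton_subset_iff]
  constructor
  · rintro ⟨τ, _, _, h⟩; exact h
  · intro h
    refine ⟨l.upTriangle, h.1, ?_, h⟩
    obtain ⟨k, i, j⟩ := l
    cases k <;> simp [Lozenge.upTriangle]

lemma up_mem_triangles {l : Lozenge} {i j : ℤ} :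
    (⟨true, i, j⟩ : UnitTriangle) ∈ l.triangles ↔
      l ∈ ({⟨.right, i, j⟩, ⟨.left, i, j⟩, ⟨.vertical, i, j⟩} : Finset Lozenge) := by
  obtain ⟨k, i', j'⟩ := l
  cases k <;> simp [Lozenge.triangles, Lozenge.upTriangle, Lozenge.downTriangle] <;> omega

lemma down_mem_triangles {l : Lozenge} {i j : ℤ} :
    (⟨false, i, j⟩ : UnitTriangle) ∈ l.triangles ↔
      l ∈ ({⟨.right, i, j⟩, ⟨.left, i + 1, j⟩, ⟨.vertical, i, j + 1⟩} : Finset Lozenge) := by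
  obtain ⟨k, i', j'⟩ := l
  cases k <;> simp [Lozenge.triangles, Lozenge.upTriangle, Lozenge.downTriangle] <;> omega

lemma card_filter_mem (T s : Finset Lozenge) :
    ((T.filter fun l => l ∈ s).card : ℤ) = ∑ l ∈ s, ind T l := by
  rw [Finset.filter_mem_eq_inter, Finset.inter_comm, ← Finset.filter_mem_eq_inter,
    Finset.card_filter]
  push_cast
  rfl

/-- A set of lozenges is a tiling of `R` if it lies in `R` and covers every triangle once. -/
lemma mem_tilings {R : Finset UnitTriangle} {T : Finset Lozenge} : T ∈ tilings R ↔
    (∀ l ∈ T, l.upTriangle ∈ R ∧ l.downTriangle ∈ R) ∧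
    (∀ i j, (⟨true, i, j⟩ : UnitTriangle) ∈ R →
      ind T ⟨.right, i, j⟩ + ind T ⟨.left, i, j⟩ + ind T ⟨.vertical, i, j⟩ = 1) ∧
    (∀ i j, (⟨false, i, j⟩ : UnitTriangle) ∈ R →
      ind T ⟨.right, i, j⟩ + ind T ⟨.left, i + 1, j⟩ + ind T ⟨.vertical, i, j + 1⟩ = 1) := by
  unfold tilings
  simp only [Finset.mem_filter, Finset.mem_powerset, Finset.subset_iff, mem_lozengesIn]
  refine and_congr Iff.rfl ⟨fun h => ⟨fun i j hτ => ?_, fun i j hτ => ?_⟩, ?_⟩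
  · have := h _ hτ
    simp only [up_mem_triangles] at this
    zify at this
    rw [card_filter_mem] at this
    simpa [add_assoc] using this
  · have := h _ hτ
    simp only [down_mem_triangles] at this
    zify at this
    rw [card_filter_mem] at this
    simpa [add_assoc] using this
  · rintro ⟨h1, h2⟩ ⟨u, i, j⟩ hτ
    cases u
    · simp only [down_mem_triangles]
      zify
      rw [card_filter_mem]
      simpa [add_assoc] using h2 i j hτ
    · simp only [up_mem_triangles]
      zify
      rw [card_filter_mem]
      simpa [add_assoc] using h1 i j hτ

/-- The pairs of chains that describe the tilings of a region: `U` and `D` are the positions on the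
axis covered by lobes above and below it, and `[a, b]` is the free segment of the axis. The second
chain, for the part below the axis, is rotated by `π`. -/
def Model (U D : Finset ℤ) (a b : ℤ) (y : ℕ) : Set ((ℕ → ℤ → ℤ) × (ℕ → ℤ → ℤ)) :=
  {P | ∃ S ⊆ Finset.Ico a b, S.card = y ∧ P.1 ∈ Pat (U ∪ S) ∧ P.2 ∈ Pat (refl (D ∪ S))}

namespace IntrudedHexagon
variable {G : IntrudedHexagon}

namespace Spec
variable {U D : Finset ℤ} {y : ℕ} (hG : G.Spec U D y)
include hG

/-- This removes the set `S` from the description: the two chains are frozen outside their strips,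
take the same steps on the free segment, and are flat at the other positions outside `U` and `D`
respectively. Conversely, `S` is recovered as the set of steps of the upper bottom row on the free
segment, and its size follows from the total drop of that row. -/
lemma mem_model_iff {N M : ℕ → ℤ → ℤ} :
    (N, M) ∈ Model U D G.tipL G.tipR y ↔ G.upper.Compat N ∧ G.lower.Compat M ∧
      (∀ p, G.tipL ≤ p → p < G.tipR → N 0 p - N 0 (p + 1) = M 0 (-1 - p) - M 0 (-p)) ∧
      (∀ p, ¬ (G.tipL ≤ p ∧ p < G.tipR) → p ∉ U → N 0 (p + 1) = N 0 p) ∧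
      (∀ p, ¬ (G.tipL ≤ p ∧ p < G.tipR) → p ∉ D → M 0 (-p) = M 0 (-1 - p)) := by
  have a1 := hG.tipR_le
  have a2 := hG.tipR_le'
  have a3 := hG.le_tipL
  have a5 := hG.sw_le
  have a6 := hG.tips
  constructor
  · rintro ⟨S, hS, hy, ⟨hN, hN0⟩, ⟨hM, hM0⟩⟩
    simp only at hN hN0 hM hM0
    obtain ⟨c1, c2⟩ := hG.card_union hS hy
    rw [c1] at hN
    rw [c2] at hM
    have hS' : ∀ p ∈ S, G.tipL ≤ p ∧ p < G.tipR := fun p hp => Finset.mem_Ico.1 (hS hp)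
    have hU' : ∀ p ∈ U, ¬ (G.tipL ≤ p ∧ p < G.tipR) := fun p hp => by
      have := (hG.mem_or p).1 (Or.inl hp); omega
    have hD' : ∀ p ∈ D, ¬ (G.tipL ≤ p ∧ p < G.tipR) := fun p hp => by
      have := (hG.mem_or p).1 (Or.inr hp); omega
    have sN : ∀ p, N 0 (p + 1) = N 0 p - if p ∈ U ∪ S then 1 else 0 := fun p => by
      rw [hN0]; exact row_succ _ _
    have sM : ∀ p, M 0 (-p) = M 0 (-1 - p) - if p ∈ D ∪ S then 1 else 0 := fun p => by
      rw [hM0]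
      have := row_succ (refl (D ∪ S)) (-1 - p)
      rw [show -1 - p + 1 = -p by ring] at this
      rw [this]
      simp only [mem_refl, sub_sub_cancel]
    refine ⟨⟨hN, ?_, ?_, ?_⟩, ⟨hM, ?_, ?_, ?_⟩, ?_, ?_, ?_⟩
    · intro i hi
      rw [hN0]; unfold row
      rw [below_eq_zero, neg_zero]
      intro p hp
      simp only [upper] at hi
      rcases Finset.mem_union.1 hp with h | h
      · have := hG.U_range p h; omega
      · have := hS' p h; omega
    · intro i hi
      rw [hN0]; unfold row
      rw [below_eq_card, c1]
      intro p hp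
      simp only [upper] at hi
      rcases Finset.mem_union.1 hp with h | h
      · have := hG.U_range p h; omega
      · have := hS' p h; omega
    · intro a b hb hab
      rw [hN0]
      exact row_block hab fun p h1 h2 => Finset.mem_union_left _ (hG.upper_block hb p h1 h2)
    · intro i hi
      rw [hM0]; unfold row
      rw [below_eq_zero, neg_zero]
      intro p hp
      simp only [lower] at hi
      rw [mem_refl] at hp
      rcases Finset.mem_union.1 hp with h | h
      · have := hG.D_range _ h; omega
      · have := hS' _ h; omega
    · intro i hi
      rw [hM0]; unfold row
      rw [below_eq_card, c2]
      intro p hp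
      simp only [lower] at hi
      rw [mem_refl] at hp
      rcases Finset.mem_union.1 hp with h | h
      · have := hG.D_range _ h; omega
      · have := hS' _ h; omega
    · intro a b hb hab
      rw [hM0]
      refine row_block hab fun p h1 h2 => ?_
      rw [refl_union]
      exact Finset.mem_union_left _ (hG.lower_block hb p h1 h2)
    · intro p h1 h2
      have e : p ∈ U ∪ S ↔ p ∈ D ∪ S := by
        simp only [Finset.mem_union]
        have := hU' p
        have := hD' p
        tauto
      have := sN p
      have := sM p
      simp only [e] at *
      omega
    · intro p h1 h2
      rw [sN, if_neg]
      · ring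
      · simp only [Finset.mem_union]
        have := hS' p
        tauto
    · intro p h1 h2
      rw [sM, if_neg]
      · ring
      · simp only [Finset.mem_union]
        have := hS' p
        tauto
  · rintro ⟨hN, hM, h1, h2, h3⟩
    obtain ⟨A, hA, cA, rA⟩ := exists_row (r := N 0) (hN.anti 0) (hN.slope 0) hN.left hN.right
    obtain ⟨B, hB, cB, rB⟩ := exists_row (r := M 0) (hM.anti 0) (hM.slope 0) hM.left hM.right
    have sN : ∀ p, N 0 (p + 1) = N 0 p - if p ∈ A then 1 else 0 := fun p => by
      rw [← rA]; exact row_succ _ _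
    have sM : ∀ p, M 0 (-p) = M 0 (-1 - p) - if -1 - p ∈ B then 1 else 0 := fun p => by
      rw [← rB]
      have := row_succ B (-1 - p)
      rwa [show -1 - p + 1 = -p by ring] at this
    set S := A.filter fun p => G.tipL ≤ p ∧ p < G.tipR with hSdef
    have hS : S ⊆ Finset.Ico G.tipL G.tipR := fun p hp => by
      rw [Finset.mem_Ico]; exact (Finset.mem_filter.1 hp).2
    have hUA : ∀ p ∈ U, p ∈ A := by
      intro p hp
      by_cases hps : p < G.s
      · obtain ⟨l, hl, hu, hl1, hl2⟩ := hG.U_lobe p hp hps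
        have hb : G.upper.block l.left (l.left + l.size) := Or.inl ⟨l, hl, hu, rfl, rfl⟩
        have e1 := hN.block' hb (k := 0) (i := p) hl1 (by push_cast; omega)
        have e2 := hN.block' hb (k := 0) (i := p + 1) (by omega) (by push_cast; omega)
        by_contra hc
        have := sN p
        rw [if_neg hc] at this
        omega
      · have hr := hG.U_range p hp
        have hb : G.upper.block G.s G.neEnd := Or.inr ⟨rfl, rfl⟩
        have e1 := hN.block' hb (k := 0) (i := p) (by omega) (by push_cast; omega)
        have e2 := hN.block' hb (k := 0) (i := p + 1) (by omega) (by push_cast; omega)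
        by_contra hc
        have := sN p
        rw [if_neg hc] at this
        omega
    have hDB : ∀ p ∈ D, -1 - p ∈ B := by
      intro p hp
      have key : ∀ a b, G.lower.block a b → a ≤ -1 - p → -p ≤ b → -1 - p ∈ B := by
        intro a b hb h4 h5
        have e1 := hM.block' hb (k := 0) (i := -1 - p) h4 (by push_cast; omega)
        have e2 := hM.block' hb (k := 0) (i := -p) (by omega) (by push_cast; omega)
        by_contra hc
        have := sM p
        rw [if_neg hc] at this
        omega
      have hr := hG.D_range p hp
      by_cases hp1 : -(G.sw : ℤ) ≤ p
      · by_cases hp2 : p < G.neEnd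
        · obtain ⟨l, hl, hu, hl1, hl2⟩ := hG.D_lobe p hp hp1 hp2
          exact key _ _ (Or.inl ⟨l, hl, hu, rfl, rfl⟩) (by omega) (by omega)
        · exact key _ _ (Or.inr (Or.inr ⟨rfl, rfl⟩)) (by omega) (by omega)
      · exact key _ _ (Or.inr (Or.inl ⟨rfl, rfl⟩)) (by omega) (by omega)
    have eA : U ∪ S = A := by
      ext p
      rw [Finset.mem_union, hSdef, Finset.mem_filter]
      constructor
      · rintro (h | h)
        · exact hUA p h
        · exact h.1
      · intro hp
        by_contra hc
        push Not at hc
        have := h2 p (fun h => by have := hc.2 hp h.1; omega) hc.1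
        rw [sN, if_pos hp] at this
        omega
    have eB : refl (D ∪ S) = B := by
      ext p
      have hfree : ∀ q, G.tipL ≤ q → q < G.tipR → (q ∈ A ↔ -1 - q ∈ B) := by
        intro q hq1 hq2
        have e1 := h1 q hq1 hq2
        have e2 := sN q
        have e3 := sM q
        constructor
        · intro h
          rw [if_pos h] at e2
          by_contra hc
          rw [if_neg hc] at e3
          omega
        · intro h
          rw [if_pos h] at e3
          by_contra hc
          rw [if_neg hc] at e2
          omega
      rw [mem_refl, Finset.mem_union, hSdef, Finset.mem_filter]
      constructor
      · rintro (h | h)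
        · simpa using hDB _ h
        · simpa using (hfree _ h.2.1 h.2.2).1 h.1
      · intro hp
        by_contra hc
        push Not at hc
        by_cases hfr : G.tipL ≤ -1 - p ∧ -1 - p < G.tipR
        · have := (hfree _ hfr.1 hfr.2).2 (by simpa using hp)
          have := hc.2 this hfr.1
          omega
        · have := h3 (-1 - p) hfr hc.1
          rw [sM, if_pos (by simpa using hp)] at this
          omega
    refine ⟨S, hS, ?_, ?_, ?_⟩
    · have := congrArg Finset.card eA
      rw [cA, Finset.card_union_of_disjoint (hG.free_disjoint hS).1, hG.upper_n] at this
      omega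
    · rw [eA]
      refine ⟨?_, rA.symm⟩
      simp only
      rw [cA]; exact hN.toChain
    · rw [eB]
      refine ⟨?_, rB.symm⟩
      simp only
      rw [cB]; exact hM.toChain

lemma upper_tiling {T : Finset Lozenge} (hT : T ∈ tilings G.region) :
    G.upper.Tiling (fun k i => ind T ⟨.right, i, G.axis + k⟩)
      (fun k i => ind T ⟨.left, i, G.axis + k⟩) (fun k i => ind T ⟨.vertical, i, G.axis + k⟩) := by
  obtain ⟨h1, h2, h3⟩ := mem_tilings.1 hT
  refine ⟨fun k i h => h2 _ _ (hG.upIn_upper.2 h), fun k i h => ?_, fun k i h => ?_, fun k i h => ?_,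
    fun k i h => ?_, fun i h => ?_, fun _ _ => ind_nonneg _ _, fun _ _ => ind_nonneg _ _,
    fun _ _ => ind_nonneg _ _⟩
  · have := h3 _ _ (hG.dnIn_upper.2 h)
    push_cast
    rwa [← add_assoc]
  · rw [ind_eq_zero]
    intro hl
    have := h1 _ hl
    exact h ⟨hG.upIn_upper.1 this.1, hG.dnIn_upper.1 this.2⟩
  · rw [ind_eq_zero]
    intro hl
    have := h1 _ hl
    exact h ⟨hG.upIn_upper.1 this.1, hG.dnIn_upper.1 this.2⟩
  · rw [ind_eq_zero]
    intro hl
    have := h1 _ hl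
    refine h ⟨hG.upIn_upper.1 this.1, hG.dnIn_upper.1 ?_⟩
    have h4 := this.2
    simp only [Lozenge.downTriangle] at h4
    convert h4 using 2
    push_cast; ring
  · rw [ind_eq_zero]
    intro hl
    have := h1 _ hl
    exact h (hG.upIn_upper.1 this.1)

/-- A lozenge is recorded by its up-pointing triangle, which the rotation exchanges with its
down-pointing one. This causes the different index shifts for the three kinds. -/
lemma lower_tiling {T : Finset Lozenge} (hT : T ∈ tilings G.region) :
    G.lower.Tiling (fun k i => ind T ⟨.right, -i - 1, G.axis - 1 - k⟩)
      (fun k i => ind T ⟨.left, -i, G.axis - 1 - k⟩)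
      (fun k i => ind T ⟨.vertical, -i - 1, G.axis - k⟩) := by
  obtain ⟨h1, h2, h3⟩ := mem_tilings.1 hT
  refine ⟨fun k i h => ?_, fun k i h => ?_, fun k i h => ?_, fun k i h => ?_,
    fun k i h => ?_, fun i h => ?_, fun _ _ => ind_nonneg _ _, fun _ _ => ind_nonneg _ _,
    fun _ _ => ind_nonneg _ _⟩
  · have := h3 _ _ (hG.upIn_lower.2 h)
    rwa [show -i - 1 + 1 = -i by ring, show (G.axis : ℤ) - 1 - k + 1 = G.axis - k by ring] at this
  · have := h2 _ _ (hG.dnIn_lower.2 h)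
    rw [show -(i + 1) = -i - 1 by ring,
      show (G.axis : ℤ) - ((k + 1 : ℕ) : ℤ) = G.axis - 1 - k by push_cast; ring]
    exact this
  · rw [ind_eq_zero]
    intro hl
    have := h1 _ hl
    exact h ⟨hG.upIn_lower.1 this.2, hG.dnIn_lower.1 this.1⟩
  · rw [ind_eq_zero]
    intro hl
    have := h1 _ hl
    refine h ⟨hG.upIn_lower.1 this.2, hG.dnIn_lower.1 ?_⟩
    have h4 := this.1
    simp only [Lozenge.upTriangle] at h4
    convert h4 using 2
    ring
  · rw [ind_eq_zero]
    intro hl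
    have := h1 _ hl
    refine h ⟨hG.upIn_lower.1 ?_, hG.dnIn_lower.1 ?_⟩
    · have h4 := this.2
      simp only [Lozenge.downTriangle] at h4
      convert h4 using 2
      push_cast; ring
    · have h4 := this.1
      simp only [Lozenge.upTriangle] at h4
      convert h4 using 2
      push_cast; ring
  · rw [ind_eq_zero]
    intro hl
    have := h1 _ hl
    refine h (hG.upIn_lower.1 ?_)
    have h4 := this.2
    simp only [Lozenge.downTriangle] at h4
    convert h4 using 2
    push_cast; ring

end Spec

/-- The pair of chains of a tiling. -/
noncomputable def chains (G : IntrudedHexagon) (T : Finset Lozenge) :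
    (ℕ → ℤ → ℤ) × (ℕ → ℤ → ℤ) :=
  (G.upper.heights fun k i => ind T ⟨.vertical, i, G.axis + k⟩,
    G.lower.heights fun k i => ind T ⟨.vertical, -i - 1, G.axis - k⟩)


/-- The condition for a lozenge of the region to belong to the tiling with given chains. -/
def Fits (G : IntrudedHexagon) (P : (ℕ → ℤ → ℤ) × (ℕ → ℤ → ℤ)) (l : Lozenge) : Prop :=
  if (G.axis : ℤ) ≤ l.j then
    match l.kind with
    | .right => G.upper.indR P.1 (l.j - G.axis).toNat l.i = 1
    | .left => G.upper.indL P.1 (l.j - G.axis).toNat l.i = 1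
    | .vertical => G.upper.indV P.1 (l.j - G.axis).toNat l.i = 1
  else
    match l.kind with
    | .right => G.lower.indR P.2 (G.axis - 1 - l.j).toNat (-l.i - 1) = 1
    | .left => G.lower.indL P.2 (G.axis - 1 - l.j).toNat (-l.i) = 1
    | .vertical => G.lower.indV P.2 (G.axis - l.j).toNat (-l.i - 1) = 1

open Classical in
/-- The set of lozenges of a pair of chains. -/
noncomputable def ofChains (G : IntrudedHexagon) (P : (ℕ → ℤ → ℤ) × (ℕ → ℤ → ℤ)) :
    Finset Lozenge :=
  (lozengesIn G.region).filter fun l => G.Fits P l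

lemma mem_ofChains {P : (ℕ → ℤ → ℤ) × (ℕ → ℤ → ℤ)} {l : Lozenge} :
    l ∈ G.ofChains P ↔ l ∈ lozengesIn G.region ∧ G.Fits P l := by
  classical
  unfold ofChains
  rw [Finset.mem_filter]

lemma ind_ofChains_eq {P : (ℕ → ℤ → ℤ) × (ℕ → ℤ → ℤ)} {l : Lozenge} {a : ℤ}
    (h0 : 0 ≤ a) (h1 : a ≤ 1) (hp : G.Fits P l ↔ a = 1)
    (hz : l ∉ lozengesIn G.region → a = 0) : ind (G.ofChains P) l = a := by
  unfold ind
  by_cases hl : l ∈ lozengesIn G.region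
  · simp only [mem_ofChains, hl, true_and, hp]
    split_ifs <;> omega
  · rw [if_neg fun h => hl (mem_ofChains.1 h).1]
    exact (hz hl).symm

lemma _root_.LozengeTiling.Strip.Tiling.le_one {S : Strip} {r l v : ℕ → ℤ → ℤ}
    (h : S.Tiling r l v) (k : ℕ) (i : ℤ) :
    r k i ≤ 1 ∧ l k i ≤ 1 ∧ v k i ≤ 1 := by
  have h1 := h.r_nonneg k i
  have h2 := h.l_nonneg k i
  have h3 := h.v_nonneg k i
  by_cases hu : S.UpIn k i
  · have := h.up k i hu; omega
  · have h4 := h.r_supp k i (by tauto)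
    have h5 := h.l_supp k i (by tauto)
    have h6 : v k i = 0 := by
      cases k
      · exact h.v_supp_zero i hu
      · exact h.v_supp _ i (by tauto)
    omega

namespace Spec
variable {U D : Finset ℤ} {y : ℕ} (hG : G.Spec U D y)
include hG

lemma chains_mem_model {T : Finset Lozenge} (hT : T ∈ tilings G.region) :
    G.chains T ∈ Model U D G.tipL G.tipR y := by
  have hu := hG.upper_tiling hT
  have hl := hG.lower_tiling hT
  have hTm := (mem_tilings.1 hT).1
  have cu := Strip.compat_heights hG.upper_valid hu
  have cl := Strip.compat_heights hG.lower_valid hl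
  -- The two triangles of a vertical lozenge on the axis lie on opposite sides of it, so the segment
  -- between them is free.
  have hv : ∀ p, ind T ⟨.vertical, p, G.axis⟩ ≠ 0 → G.tipL ≤ p ∧ p < G.tipR := by
    intro p hp
    have h1 := hTm ⟨.vertical, p, G.axis⟩ (by by_contra hc; exact hp (ind_eq_zero.2 hc))
    have h2 := (hG.free_iff (p := p)).1 ⟨hG.upIn_upper.1 (by simpa [Lozenge.upTriangle] using h1.1),
      hG.upIn_lower.1 (by
        have h4 := h1.2
        simp only [Lozenge.downTriangle] at h4
        convert h4 using 2 <;> push_cast <;> ring)⟩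
    exact h2.2.2
  have hv0 : ∀ p, ¬ (G.tipL ≤ p ∧ p < G.tipR) → ind T ⟨.vertical, p, G.axis⟩ = 0 := by
    intro p hp
    by_contra hc
    exact hp (hv p hc)
  have fu : ∀ p, p ∉ U → G.upper.fillV (fun k i => ind T ⟨.vertical, i, G.axis + k⟩) 0 p =
      ind T ⟨.vertical, p, G.axis⟩ := by
    intro p hp
    have := hG.upper_valid
    unfold Strip.fillV
    by_cases hup : G.upper.UpIn 0 p
    · simp [hup, hup.1]
    · have : ind T ⟨.vertical, p, G.axis⟩ = 0 := by
        have := hu.v_supp_zero p hup; simpa using this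
      rw [this]
      split_ifs with h0 h2 h3
      · rfl
      · rfl
      · exfalso
        apply hup
        refine ⟨h0, by omega, by omega, fun a b hb h4 => hp ?_⟩
        exact hG.upper_block hb p h4.1 (by have := h4.2; push_cast at this; omega)
      · rfl
  have fl : ∀ p, p ∉ D → G.lower.fillV (fun k i => ind T ⟨.vertical, -i - 1, G.axis - k⟩) 0
      (-1 - p) = ind T ⟨.vertical, p, G.axis⟩ := by
    intro p hp
    have e : -(-1 - p) - 1 = p := by ring
    unfold Strip.fillV
    by_cases hup : G.lower.UpIn 0 (-1 - p)
    · simp [hup, hup.1]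
    · have : ind T ⟨.vertical, p, G.axis⟩ = 0 := by
        have := hl.v_supp_zero (-1 - p) hup; simpa [e] using this
      rw [this]
      split_ifs with h0 h2 h3
      · rfl
      · rfl
      · exfalso
        apply hup
        refine ⟨h0, by omega, by omega, fun a b hb h4 => hp ?_⟩
        have := hG.lower_block hb (-1 - p) h4.1 (by have := h4.2; push_cast at this; omega)
        rw [mem_refl] at this
        simpa using this
      · rfl
  have slu : ∀ p, p ∉ U → (G.chains T).1 0 (p + 1) =
      (G.chains T).1 0 p - ind T ⟨.vertical, p, G.axis⟩ := by
    intro p hp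
    rw [← fu p hp]
    exact Strip.heights_succ 0 p
  have sll : ∀ p, p ∉ D → (G.chains T).2 0 (-p) =
      (G.chains T).2 0 (-1 - p) - ind T ⟨.vertical, p, G.axis⟩ := by
    intro p hp
    rw [← fl p hp]
    have := Strip.heights_succ (S := G.lower)
      (v := fun k i => ind T ⟨.vertical, -i - 1, G.axis - k⟩) 0 (-1 - p)
    rwa [show -1 - p + 1 = -p by ring] at this
  refine hG.mem_model_iff.2 ⟨cu, cl, ?_, ?_, ?_⟩
  · intro p h1 h2
    have hpU : p ∉ U := fun h => by have := (hG.mem_or p).1 (Or.inl h); omega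
    have hpD : p ∉ D := fun h => by have := (hG.mem_or p).1 (Or.inr h); omega
    have e1 := slu p hpU
    have e2 := sll p hpD
    unfold chains at e1 e2
    simp only at e1 e2
    omega
  · intro p h1 h2
    have := slu p h2
    rw [hv0 p h1] at this
    simpa [chains] using this
  · intro p h1 h2
    have := sll p h2
    rw [hv0 p h1] at this
    simpa [chains] using this

lemma ind_ofChains {N M : ℕ → ℤ → ℤ} (hP : (N, M) ∈ Model U D G.tipL G.tipR y) :
    (∀ (k : ℕ) i, ind (G.ofChains (N, M)) ⟨.right, i, G.axis + k⟩ = G.upper.indR N k i) ∧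
    (∀ (k : ℕ) i, ind (G.ofChains (N, M)) ⟨.left, i, G.axis + k⟩ = G.upper.indL N k i) ∧
    (∀ (k : ℕ) i, ind (G.ofChains (N, M)) ⟨.vertical, i, G.axis + k⟩ = G.upper.indV N k i) ∧
    (∀ (k : ℕ) i, ind (G.ofChains (N, M)) ⟨.right, -i - 1, G.axis - 1 - k⟩ =
      G.lower.indR M k i) ∧
    (∀ (k : ℕ) i, ind (G.ofChains (N, M)) ⟨.left, -i, G.axis - 1 - k⟩ = G.lower.indL M k i) ∧
    (∀ (k : ℕ) i, ind (G.ofChains (N, M)) ⟨.vertical, -i - 1, G.axis - k⟩ =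
      G.lower.indV M k i) := by
  obtain ⟨hN, hM, h1, h2, h3⟩ := hG.mem_model_iff.1 hP
  have tN := Strip.tiling_of_heights hN
  have tM := Strip.tiling_of_heights hM
  have notU : ∀ p, G.upper.UpIn 0 p → p ∉ U := by
    intro p hp hpU
    by_cases hps : p < G.s
    · obtain ⟨l, hl, hu, hl1, hl2⟩ := hG.U_lobe p hpU hps
      exact hp.2.2.2 _ _ (Or.inl ⟨l, hl, hu, rfl, rfl⟩) (by push_cast; omega)
    · have := hG.U_range p hpU
      exact hp.2.2.2 _ _ (Or.inr ⟨rfl, rfl⟩) (by push_cast; omega)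
  have notD : ∀ p, G.lower.UpIn 0 (-1 - p) → p ∉ D := by
    intro p hp hpD
    have hr := hG.D_range p hpD
    by_cases hp1 : -(G.sw : ℤ) ≤ p
    · by_cases hp2 : p < G.neEnd
      · obtain ⟨l, hl, hu, hl1, hl2⟩ := hG.D_lobe p hpD hp1 hp2
        exact hp.2.2.2 _ _ (Or.inl ⟨l, hl, hu, rfl, rfl⟩) (by push_cast; omega)
      · exact hp.2.2.2 _ _ (Or.inr (Or.inr ⟨rfl, rfl⟩)) (by push_cast; omega)
    · exact hp.2.2.2 _ _ (Or.inr (Or.inl ⟨rfl, rfl⟩)) (by push_cast; omega)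
  -- A vertical lozenge crossing the axis appears in row `0` of both chains. The two descriptions
  -- agree: on the free segment because the bottom rows take the same steps, and elsewhere because
  -- both vanish.
  have v00 : ∀ p, G.upper.indV N 0 p = G.lower.indV M 0 (-1 - p) := by
    intro p
    by_cases hf : G.upper.UpIn 0 p ∧ G.lower.UpIn 0 (-1 - p)
    · have hp := (hG.free_iff.1 hf).2.2
      have := h1 p hp.1 hp.2
      unfold Strip.indV
      rw [if_pos hf.1, if_pos hf.2, show -1 - p + 1 = -p by ring, this]
    · have e1 : G.upper.indV N 0 p = 0 := by
        unfold Strip.indV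
        split_ifs with hu
        · have : ¬ (G.tipL ≤ p ∧ p < G.tipR) ∨ ¬ 0 < G.lower.n := by
            by_contra hc
            push Not at hc
            exact hf (hG.free_iff.2 ⟨hu.1, hc.2, hc.1⟩)
          rcases this with hc | hc
          · have := h2 p hc (notU p hu); omega
          · by_cases hfr : G.tipL ≤ p ∧ p < G.tipR
            · have := h1 p hfr.1 hfr.2
              rw [hM.toChain.top 0 (by omega), hM.toChain.top 0 (by omega)] at this
              simpa using this
            · have := h2 p hfr (notU p hu); omega
        · rfl
      have e2 : G.lower.indV M 0 (-1 - p) = 0 := by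
        unfold Strip.indV
        rw [show -1 - p + 1 = -p by ring]
        split_ifs with hu
        · have : ¬ (G.tipL ≤ p ∧ p < G.tipR) ∨ ¬ 0 < G.upper.n := by
            by_contra hc
            push Not at hc
            exact hf (hG.free_iff.2 ⟨hc.2, hu.1, hc.1⟩)
          rcases this with hc | hc
          · have := h3 p hc (notD p hu); omega
          · by_cases hfr : G.tipL ≤ p ∧ p < G.tipR
            · have := h1 p hfr.1 hfr.2
              rw [hN.toChain.top 0 (by omega), hN.toChain.top 0 (by omega)] at this
              omega
            · have := h3 p hfr (notD p hu); omega
        · rfl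
      rw [e1, e2]
  have v0z : ∀ p, ¬ (G.upper.UpIn 0 p ∧ G.lower.UpIn 0 (-1 - p)) → G.upper.indV N 0 p = 0 := by
    intro p hp
    by_cases hu : G.upper.UpIn 0 p
    · rw [v00]; exact tM.v_supp_zero _ (fun h => hp ⟨hu, h⟩)
    · exact tN.v_supp_zero _ hu
  have ru : ∀ (k : ℕ) i, ind (G.ofChains (N, M)) ⟨.right, i, G.axis + k⟩ = G.upper.indR N k i := by
    intro k i
    refine ind_ofChains_eq (tN.r_nonneg k i) (tN.le_one k i).1 ?_ (fun hl => ?_)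
    · simp [Fits]
    · refine tN.r_supp k i fun h => hl ?_
      exact mem_lozengesIn.2 ⟨hG.upIn_upper.2 h.1, hG.dnIn_upper.2 h.2⟩
  have lu : ∀ (k : ℕ) i, ind (G.ofChains (N, M)) ⟨.left, i, G.axis + k⟩ = G.upper.indL N k i := by
    intro k i
    refine ind_ofChains_eq (tN.l_nonneg k i) (tN.le_one k i).2.1 ?_ (fun hl => ?_)
    · simp [Fits]
    · refine tN.l_supp k i fun h => hl ?_
      exact mem_lozengesIn.2 ⟨hG.upIn_upper.2 h.1, hG.dnIn_upper.2 h.2⟩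
  have vu : ∀ (k : ℕ) i, ind (G.ofChains (N, M)) ⟨.vertical, i, G.axis + k⟩ = G.upper.indV N k i := by
    intro k i
    refine ind_ofChains_eq (tN.v_nonneg k i) (tN.le_one k i).2.2 ?_ (fun hl => ?_)
    · simp [Fits]
    · cases k with
      | zero =>
        refine v0z i fun h => hl (mem_lozengesIn.2 ⟨hG.upIn_upper.2 h.1, ?_⟩)
        have := hG.upIn_lower.2 h.2
        simp only [Lozenge.downTriangle]
        convert this using 2
        · ring
        · push_cast; ring
      | succ k =>
        refine tN.v_supp k i fun h => hl (mem_lozengesIn.2 ⟨hG.upIn_upper.2 h.1, ?_⟩)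
        have := hG.dnIn_upper.2 h.2
        simp only [Lozenge.downTriangle]
        convert this using 2
        push_cast; ring
  have rl : ∀ (k : ℕ) i, ind (G.ofChains (N, M)) ⟨.right, -i - 1, G.axis - 1 - k⟩ = G.lower.indR M k i := by
    intro k i
    refine ind_ofChains_eq (tM.r_nonneg k i) (tM.le_one k i).1 ?_ (fun hl => ?_)
    · rw [Fits, if_neg (by simp only; omega)]; simp
    · refine tM.r_supp k i fun h => hl ?_
      exact mem_lozengesIn.2 ⟨hG.dnIn_lower.2 h.2, hG.upIn_lower.2 h.1⟩
  have ll : ∀ (k : ℕ) i, ind (G.ofChains (N, M)) ⟨.left, -i, G.axis - 1 - k⟩ = G.lower.indL M k i := by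
    intro k i
    refine ind_ofChains_eq (tM.l_nonneg k i) (tM.le_one k i).2.1 ?_ (fun hl => ?_)
    · rw [Fits, if_neg (by simp only; omega)]; simp
    · refine tM.l_supp k i fun h => hl ?_
      refine mem_lozengesIn.2 ⟨?_, hG.upIn_lower.2 h.1⟩
      have := hG.dnIn_lower.2 h.2
      rw [show -(i - 1) - 1 = -i by ring] at this
      exact this
  have vl : ∀ (k : ℕ) i, ind (G.ofChains (N, M)) ⟨.vertical, -i - 1, G.axis - k⟩ = G.lower.indV M k i := by
    intro k i
    cases k with
    | zero =>
      have := vu 0 (-i - 1)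
      rw [v00, show -1 - (-i - 1) = i by ring] at this
      simpa using this
    | succ k =>
      refine ind_ofChains_eq (tM.v_nonneg _ i) (tM.le_one _ i).2.2 ?_ (fun hl => ?_)
      · rw [Fits, if_neg (by simp only; push_cast; omega)]; simp
      · refine tM.v_supp k i fun h => hl (mem_lozengesIn.2 ⟨?_, ?_⟩)
        · have := hG.dnIn_lower.2 h.2
          simp only [Lozenge.upTriangle]
          convert this using 2
          push_cast; ring
        · have := hG.upIn_lower.2 h.1
          simp only [Lozenge.downTriangle]
          convert this using 2
          push_cast; ring
  exact ⟨ru, lu, vu, rl, ll, vl⟩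

/-- The lozenges prescribed by the two chains tile the region. The resulting tiling has the given
chains, since a compatible chain is determined by its vertical lozenges. -/
lemma exists_chains_eq {P : (ℕ → ℤ → ℤ) × (ℕ → ℤ → ℤ)} (hP : P ∈ Model U D G.tipL G.tipR y) :
    ∃ T ∈ tilings G.region, G.chains T = P := by
  obtain ⟨N, M⟩ := P
  obtain ⟨hN, hM, -, -, -⟩ := hG.mem_model_iff.1 hP
  have tN := Strip.tiling_of_heights hN
  have tM := Strip.tiling_of_heights hM
  obtain ⟨ru, lu, vu, rl, ll, vl⟩ := hG.ind_ofChains hP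
  have hsub : ∀ l ∈ G.ofChains (N, M), l.upTriangle ∈ G.region ∧ l.downTriangle ∈ G.region :=
    fun l hl => mem_lozengesIn.1 (mem_ofChains.1 hl).1
  generalize G.ofChains (N, M) = T at ru lu vu rl ll vl hsub
  have hTt : T ∈ tilings G.region := by
    refine mem_tilings.2 ⟨hsub, ?_, ?_⟩
    · intro i j hτ
      rcases le_or_gt (G.axis : ℤ) j with hj | hj
      · obtain ⟨k, rfl⟩ : ∃ k : ℕ, j = G.axis + k := ⟨(j - G.axis).toNat, by omega⟩
        rw [ru, lu, vu]
        exact tN.up k i (hG.upIn_upper.1 hτ)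
      · obtain ⟨k, rfl⟩ : ∃ k : ℕ, j = G.axis - 1 - k := ⟨(G.axis - 1 - j).toNat, by omega⟩
        obtain ⟨i, rfl⟩ : ∃ i', i = -i' - 1 := ⟨-i - 1, by ring⟩
        have e1 := ll k (i + 1)
        have e2 := vl (k + 1) i
        rw [show -(i + 1) = -i - 1 by ring] at e1
        rw [show (G.axis : ℤ) - ((k + 1 : ℕ) : ℤ) = G.axis - 1 - k by push_cast; ring] at e2
        rw [rl, e1, e2]
        exact tM.down k i (hG.dnIn_lower.1 hτ)
    · intro i j hτ
      rcases le_or_gt (G.axis : ℤ) j with hj | hj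
      · obtain ⟨k, rfl⟩ : ∃ k : ℕ, j = G.axis + k := ⟨(j - G.axis).toNat, by omega⟩
        have e2 := vu (k + 1) i
        rw [show (G.axis : ℤ) + ((k + 1 : ℕ) : ℤ) = G.axis + k + 1 by push_cast; ring] at e2
        rw [ru, lu, e2]
        exact tN.down k i (hG.dnIn_upper.1 hτ)
      · obtain ⟨k, rfl⟩ : ∃ k : ℕ, j = G.axis - 1 - k := ⟨(G.axis - 1 - j).toNat, by omega⟩
        obtain ⟨i, rfl⟩ : ∃ i', i = -i' - 1 := ⟨-i - 1, by ring⟩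
        rw [show -i - 1 + 1 = -i by ring, show (G.axis : ℤ) - 1 - k + 1 = G.axis - k by ring, rl, ll,
          vl]
        exact tM.up k i (hG.upIn_lower.1 hτ)
  refine ⟨T, hTt, ?_⟩
  refine Prod.ext ?_ ?_
  · refine (Strip.compat_heights hG.upper_valid (hG.upper_tiling hTt)).ext hN fun k i hu => ?_
    have e := Strip.v_eq (v := fun k i => ind T ⟨.vertical, i, G.axis + k⟩) hu
    rw [vu, Strip.indV, if_pos hu] at e
    exact e.symm
  · refine (Strip.compat_heights hG.lower_valid (hG.lower_tiling hTt)).ext hM fun k i hu => ?_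
    have e := Strip.v_eq (v := fun k i => ind T ⟨.vertical, -i - 1, G.axis - k⟩) hu
    rw [vl, Strip.indV, if_pos hu] at e
    exact e.symm

/-- The heights determine the indicators of the lozenges at the triangles above the axis. -/
lemma ind_upper {T : Finset Lozenge} (hT : T ∈ tilings G.region) {k : ℕ} {i : ℤ}
    (hu : G.upper.UpIn k i) :
    ind T ⟨.right, i, G.axis + k⟩ =
      (G.chains T).1 k (i + 1) + 1 - (G.chains T).1 (k + 1) i ∧
    ind T ⟨.left, i, G.axis + k⟩ = (G.chains T).1 (k + 1) i - (G.chains T).1 k i ∧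
    ind T ⟨.vertical, i, G.axis + k⟩ = (G.chains T).1 k i - (G.chains T).1 k (i + 1) :=
  ⟨Strip.r_eq hG.upper_valid (hG.upper_tiling hT) hu,
    Strip.l_eq hG.upper_valid (hG.upper_tiling hT) hu,
    Strip.v_eq (v := fun k i => ind T ⟨.vertical, i, G.axis + k⟩) hu⟩

lemma ind_lower {T : Finset Lozenge} (hT : T ∈ tilings G.region) {k : ℕ} {i : ℤ}
    (hu : G.lower.UpIn k i) :
    ind T ⟨.right, -i - 1, G.axis - 1 - k⟩ =
      (G.chains T).2 k (i + 1) + 1 - (G.chains T).2 (k + 1) i ∧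
    ind T ⟨.left, -i, G.axis - 1 - k⟩ = (G.chains T).2 (k + 1) i - (G.chains T).2 k i ∧
    ind T ⟨.vertical, -i - 1, G.axis - k⟩ = (G.chains T).2 k i - (G.chains T).2 k (i + 1) :=
  ⟨Strip.r_eq hG.lower_valid (hG.lower_tiling hT) hu,
    Strip.l_eq hG.lower_valid (hG.lower_tiling hT) hu,
    Strip.v_eq (v := fun k i => ind T ⟨.vertical, -i - 1, G.axis - k⟩) hu⟩

/-- Each lozenge of a tiling has a triangle in one of the two strips at which its indicator is a
height difference, so the heights determine the tiling. -/
lemma chains_injOn : Set.InjOn G.chains (tilings G.region : Set (Finset Lozenge)) := by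
  have key : ∀ T ∈ tilings G.region, ∀ T' ∈ tilings G.region, G.chains T = G.chains T' →
      T ⊆ T' := by
    intro T hT T' hT' he l hl
    have hm := (mem_tilings.1 hT).1 l hl
    have h1 : ind T l = 1 := by simp [ind, hl]
    suffices h : ind T l = ind T' l by
      by_contra hc
      rw [ind_eq_zero.2 hc] at h
      omega
    obtain ⟨c, i, j⟩ := l
    rcases le_or_gt (G.axis : ℤ) j with hj | hj
    · obtain ⟨k, rfl⟩ : ∃ k : ℕ, j = G.axis + k := ⟨(j - G.axis).toNat, by omega⟩
      have hu := hG.upIn_upper.1 hm.1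
      have e1 := hG.ind_upper hT hu
      have e2 := hG.ind_upper hT' hu
      rw [he] at e1
      cases c
      · rw [e1.1, e2.1]
      · rw [e1.2.1, e2.2.1]
      · rw [e1.2.2, e2.2.2]
    · obtain ⟨k, rfl⟩ : ∃ k : ℕ, j = G.axis - 1 - k := ⟨(G.axis - 1 - j).toNat, by omega⟩
      obtain ⟨i, rfl⟩ : ∃ i', i = -i' - 1 := ⟨-i - 1, by ring⟩
      cases c
      · have hu := hG.upIn_lower.1 hm.2
        rw [(hG.ind_lower hT hu).1, (hG.ind_lower hT' hu).1, he]
      · have hu : G.lower.UpIn k (i + 1) := by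
          refine hG.upIn_lower.1 ?_
          have := hm.2
          simp only [Lozenge.downTriangle] at this
          rwa [show -i - 1 - 1 = -(i + 1) - 1 by ring] at this
        have e1 := (hG.ind_lower hT hu).2.1
        have e2 := (hG.ind_lower hT' hu).2.1
        rw [show -(i + 1) = -i - 1 by ring] at e1 e2
        rw [e1, e2, he]
      · have hu : G.lower.UpIn (k + 1) i := by
          refine hG.upIn_lower.1 ?_
          have := hm.2
          simp only [Lozenge.downTriangle] at this
          convert this using 2
          push_cast; ring
        have e1 := (hG.ind_lower hT hu).2.2
        have e2 := (hG.ind_lower hT' hu).2.2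
        rw [show (G.axis : ℤ) - ((k + 1 : ℕ) : ℤ) = G.axis - 1 - k by push_cast; ring] at e1 e2
        rw [e1, e2, he]
  intro T hT T' hT' he
  exact (key T hT T' hT' he).antisymm (key T' hT' T hT he.symm)

end Spec

end IntrudedHexagon
end LozengeTiling

namespace LozengeTiling
/-! ### Heights of the vertices and stepped surfaces -/

/-- The sum of the heights of the two chains at a point of the free segment, whose left end is
`a`. -/
def shift (U D : Finset ℤ) (a : ℤ) (y : ℕ) : ℤ := row U a + row (refl D) (-a) - y

namespace IntrudedHexagon
variable {G : IntrudedHexagon}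

/-- The height of a vertex on the surface with chains `P`. -/
def ht (G : IntrudedHexagon) (c : ℤ) (P : (ℕ → ℤ → ℤ) × (ℕ → ℤ → ℤ)) (side : Bool) (v : Vertex) :
    ℤ :=
  if side then P.1 (v.2 - G.axis).toNat v.1 else c - P.2 (G.axis - v.2).toNat (-v.1)

/-- The vertex `v` lies in the closed half plane above or below the axis. -/
def InSide (G : IntrudedHexagon) (side : Bool) (v : Vertex) : Prop :=
  if side then (G.axis : ℤ) ≤ v.2 else v.2 ≤ G.axis

lemma inSide_vertex {τ : UnitTriangle} {v : Vertex} (hv : v ∈ τ.vertices) :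
    G.InSide (G.above τ) v := by
  obtain ⟨u, i, j⟩ := τ
  unfold InSide above
  simp only [UnitTriangle.vertices] at hv
  cases u <;> simp at hv <;> split_ifs with h <;> simp at h <;> rcases hv with rfl | rfl | rfl <;>
    simp <;> omega

lemma isInterior_iff {v : Vertex} : G.IsInterior v ↔
    (⟨true, v.1, v.2⟩ : UnitTriangle) ∈ G.region ∧
    (⟨true, v.1 - 1, v.2⟩ : UnitTriangle) ∈ G.region ∧
    (⟨true, v.1, v.2 - 1⟩ : UnitTriangle) ∈ G.region ∧
    (⟨false, v.1 - 1, v.2⟩ : UnitTriangle) ∈ G.region ∧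
    (⟨false, v.1, v.2 - 1⟩ : UnitTriangle) ∈ G.region ∧
    (⟨false, v.1 - 1, v.2 - 1⟩ : UnitTriangle) ∈ G.region := by
  obtain ⟨x, w⟩ := v
  unfold IsInterior
  constructor
  · intro h
    refine ⟨h _ ?_, h _ ?_, h _ ?_, h _ ?_, h _ ?_, h _ ?_⟩ <;> simp [UnitTriangle.vertices]
  · rintro ⟨h1, h2, h3, h4, h5, h6⟩ ⟨u, i, j⟩ hv
    cases u <;> simp [UnitTriangle.vertices] at hv <;> rcases hv with ⟨rfl, rfl⟩ | ⟨rfl, rfl⟩ | ⟨rfl, rfl⟩ <;>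
      simp_all

lemma exists_upper (j : ℤ) (h : (G.axis : ℤ) ≤ j) : ∃ k : ℕ, j = G.axis + k :=
  ⟨(j - G.axis).toNat, by omega⟩

lemma exists_lower (j : ℤ) (h : j ≤ (G.axis : ℤ)) : ∃ k : ℕ, j = G.axis - k :=
  ⟨(G.axis - j).toNat, by omega⟩

@[simp] lemma ht_upper (c : ℤ) (P : (ℕ → ℤ → ℤ) × (ℕ → ℤ → ℤ)) (i : ℤ) (k : ℕ) :
    G.ht c P true (i, G.axis + k) = P.1 k i := by simp [ht]

@[simp] lemma ht_lower (c : ℤ) (P : (ℕ → ℤ → ℤ) × (ℕ → ℤ → ℤ)) (i : ℤ) (k : ℕ) :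
    G.ht c P false (i, G.axis - k) = c - P.2 k (-i) := by simp [ht]

lemma ht_upper' (c : ℤ) (P : (ℕ → ℤ → ℤ) × (ℕ → ℤ → ℤ)) {i j : ℤ} {k : ℕ} (h : j = G.axis + k) :
    G.ht c P true (i, j) = P.1 k i := by subst h; simp

lemma ht_lower' (c : ℤ) (P : (ℕ → ℤ → ℤ) × (ℕ → ℤ → ℤ)) {i i' j : ℤ} {k : ℕ}
    (h : j = G.axis - k) (hi : i = -i') : G.ht c P false (i, j) = c - P.2 k i' := by
  subst h hi; simp

namespace Spec
variable {U D : Finset ℤ} {y : ℕ} (hG : G.Spec U D y)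
include hG

/-- At the left tip all of `S` lies to the right, and it is counted in full by the reflected row; so
the sum of the two heights does not depend on `S`. Moving right along the free segment changes the
two heights by opposite amounts. -/
lemma glue {P : (ℕ → ℤ → ℤ) × (ℕ → ℤ → ℤ)} (hP : P ∈ Model U D G.tipL G.tipR y) {i : ℤ}
    (h1 : G.tipL ≤ i) (h2 : i ≤ G.tipR) : P.1 0 i + P.2 0 (-i) = shift U D G.tipL y := by
  have hsl := (hG.mem_model_iff (N := P.1) (M := P.2)).1 hP
  induction i, h1 using Int.leInduction with
  | base =>
    obtain ⟨S, hS, hy, ⟨-, hN⟩, ⟨-, hM⟩⟩ := hP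
    obtain ⟨d1, d2⟩ := hG.free_disjoint hS
    have dr : Disjoint (refl D) (refl S) := by
      rw [Finset.disjoint_left] at d2 ⊢
      intro p hp hp'
      rw [mem_refl] at hp hp'
      exact d2 hp hp'
    rw [hN, hM, refl_union]
    unfold shift row
    rw [below_union d1, below_union dr, below_eq_zero (A := S), below_eq_card (A := refl S), card_refl,
      hy]
    · ring
    · intro p hp
      rw [mem_refl] at hp
      have := Finset.mem_Ico.1 (hS hp); omega
    · intro p hp
      have := Finset.mem_Ico.1 (hS hp); omega
  | succ i hi ih =>
    have h3 := ih (by omega)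
    have h4 := hsl.2.2.1 i hi (by omega)
    rw [show -(i + 1) = -1 - i by ring]
    omega

lemma ht_glue {P : (ℕ → ℤ → ℤ) × (ℕ → ℤ → ℤ)} (hP : P ∈ Model U D G.tipL G.tipR y) {i : ℤ}
    (h1 : G.tipL ≤ i) (h2 : i ≤ G.tipR) :
    G.ht (shift U D G.tipL y) P true (i, G.axis) = G.ht (shift U D G.tipL y) P false (i, G.axis) := by
  have := hG.glue hP h1 h2
  simp only [ht, if_true, sub_self, Int.toNat_zero]
  simp
  omega

/-- An interior vertex on the axis has free segments on both sides, which excludes the tips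
themselves. -/
lemma tip_of_interior {i : ℤ} (h : G.IsInterior (i, G.axis)) : G.tipL < i ∧ i < G.tipR := by
  obtain ⟨h1, h2, h3, h4, h5, h6⟩ := isInterior_iff.1 h
  simp only at h1 h2 h5 h6
  have e1 := (hG.free_iff (p := i)).1 ⟨hG.upIn_upper.1 (by simpa using h1), hG.upIn_lower.1 (by
    convert h5 using 2 <;> push_cast <;> ring)⟩
  have e2 := (hG.free_iff (p := i - 1)).1 ⟨hG.upIn_upper.1 (by simpa using h2), hG.upIn_lower.1 (by
    convert h6 using 2 <;> push_cast <;> ring)⟩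
  omega

/-- The two heights of an interior vertex agree. -/
lemma ht_interior {P : (ℕ → ℤ → ℤ) × (ℕ → ℤ → ℤ)} (hP : P ∈ Model U D G.tipL G.tipR y)
    {v : Vertex} (hv : G.IsInterior v) {side : Bool} (hs : G.InSide side v) :
    G.ht (shift U D G.tipL y) P side v =
      G.ht (shift U D G.tipL y) P (decide ((G.axis : ℤ) ≤ v.2)) v := by
  obtain ⟨i, j⟩ := v
  rcases lt_trichotomy (G.axis : ℤ) j with hj | hj | hj
  · cases side
    · simp only [InSide] at hs; simp at hs; omega
    · simp [hj.le]
  · subst hj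
    have := hG.tip_of_interior hv
    cases side
    · simp [hG.ht_glue hP this.1.le this.2.le]
    · simp
  · cases side
    · simp [not_le.2 hj]
    · simp only [InSide] at hs; simp at hs; omega

/-- Surfaces only differ at interior vertices. -/
lemma interior_of_ne {P P' : (ℕ → ℤ → ℤ) × (ℕ → ℤ → ℤ)} (hP : P ∈ Model U D G.tipL G.tipR y)
    (hP' : P' ∈ Model U D G.tipL G.tipR y) {v : Vertex} {side : Bool} (hs : G.InSide side v)
    (hne : G.ht (shift U D G.tipL y) P side v ≠ G.ht (shift U D G.tipL y) P' side v) :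
    G.IsInterior v := by
  obtain ⟨i, j⟩ := v
  have a1 := hG.tipR_le
  have a2 := hG.tipR_le'
  have a3 := hG.le_tipL
  have a5 := hG.sw_le
  obtain ⟨S, hS, hy, ⟨q1, hN⟩, ⟨q2, hM⟩⟩ := hP
  obtain ⟨S', hS', hy', ⟨q3, hN'⟩, ⟨q4, hM'⟩⟩ := hP'
  have hP : P ∈ Model U D G.tipL G.tipR y := ⟨S, hS, hy, ⟨q1, hN⟩, ⟨q2, hM⟩⟩
  have hP' : P' ∈ Model U D G.tipL G.tipR y := 
    ⟨S', hS', hy', ⟨q3, hN'⟩, ⟨q4, hM'⟩⟩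
  obtain ⟨cN, cM, -⟩ := (hG.mem_model_iff (N := P.1) (M := P.2)).1 hP
  obtain ⟨cN', cM', -⟩ := (hG.mem_model_iff (N := P'.1) (M := P'.2)).1 hP'
  -- on the axis, the heights at points of the ferns are fixed
  have rowfix : ∀ S ⊆ Finset.Ico G.tipL G.tipR, S.card = y → ∀ i,
      ¬ (G.tipL < i ∧ i < G.tipR) → row (U ∪ S) i = row U i - (if i ≤ G.tipL then 0 else y) ∧
        row (refl (D ∪ S)) (-i) = row (refl D) (-i) - (if i ≤ G.tipL then y else 0) := by
    intro S hS hy i hi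
    obtain ⟨d1, d2⟩ := hG.free_disjoint hS
    have hS' : ∀ p ∈ S, G.tipL ≤ p ∧ p < G.tipR := fun p hp => Finset.mem_Ico.1 (hS hp)
    unfold row
    rw [below_refl, below_refl, neg_neg, below_union d1, below_union d2,
      Finset.card_union_of_disjoint d2, hy]
    split_ifs with h
    · rw [below_eq_zero (A := S) fun p hp => by have := hS' p hp; omega]
      push_cast
      constructor <;> ring
    · rw [below_eq_card (A := S) fun p hp => by have := hS' p hp; omega, hy]
      push_cast
      constructor <;> ring
  have axisfix : ∀ i, ¬ (G.tipL < i ∧ i < G.tipR) → P.1 0 i = P'.1 0 i ∧ P.2 0 (-i) = P'.2 0 (-i) := by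
    intro i hi
    rw [hN, hN', hM, hM']
    have e1 := rowfix S hS hy i hi
    have e2 := rowfix S' hS' hy' i hi
    rw [e1.1, e1.2, e2.1, e2.2]
    exact ⟨rfl, rfl⟩
  have bN : ∀ a b, G.upper.block a b → P.1 0 a = P'.1 0 a := by
    intro a b hb
    refine (axisfix a ?_).1
    rcases hb with ⟨l, hl, -, rfl, rfl⟩ | ⟨rfl, rfl⟩
    · have := hG.lobe_range l hl; omega
    · omega
  have bM : ∀ a b, G.lower.block a b → P.2 0 a = P'.2 0 a := by
    intro a b hb
    rw [show a = - -a by ring]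
    refine (axisfix (-a) ?_).2
    rcases hb with ⟨l, hl, -, rfl, rfl⟩ | ⟨rfl, rfl⟩ | ⟨rfl, rfl⟩
    · have := hG.lobe_range l hl; omega
    · omega
    · omega
  -- A point at which the heights differ lies strictly inside the strip and outside every block. The
  -- triangles of the strip around it then belong to the region; for `k = 0` those on the other side
  -- of the axis come from the other chain.
  have upperTri : ∀ (k : ℕ) i, P.1 k i ≠ P'.1 k i → G.upper.UpIn k i ∧ G.upper.UpIn k (i - 1) ∧
      G.upper.DnIn k (i - 1) ∧ ∀ l, k = l + 1 → G.upper.UpIn l i ∧ G.upper.DnIn l i ∧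
        G.upper.DnIn l (i - 1) := by
    intro k i h
    obtain ⟨h1, h2, h3, h4⟩ := cN.interior cN' h bN
    refine ⟨⟨h1, by omega, by omega, fun a b hb hc => h4 a b hb (by omega)⟩,
      ⟨h1, by omega, by omega, fun a b hb hc => h4 a b hb (by omega)⟩,
      ⟨h1, by omega, by omega, fun a b hb hc => h4 a b hb (by omega)⟩, ?_⟩
    rintro l rfl
    push_cast at h3 h4
    exact ⟨⟨by omega, by omega, by omega, fun a b hb hc => h4 a b hb (by omega)⟩,
      ⟨by omega, by omega, by omega, fun a b hb hc => h4 a b hb (by omega)⟩,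
      ⟨by omega, by omega, by omega, fun a b hb hc => h4 a b hb (by omega)⟩⟩
  have lowerTri : ∀ (k : ℕ) i, P.2 k i ≠ P'.2 k i → G.lower.UpIn k i ∧ G.lower.UpIn k (i - 1) ∧
      G.lower.DnIn k (i - 1) ∧ ∀ l, k = l + 1 → G.lower.UpIn l i ∧ G.lower.DnIn l i ∧
        G.lower.DnIn l (i - 1) := by
    intro k i h
    obtain ⟨h1, h2, h3, h4⟩ := cM.interior cM' h bM
    refine ⟨⟨h1, by omega, by omega, fun a b hb hc => h4 a b hb (by omega)⟩,
      ⟨h1, by omega, by omega, fun a b hb hc => h4 a b hb (by omega)⟩,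
      ⟨h1, by omega, by omega, fun a b hb hc => h4 a b hb (by omega)⟩, ?_⟩
    rintro l rfl
    push_cast at h3 h4
    exact ⟨⟨by omega, by omega, by omega, fun a b hb hc => h4 a b hb (by omega)⟩,
      ⟨by omega, by omega, by omega, fun a b hb hc => h4 a b hb (by omega)⟩,
      ⟨by omega, by omega, by omega, fun a b hb hc => h4 a b hb (by omega)⟩⟩
  have up_u := fun (k : ℕ) (i : ℤ) (h : G.upper.UpIn k i) (i' j' : ℤ) (hi : i' = i)
    (hj : j' = G.axis + k) => show (⟨true, i', j'⟩ : UnitTriangle) ∈ G.region by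
      subst hi hj; exact hG.upIn_upper.2 h
  have dn_u := fun (k : ℕ) (i : ℤ) (h : G.upper.DnIn k i) (i' j' : ℤ) (hi : i' = i)
    (hj : j' = G.axis + k) => show (⟨false, i', j'⟩ : UnitTriangle) ∈ G.region by
      subst hi hj; exact hG.dnIn_upper.2 h
  have up_l := fun (k : ℕ) (i : ℤ) (h : G.lower.UpIn k i) (i' j' : ℤ) (hi : i' = -i - 1)
    (hj : j' = G.axis - 1 - k) => show (⟨false, i', j'⟩ : UnitTriangle) ∈ G.region by
      subst hi hj; exact hG.upIn_lower.2 h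
  have dn_l := fun (k : ℕ) (i : ℤ) (h : G.lower.DnIn k i) (i' j' : ℤ) (hi : i' = -i - 1)
    (hj : j' = G.axis - 1 - k) => show (⟨true, i', j'⟩ : UnitTriangle) ∈ G.region by
      subst hi hj; exact hG.dnIn_lower.2 h
  have onAxis : P.1 0 i ≠ P'.1 0 i → P.2 0 (-i) ≠ P'.2 0 (-i) → G.IsInterior (i, (G.axis : ℤ)) := by
    intro h1 h2
    obtain ⟨b1, b2, b3, -⟩ := upperTri 0 i h1
    obtain ⟨b4, b5, b6, -⟩ := lowerTri 0 (-i) h2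
    exact isInterior_iff.2 ⟨up_u _ _ b1 _ _ rfl (by simp), up_u _ _ b2 _ _ rfl (by simp),
      dn_l _ _ b6 _ _ (by ring) (by push_cast; ring), dn_u _ _ b3 _ _ rfl (by simp),
      up_l _ _ b5 _ _ (by ring) (by push_cast; ring), up_l _ _ b4 _ _ (by ring) (by push_cast; ring)⟩
  -- On the free segment the sum of the two heights is fixed, and off its interior neither height
  -- varies. So the two halves can only disagree together.
  have gl : P.1 0 i ≠ P'.1 0 i ∨ P.2 0 (-i) ≠ P'.2 0 (-i) →
      P.1 0 i ≠ P'.1 0 i ∧ P.2 0 (-i) ≠ P'.2 0 (-i) := by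
    intro h
    by_cases hi : G.tipL < i ∧ i < G.tipR
    · have e1 := hG.glue hP hi.1.le hi.2.le
      have e2 := hG.glue hP' hi.1.le hi.2.le
      omega
    · have := axisfix i hi; tauto
  cases side
  · simp only [InSide] at hs
    obtain ⟨k, rfl⟩ := exists_lower (G := G) j (by simpa using hs)
    rw [ht_lower, ht_lower] at hne
    have hne : P.2 k (-i) ≠ P'.2 k (-i) := fun h => hne (by rw [h])
    cases k with
    | zero =>
      simp only [Nat.cast_zero, sub_zero]
      obtain ⟨h1, h2⟩ := gl (Or.inr hne)
      exact onAxis h1 h2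
    | succ l =>
      obtain ⟨b1, b2, b3, b4⟩ := lowerTri _ _ hne
      obtain ⟨b4, b5, b6⟩ := b4 l rfl
      exact isInterior_iff.2 ⟨dn_l _ _ b6 _ _ (by ring) (by push_cast; ring),
        dn_l _ _ b5 _ _ (by ring) (by push_cast; ring), dn_l _ _ b3 _ _ (by ring) (by push_cast; ring),
        up_l _ _ b4 _ _ (by ring) (by push_cast; ring), up_l _ _ b2 _ _ (by ring) (by push_cast; ring),
        up_l _ _ b1 _ _ (by ring) (by push_cast; ring)⟩
  · simp only [InSide] at hs
    obtain ⟨k, rfl⟩ := exists_upper (G := G) j (by simpa using hs)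
    rw [ht_upper, ht_upper] at hne
    cases k with
    | zero =>
      simp only [Nat.cast_zero, add_zero]
      obtain ⟨h1, h2⟩ := gl (Or.inl hne)
      exact onAxis h1 h2
    | succ l =>
      obtain ⟨b1, b2, b3, b4⟩ := upperTri _ _ hne
      obtain ⟨b4, b5, b6⟩ := b4 l rfl
      exact isInterior_iff.2 ⟨up_u _ _ b1 _ _ rfl rfl, up_u _ _ b2 _ _ rfl rfl,
        up_u _ _ b4 _ _ rfl (by push_cast; ring), dn_u _ _ b3 _ _ rfl rfl,
        dn_u _ _ b5 _ _ rfl (by push_cast; ring), dn_u _ _ b6 _ _ rfl (by push_cast; ring)⟩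

/-- The three monotonicity relations between the heights of neighbouring vertices. -/
lemma ht_anti {c : ℤ} {P : (ℕ → ℤ → ℤ) × (ℕ → ℤ → ℤ)} (hP : P ∈ Model U D G.tipL G.tipR y)
    {side : Bool} {i j : ℤ} (h : G.InSide side (i, j)) :
    G.ht c P side (i + 1, j) ≤ G.ht c P side (i, j) := by
  obtain ⟨cN, cM, -⟩ := (hG.mem_model_iff (N := P.1) (M := P.2)).1 hP
  cases side
  · obtain ⟨k, rfl⟩ := exists_lower (G := G) j (by simpa [InSide] using h)
    have := cM.anti k (-(i + 1))
    rw [ht_lower, ht_lower]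
    rw [show -(i + 1) + 1 = -i by ring] at this
    omega
  · obtain ⟨k, rfl⟩ := exists_upper (G := G) j (by simpa [InSide] using h)
    rw [ht_upper, ht_upper]
    exact cN.anti k i

lemma ht_up {c : ℤ} {P : (ℕ → ℤ → ℤ) × (ℕ → ℤ → ℤ)} (hP : P ∈ Model U D G.tipL G.tipR y)
    {side : Bool} {i j : ℤ} (h : G.InSide side (i, j)) (h' : G.InSide side (i, j + 1)) :
    G.ht c P side (i, j) ≤ G.ht c P side (i, j + 1) := by
  obtain ⟨cN, cM, -⟩ := (hG.mem_model_iff (N := P.1) (M := P.2)).1 hP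
  cases side
  · obtain ⟨k, hk⟩ := exists_lower (G := G) (j + 1) (by simpa [InSide] using h')
    have := cM.up k (-i)
    rw [ht_lower' c P (k := k + 1) (i' := -i) (by push_cast; omega) (by ring),
      ht_lower' c P hk (i' := -i) (by ring)]
    omega
  · obtain ⟨k, rfl⟩ := exists_upper (G := G) j (by simpa [InSide] using h)
    rw [ht_upper, ht_upper' c P (k := k + 1) (by push_cast; ring)]
    exact cN.up k i

lemma ht_diag {c : ℤ} {P : (ℕ → ℤ → ℤ) × (ℕ → ℤ → ℤ)} (hP : P ∈ Model U D G.tipL G.tipR y)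
    {side : Bool} {i j : ℤ} (h : G.InSide side (i, j)) (h' : G.InSide side (i, j + 1)) :
    G.ht c P side (i, j + 1) ≤ G.ht c P side (i + 1, j) + 1 := by
  obtain ⟨cN, cM, -⟩ := (hG.mem_model_iff (N := P.1) (M := P.2)).1 hP
  cases side
  · obtain ⟨k, hk⟩ := exists_lower (G := G) (j + 1) (by simpa [InSide] using h')
    have := cM.diag k (-(i + 1))
    rw [ht_lower' c P (i := i + 1) (j := j) (k := k + 1) (i' := -(i + 1)) (by push_cast; omega)
      (by ring), ht_lower' c P (i := i) hk (i' := -(i + 1) + 1) (by ring)]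
    omega
  · obtain ⟨k, rfl⟩ := exists_upper (G := G) j (by simpa [InSide] using h)
    rw [ht_upper, ht_upper' c P (k := k + 1) (by push_cast; ring)]
    exact cN.diag k i

/-- The lozenges that cover an up-pointing triangle in terms of the heights. -/
lemma ind_up {c : ℤ} {T : Finset Lozenge} (hT : T ∈ tilings G.region) {i j : ℤ}
    (hτ : (⟨true, i, j⟩ : UnitTriangle) ∈ G.region) {s : Bool} (hs : s = G.above ⟨true, i, j⟩) :
    ind T ⟨.right, i, j⟩ = G.ht c (G.chains T) s (i + 1, j) + 1 - G.ht c (G.chains T) s (i, j + 1) ∧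
    ind T ⟨.left, i, j⟩ = G.ht c (G.chains T) s (i, j + 1) - G.ht c (G.chains T) s (i, j) ∧
    ind T ⟨.vertical, i, j⟩ = G.ht c (G.chains T) s (i, j) - G.ht c (G.chains T) s (i + 1, j) := by
  subst hs
  rcases le_or_gt (G.axis : ℤ) j with hj | hj
  · obtain ⟨k, rfl⟩ := exists_upper j hj
    have h := hG.ind_upper hT (hG.upIn_upper.1 hτ)
    rw [show G.above ⟨true, i, G.axis + k⟩ = true by simp [above]]
    rw [ht_upper, ht_upper, ht_upper' c _ (k := k + 1) (by push_cast; ring)]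
    exact h
  · obtain ⟨k, rfl⟩ : ∃ k : ℕ, j = G.axis - 1 - k := ⟨(G.axis - 1 - j).toNat, by omega⟩
    obtain ⟨i, rfl⟩ : ∃ i', i = -i' - 1 := ⟨-i - 1, by ring⟩
    have h := Strip.eq_of_down hG.lower_valid (hG.lower_tiling hT) (hG.dnIn_lower.1 hτ)
    rw [show G.above ⟨true, -i - 1, G.axis - 1 - k⟩ = false by simp [above]; omega]
    rw [ht_lower' c _ (i := -i - 1 + 1) (j := G.axis - 1 - k) (k := k + 1) (i' := i)
        (by push_cast; ring) (by ring),
      ht_lower' c _ (i := -i - 1) (j := G.axis - 1 - k + 1) (k := k) (i' := i + 1)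
        (by ring) (by ring),
      ht_lower' c _ (i := -i - 1) (j := G.axis - 1 - k) (k := k + 1) (i' := i + 1)
        (by push_cast; ring) (by ring)]
    rw [show -(i + 1) = -i - 1 by ring,
      show (G.axis : ℤ) - ((k + 1 : ℕ) : ℤ) = G.axis - 1 - k by push_cast; ring] at h
    simp only [chains]
    omega

lemma ind_down {c : ℤ} {T : Finset Lozenge} (hT : T ∈ tilings G.region) {i j : ℤ}
    (hτ : (⟨false, i, j⟩ : UnitTriangle) ∈ G.region) {s : Bool} (hs : s = G.above ⟨false, i, j⟩) :
    ind T ⟨.right, i, j⟩ = G.ht c (G.chains T) s (i + 1, j) + 1 - G.ht c (G.chains T) s (i, j + 1) ∧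
    ind T ⟨.left, i + 1, j⟩ =
      G.ht c (G.chains T) s (i + 1, j + 1) - G.ht c (G.chains T) s (i + 1, j) ∧
    ind T ⟨.vertical, i, j + 1⟩ =
      G.ht c (G.chains T) s (i, j + 1) - G.ht c (G.chains T) s (i + 1, j + 1) := by
  subst hs
  rcases le_or_gt (G.axis : ℤ) j with hj | hj
  · obtain ⟨k, rfl⟩ := exists_upper j hj
    have h := Strip.eq_of_down hG.upper_valid (hG.upper_tiling hT) (hG.dnIn_upper.1 hτ)
    rw [show G.above ⟨false, i, G.axis + k⟩ = true by simp [above]]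
    rw [ht_upper, ht_upper' c _ (k := k + 1) (by push_cast; ring),
      ht_upper' c _ (k := k + 1) (by push_cast; ring)]
    rw [show (G.axis : ℤ) + ((k + 1 : ℕ) : ℤ) = G.axis + k + 1 by push_cast; ring] at h
    exact h
  · obtain ⟨k, rfl⟩ : ∃ k : ℕ, j = G.axis - 1 - k := ⟨(G.axis - 1 - j).toNat, by omega⟩
    obtain ⟨i, rfl⟩ : ∃ i', i = -i' - 1 := ⟨-i - 1, by ring⟩
    have h := hG.ind_lower hT (hG.upIn_lower.1 hτ)
    rw [show G.above ⟨false, -i - 1, G.axis - 1 - k⟩ = false by simp [above]; omega]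
    rw [ht_lower' c _ (i := -i - 1 + 1) (j := G.axis - 1 - k) (k := k + 1) (i' := i)
        (by push_cast; ring) (by ring),
      ht_lower' c _ (i := -i - 1) (j := G.axis - 1 - k + 1) (k := k) (i' := i + 1)
        (by ring) (by ring),
      ht_lower' c _ (i := -i - 1 + 1) (j := G.axis - 1 - k + 1) (k := k) (i' := i)
        (by ring) (by ring)]
    rw [show -i - 1 + 1 = -i by ring, show (G.axis : ℤ) - 1 - k + 1 = G.axis - k by ring]
    omega

end Spec
end IntrudedHexagon
end LozengeTiling

namespace LozengeTiling
/-! ### The weight of a tiling and the volume below its surface -/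

/-- The sum of the heights of the top sides of the lozenges of a given kind. -/
def expo (c : LozengeKind) (T : Finset Lozenge) : ℕ :=
  ∑ l ∈ T, if l.kind = c then (l.j + 1).toNat else 0

lemma prod_wt₁ (T : Finset Lozenge) : ∏ l ∈ T, wt₁ l = X ^ expo .right T := by
  unfold expo
  rw [← Finset.prod_pow_eq_pow_sum]
  refine Finset.prod_congr rfl fun l _ => ?_
  obtain ⟨k, i, j⟩ := l
  cases k <;> simp [wt₁]

lemma prod_wt₂ (T : Finset Lozenge) : ∏ l ∈ T, wt₂ l = X ^ expo .left T := by
  unfold expo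
  rw [← Finset.prod_pow_eq_pow_sum]
  refine Finset.prod_congr rfl fun l _ => ?_
  obtain ⟨k, i, j⟩ := l
  cases k <;> simp [wt₂]

lemma sum_kind {R : Finset UnitTriangle} {T : Finset Lozenge} (hT : T ∈ tilings R)
    (c : LozengeKind) (w : ℤ → ℤ) :
    ∑ l ∈ T with l.kind = c, w l.j =
      ∑ τ ∈ R with τ.up = true, ind T ⟨c, τ.i, τ.j⟩ * w τ.j := by
  have : ∀ τ : UnitTriangle, ind T ⟨c, τ.i, τ.j⟩ * w τ.j =
      if (⟨c, τ.i, τ.j⟩ : Lozenge) ∈ T then w τ.j else 0 := by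
    intro τ; unfold ind; split_ifs <;> simp
  simp only [this]
  rw [← Finset.sum_filter]
  refine Finset.sum_nbij' (fun l => ⟨true, l.i, l.j⟩) (fun τ => ⟨c, τ.i, τ.j⟩) ?_ ?_ ?_ ?_ ?_
  · rintro ⟨k, i, j⟩ hl
    rw [Finset.mem_filter] at hl
    obtain ⟨h1, rfl⟩ := hl
    simp only [Finset.mem_filter, and_true]
    exact ⟨((mem_tilings.1 hT).1 _ h1).1, h1⟩
  · rintro ⟨u, i, j⟩ hτ
    simp only [Finset.mem_filter] at hτ ⊢
    simp [hτ.2]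
  · rintro ⟨k, i, j⟩ hl
    rw [Finset.mem_filter] at hl
    simp [← hl.2]
  · rintro ⟨u, i, j⟩ hτ
    simp only [Finset.mem_filter] at hτ
    simp [hτ.1.2]
  · intros; rfl

namespace IntrudedHexagon
variable {G : IntrudedHexagon}

open Classical in
/-- The interior vertices of the region. -/
noncomputable def interior (G : IntrudedHexagon) : Finset Vertex :=
  (G.region.image fun τ => (τ.i, τ.j)).filter G.IsInterior

lemma mem_interior {v : Vertex} : v ∈ G.interior ↔ G.IsInterior v := by
  simp only [interior, Finset.mem_filter, Finset.mem_image]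
  exact ⟨fun h => h.2, fun h => ⟨⟨_, (isInterior_iff.1 h).1, rfl⟩, h⟩⟩

/-- Re-indexes a sum over up-pointing triangles by one of their vertices. Nothing is lost at the
boundary because `f` vanishes there. -/
lemma sum_shifted {f : Vertex → ℤ} (hf : ∀ v, ¬ G.IsInterior v → f v = 0) (a b : ℤ)
    (hI : ∀ v, G.IsInterior v → (⟨true, v.1 - a, v.2 - b⟩ : UnitTriangle) ∈ G.region) (w : ℤ → ℤ) :
    ∑ τ ∈ G.region with τ.up = true, f (τ.i + a, τ.j + b) * w τ.j =
      ∑ v ∈ G.interior, f v * w (v.2 - b) := by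
  symm
  refine Finset.sum_bij_ne_zero (fun v _ _ => ⟨true, v.1 - a, v.2 - b⟩) ?_ ?_ ?_ ?_
  · intro v hv _
    simp [hI v (mem_interior.1 hv)]
  · intro v _ _ v' _ _ h
    simp at h
    exact Prod.ext h.1 h.2
  · rintro ⟨u, i, j⟩ hτ hne
    have hu := (Finset.mem_filter.1 hτ).2
    simp only at hu
    have hi : G.IsInterior (i + a, j + b) := by
      by_contra hc
      exact hne (by simp [hf _ hc])
    refine ⟨(i + a, j + b), mem_interior.2 hi, ?_, ?_⟩
    · simpa using hne
    · simp [hu]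
  · intro v _ _
    simp

/-- The sum of the heights of the interior vertices. -/
noncomputable def vol (G : IntrudedHexagon) (c : ℤ) (P : (ℕ → ℤ → ℤ) × (ℕ → ℤ → ℤ)) : ℤ :=
  ∑ v ∈ G.interior, G.ht c P (decide ((G.axis : ℤ) ≤ v.2)) v

namespace Spec
variable {U D : Finset ℤ} {y : ℕ} (hG : G.Spec U D y)
include hG

/-- Summation by parts. Let `f` be the difference of the two height functions. The indicator of a
right- or left-tilting lozenge is a difference of heights at two vertices of its up-pointing
triangle that lie in adjacent rows. Collecting the terms at each vertex leaves `f` times a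
difference of the row weight `w`. Linear `w` turns weights into volumes (`expo_sub`); constant `w`
shows that the number of right-tilting lozenges is the same for all tilings (`card_right_eq`). -/
lemma sum_ind_sub {T T' : Finset Lozenge} (hT : T ∈ tilings G.region) (hT' : T' ∈ tilings G.region) :
    ∃ f : Vertex → ℤ, (∑ v ∈ G.interior, f v =
        G.vol (shift U D G.tipL y) (G.chains T) - G.vol (shift U D G.tipL y) (G.chains T')) ∧
      ∀ w : ℤ → ℤ,
      (∑ τ ∈ G.region with τ.up = true, ind T ⟨.right, τ.i, τ.j⟩ * w τ.j) -
          (∑ τ ∈ G.region with τ.up = true, ind T' ⟨.right, τ.i, τ.j⟩ * w τ.j) =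
        ∑ v ∈ G.interior, f v * (w v.2 - w (v.2 - 1)) ∧
      (∑ τ ∈ G.region with τ.up = true, ind T ⟨.left, τ.i, τ.j⟩ * w τ.j) -
          (∑ τ ∈ G.region with τ.up = true, ind T' ⟨.left, τ.i, τ.j⟩ * w τ.j) =
        ∑ v ∈ G.interior, f v * (w (v.2 - 1) - w v.2) := by
  classical
  set c := shift U D G.tipL y with hc
  have hP := hG.chains_mem_model hT
  have hP' := hG.chains_mem_model hT'
  set f : Vertex → ℤ := fun v => if G.IsInterior v then
    G.ht c (G.chains T) (decide ((G.axis : ℤ) ≤ v.2)) v -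
      G.ht c (G.chains T') (decide ((G.axis : ℤ) ≤ v.2)) v else 0 with hf
  have hf0 : ∀ v, ¬ G.IsInterior v → f v = 0 := fun v hv => by simp [hf, hv]
  have hd : ∀ side v, G.InSide side v →
      G.ht c (G.chains T) side v - G.ht c (G.chains T') side v = f v := by
    intro side v hs
    by_cases hv : G.IsInterior v
    · simp only [hf, hv, if_true]
      rw [hG.ht_interior hP hv hs, hG.ht_interior hP' hv hs]
    · rw [hf0 v hv]
      by_contra hne
      exact hv (hG.interior_of_ne hP hP' hs fun h => hne (by rw [h, sub_self]))
  have hR : ∀ τ ∈ G.region.filter (fun τ => τ.up = true),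
      ind T ⟨.right, τ.i, τ.j⟩ - ind T' ⟨.right, τ.i, τ.j⟩ =
        f (τ.i + 1, τ.j + 0) - f (τ.i + 0, τ.j + 1) ∧
      ind T ⟨.left, τ.i, τ.j⟩ - ind T' ⟨.left, τ.i, τ.j⟩ =
        f (τ.i + 0, τ.j + 1) - f (τ.i + 0, τ.j + 0) := by
    rintro ⟨u, i, j⟩ hτ
    obtain ⟨h1, rfl⟩ := Finset.mem_filter.1 hτ
    have e := hG.ind_up (c := c) hT h1 rfl
    have e' := hG.ind_up (c := c) hT' h1 rfl
    have v1 := hd _ (i + 1, j) (inSide_vertex (G := G) (τ := ⟨true, i, j⟩) (by simp [UnitTriangle.vertices]))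
    have v2 := hd _ (i, j + 1) (inSide_vertex (G := G) (τ := ⟨true, i, j⟩) (by simp [UnitTriangle.vertices]))
    have v3 := hd _ (i, j) (inSide_vertex (G := G) (τ := ⟨true, i, j⟩) (by simp [UnitTriangle.vertices]))
    simp only [add_zero]
    rw [← v1, ← v2, ← v3, e.1, e.2.1, e'.1, e'.2.1]
    constructor <;> ring
  refine ⟨f, ?_, fun w => ⟨?_, ?_⟩⟩
  · unfold vol
    rw [← Finset.sum_sub_distrib]
    exact Finset.sum_congr rfl fun v hv => by simp [hf, mem_interior.1 hv]
  · rw [← Finset.sum_sub_distrib]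
    simp only [← sub_mul, mul_sub, Finset.sum_sub_distrib]
    have s1 := sum_shifted hf0 1 0 (fun v hv => by simpa using (isInterior_iff.1 hv).2.1) w
    have s2 := sum_shifted hf0 0 1 (fun v hv => by simpa using (isInterior_iff.1 hv).2.2.1) w
    simp only [sub_zero] at s1
    rw [← s1, ← s2, ← Finset.sum_sub_distrib]
    exact Finset.sum_congr rfl fun τ hτ => by rw [(hR τ hτ).1]; ring
  · rw [← Finset.sum_sub_distrib]
    simp only [← sub_mul, mul_sub, Finset.sum_sub_distrib]
    have s1 := sum_shifted hf0 0 0 (fun v hv => by simpa using (isInterior_iff.1 hv).1) w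
    have s2 := sum_shifted hf0 0 1 (fun v hv => by simpa using (isInterior_iff.1 hv).2.2.1) w
    simp only [sub_zero] at s1
    rw [← s1, ← s2, ← Finset.sum_sub_distrib]
    exact Finset.sum_congr rfl fun τ hτ => by rw [(hR τ hτ).2]; ring

omit hG in
lemma _root_.LozengeTiling.IntrudedHexagon.expo_cast {T : Finset Lozenge}
    (hT : T ∈ tilings G.region) (c : LozengeKind) :
    (expo c T : ℤ) = ∑ τ ∈ G.region with τ.up = true, ind T ⟨c, τ.i, τ.j⟩ * (τ.j + 1) := by
  rw [← sum_kind hT c (fun j => j + 1)]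
  unfold expo
  rw [← Finset.sum_filter]
  push_cast
  refine Finset.sum_congr rfl fun l hl => ?_
  have := row_range ((mem_tilings.1 hT).1 l (Finset.mem_filter.1 hl).1).1
  simp only [Lozenge.upTriangle] at this
  omega

/-- The weights of two tilings differ by the difference of the volumes. -/
lemma expo_sub {T T' : Finset Lozenge} (hT : T ∈ tilings G.region) (hT' : T' ∈ tilings G.region) :
    (expo .right T : ℤ) - expo .right T' =
      G.vol (shift U D G.tipL y) (G.chains T) - G.vol (shift U D G.tipL y) (G.chains T') ∧
    (expo .left T : ℤ) - expo .left T' =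
      G.vol (shift U D G.tipL y) (G.chains T') - G.vol (shift U D G.tipL y) (G.chains T) := by
  obtain ⟨f, h1, h2⟩ := hG.sum_ind_sub hT hT'
  -- The top side of a lozenge whose up-pointing triangle is in row `j` has height `j + 1`; this
  -- weight has constant difference `1`.
  obtain ⟨h3, h4⟩ := h2 (fun j => j + 1)
  rw [expo_cast hT, expo_cast hT', expo_cast hT, expo_cast hT', h3, h4, ← h1,
    ← neg_sub (G.vol _ _), ← h1, ← Finset.sum_neg_distrib]
  constructor <;> refine Finset.sum_congr rfl fun v _ => ?_ <;> ring

/-- The number of right-tilting lozenges does not depend on the tiling. -/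
lemma card_right_eq {T T' : Finset Lozenge} (hT : T ∈ tilings G.region)
    (hT' : T' ∈ tilings G.region) :
    (T.filter fun l => l.kind = .right).card = (T'.filter fun l => l.kind = .right).card := by
  obtain ⟨f, h1, h2⟩ := hG.sum_ind_sub hT hT'
  have h3 := (h2 fun _ => 1).1
  rw [← sum_kind hT .right fun _ => 1, ← sum_kind hT' .right fun _ => 1] at h3
  simp at h3
  omega

end Spec

/-! ### Stepped surfaces -/

/-- The lift of the vertex `v` to height `n`. -/
def cell (G : IntrudedHexagon) (v : Vertex) (n : ℤ) : Cell :=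
  ![v.1 + G.sw + n, n, G.sw + G.nw - v.2 + n]

/-- Raising the height moves the point along `(1, 1, 1)`, the direction of projection. The height
itself is the middle coordinate, normalised so that the top left corner at height `0` is the origin.
-/
lemma cell_add (v : Vertex) (n r : ℤ) : G.cell v (n + r) = G.cell v n + fun _ => r := by
  unfold cell
  ext k
  fin_cases k <;> simp <;> ring

lemma cell_inj {v v' : Vertex} {n n' : ℤ} : G.cell v n = G.cell v' n' ↔ v = v' ∧ n = n' := by
  constructor
  · intro h
    have h0 := congrFun h 0
    have h1 := congrFun h 1
    have h2 := congrFun h 2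
    simp [cell] at h0 h1 h2
    subst h1
    refine ⟨Prod.ext ?_ ?_, rfl⟩ <;> omega
  · rintro ⟨rfl, rfl⟩; rfl

lemma exists_cell (c : Cell) : ∃ v n, c = G.cell v n := by
  refine ⟨(c 0 - c 1 - G.sw, G.sw + G.nw + c 1 - c 2), c 1, ?_⟩
  ext k
  fin_cases k <;> simp [cell]
  ring

/-- The height gained along an edge that is lifted to an edge of the cubic lattice. -/
def gain (k : Fin 3) : ℤ := if k = 1 then 1 else 0

lemma cell_step (v : Vertex) (k : Fin 3) (n : ℤ) :
    G.cell (v + dir k) (n + gain k) = G.cell v n + step k := by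
  obtain ⟨i, j⟩ := v
  ext m
  fin_cases k <;> fin_cases m <;> simp [cell, dir, gain, step] <;> ring

end IntrudedHexagon
end LozengeTiling

/-! ### Edges of a tiling and of the contour lift to edges of the cubic lattice -/

namespace LozengeTiling
namespace IntrudedHexagon
variable {G : IntrudedHexagon}

/-- The lift of the edge from `u` to `u + dir k` is an edge of the cubic lattice. -/
def Flat (G : IntrudedHexagon) (c : ℤ) (P : (ℕ → ℤ → ℤ) × (ℕ → ℤ → ℤ)) (side : Bool) (u : Vertex)
    (k : Fin 3) : Prop :=
  G.ht c P side (u + dir k) = G.ht c P side u + gain k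

/-- The lift of the vertices. -/
def surface (G : IntrudedHexagon) (c : ℤ) (P : (ℕ → ℤ → ℤ) × (ℕ → ℤ → ℤ)) (side : Bool) (u : Vertex) :
    Cell :=
  G.cell u (G.ht c P side u)

lemma Flat.surface {c : ℤ} {P : (ℕ → ℤ → ℤ) × (ℕ → ℤ → ℤ)} {side : Bool} {u : Vertex} {k : Fin 3}
    (h : G.Flat c P side u k) :
    G.surface c P side (u + dir k) = G.surface c P side u + step k := by
  unfold IntrudedHexagon.surface
  rw [h, cell_step]

lemma ind_eq_zero_of_cover {R : Finset UnitTriangle} {T : Finset Lozenge} (hT : T ∈ tilings R)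
    {τ : UnitTriangle} (hτ : τ ∈ R) {l l' : Lozenge} (hl : l ∈ T) (h : τ ∈ l.triangles)
    (h' : τ ∈ l'.triangles) (hne : l' ≠ l) : ind T l' = 0 := by
  rw [ind_eq_zero]
  intro hl'
  unfold tilings at hT
  have h1 := (Finset.mem_filter.1 hT).2 τ hτ
  rw [Finset.card_eq_one] at h1
  obtain ⟨m, hm⟩ := h1
  have e1 : l ∈ T.filter fun l => τ ∈ l.triangles := by simp [hl, h]
  have e2 : l' ∈ T.filter fun l => τ ∈ l.triangles := by simp [hl', h']
  rw [hm, Finset.mem_singleton] at e1 e2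
  exact hne (e2.trans e1.symm)

lemma right_diagonal (i j : ℤ) :
    (i + 1, j) ∈ (⟨.right, i, j⟩ : Lozenge).diagonal ∧
      (i, j + 1) ∈ (⟨.right, i, j⟩ : Lozenge).diagonal := by
  simp [Lozenge.diagonal, Lozenge.upTriangle, Lozenge.downTriangle, UnitTriangle.vertices]

lemma left_diagonal (i j : ℤ) :
    (i, j) ∈ (⟨.left, i, j⟩ : Lozenge).diagonal ∧
      (i, j + 1) ∈ (⟨.left, i, j⟩ : Lozenge).diagonal := by
  simp [Lozenge.diagonal, Lozenge.upTriangle, Lozenge.downTriangle, UnitTriangle.vertices]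

lemma vertical_diagonal (i j : ℤ) :
    (i, j) ∈ (⟨.vertical, i, j⟩ : Lozenge).diagonal ∧
      (i + 1, j) ∈ (⟨.vertical, i, j⟩ : Lozenge).diagonal := by
  simp [Lozenge.diagonal, Lozenge.upTriangle, Lozenge.downTriangle, UnitTriangle.vertices]

lemma up_edge {i j : ℤ} {u : Vertex} {k : Fin 3}
    (h1 : u ∈ (⟨true, i, j⟩ : UnitTriangle).vertices)
    (h2 : u + dir k ∈ (⟨true, i, j⟩ : UnitTriangle).vertices) :
    (u = (i, j) ∧ k = 0) ∨ (u = (i + 1, j) ∧ k = 1) ∨ (u = (i, j + 1) ∧ k = 2) := by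
  obtain ⟨x, w⟩ := u
  fin_cases k <;> simp [UnitTriangle.vertices, dir] at h1 h2 ⊢ <;> omega

lemma down_edge {i j : ℤ} {u : Vertex} {k : Fin 3}
    (h1 : u ∈ (⟨false, i, j⟩ : UnitTriangle).vertices)
    (h2 : u + dir k ∈ (⟨false, i, j⟩ : UnitTriangle).vertices) :
    (u = (i, j + 1) ∧ k = 0) ∨ (u = (i + 1, j) ∧ k = 1) ∨ (u = (i + 1, j + 1) ∧ k = 2) := by
  obtain ⟨x, w⟩ := u
  fin_cases k <;> simp [UnitTriangle.vertices, dir] at h1 h2 ⊢ <;> omega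

namespace Spec
variable {U D : Finset ℤ} {y : ℕ} (hG : G.Spec U D y)
include hG

/-- The defect of an edge from lifting to an edge of the cubic lattice is the indicator of the
lozenge that has the edge as short diagonal. If the edge is not the diagonal of the lozenge covering
the triangle, that indicator is zero because the triangle is covered only once. -/
lemma flat_lozenge {c : ℤ} {T : Finset Lozenge} (hT : T ∈ tilings G.region) {l : Lozenge}
    (hl : l ∈ T) {τ : UnitTriangle} (hτ : τ ∈ l.triangles) {u : Vertex} {k : Fin 3}
    (h1 : u ∈ τ.vertices) (h2 : u + dir k ∈ τ.vertices)
    (h3 : ¬ (u ∈ l.diagonal ∧ u + dir k ∈ l.diagonal)) :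
    G.Flat c (G.chains T) (G.above τ) u k := by
  have hτR : τ ∈ G.region := by
    have := (mem_tilings.1 hT).1 l hl
    simp only [Lozenge.triangles, Finset.mem_insert, Finset.mem_singleton] at hτ
    rcases hτ with rfl | rfl
    · exact this.1
    · exact this.2
  obtain ⟨b, i, j⟩ := τ
  unfold Flat
  cases b
  · have e := hG.ind_down (c := c) hT hτR rfl
    rcases down_edge h1 h2 with ⟨rfl, rfl⟩ | ⟨rfl, rfl⟩ | ⟨rfl, rfl⟩
    · have z := ind_eq_zero_of_cover hT hτR hl hτ (l' := ⟨.vertical, i, j + 1⟩)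
        (by rw [down_mem_triangles]; simp) (by
          rintro rfl
          have := vertical_diagonal i (j + 1)
          exact h3 (by simpa [dir] using this))
      simp only [dir, gain]
      simp
      omega
    · have z := ind_eq_zero_of_cover hT hτR hl hτ (l' := ⟨.right, i, j⟩)
        (by rw [down_mem_triangles]; simp) (by
          rintro rfl
          have := right_diagonal i j
          exact h3 (by simpa [dir] using this))
      simp only [dir, gain]
      simp
      omega
    · have z := ind_eq_zero_of_cover hT hτR hl hτ (l' := ⟨.left, i + 1, j⟩)
        (by rw [down_mem_triangles]; simp) (by
          rintro rfl
          have := left_diagonal (i + 1) j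
          exact h3 (by simpa [dir] using this.symm))
      simp only [dir, gain]
      simp
      omega
  · have e := hG.ind_up (c := c) hT hτR rfl
    rcases up_edge h1 h2 with ⟨rfl, rfl⟩ | ⟨rfl, rfl⟩ | ⟨rfl, rfl⟩
    · have z := ind_eq_zero_of_cover hT hτR hl hτ (l' := ⟨.vertical, i, j⟩)
        (by rw [up_mem_triangles]; simp) (by
          rintro rfl
          have := vertical_diagonal i j
          exact h3 (by simpa [dir] using this))
      simp only [dir, gain]
      simp
      omega
    · have z := ind_eq_zero_of_cover hT hτR hl hτ (l' := ⟨.right, i, j⟩)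
        (by rw [up_mem_triangles]; simp) (by
          rintro rfl
          have := right_diagonal i j
          exact h3 (by simpa [dir] using this))
      simp only [dir, gain]
      simp
      omega
    · have z := ind_eq_zero_of_cover hT hτR hl hτ (l' := ⟨.left, i, j⟩)
        (by rw [up_mem_triangles]; simp) (by
          rintro rfl
          have := left_diagonal i j
          exact h3 (by simpa [dir] using this.symm))
      simp only [dir, gain]
      simp
      omega

/-- The boundary contour consists of flat edges. -/
lemma flat_contour {P : (ℕ → ℤ → ℤ) × (ℕ → ℤ → ℤ)} (hP : P ∈ Model U D G.tipL G.tipR y)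
    {side : Bool} {u : Vertex} {k : Fin 3} (h : G.IsContourEdge side u k) :
    G.Flat (shift U D G.tipL y) P side u k := by
  have a0 := hG.height
  have a1 := hG.tipR_le
  have a2 := hG.tipR_le'
  have a3 := hG.le_tipL
  have a4 := hG.tips
  have a5 := hG.sw_le
  have hgl := fun i => hG.glue hP (i := i)
  obtain ⟨N, M⟩ := P
  generalize shift U D G.tipL y = c at hgl
  obtain ⟨cN, cM, -, zN, zM⟩ := hG.mem_model_iff.1 hP
  have nU : G.upper.n = G.sw + G.nw - G.axis := rfl
  have nL : G.lower.n = G.axis := rfl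
  cases h with
  | top u hu hH =>
    obtain ⟨i, j⟩ := u
    simp only at hH
    obtain ⟨n, rfl⟩ := exists_upper (G := G) j (by omega)
    unfold Flat
    simp only [dir, gain, Matrix.cons_val_zero, Prod.mk_add_mk, add_zero]
    rw [ht_upper, ht_upper]
    simp only [cN.top n (by omega)]
    simp
  | bottom u hu hH =>
    obtain ⟨i, j⟩ := u
    simp only at hH
    obtain ⟨n, rfl⟩ := exists_lower (G := G) j (by omega)
    unfold Flat
    simp only [dir, gain, Matrix.cons_val_zero, Prod.mk_add_mk, add_zero]
    rw [ht_lower, ht_lower]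
    simp only [cM.top n (by omega)]
    simp
  | slantedAbove u k hk hE h1 h2 =>
    obtain ⟨i, j⟩ := u
    obtain ⟨c1, c2, hE⟩ := hE
    unfold Flat
    fin_cases k
    · exact absurd rfl hk
    · simp [dir, Contains] at hE c1 c2 h1 h2
      obtain ⟨n, rfl⟩ := exists_upper (G := G) j h1
      simp only [dir, gain]
      simp
      rw [ht_upper' c _ (i := i + -1) (k := n + 1) (by push_cast; ring)]
      simp only
      rw [cN.right' (k := n + 1) (by simp only [upper]; unfold neEnd; push_cast; omega),
        cN.right' (k := n) (by simp only [upper]; unfold neEnd; omega)]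
      omega
    · simp [dir, Contains] at hE c1 c2 h1 h2
      obtain ⟨n, hn⟩ := exists_upper (G := G) (j + -1) (by omega)
      simp only [dir, gain]
      simp
      rw [ht_upper' c _ hn, ht_upper' c _ (k := n + 1) (by push_cast; omega)]
      simp only
      rcases hE with hE | hE
      · rw [cN.left' n (i := i) (by simp only [upper]; omega), cN.left' (n + 1) (i := i) (by simp only [upper]; omega)]
      -- Above the axis, the part of the southeast side is the left side of the extra triangle on
      -- the segment from `s` to `neEnd`, so its heights are frozen.
      · have hb : G.upper.block G.s G.neEnd := Or.inr ⟨rfl, rfl⟩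
        rw [cN.block' hb (k := n) (i := i) hE.ge (by unfold neEnd; omega),
          cN.block' hb (k := n + 1) (i := i) hE.ge (by unfold neEnd; push_cast; omega)]
  | slantedBelow u k hk hE h1 h2 =>
    obtain ⟨i, j⟩ := u
    obtain ⟨c1, c2, hE⟩ := hE
    unfold Flat
    fin_cases k
    · exact absurd rfl hk
    · simp [dir, Contains] at hE c1 c2 h1 h2
      obtain ⟨n, hn⟩ := exists_lower (G := G) (j + 1) h2
      simp only [dir, gain]
      simp
      rw [ht_lower' c _ hn (i' := -i + 1) (by ring),
        ht_lower' c _ (k := n + 1) (i := i) (j := j) (i' := -i) (by push_cast; omega) (by ring)]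
      simp only
      rcases hE with hE | hE
      · rw [cM.right' (by simp only [lower]; omega), cM.right' (by simp only [lower]; push_cast; omega)]
        omega
      -- Symmetrically, the part of the northeast side below the axis bounds the extra triangle
      -- between `neEnd` and `s`.
      · have hb : G.lower.block (-(G.s : ℤ)) (-G.neEnd) := Or.inr (Or.inr ⟨rfl, rfl⟩)
        rw [cM.block' hb (k := n) (i := -i + 1) (by omega) (by unfold neEnd; omega),
          cM.block' hb (k := n + 1) (i := -i) (by omega) (by unfold neEnd; push_cast; omega)]
        ring
    · simp [dir, Contains] at hE c1 c2 h1 h2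
      obtain ⟨n, rfl⟩ := exists_lower (G := G) j h1
      simp only [dir, gain]
      simp
      rw [ht_lower' c _ (i := i) (k := n + 1) (i' := -i) (by push_cast; omega) (by ring)]
      simp only
      rcases hE with hE | hE
      · have hb : G.lower.block G.sw G.axis := Or.inr (Or.inl ⟨rfl, rfl⟩)
        rw [cM.block' hb (k := n) (i := -i) (by omega) (by omega),
          cM.block' hb (k := n + 1) (i := -i) (by omega) (by push_cast; omega)]
      · rw [cM.left' n (i := -i) (by simp only [lower]; omega),
          cM.left' (n + 1) (i := -i) (by simp only [lower]; omega)]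
  | lobeAxis l u hl h1 h2 h3 =>
    obtain ⟨i, j⟩ := u
    simp only at h3
    subst h3
    have hr := hG.lobe_range l hl
    unfold Flat
    simp only [dir, gain, Matrix.cons_val_zero, Prod.mk_add_mk, add_zero]
    -- The axis side of a lobe belongs to only one of the disjoint sets `U` and `D`, so the chain on
    -- the side opposite to the lobe has no particle there and is flat.
    cases hu : l.up
    · simp [LobeContains, hu, dir] at h1 h2
      have hD := hG.lobe_down l hl hu i (by omega) (by omega)
      have hU : i ∉ U := fun h => (Finset.disjoint_left.1 hG.disj) h hD
      have := zN i (by omega) hU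
      simp [ht, this]
    · simp [LobeContains, hu, dir] at h1 h2
      have hU := hG.lobe_up l hl hu i (by omega) (by omega)
      have hD : i ∉ D := fun h => (Finset.disjoint_left.1 hG.disj) hU h
      have := zM i (by omega) hD
      simp [ht, this]
      rw [show -1 + -i = -1 - i by ring]
  | lobeRising l u hl h1 h2 h3 =>
    obtain ⟨i, j⟩ := u
    unfold Flat
    simp only at h3
    simp only [dir, gain]
    cases hu : l.up
    · simp [LobeContains, hu, dir] at h1 h2 h3 ⊢
      have hb : G.lower.block (-(l.left + l.size)) (-l.left) := Or.inl ⟨l, hl, hu, rfl, rfl⟩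
      obtain ⟨n, rfl⟩ := exists_lower (G := G) j (by omega)
      rw [ht_lower' c _ (i := i) (k := n + 1) (i' := -i) (by push_cast; omega) (by ring), ht_lower]
      simp only
      rw [cM.block' hb (k := n + 1) (i := -i) (by omega) (by push_cast; omega),
        cM.block' hb (k := n) (i := -i) (by omega) (by omega)]
    · simp [LobeContains, hu, dir] at h1 h2 h3 ⊢
      have hb : G.upper.block l.left (l.left + l.size) := Or.inl ⟨l, hl, hu, rfl, rfl⟩
      obtain ⟨n, hn⟩ := exists_upper (G := G) (j + -1) (by omega)
      rw [ht_upper' c _ hn, ht_upper' c _ (k := n + 1) (by push_cast; omega)]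
      simp only
      rw [cN.block' hb (k := n) (i := i) (by omega) (by omega),
        cN.block' hb (k := n + 1) (i := i) (by omega) (by push_cast; omega)]
  | lobeFalling l u hl h1 h2 h3 =>
    obtain ⟨i, j⟩ := u
    unfold Flat
    simp only at h3
    simp only [dir, gain]
    cases hu : l.up
    · simp [LobeContains, hu, dir] at h1 h2 h3 ⊢
      have hb : G.lower.block (-(l.left + l.size)) (-l.left) := Or.inl ⟨l, hl, hu, rfl, rfl⟩
      obtain ⟨n, hn⟩ := exists_lower (G := G) (j + 1) (by omega)
      rw [ht_lower' c _ hn (i' := -i + 1) (by ring),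
        ht_lower' c _ (i := i) (j := j) (k := n + 1) (i' := -i) (by push_cast; omega) (by ring)]
      simp only
      rw [cM.block' hb (k := n) (i := -i + 1) (by omega) (by omega),
        cM.block' hb (k := n + 1) (i := -i) (by omega) (by push_cast; omega)]
      ring
    · simp [LobeContains, hu, dir] at h1 h2 h3 ⊢
      have hb : G.upper.block l.left (l.left + l.size) := Or.inl ⟨l, hl, hu, rfl, rfl⟩
      obtain ⟨n, rfl⟩ := exists_upper (G := G) j (by omega)
      rw [ht_upper' c _ (k := n + 1) (by push_cast; omega), ht_upper]
      simp only
      rw [cN.block' hb (k := n + 1) (i := i + -1) (by omega) (by push_cast; omega),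
        cN.block' hb (k := n) (i := i) (by omega) (by omega)]
      ring

lemma isSteppedSurface {T : Finset Lozenge} (hT : T ∈ tilings G.region) :
    G.IsSteppedSurface T (G.surface (shift U D G.tipL y) (G.chains T)) := by
  have hP := hG.chains_mem_model hT
  have a0 := hG.height
  refine ⟨?_, fun l hl τ hτ u k h1 h2 h3 => (hG.flat_lozenge hT hl hτ h1 h2 h3).surface,
    fun side u k h => (hG.flat_contour hP h).surface, fun i h1 h2 => ?_⟩
  · obtain ⟨cN, -⟩ := (hG.mem_model_iff (N := (G.chains T).1) (M := (G.chains T).2)).1 hP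
    have e : ((G.sw : ℤ) + G.nw) = G.axis + ((G.sw + G.nw - G.axis : ℕ) : ℤ) := by omega
    unfold surface
    rw [ht_upper' _ _ e, cN.top _ (by simp only [upper]; exact le_rfl)]
    ext k
    fin_cases k <;> simp [cell]
  · unfold surface
    rw [hG.ht_glue hP h1 h2]

end Spec
end IntrudedHexagon
end LozengeTiling

/-! ### Uniqueness of the stepped surface of a tiling -/

namespace LozengeTiling

/-- A function on a half-plane region that is constant along the steps of its boundary and of its
triangles is constant. -/
lemma Strip.path_const {α : Type*} {S : Strip} {mx L : ℤ} {e : ℕ → ℤ → α} (hm : S.Valid)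
    (h1 : ∀ i, S.lo < i → i ≤ mx → i + S.n ≤ S.hi → e S.n i = e S.n (i - 1))
    (h2 : ∀ k < S.n, L ≤ S.lo + k → e k S.lo = e (k + 1) S.lo)
    (h3 : ∀ k i, S.DnIn k i → e k (i + 1) = e (k + 1) i)
    (h4 : ∀ k < S.n, ∀ i, S.lo < i → i ≤ mx → i + k = S.hi → e k i = e (k + 1) (i - 1))
    {k : ℕ} (hk : k ≤ S.n) {i : ℤ} (hi : S.lo ≤ i) (hi' : i ≤ mx) (hk' : i + k ≤ S.hi)
    (hL : L ≤ i + k) (hb : ∀ a b, S.block a b → ¬ (a < i ∧ i + k < b)) : e k i = e S.n S.lo := by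
  -- Walk to the top row along steps `(k, i) → (k + 1, i - 1)`, or straight up when the left side is
  -- reached, and then leftwards along the top to the corner. The diagonal steps keep `i + k` fixed.
  -- This is why the lower bound `L` on `i + k` can guarantee that the left side is only used where
  -- it belongs to the hexagon.
  obtain ⟨m, hm⟩ : ∃ m, m = S.n - k := ⟨_, rfl⟩
  induction m generalizing k i with
  | zero =>
    obtain rfl : k = S.n := by omega
    clear hb hL
    induction i, hi using Int.leInduction with
    | base => rfl
    | succ i hi ih =>
      rw [h1 (i + 1) (by omega) hi' hk', add_sub_cancel_right]
      exact ih (by omega) (by omega)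
  | succ m ih =>
    rcases hi.eq_or_lt with rfl | hlt
    · rw [h2 k (by omega) hL]
      have := ‹S.Valid›.wide
      exact ih (by omega) le_rfl hi' (by push_cast; omega) (by push_cast; omega)
        (fun a b hab hc => by have := ‹S.Valid›.lo_le a b hab; omega) (by omega)
    · have : e k i = e (k + 1) (i - 1) := by
        rcases hk'.eq_or_lt with heq | hlt'
        · exact h4 k (by omega) i hlt hi' heq
        · have := h3 k (i - 1) ⟨by omega, by omega, by omega, fun a b hab hc =>
            hb a b hab (by omega)⟩
          rwa [sub_add_cancel] at this
      rw [this]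
      exact ih (by omega) (by omega) (by omega) (by push_cast; omega) (by push_cast; omega)
        (fun a b hab hc => hb a b hab (by push_cast at hc; omega)) (by omega)

/-- Only one edge of a triangle can be the diagonal of its lozenge; the other two already connect
its vertices. -/
lemma triangle_const {α : Type*} {l : Lozenge} {τ : UnitTriangle} (hτ : τ ∈ l.triangles)
    {f : Vertex → α} (hf : ∀ (u : Vertex) (k : Fin 3), u ∈ τ.vertices → u + dir k ∈ τ.vertices →
      ¬ (u ∈ l.diagonal ∧ u + dir k ∈ l.diagonal) → f (u + dir k) = f u) :
    ∃ x, ∀ u ∈ τ.vertices, f u = x := by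
  obtain ⟨c, i, j⟩ := l
  simp only [Lozenge.triangles, Finset.mem_insert, Finset.mem_singleton] at hτ
  rcases hτ with rfl | rfl
  · have e0 := hf (i, j) 0
    have e1 := hf (i + 1, j) 1
    have e2 := hf (i, j + 1) 2
    simp only [dir, Lozenge.upTriangle, Lozenge.diagonal, Lozenge.downTriangle] at e0 e1 e2
    refine ⟨f (i, j), ?_⟩
    cases c <;> simp [UnitTriangle.vertices, Lozenge.upTriangle] at e0 e1 e2 ⊢ <;> simp_all
  · cases c
    · have e0 := hf (i, j + 1) 0
      have e1 := hf (i + 1, j) 1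
      have e2 := hf (i + 1, j + 1) 2
      simp only [dir, Lozenge.upTriangle, Lozenge.diagonal, Lozenge.downTriangle] at e0 e1 e2
      refine ⟨f (i + 1, j), ?_⟩
      simp [UnitTriangle.vertices, Lozenge.downTriangle] at e0 e1 e2 ⊢; simp_all
    · have e0 := hf (i - 1, j + 1) 0
      have e1 := hf (i, j) 1
      have e2 := hf (i, j + 1) 2
      simp only [dir, Lozenge.upTriangle, Lozenge.diagonal, Lozenge.downTriangle] at e0 e1 e2
      refine ⟨f (i, j), ?_⟩
      simp [UnitTriangle.vertices, Lozenge.downTriangle] at e0 e1 e2 ⊢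
      rw [← sub_eq_add_neg] at e1
      simp_all
    · have e0 := hf (i, j) 0
      have e1 := hf (i + 1, j - 1) 1
      have e2 := hf (i + 1, j) 2
      simp only [dir, Lozenge.upTriangle, Lozenge.diagonal, Lozenge.downTriangle] at e0 e1 e2
      refine ⟨f (i, j), ?_⟩
      simp [UnitTriangle.vertices, Lozenge.downTriangle] at e0 e1 e2 ⊢
      rw [← sub_eq_add_neg] at e2
      simp_all

namespace IntrudedHexagon
variable {G : IntrudedHexagon}
namespace Spec
variable {U D : Finset ℤ} {y : ℕ} (hG : G.Spec U D y)
include hG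

/-- The stepped surface of a tiling is unique at the interior vertices. -/
lemma lift_eq {T : Finset Lozenge} (hT : T ∈ tilings G.region) {σ : Bool → Vertex → Cell}
    (hσ : G.IsSteppedSurface T σ) {v : Vertex} (hv : G.IsInterior v) :
    G.lift σ v =
      G.cell v (G.ht (shift U D G.tipL y) (G.chains T) (decide ((G.axis : ℤ) ≤ v.2)) v) := by
  have hτ := hG.isSteppedSurface hT
  set σ' := G.surface (shift U D G.tipL y) (G.chains T) with hσ'
  -- The difference of two lifts of the same tiling is constant on each triangle and along the
  -- contour. It vanishes at the top left corner, so connectedness makes it vanish at every interior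
  -- vertex. Nothing is claimed about other points, where `σ` may be arbitrary.
  set d : Bool → Vertex → Cell := fun s v => σ s v - σ' s v with hd
  have a0 := hG.height
  have a1 := hG.tipR_le
  have a2 := hG.tipR_le'
  have a3 := hG.le_tipL
  have a4 := hG.tips
  have a5 := hG.sw_le
  have dc : ∀ s u k, G.IsContourEdge s u k → d s (u + dir k) = d s u := by
    intro s u k h
    simp only [hd]
    rw [hσ.contour s u k h, hτ.contour s u k h]
    abel
  have dt : ∀ τ ∈ G.region, ∀ u ∈ τ.vertices, ∀ w ∈ τ.vertices,
      d (G.above τ) u = d (G.above τ) w := by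
    intro τ h u hu w hw
    have hc := (Finset.mem_filter.1 hT).2 τ h
    rw [Finset.card_eq_one] at hc
    obtain ⟨l, hl⟩ := hc
    have hl : l ∈ T.filter fun l => τ ∈ l.triangles := by rw [hl]; simp
    rw [Finset.mem_filter] at hl
    obtain ⟨x, hx⟩ := triangle_const hl.2 (f := d (G.above τ)) (by
      intro u k h1 h2 h3
      simp only [hd]
      rw [hσ.lozenge l hl.1 τ hl.2 u k h1 h2 h3, hτ.lozenge l hl.1 τ hl.2 u k h1 h2 h3]
      abel)
    rw [hx u hu, hx w hw]
  have dn : ∀ (s : Bool) (u w : Vertex) (k : Fin 3), w = u + dir k → G.IsHexagonEdge u k → k ≠ 0 →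
      G.InSide s u → G.InSide s w → d s w = d s u := by
    rintro s u w k rfl h hk h1 h2
    cases s
    · exact dc _ _ _ (.slantedBelow u k hk h (by simpa [InSide] using h1) (by simpa [InSide] using h2))
    · exact dc _ _ _ (.slantedAbove u k hk h (by simpa [InSide] using h1) (by simpa [InSide] using h2))
  have up : ∀ k : ℕ, k ≤ G.upper.n → ∀ i : ℤ, G.upper.lo ≤ i → i ≤ G.s → i + k ≤ G.upper.hi →
      (∀ a b, G.upper.block a b → ¬ (a < i ∧ i + k < b)) → d true (i, G.axis + k) = 0 := by
    intro k hk i h1 h2 h3 h4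
    have := Strip.path_const (e := fun k i => d true (i, (G.axis : ℤ) + k)) (mx := G.s)
      (L := G.upper.lo) hG.upper_valid ?_ ?_ ?_ ?_ hk h1 h2 h3 (by omega) h4
    · rw [this]
      have e : (G.axis : ℤ) + (G.upper.n : ℤ) = G.sw + G.nw := by simp only [upper]; omega
      rw [e, show G.upper.lo = -(G.sw : ℤ) from rfl]
      simp only [hd]
      rw [hσ.topLeft, hτ.topLeft, sub_zero]
    · intro i h1 h2 h3
      simp only [upper] at h1 h3 ⊢
      unfold neEnd at h3
      have := dc true (i - 1, G.axis + ((G.sw + G.nw - G.axis : ℕ) : ℤ)) 0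
        (.top _ ⟨⟨by omega, by omega, by omega, by omega, by omega, by omega⟩, by
          simp only [dir]; simp [Contains]; omega, Or.inl ⟨rfl, Or.inr (by omega)⟩⟩ (by simp only; omega))
      simpa [dir] using this
    · intro k hk _
      simp only [upper] at hk ⊢
      symm
      have := hG.upper_valid.wide
      simp only [upper] at this
      unfold neEnd at this
      refine (dn true (-(G.sw : ℤ), G.axis + ((k + 1 : ℕ) : ℤ)) _ 2 ?_
        ⟨⟨by simp only; omega, by simp only; omega, by simp only; omega, by simp only; omega, by simp only; push_cast; omega, by simp only; push_cast; omega⟩, by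
          simp only [dir]; simp [Contains]; omega, by simp⟩ (by decide) ?_ ?_).symm
      · simp [dir]; ring
      · simp [InSide]; omega
      · simp [InSide]
    · intro k i h
      have hR := hG.dnIn_upper.2 h
      have := dt _ hR (i + 1, G.axis + k) (by simp [UnitTriangle.vertices])
        (i, G.axis + k + 1) (by simp [UnitTriangle.vertices])
      rw [show G.above ⟨false, i, G.axis + k⟩ = true by simp [above]] at this
      rw [this]
      push_cast
      rw [add_assoc]
    · intro k hk i h1 h2 h3
      simp only [upper] at hk h1 h3
      unfold neEnd at h3
      refine (dn true (i, G.axis + k) _ 1 ?_ ⟨⟨by simp only; omega, by simp only; omega, by simp only; omega, by simp only; omega, by simp only; omega, by simp only; omega⟩, by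
          simp only [dir]; simp [Contains]; omega, by simp; omega⟩ (by decide) ?_ ?_).symm
      · simp [dir, ← sub_eq_add_neg, add_assoc]
      · simp [InSide]
      · simp [InSide]; omega
  -- In the rotated lower half the walk ends at the bottom right corner of the hexagon. The
  -- condition `-neEnd ≤ i + k` keeps it on the part of the line `x = s` up to the eastern vertex.
  have lw' : ∀ k : ℕ, k ≤ G.lower.n → ∀ i : ℤ, G.lower.lo ≤ i → i ≤ G.sw → i + k ≤ G.lower.hi →
      -G.neEnd ≤ i + k →
      (∀ a b, G.lower.block a b → ¬ (a < i ∧ i + k < b)) →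
      d false (-i, G.axis - k) = d false (-G.lower.lo, G.axis - G.lower.n) := by
    intro k hk i h1 h2 h3 hL h4
    refine Strip.path_const (e := fun k i => d false (-i, (G.axis : ℤ) - k)) (mx := G.sw)
      hG.lower_valid ?_ ?_ ?_ ?_ hk h1 h2 h3 hL h4
    · intro i h1 h2 h3
      simp only [lower] at h1 h3 ⊢
      have := dc false (-i, 0) 0
        (.bottom _ ⟨⟨by simp only; omega, by simp only; omega, by simp only; omega, by simp only; omega, by simp only; omega, by simp only; omega⟩, by
          simp only [dir]; simp [Contains]; omega, Or.inl ⟨rfl, Or.inl rfl⟩⟩ rfl)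
      simp [dir] at this ⊢
      rw [show (1 : ℤ) - i = -i + 1 by ring]
      exact this.symm
    · intro k hk hL
      simp only [lower] at hk hL ⊢
      unfold neEnd at hL
      have := hG.lower_valid.wide
      simp only [lower] at this
      have := dn false (G.s, G.axis - k) (G.s, G.axis - ((k + 1 : ℕ) : ℤ)) 2
        (by simp [dir]; ring)
        ⟨⟨by simp only; omega, by simp only; omega, by simp only; omega, by simp only; omega,
          by simp only; omega, by simp only; omega⟩, by
          simp only [dir]; simp [Contains]; omega, by simp⟩ (by decide)
        (by simp [InSide]) (by simp [InSide]; omega)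
      rw [neg_neg]
      exact this.symm
    · intro k i h
      have hR := hG.dnIn_lower.2 h
      have := dt _ hR (-i - 1, G.axis - 1 - k + 1) (by simp [UnitTriangle.vertices])
        (-i - 1 + 1, G.axis - 1 - k) (by simp [UnitTriangle.vertices])
      rw [show G.above ⟨true, -i - 1, G.axis - 1 - k⟩ = false by simp [above]; omega] at this
      convert this using 2
      · congr 1 <;> ring
      · push_cast; congr 1 <;> ring
    · intro k hk i h1 h2 h3
      simp only [lower] at hk h1 h3
      refine (dn false (-i + 1, G.axis - ((k + 1 : ℕ) : ℤ)) (-i, G.axis - k) 1 ?_ ⟨⟨by simp only; omega, by simp only; omega, by simp only; omega, by simp only; omega, by simp only; omega, by simp only; omega⟩, by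
          simp only [dir]; simp [Contains]; omega, by simp; omega⟩ (by decide) ?_ ?_).trans ?_
      · simp [dir]; ring
      · simp [InSide]; omega
      · simp [InSide]
      · congr 2; ring
  -- The two halves are linked at the left tip of the free segment: the gluing condition holds
  -- there, and from there one walk leads to the top left corner and another to the bottom right
  -- corner.
  have base : d false (-G.lower.lo, G.axis - G.lower.n) = 0 := by
    have e1 := lw' 0 (Nat.zero_le _) (-G.tipL) (by simp only [lower]; omega) (by omega)
      (by simp only [lower]; omega) (by push_cast; omega) (by
        rintro a b (⟨l, hl, -, rfl, rfl⟩ | ⟨rfl, rfl⟩ | ⟨rfl, rfl⟩) h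
        · have := hG.lobe_range l hl; push_cast at h; omega
        · omega
        · push_cast at h; omega)
    have e2 := up 0 (Nat.zero_le _) G.tipL (by simp only [upper]; omega) (by omega)
      (by simp only [upper]; omega) (by
        rintro a b (⟨l, hl, -, rfl, rfl⟩ | ⟨rfl, rfl⟩) h
        · have := hG.lobe_range l hl; push_cast at h; omega
        · omega)
    rw [← e1, ← e2]
    simp only [hd, neg_neg, Nat.cast_zero, sub_zero, add_zero]
    rw [hσ.glue _ le_rfl (by omega), hτ.glue _ le_rfl (by omega)]
  obtain ⟨i, j⟩ := v
  have hI := isInterior_iff.1 hv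
  suffices d (decide ((G.axis : ℤ) ≤ j)) (i, j) = 0 from sub_eq_zero.1 this
  rcases le_or_gt (G.axis : ℤ) j with hj | hj
  · obtain ⟨k, rfl⟩ := exists_upper j hj
    have h1 := (up_mem_region.1 hI.1).1
    obtain ⟨h2, h3, h4, h5⟩ := hG.upIn_upper.1 hI.1
    rw [decide_eq_true hj]
    exact up k h2.le i h3 (by simp only at h1; omega) (by omega) fun a b hab hc =>
      h5 a b hab (by omega)
  · obtain ⟨k, rfl⟩ := exists_lower j hj.le
    have h0 := hI.2.2.2.2.2
    have h1 := (down_mem_region.1 h0).1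
    have e : (⟨false, - -i - 1, G.axis - 1 - k⟩ : UnitTriangle) ∈ G.region := by
      convert h0 using 2 <;> simp only <;> ring
    obtain ⟨h2, h3, h4, h5⟩ := hG.upIn_lower.1 e
    rw [decide_eq_false hj.not_ge, ← base]
    have h6 := h5 (-(G.s : ℤ)) (-G.neEnd) (Or.inr (Or.inr ⟨rfl, rfl⟩))
    have h7 : G.lower.lo = -(G.s : ℤ) := rfl
    rw [← lw' k h2.le (-i) h3 (by simp only at h1; omega) (by omega) (by omega) fun a b hab hc =>
      h5 a b hab (by omega)]
    rw [neg_neg]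

end Spec
end IntrudedHexagon
end LozengeTiling

namespace LozengeTiling
/-! ### The lowest and the highest surface, the augmented box and monotone stacks -/

/-- The pair of chains of the lowest surface. -/
noncomputable def minPair (U D : Finset ℤ) (a : ℤ) (y : ℕ) : (ℕ → ℤ → ℤ) × (ℕ → ℤ → ℤ) :=
  (low (U ∪ Finset.Ico a (a + y)), high (refl (D ∪ Finset.Ico a (a + y))))

/-- The pair of chains of the highest surface. -/
noncomputable def maxPair (U D : Finset ℤ) (b : ℤ) (y : ℕ) : (ℕ → ℤ → ℤ) × (ℕ → ℤ → ℤ) :=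
  (high (U ∪ Finset.Ico (b - y) b), low (refl (D ∪ Finset.Ico (b - y) b)))

/-- Among the subsets of an interval with a given size, the leftmost block has the largest counts to
the left of every point, hence the lowest row. `below_right_le_below` is the opposite extreme. -/
lemma below_le_below_left {S : Finset ℤ} {a b : ℤ} (hS : S ⊆ Finset.Ico a b) (i : ℤ) :
    below S i ≤ below (Finset.Ico a (a + S.card)) i := by
  rw [below_Ico _ _ _ (by omega)]
  have h1 := below_le_card S i
  have h2 : below S i ≤ max 0 (i - a) := by
    unfold below
    have : S.filter (· < i) ⊆ Finset.Ico a i := fun p hp => by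
      rw [Finset.mem_filter] at hp
      have := Finset.mem_Ico.1 (hS hp.1)
      exact Finset.mem_Ico.2 ⟨this.1, hp.2⟩
    have := Finset.card_le_card this
    rw [Int.card_Ico] at this
    omega
  omega

lemma below_right_le_below {S : Finset ℤ} {a b : ℤ} (hS : S ⊆ Finset.Ico a b) (i : ℤ) :
    below (Finset.Ico (b - S.card) b) i ≤ below S i := by
  rw [below_Ico _ _ _ (by omega)]
  have h1 := below_nonneg S i
  have h2 : (S.card : ℤ) - below S i ≤ max 0 (b - i) := by
    have h3 := Finset.card_filter_add_card_filter_not (s := S) (· < i)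
    have : S.filter (¬ · < i) ⊆ Finset.Ico i b := fun p hp => by
      rw [Finset.mem_filter] at hp
      have := Finset.mem_Ico.1 (hS hp.1)
      exact Finset.mem_Ico.2 ⟨by omega, this.2⟩
    have := Finset.card_le_card this
    rw [Int.card_Ico] at this
    unfold below
    omega
  omega

namespace IntrudedHexagon
variable {G : IntrudedHexagon}

/-- The pair of chains with given heights. -/
def pairOf (G : IntrudedHexagon) (c : ℤ) (h : Bool → Vertex → ℤ) : (ℕ → ℤ → ℤ) × (ℕ → ℤ → ℤ) :=
  (fun k i => h true (i, G.axis + k), fun k i => c - h false (-i, G.axis - k))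

lemma ht_pairOf {c : ℤ} {h : Bool → Vertex → ℤ} {s : Bool} {v : Vertex} (hs : G.InSide s v) :
    G.ht c (G.pairOf c h) s v = h s v := by
  obtain ⟨i, j⟩ := v
  cases s
  · obtain ⟨k, rfl⟩ := exists_lower (G := G) j (by simpa [InSide] using hs)
    simp [pairOf]
  · obtain ⟨k, rfl⟩ := exists_upper (G := G) j (by simpa [InSide] using hs)
    simp [pairOf]

lemma inSide_upper (i : ℤ) (k : ℕ) : G.InSide true (i, G.axis + k) := by simp [InSide]

lemma inSide_lower (i : ℤ) (k : ℕ) : G.InSide false (i, G.axis - k) := by simp [InSide]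

lemma pair_ext {c : ℤ} {P P' : (ℕ → ℤ → ℤ) × (ℕ → ℤ → ℤ)}
    (h : ∀ s v, G.InSide s v → G.ht c P s v = G.ht c P' s v) : P = P' := by
  refine Prod.ext ?_ ?_ <;> funext k i
  · simpa using h true (i, G.axis + k) (inSide_upper i k)
  · simpa using h false (-i, G.axis - k) (inSide_lower _ k)

lemma inSide_decide (v : Vertex) : G.InSide (decide ((G.axis : ℤ) ≤ v.2)) v := by
  unfold InSide
  split_ifs with h
  · simpa using h
  · simp at h; omega

/-- The height of the surface over an interior vertex. -/
def hgt (G : IntrudedHexagon) (c : ℤ) (P : (ℕ → ℤ → ℤ) × (ℕ → ℤ → ℤ)) (v : Vertex) : ℤ :=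
  G.ht c P (decide ((G.axis : ℤ) ≤ v.2)) v

namespace Spec
variable {U D : Finset ℤ} {y : ℕ} (hG : G.Spec U D y)
include hG

lemma minPair_mem : minPair U D G.tipL y ∈ Model U D G.tipL G.tipR y :=
  ⟨_, Finset.Ico_subset_Ico le_rfl hG.tips, by simp, low_mem_Pat _, high_mem_Pat _⟩

lemma maxPair_mem : maxPair U D G.tipR y ∈ Model U D G.tipL G.tipR y :=
  ⟨_, Finset.Ico_subset_Ico (by have := hG.tips; omega) le_rfl, by simp, high_mem_Pat _,
    low_mem_Pat _⟩

/-- Moving `S` to the left lowers the bottom row above the axis and raises the reflected one below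
it. The latter enters the height with a minus sign, so one choice of `S` is extremal in both halves.
Likewise a lowest surface needs `low` above the axis and `high` below it. -/
lemma ht_bounds {c : ℤ} {P : (ℕ → ℤ → ℤ) × (ℕ → ℤ → ℤ)} (hP : P ∈ Model U D G.tipL G.tipR y)
    {s : Bool} {v : Vertex} (hs : G.InSide s v) :
    G.ht c (minPair U D G.tipL y) s v ≤ G.ht c P s v ∧
      G.ht c P s v ≤ G.ht c (maxPair U D G.tipR y) s v := by
  obtain ⟨i, j⟩ := v
  obtain ⟨S, hS, hy, ⟨c1, e1⟩, ⟨c2, e2⟩⟩ := hP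
  have hS0 : Finset.Ico G.tipL (G.tipL + y) ⊆ Finset.Ico G.tipL G.tipR :=
    Finset.Ico_subset_Ico le_rfl hG.tips
  have hS1 : Finset.Ico (G.tipR - y) G.tipR ⊆ Finset.Ico G.tipL G.tipR :=
    Finset.Ico_subset_Ico (by have := hG.tips; omega) le_rfl
  obtain ⟨d1, d2⟩ := hG.free_disjoint hS
  obtain ⟨d3, d4⟩ := hG.free_disjoint hS0
  obtain ⟨d5, d6⟩ := hG.free_disjoint hS1
  have b0 := below_le_below_left hS
  have b1 := below_right_le_below hS
  rw [hy] at b0 b1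
  have n0 := hG.card_union hS hy
  have n1 := hG.card_union hS0 (by simp)
  have n2 := hG.card_union hS1 (by simp)
  have r0 : ∀ i, row (U ∪ Finset.Ico G.tipL (G.tipL + y)) i ≤ row (U ∪ S) i := fun i => by
    unfold row
    rw [below_union d1, below_union d3]
    have := b0 i; omega
  have r1 : ∀ i, row (U ∪ S) i ≤ row (U ∪ Finset.Ico (G.tipR - y) G.tipR) i := fun i => by
    unfold row
    rw [below_union d1, below_union d5]
    have := b1 i; omega
  have cc : (D ∪ S).card = (D ∪ Finset.Ico G.tipL (G.tipL + y)).card ∧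
      (D ∪ S).card = (D ∪ Finset.Ico (G.tipR - y) G.tipR).card := by
    rw [← card_refl (D ∪ S), n0.2, ← card_refl, n1.2, ← card_refl, n2.2]; exact ⟨rfl, rfl⟩
  have r2 : ∀ i, row (refl (D ∪ S)) i ≤ row (refl (D ∪ Finset.Ico G.tipL (G.tipL + y))) i :=
    fun i => by
      unfold row
      rw [below_refl, below_refl, below_union d2, below_union d4, ← cc.1]
      have := b0 (-i); omega
  have r3 : ∀ i, row (refl (D ∪ Finset.Ico (G.tipR - y) G.tipR)) i ≤ row (refl (D ∪ S)) i :=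
    fun i => by
      unfold row
      rw [below_refl, below_refl, below_union d2, below_union d6, ← cc.2]
      have := b1 (-i); omega
  cases s
  · obtain ⟨k, rfl⟩ := exists_lower (G := G) j (by simpa [InSide] using hs)
    simp only [ht_lower, minPair, maxPair]
    have u1 := le_high c2 (A := refl (D ∪ Finset.Ico G.tipL (G.tipL + y)))
      (fun i => by rw [e2]; exact r2 i) k (-i)
    have u2 := low_le c2 (A := refl (D ∪ Finset.Ico (G.tipR - y) G.tipR))
      (by rw [n0.2, n2.2]) (fun i => by rw [e2]; exact r3 i) k (-i)
    omega
  · obtain ⟨k, rfl⟩ := exists_upper (G := G) j (by simpa [InSide] using hs)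
    simp only [ht_upper, minPair, maxPair]
    exact ⟨low_le c1 (by rw [n0.1, n1.1]) (fun i => by rw [e1]; exact r0 i) k i,
      le_high c1 (fun i => by rw [e1]; exact r1 i) k i⟩

lemma ht_step {c : ℤ} {P : (ℕ → ℤ → ℤ) × (ℕ → ℤ → ℤ)} (hP : P ∈ Model U D G.tipL G.tipR y)
    {s : Bool} {u : Vertex} {k : Fin 3} (h : G.InSide s u) (h' : G.InSide s (u + dir k)) :
    G.ht c P s (u + dir k) ≤ G.ht c P s u + gain k := by
  obtain ⟨i, j⟩ := u
  fin_cases k <;> simp [dir, gain] at h' ⊢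
  · exact hG.ht_anti hP h
  · have := hG.ht_diag (c := c) hP (side := s) (i := i - 1) (j := j) (by cases s <;> simpa [InSide] using h)
      (by cases s <;> simpa [InSide] using h')
    rwa [sub_add_cancel] at this
  · have := hG.ht_up (c := c) hP (side := s) (i := i) (j := j + -1) h' (by simpa using h)
    rwa [neg_add_cancel_right] at this

/-- Heights between those of two surfaces that satisfy the local conditions form a surface. -/
lemma pairOf_mem {P P' : (ℕ → ℤ → ℤ) × (ℕ → ℤ → ℤ)} (hP : P ∈ Model U D G.tipL G.tipR y)
    (hP' : P' ∈ Model U D G.tipL G.tipR y) {h : Bool → Vertex → ℤ}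
    (h1 : ∀ s v, G.InSide s v → G.ht (shift U D G.tipL y) P s v ≤ h s v)
    (h2 : ∀ s v, G.InSide s v → h s v ≤ G.ht (shift U D G.tipL y) P' s v)
    (h3 : ∀ s u k, G.InSide s u → G.InSide s (u + dir k) → h s (u + dir k) ≤ h s u + gain k)
    (h4 : ∀ i, G.tipL ≤ i → i ≤ G.tipR → h true (i, G.axis) = h false (i, G.axis)) :
    G.pairOf (shift U D G.tipL y) h ∈ Model U D G.tipL G.tipR y := by
  have a1 := hG.tipR_le
  have a2 := hG.tipR_le'
  have a3 := hG.le_tipL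
  have a5 := hG.sw_le
  set c := shift U D G.tipL y with hc
  obtain ⟨cN, cM, -, zN, zM⟩ := (hG.mem_model_iff (N := P.1) (M := P.2)).1 hP
  obtain ⟨cN', cM', -⟩ := (hG.mem_model_iff (N := P'.1) (M := P'.2)).1 hP'
  have g := fun i => hG.glue hP (i := i)
  set Q := G.pairOf c h with hQ
  have s1 : ∀ k i, P.1 k i ≤ Q.1 k i ∧ Q.1 k i ≤ P'.1 k i := fun k i => by
    have e1 := h1 true (i, G.axis + k) (inSide_upper i k)
    have e2 := h2 true (i, G.axis + k) (inSide_upper i k)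
    rw [ht_upper] at e1 e2
    exact ⟨e1, e2⟩
  have s2 : ∀ k i, P'.2 k i ≤ Q.2 k i ∧ Q.2 k i ≤ P.2 k i := fun k i => by
    have e1 := h1 false (-i, G.axis - k) (inSide_lower _ k)
    have e2 := h2 false (-i, G.axis - k) (inSide_lower _ k)
    rw [ht_lower, neg_neg] at e1 e2
    simp only [hQ, pairOf]
    omega
  -- Points of the axis outside the open free segment are not interior, so the two bounding surfaces
  -- agree there and pin down any heights between them. The block conditions then carry over from
  -- `P`.
  have t1 : ∀ i, ¬ (G.tipL < i ∧ i < G.tipR) → Q.1 0 i = P.1 0 i := fun i hi => by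
    have : G.ht c P true (i, G.axis) = G.ht c P' true (i, G.axis) := by
      by_contra hne
      exact hi (hG.tip_of_interior (hG.interior_of_ne hP hP' (by simp [InSide]) hne))
    have e := s1 0 i
    simp [ht] at this
    omega
  have t2 : ∀ i, ¬ (G.tipL < i ∧ i < G.tipR) → Q.2 0 (-i) = P.2 0 (-i) := fun i hi => by
    have : G.ht c P false (i, G.axis) = G.ht c P' false (i, G.axis) := by
      by_contra hne
      exact hi (hG.tip_of_interior (hG.interior_of_ne hP hP' (by simp [InSide]) hne))
    have e := s2 0 (-i)
    simp [ht] at this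
    omega
  have k1 : Chain G.upper.n Q.1 := by
    refine ⟨fun k i => ?_, fun k i => ?_, fun k i => ?_, fun k hk i => ?_⟩
    · have := h3 true (i, G.axis + k) 0 (by simp [InSide]) (by simp [InSide, dir])
      simpa [dir, gain, hQ, pairOf] using this
    · have := h3 true (i, G.axis + ((k + 1 : ℕ) : ℤ)) 2 (inSide_upper _ _)
        (by simp [InSide, dir])
      simpa [dir, gain, add_assoc, hQ, pairOf] using this
    · have := h3 true (i + 1, G.axis + k) 1 (inSide_upper _ _) (by simp [InSide, dir]; omega)
      simpa [dir, gain, add_assoc, hQ, pairOf] using this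
    · have e := s1 k i
      rw [cN.top k hk, cN'.top k hk] at e
      omega
  have k2 : Chain G.lower.n Q.2 := by
    refine ⟨fun k i => ?_, fun k i => ?_, fun k i => ?_, fun k hk i => ?_⟩
    · have := h3 false (-1 + -i, G.axis - k) 0 (inSide_lower _ _) (by simp [InSide, dir])
      simp [dir, gain] at this
      simp only [hQ, pairOf]
      rw [show -(i + 1) = -1 + -i by ring]
      omega
    · have := h3 false (-i, G.axis - k) 2 (inSide_lower _ _) (by simp [InSide, dir]; omega)
      simp [dir, gain] at this
      simp only [hQ, pairOf]
      rw [show (G.axis : ℤ) - ((k + 1 : ℕ) : ℤ) = G.axis - k + -1 by push_cast; ring]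
      omega
    · have := h3 false (-i, G.axis - ((k + 1 : ℕ) : ℤ)) 1 (inSide_lower _ _)
        (by simp [InSide, dir])
      simp [dir, gain] at this
      simp only [hQ, pairOf]
      rw [show (G.axis : ℤ) - k = G.axis - (k + 1) + 1 by ring, neg_add]
      push_cast
      omega
    · have e := s2 k i
      rw [cM.top k hk, cM'.top k hk] at e
      omega
  refine hG.mem_model_iff.2 ⟨⟨k1, fun i hi => ?_, fun i hi => ?_, fun a b hab hle => ?_⟩,
    ⟨k2, fun i hi => ?_, fun i hi => ?_, fun a b hab hle => ?_⟩, fun p hp1 hp2 => ?_,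
    fun p hp hU => ?_, fun p hp hD => ?_⟩
  · show Q.1 0 i = _
    have e := s1 0 i
    rw [cN.left i hi, cN'.left i hi] at e
    omega
  · show Q.1 0 i = _
    have e := s1 0 i
    rw [cN.right i hi, cN'.right i hi] at e
    omega
  · have := cN.blocks a b hab hle
    have hr : ¬ (G.tipL < a ∧ a < G.tipR) ∧ ¬ (G.tipL < b ∧ b < G.tipR) := by
      rcases hab with ⟨l, hl, -, rfl, rfl⟩ | ⟨rfl, rfl⟩
      · have := hG.lobe_range l hl; omega
      · omega
    show Q.1 0 b = Q.1 0 a - (b - a)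
    rw [t1 _ hr.1, t1 _ hr.2, this]
  · show Q.2 0 i = _
    have e := s2 0 i
    rw [cM.left i hi, cM'.left i hi] at e
    omega
  · show Q.2 0 i = _
    have e := s2 0 i
    rw [cM.right i hi, cM'.right i hi] at e
    omega
  · have := cM.blocks a b hab hle
    have hr : ¬ (G.tipL < -a ∧ -a < G.tipR) ∧ ¬ (G.tipL < -b ∧ -b < G.tipR) := by
      rcases hab with ⟨l, hl, -, rfl, rfl⟩ | ⟨rfl, rfl⟩ | ⟨rfl, rfl⟩
      · have := hG.lobe_range l hl; omega
      · omega
      · omega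
    have u1 := t2 _ hr.1
    have u2 := t2 _ hr.2
    rw [neg_neg] at u1 u2
    show Q.2 0 b = Q.2 0 a - (b - a)
    rw [u1, u2, this]
  · have e1 := h4 p hp1 hp2.le
    have e2 := h4 (p + 1) (by omega) (by omega)
    simp [e1, e2]
  · show Q.1 0 (p + 1) = Q.1 0 p
    rw [t1 _ (by omega), t1 _ (by omega), zN p hp hU]
  · have := zM p hp hD
    have u1 := t2 p (by omega)
    have u2 := t2 (p + 1) (by omega)
    rw [show -(p + 1) = -1 - p by ring] at u2
    show Q.2 0 (-p) = Q.2 0 (-1 - p)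
    rw [u1, u2, this]

/-- The cubes of the augmented box. -/
lemma mem_augmentedBox {s : Bool} {v : Vertex} (hs : G.InSide s v) {n : ℤ} :
    G.cell v n ∈ G.augmentedBox ↔
      G.ht (shift U D G.tipL y) (minPair U D G.tipL y) s v ≤ n ∧
        n < G.ht (shift U D G.tipL y) (maxPair U D G.tipR y) s v := by
  constructor
  · rintro ⟨w, hw, ⟨T, hT, σ, hσ, r, hr, e⟩, ⟨T', hT', σ', hσ', r', hr', e'⟩⟩
    rw [hG.lift_eq hT hσ hw, ← cell_add, cell_inj] at e
    rw [hG.lift_eq hT' hσ' hw, ← cell_add, cell_inj] at e'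
    obtain ⟨rfl, e⟩ := e
    rw [← hG.ht_interior (hG.chains_mem_model hT) hw hs] at e
    rw [← hG.ht_interior (hG.chains_mem_model hT') hw hs] at e'
    have b := hG.ht_bounds (c := shift U D G.tipL y) (hG.chains_mem_model hT) hs
    have b' := hG.ht_bounds (c := shift U D G.tipL y) (hG.chains_mem_model hT') hs
    omega
  · rintro ⟨h1, h2⟩
    -- A cube strictly between the extremal heights forces these to differ, which happens only over
    -- interior vertices. Both extremal surfaces come from tilings, so they witness the two
    -- existential conditions.
    have hv := hG.interior_of_ne hG.minPair_mem hG.maxPair_mem hs (h1.trans_lt h2).ne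
    obtain ⟨T, hT, e⟩ := hG.exists_chains_eq hG.minPair_mem
    obtain ⟨T', hT', e'⟩ := hG.exists_chains_eq hG.maxPair_mem
    refine ⟨v, hv, ⟨T', hT', _, hG.isSteppedSurface hT', G.hgt (shift U D G.tipL y) (G.chains T') v - n, ?_, ?_⟩,
      T, hT, _, hG.isSteppedSurface hT, G.hgt (shift U D G.tipL y) (G.chains T) v - n, ?_, ?_⟩
    · have := hG.ht_interior hG.maxPair_mem hv hs
      unfold hgt
      rw [e']
      omega
    · rw [hG.lift_eq hT' (hG.isSteppedSurface hT') hv, ← cell_add]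
      unfold hgt; congr 1; ring
    · have := hG.ht_interior hG.minPair_mem hv hs
      unfold hgt
      rw [e]
      omega
    · rw [hG.lift_eq hT (hG.isSteppedSurface hT) hv, ← cell_add]
      unfold hgt; congr 1; ring

lemma interior_of_mem {v : Vertex} {n : ℤ} (h : G.cell v n ∈ G.augmentedBox) : G.IsInterior v := by
  obtain ⟨w, hw, ⟨T, hT, σ, hσ, r, hr, e⟩, -⟩ := h
  rw [hG.lift_eq hT hσ hw, ← cell_add, cell_inj] at e
  exact e.1 ▸ hw

lemma augmentedBox_finite : G.augmentedBox.Finite := by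
  refine Set.Finite.subset (Finset.finite_toSet (G.interior.biUnion fun v =>
    (Finset.Ico (G.hgt (shift U D G.tipL y) (minPair U D G.tipL y) v)
      (G.hgt (shift U D G.tipL y) (maxPair U D G.tipR y) v)).image (G.cell v))) ?_
  intro x hx
  obtain ⟨v, n, rfl⟩ := exists_cell (G := G) x
  simp only [Finset.coe_biUnion, Set.mem_iUnion, Finset.mem_coe, Finset.mem_image, Finset.mem_Ico]
  exact ⟨v, mem_interior.2 (hG.interior_of_mem hx), n,
    (hG.mem_augmentedBox (inSide_decide v)).1 hx, rfl⟩

end Spec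
end IntrudedHexagon
end LozengeTiling

/-! ### Monotone stacks as the solids below stepped surfaces -/

namespace LozengeTiling
namespace IntrudedHexagon
variable {G : IntrudedHexagon}

/-- The cubes between two surfaces. -/
noncomputable def stack (G : IntrudedHexagon) (c : ℤ) (P₀ P : (ℕ → ℤ → ℤ) × (ℕ → ℤ → ℤ)) :
    Finset Cell :=
  G.interior.biUnion fun v => (Finset.Ico (G.hgt c P₀ v) (G.hgt c P v)).image (G.cell v)

lemma vol_eq (c : ℤ) (P : (ℕ → ℤ → ℤ) × (ℕ → ℤ → ℤ)) : G.vol c P = ∑ v ∈ G.interior, G.hgt c P v :=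
  rfl

namespace Spec
variable {U D : Finset ℤ} {y : ℕ} (hG : G.Spec U D y)
include hG

lemma mem_stack {P : (ℕ → ℤ → ℤ) × (ℕ → ℤ → ℤ)} (hP : P ∈ Model U D G.tipL G.tipR y)
    {s : Bool} {v : Vertex} (hs : G.InSide s v) {n : ℤ} :
    G.cell v n ∈ G.stack (shift U D G.tipL y) (minPair U D G.tipL y) P ↔
      G.ht (shift U D G.tipL y) (minPair U D G.tipL y) s v ≤ n ∧
        n < G.ht (shift U D G.tipL y) P s v := by
  simp only [stack, Finset.mem_biUnion, Finset.mem_image, Finset.mem_Ico, mem_interior]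
  constructor
  · rintro ⟨w, hw, m, hm, e⟩
    obtain ⟨rfl, rfl⟩ := cell_inj.1 e
    rw [hG.ht_interior hG.minPair_mem hw hs, hG.ht_interior hP hw hs]
    exact hm
  · rintro ⟨h1, h2⟩
    have hv := hG.interior_of_ne hG.minPair_mem hP hs (h1.trans_lt h2).ne
    refine ⟨v, hv, n, ?_, rfl⟩
    rw [hG.ht_interior hG.minPair_mem hv hs] at h1
    rw [hG.ht_interior hP hv hs] at h2
    exact ⟨h1, h2⟩

lemma card_stack {P : (ℕ → ℤ → ℤ) × (ℕ → ℤ → ℤ)} (hP : P ∈ Model U D G.tipL G.tipR y) :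
    ((G.stack (shift U D G.tipL y) (minPair U D G.tipL y) P).card : ℤ) =
      G.vol (shift U D G.tipL y) P - G.vol (shift U D G.tipL y) (minPair U D G.tipL y) := by
  unfold stack
  rw [Finset.card_biUnion, vol_eq, vol_eq, ← Finset.sum_sub_distrib]
  · push_cast
    refine Finset.sum_congr rfl fun v _ => ?_
    rw [Finset.card_image_of_injective _ fun a b h => (cell_inj.1 h).2, Int.card_Ico]
    have := (hG.ht_bounds (c := shift U D G.tipL y) hP (inSide_decide v)).1
    unfold hgt
    omega
  · intro v _ w _ hvw
    rw [Function.onFun, Finset.disjoint_left]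
    intro x hx hx'
    obtain ⟨m, -, rfl⟩ := Finset.mem_image.1 hx
    obtain ⟨m', -, e⟩ := Finset.mem_image.1 hx'
    exact hvw (cell_inj.1 e).1.symm

omit hG in
lemma inSide_common {u : Vertex} {k : Fin 3} : ∃ s, G.InSide s u ∧ G.InSide s (u + dir k) := by
  obtain ⟨i, j⟩ := u
  by_cases h : (G.axis : ℤ) ≤ j ∧ (G.axis : ℤ) ≤ ((i, j) + dir k : Vertex).2
  · exact ⟨true, by simpa [InSide] using h.1, by simpa [InSide] using h.2⟩
  · refine ⟨false, ?_, ?_⟩ <;> fin_cases k <;> simp [dir, InSide] at h ⊢ <;> omega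

omit hG in
lemma cell_sub_step {u : Vertex} {k : Fin 3} {n : ℤ} :
    G.cell (u + dir k) n - step k = G.cell u (n - gain k) := by
  rw [sub_eq_iff_eq_add, ← cell_step, sub_add_cancel]

/-- Along `dir k` the height rises by at most `gain k`. So if a cube over `u + dir k` is below the
surface, the cube one step back over `u` is below it as well. -/
lemma isMonotoneStack_stack {P : (ℕ → ℤ → ℤ) × (ℕ → ℤ → ℤ)}
    (hP : P ∈ Model U D G.tipL G.tipR y) :
    IsMonotoneStack G.augmentedBox (G.stack (shift U D G.tipL y) (minPair U D G.tipL y) P) := by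
  constructor
  · intro x hx
    obtain ⟨v, n, rfl⟩ := exists_cell (G := G) x
    have h := (hG.mem_stack hP (inSide_decide v)).1 hx
    have := (hG.ht_bounds (c := shift U D G.tipL y) hP (inSide_decide v)).2
    exact (hG.mem_augmentedBox (inSide_decide v)).2 ⟨h.1, by omega⟩
  · intro x hx k hxk
    obtain ⟨v, n, rfl⟩ := exists_cell (G := G) x
    obtain ⟨u, rfl⟩ : ∃ u, v = u + dir k := ⟨v - dir k, by simp⟩
    obtain ⟨s, h1, h2⟩ := inSide_common (G := G) (u := u) (k := k)
    rw [cell_sub_step] at hxk ⊢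
    have e1 := (hG.mem_stack hP h2).1 hx
    have e2 := (hG.mem_augmentedBox h1).1 hxk
    have e3 := hG.ht_step (c := shift U D G.tipL y) hP h1 h2
    exact (hG.mem_stack hP h1).2 ⟨e2.1, by omega⟩

/-- The columns of a monotone stack have no gaps. -/
lemma column_closed {π : Finset Cell} (hπ : IsMonotoneStack G.augmentedBox π) {s : Bool} {v : Vertex}
    (hs : G.InSide s v) {n : ℤ} (hn : G.cell v n ∈ π)
    (hmin : G.ht (shift U D G.tipL y) (minPair U D G.tipL y) s v ≤ n - 1) :
    G.cell v (n - 1) ∈ π := by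
  obtain ⟨i, j⟩ := v
  have hI := hG.interior_of_mem (hπ.1 _ hn)
  rw [hG.ht_interior hG.minPair_mem hI hs] at hmin
  -- The path used below passes over `(i - 1, j)` and `(i - 1, j + 1)`, so a side containing both
  -- rows `j` and `j + 1` is chosen.
  have key : ∃ s, G.InSide s (i, j) ∧ G.InSide s (i - 1, j + 1) ∧
      G.ht (shift U D G.tipL y) (minPair U D G.tipL y) s (i, j) ≤ n - 1 := by
    rcases le_or_gt (G.axis : ℤ) j with h | h
    · refine ⟨true, by simpa [InSide] using h, by simp [InSide]; omega, ?_⟩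
      rw [hG.ht_interior hG.minPair_mem hI (by simpa [InSide] using h)]
      exact hmin
    · refine ⟨false, by simpa [InSide] using h.le, by simp [InSide]; omega, ?_⟩
      rw [hG.ht_interior hG.minPair_mem hI (by simpa [InSide] using h.le)]
      exact hmin
  clear hs hmin
  obtain ⟨s, s1, s2, hmin⟩ := key
  have s3 : G.InSide s (i - 1, j) := by cases s <;> simpa [InSide] using s1
  have e1 := (hG.mem_augmentedBox s1).1 (hπ.1 _ hn)
  have d0 : ((i - 1, j) + dir 0 : Vertex) = (i, j) := by simp [dir]
  have d2 : ((i - 1, j + 1) + dir 2 : Vertex) = (i - 1, j) := by simp [dir]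
  have d1 : ((i, j) + dir 1 : Vertex) = (i - 1, j + 1) := by simp [dir, sub_eq_add_neg]
  have step0 := fun {P} (hP : P ∈ Model U D G.tipL G.tipR y) =>
    hG.ht_step (c := shift U D G.tipL y) hP (s := s) (u := (i - 1, j)) (k := 0) s3 (by rwa [d0])
  have step1 := fun {P} (hP : P ∈ Model U D G.tipL G.tipR y) =>
    hG.ht_step (c := shift U D G.tipL y) hP (s := s) (u := (i, j)) (k := 1) s1 (by rwa [d1])
  have step2 := fun {P} (hP : P ∈ Model U D G.tipL G.tipR y) =>
    hG.ht_step (c := shift U D G.tipL y) hP (s := s) (u := (i - 1, j + 1)) (k := 2) s2 (by rwa [d2])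
  rw [d0] at step0
  rw [d1] at step1
  rw [d2] at step2
  rw [show gain 0 = 0 by simp [gain]] at step0
  rw [show gain 1 = 1 by simp [gain]] at step1
  rw [show gain 2 = 0 by simp [gain]] at step2
  have m0 := step0 hG.maxPair_mem
  have m1 := step1 hG.minPair_mem
  have m2 := step2 hG.maxPair_mem
  have m2' := step2 hG.minPair_mem
  -- Descending by `(1, 1, 1)` is done in three unit steps, in directions `0`, `2`, `1`. The height
  -- inequalities for the extremal surfaces keep the two intermediate cubes inside the box, so
  -- monotonicity applies at each step.
  have q1 : G.cell (i - 1, j) n ∈ π := by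
    have := cell_sub_step (G := G) (u := (i - 1, j)) (k := 0) (n := n)
    rw [d0, show n - gain 0 = n by simp [gain]] at this
    rw [← this]
    refine hπ.2 _ hn 0 ?_
    rw [this]
    exact (hG.mem_augmentedBox s3).2 (by omega)
  have q2 : G.cell (i - 1, j + 1) n ∈ π := by
    have := cell_sub_step (G := G) (u := (i - 1, j + 1)) (k := 2) (n := n)
    rw [d2, show n - gain 2 = n by simp [gain]] at this
    rw [← this]
    refine hπ.2 _ q1 2 ?_
    rw [this]
    exact (hG.mem_augmentedBox s2).2 (by omega)
  have := cell_sub_step (G := G) (u := (i, j)) (k := 1) (n := n)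
  rw [d1, show n - gain 1 = n - 1 by simp [gain]] at this
  rw [← this]
  refine hπ.2 _ q2 1 ?_
  rw [this]
  exact (hG.mem_augmentedBox s1).2 (by omega)

/-- Over each vertex take the top of the column of `π`, or the lowest height if the column is empty.
Columns have no gaps, so these heights determine `π`. Closure of `π` under backward steps gives the
local inequalities that make them a surface. -/
lemma exists_stack_eq {π : Finset Cell} (hπ : IsMonotoneStack G.augmentedBox π) :
    ∃ P ∈ Model U D G.tipL G.tipR y,
      G.stack (shift U D G.tipL y) (minPair U D G.tipL y) P = π := by
  have hπI : ∀ v n, G.cell v n ∈ π → ∀ s, G.InSide s v → G.ht (shift U D G.tipL y) (minPair U D G.tipL y) s v ≤ n ∧ n < G.ht (shift U D G.tipL y) (maxPair U D G.tipR y) s v :=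
    fun v n h s hs => (hG.mem_augmentedBox hs).1 (hπ.1 _ h)
  have ex : ∀ s v, G.InSide s v → ∃ m, G.ht (shift U D G.tipL y) (minPair U D G.tipL y) s v ≤ m ∧ m ≤ G.ht (shift U D G.tipL y) (maxPair U D G.tipR y) s v ∧
      ∀ n, G.cell v n ∈ π ↔ G.ht (shift U D G.tipL y) (minPair U D G.tipL y) s v ≤ n ∧ n < m := by
    intro s v hs
    have hle : G.ht (shift U D G.tipL y) (minPair U D G.tipL y) s v ≤ G.ht (shift U D G.tipL y) (maxPair U D G.tipR y) s v := (hG.ht_bounds (c := shift U D G.tipL y) hG.minPair_mem hs).2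
    by_cases hne : ∃ n, G.cell v n ∈ π
    · obtain ⟨n, hn, hmax⟩ : ∃ n, G.cell v n ∈ π ∧ ∀ m, G.cell v m ∈ π → m ≤ n :=
        Int.exists_greatest_of_bdd ⟨G.ht (shift U D G.tipL y) (maxPair U D G.tipR y) s v, fun m hm => (hπI v m hm s hs).2.le⟩ hne
      have hb := hπI v n hn s hs
      refine ⟨n + 1, by omega, by omega, fun m => ⟨fun hm => ⟨(hπI v m hm s hs).1, by
        have := hmax m hm; omega⟩, fun hm12 => ?_⟩⟩
      obtain ⟨hm1, hm2⟩ := hm12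
      obtain ⟨d, rfl⟩ : ∃ d : ℕ, m = n - d := ⟨(n - m).toNat, by omega⟩
      clear hm2
      induction d with
      | zero => simpa using hn
      | succ d ih =>
        have := hG.column_closed hπ hs (ih (by push_cast at hm1; omega)) (by push_cast at hm1; omega)
        convert this using 2
        push_cast; ring
    · push Not at hne
      exact ⟨G.ht (shift U D G.tipL y) (minPair U D G.tipL y) s v, le_rfl, hle, fun n => ⟨fun h => absurd h (hne n), fun h => by omega⟩⟩
  choose! h h1 h2 h3 using ex
  have hmem : G.pairOf (shift U D G.tipL y) h ∈ Model U D G.tipL G.tipR y := by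
    refine hG.pairOf_mem hG.minPair_mem hG.maxPair_mem h1 h2 ?_ ?_
    -- If the height rose by more than `gain k`, some cube of `π` over `u + dir k` would have as
    -- predecessor the first cube above the column over `u`. The bounds by the extremal surfaces
    -- place that cube in the box, so it would lie in `π`.
    · intro s u k hu hu'
      by_contra hlt
      have st := hG.ht_step (c := shift U D G.tipL y) hG.minPair_mem hu hu'
      have st' := hG.ht_step (c := shift U D G.tipL y) hG.maxPair_mem hu hu'
      have b := h1 s u hu
      have b' := h2 s _ hu'
      have q : G.cell (u + dir k) (h s u + gain k) ∈ π := (h3 s _ hu' _).2 ⟨by omega, by omega⟩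
      have q' := hπ.2 _ q k
      rw [cell_sub_step, add_sub_cancel_right] at q'
      have := (h3 s u hu _).1 (q' ((hG.mem_augmentedBox hu).2 ⟨b, by omega⟩))
      omega
    · intro i hi1 hi2
      have t1 : G.InSide true (i, G.axis) := by simp [InSide]
      have t2 : G.InSide false (i, G.axis) := by simp [InSide]
      have e := hG.ht_glue hG.minPair_mem hi1 hi2
      have b1 := h1 _ _ t1
      have b2 := h1 _ _ t2
      by_contra hne
      rcases lt_or_gt_of_ne hne with hlt | hlt
      · have := (h3 _ _ t1 _).1 ((h3 _ _ t2 (h true (i, G.axis))).2 ⟨by omega, hlt⟩)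
        omega
      · have := (h3 _ _ t2 _).1 ((h3 _ _ t1 (h false (i, G.axis))).2 ⟨by omega, hlt⟩)
        omega
  refine ⟨_, hmem, ?_⟩
  ext x
  obtain ⟨v, n, rfl⟩ := exists_cell (G := G) x
  have hs := inSide_decide (G := G) v
  rw [hG.mem_stack hmem hs, ht_pairOf hs, h3 _ _ hs]

lemma stack_injOn : Set.InjOn (G.stack (shift U D G.tipL y) (minPair U D G.tipL y))
    (Model U D G.tipL G.tipR y) := by
  intro P hP P' hP' h
  refine pair_ext (G := G) (c := shift U D G.tipL y) fun s v hs => ?_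
  have key : ∀ {P P'}, P ∈ Model U D G.tipL G.tipR y → P' ∈ Model U D G.tipL G.tipR y →
      G.stack (shift U D G.tipL y) (minPair U D G.tipL y) P =
        G.stack (shift U D G.tipL y) (minPair U D G.tipL y) P' →
      G.ht (shift U D G.tipL y) P s v ≤ G.ht (shift U D G.tipL y) P' s v := by
    intro P P' hP hP' h
    by_contra hlt
    have b := (hG.ht_bounds (c := shift U D G.tipL y) hP' hs).1
    have := (hG.mem_stack hP hs (n := G.ht (shift U D G.tipL y) P' s v)).2 ⟨b, by omega⟩
    rw [h] at this
    have := (hG.mem_stack hP' hs).1 this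
    omega
  exact le_antisymm (key hP hP' h) (key hP' hP h.symm)

/-- The volume generating function of the augmented box as a sum over tilings. -/
lemma volumeGF_eq : volumeGF G.augmentedBox = ∑ T ∈ tilings G.region,
    X ^ (G.vol (shift U D G.tipL y) (G.chains T) -
      G.vol (shift U D G.tipL y) (minPair U D G.tipL y)).toNat := by
  unfold volumeGF
  rw [← finsum_mem_coe_finset]
  symm
  refine finsum_mem_eq_of_bijOn (t := {π | IsMonotoneStack G.augmentedBox π})
    (fun T => G.stack (shift U D G.tipL y) (minPair U D G.tipL y) (G.chains T)) ?_ ?_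
  · refine ⟨fun T hT => hG.isMonotoneStack_stack (hG.chains_mem_model hT), fun T hT T' hT' h => ?_,
      fun π hπ => ?_⟩
    · exact hG.chains_injOn hT hT'
        (hG.stack_injOn (hG.chains_mem_model hT) (hG.chains_mem_model hT') h)
    · obtain ⟨P, hP, rfl⟩ := hG.exists_stack_eq hπ
      obtain ⟨T, hT, rfl⟩ := hG.exists_chains_eq hP
      exact ⟨T, hT, rfl⟩
  · intro T hT
    rw [← hG.card_stack (hG.chains_mem_model hT), Int.toNat_natCast]

end Spec
end IntrudedHexagon
end LozengeTiling

namespace LozengeTiling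
/-! ### Sums over chains and Vandermonde determinants -/

/-- Subtracting from each row the preceding one leaves the determinant unchanged and clears the
constant first column below its first entry. -/
lemma det_vandermonde_diff {R : Type*} [CommRing R] {n : ℕ} (x : Fin (n + 1) → R) :
    (Matrix.of fun i j : Fin n => x i.succ ^ ((j : ℕ) + 1) - x i.castSucc ^ ((j : ℕ) + 1)).det =
      (Matrix.vandermonde x).det := by
  rw [Matrix.det_eq_of_forall_row_eq_smul_add_pred (A := Matrix.vandermonde x)
    (B := Matrix.of (Fin.cons (Matrix.vandermonde x 0) fun i j =>
      Matrix.vandermonde x i.succ j - Matrix.vandermonde x i.castSucc j)) (fun _ => 1)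
    (fun j => rfl) (fun i j => by simp)]
  rw [Matrix.det_succ_column_zero, Fin.sum_univ_succ]
  simp [Matrix.vandermonde_apply]
  rfl

/-- The tuples that interlace with `p`. -/
noncomputable def interlacing {n : ℕ} (p : Fin (n + 1) → ℤ) : Finset (Fin n → ℤ) :=
  Fintype.piFinset fun i : Fin n => Finset.Ico (p i.castSucc) (p i.succ)

lemma mem_interlacing {n : ℕ} {p : Fin (n + 1) → ℤ} {b : Fin n → ℤ} :
    b ∈ interlacing p ↔ ∀ i, p i.castSucc ≤ b i ∧ b i < p i.succ := by
  simp [interlacing]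

lemma strictMono_of_interlacing {n : ℕ} {p : Fin (n + 1) → ℤ} (hp : StrictMono p) {b : Fin n → ℤ}
    (hb : b ∈ interlacing p) : StrictMono b := by
  rw [mem_interlacing] at hb
  intro i j hij
  have h1 := (hb i).2
  have h2 := (hb j).1
  have h3 : p i.succ ≤ p j.castSucc := hp.monotone (by
    rw [Fin.le_def]; simp only [Fin.val_succ, Fin.val_castSucc]; omega)
  omega

lemma sum_Ico_telescope (f : ℤ → ℝ) {a b : ℤ} (h : a ≤ b) :
    ∑ i ∈ Finset.Ico a b, (f (i + 1) - f i) = f b - f a := by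
  induction b, h using Int.leInduction with
  | base => simp
  | succ b hb ih =>
    rw [← Finset.insert_Ico_right_eq_Ico_add_one hb, Finset.sum_insert (by simp), ih]
    ring

/-- By multilinearity of the determinant in its rows, the independent sums over the positions `b i`
move into the rows. There the factor `q ^ (j + 1) - 1` makes the `j`-th entry telescope to a
difference of powers at consecutive positions of `p`, and `det_vandermonde_diff` applies. -/
lemma sum_interlacing {q : ℝ} (hq : q ≠ 0) {n : ℕ} {p : Fin (n + 1) → ℤ} (hp : Monotone p) :
    (∑ b ∈ interlacing p, (∏ i, q ^ b i) * (Matrix.vandermonde fun i => q ^ b i).det) *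
        ∏ j : Fin n, (q ^ ((j : ℕ) + 1) - 1) =
      (Matrix.vandermonde fun i => q ^ p i).det := by
  rw [← det_vandermonde_diff, Finset.sum_mul]
  have h := (Matrix.detRowAlternating (n := Fin n) (R := ℝ)).toMultilinearMap.map_sum_finset
    (fun i b j => (q ^ b) ^ ((j : ℕ) + 1) * (q ^ ((j : ℕ) + 1) - 1))
    (fun i : Fin n => Finset.Ico (p i.castSucc) (p i.succ))
  have e : (fun i : Fin n => ∑ b ∈ Finset.Ico (p i.castSucc) (p i.succ),
      fun j : Fin n => (q ^ b) ^ ((j : ℕ) + 1) * (q ^ ((j : ℕ) + 1) - 1)) =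
      Matrix.of fun i j : Fin n =>
        (q ^ p i.succ) ^ ((j : ℕ) + 1) - (q ^ p i.castSucc) ^ ((j : ℕ) + 1) := by
    funext i j
    rw [Finset.sum_apply, Matrix.of_apply,
      ← sum_Ico_telescope (fun b => (q ^ b) ^ ((j : ℕ) + 1)) (hp (Fin.castSucc_lt_succ).le)]
    refine Finset.sum_congr rfl fun b _ => ?_
    rw [zpow_add_one₀ hq, mul_pow]
    ring
  rw [e] at h
  refine Eq.trans ?_ h.symm
  refine Finset.sum_congr rfl fun b _ => ?_
  show _ = Matrix.det (Matrix.of fun i j : Fin n => (q ^ b i) ^ ((j : ℕ) + 1) * (q ^ ((j : ℕ) + 1) - 1))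
  have : (Matrix.of fun i j : Fin n => (q ^ b i) ^ ((j : ℕ) + 1) * (q ^ ((j : ℕ) + 1) - 1)) =
      Matrix.of fun i j => q ^ b i * (Matrix.of fun i j : Fin n => (q ^ ((j : ℕ) + 1) - 1) *
        Matrix.vandermonde (fun i => q ^ b i) i j) i j := by
    ext i j
    simp [Matrix.vandermonde_apply]
    ring
  rw [this, Matrix.det_mul_column, Matrix.det_mul_row]
  ring

/-- The sum over the triangular arrays of interlacing tuples with bottom row `p`. -/
noncomputable def gtSum (q : ℝ) : (n : ℕ) → (Fin n → ℤ) → ℝ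
  | 0, _ => 1
  | _ + 1, p => ∑ b ∈ interlacing p, (∏ i, q ^ b i) * gtSum q _ b

noncomputable def gtConst (q : ℝ) (n : ℕ) : ℝ :=
  ∏ k ∈ Finset.range n, ∏ j : Fin k, (q ^ ((j : ℕ) + 1) - 1)

/-- The generating function of Gelfand–Tsetlin patterns with a given row is a Vandermonde
determinant divided by a constant depending only on the length: iterate `sum_interlacing` row by
row. -/
lemma gtSum_mul {q : ℝ} (hq : q ≠ 0) {n : ℕ} {p : Fin n → ℤ} (hp : StrictMono p) :
    gtSum q n p * gtConst q n = (Matrix.vandermonde fun i => q ^ p i).det := by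
  induction n with
  | zero => simp [gtSum, gtConst]
  | succ n ih =>
    rw [← sum_interlacing hq hp.monotone, gtConst, Finset.prod_range_succ, ← mul_assoc]
    congr 1
    rw [gtSum, Finset.sum_mul]
    refine Finset.sum_congr rfl fun b hb => ?_
    rw [mul_assoc, ← ih (strictMono_of_interlacing hp hb), gtConst]

lemma gtSum_nonneg {q : ℝ} (hq : 0 < q) {n : ℕ} (p : Fin n → ℤ) : 0 ≤ gtSum q n p := by
  induction n with
  | zero => simp [gtSum]
  | succ n ih =>
    rw [gtSum]
    exact Finset.sum_nonneg fun b _ => mul_nonneg (Finset.prod_nonneg fun i _ => by positivity) (ih b)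

/-- The row of heights of a tuple of particles. -/
def tupleRow {n : ℕ} (p : Fin n → ℤ) (i : ℤ) : ℤ := -((Finset.univ.filter (p · < i)).card : ℤ)

open Classical in
/-- The chains with bottom row `p`. -/
noncomputable def chainsOf : (n : ℕ) → (Fin n → ℤ) → Finset (ℕ → ℤ → ℤ)
  | 0, _ => {fun _ _ => 0}
  | _ + 1, p => (interlacing p).biUnion fun b =>
      (chainsOf _ b).image fun N k => Nat.casesOn k (tupleRow p) N

lemma tupleRow_injective {n : ℕ} {p p' : Fin n → ℤ} (hp : StrictMono p) (hp' : StrictMono p')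
    (h : tupleRow p = tupleRow p') : p = p' := by
  have key : ∀ {p p' : Fin n → ℤ}, StrictMono p → StrictMono p' → tupleRow p = tupleRow p' →
      ∀ m, p m ≤ p' m := by
    intro p p' hp hp' h m
    by_contra hlt
    push Not at hlt
    have h1 := congrFun h (p m)
    unfold tupleRow at h1
    have e1 : (Finset.univ.filter (p · < p m)) = Finset.Iio m := by
      ext k; simp [hp.lt_iff_lt]
    have e2 : Finset.Iic m ⊆ Finset.univ.filter (p' · < p m) := by
      intro k hk
      simp only [Finset.mem_filter, Finset.mem_univ, true_and]
      exact (hp'.monotone (Finset.mem_Iic.1 hk)).trans_lt hlt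
    have := Finset.card_le_card e2
    rw [e1] at h1
    simp at this h1
    omega
  funext m
  exact le_antisymm (key hp hp' h m) (key hp' hp h.symm m)

lemma tupleRow_anti {n : ℕ} (p : Fin n → ℤ) {i j : ℤ} (h : i ≤ j) : tupleRow p j ≤ tupleRow p i := by
  unfold tupleRow
  have : Finset.univ.filter (p · < i) ⊆ Finset.univ.filter (p · < j) := fun k hk => by
    simp only [Finset.mem_filter, Finset.mem_univ, true_and] at hk ⊢; omega
  have := Finset.card_le_card this
  omega

/-- Translates interlacing of positions into the inequalities `up` and `diag` between height
profiles, by counting particles to the left of a point. -/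
lemma mem_interlacing_iff {n : ℕ} {p : Fin (n + 1) → ℤ} (hp : StrictMono p) {b : Fin n → ℤ}
    (hb : StrictMono b) : b ∈ interlacing p ↔
      ∀ i, tupleRow p i ≤ tupleRow b i ∧ tupleRow b i ≤ tupleRow p (i + 1) + 1 := by
  rw [mem_interlacing]
  unfold tupleRow
  constructor
  · intro h i
    have h1 : (Finset.univ.filter (b · < i)).map Fin.castSuccEmb ⊆ Finset.univ.filter (p · < i) := by
      intro k hk
      simp only [Finset.mem_map, Finset.mem_filter, Finset.mem_univ, true_and] at hk ⊢
      obtain ⟨m, hm, rfl⟩ := hk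
      exact (h m).1.trans_lt hm
    have h2 : Finset.univ.filter (p · < i + 1) ⊆
        insert 0 ((Finset.univ.filter (b · < i)).map (Fin.succEmb n)) := by
      intro k hk
      simp only [Finset.mem_filter, Finset.mem_univ, true_and] at hk
      induction k using Fin.cases with
      | zero => simp
      | succ m =>
        refine Finset.mem_insert_of_mem (Finset.mem_map.2 ⟨m, ?_, rfl⟩)
        simp only [Finset.mem_filter, Finset.mem_univ, true_and]
        have := (h m).2; omega
    have h1 := Finset.card_le_card h1
    have h2 := (Finset.card_le_card h2).trans (Finset.card_insert_le _ _)
    rw [Finset.card_map] at h1 h2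
    omega
  · intro h i
    have e1 : (Finset.univ.filter (b · < b i)) = Finset.Iio i := by
      ext k; simp [hb.lt_iff_lt]
    have e2 : (Finset.univ.filter (b · < b i + 1)) = Finset.Iic i := by
      ext k; simp [hb.le_iff_le]
    constructor
    · by_contra hlt
      push Not at hlt
      have h1 := (h (b i + 1)).1
      have h2 : Finset.univ.filter (p · < b i + 1) ⊆ Finset.Iio i.castSucc := by
        intro k hk
        simp only [Finset.mem_filter, Finset.mem_univ, true_and] at hk
        exact Finset.mem_Iio.2 (hp.lt_iff_lt.1 (by omega))
      have h2 := Finset.card_le_card h2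
      rw [e2] at h1
      simp at h1 h2
      omega
    · by_contra hlt
      push Not at hlt
      have h1 := (h (b i)).2
      have h2 : Finset.Iic i.succ ⊆ Finset.univ.filter (p · < b i + 1) := by
        intro k hk
        simp only [Finset.mem_filter, Finset.mem_univ, true_and]
        have := hp.monotone (Finset.mem_Iic.1 hk)
        omega
      have h2 := Finset.card_le_card h2
      rw [e1] at h1
      simp at h1 h2
      omega

lemma tupleRow_orderEmb (A : Finset ℤ) {n : ℕ} (h : A.card = n) :
    tupleRow (A.orderEmbOfFin h) = row A := by
  funext i
  unfold tupleRow row below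
  congr 2
  rw [← Finset.card_map (A.orderEmbOfFin h).toEmbedding]
  congr 1
  ext p
  simp only [Finset.mem_map, Finset.mem_filter, Finset.mem_univ, true_and]
  constructor
  · rintro ⟨m, hm, rfl⟩
    exact ⟨Finset.orderEmbOfFin_mem A h m, hm⟩
  · rintro ⟨hp, hi⟩
    obtain ⟨m, rfl⟩ : p ∈ Set.range (A.orderEmbOfFin h) := by
      rw [Finset.range_orderEmbOfFin]; exact hp
    exact ⟨m, hi, rfl⟩

/-- For the converse direction, row `1` of a chain is again the profile of a set of `n` particles by
`exists_row`. This set interlaces with `p`, and the remaining rows form a shorter chain. -/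
lemma mem_chainsOf {n : ℕ} {p : Fin n → ℤ} (hp : StrictMono p) {N : ℕ → ℤ → ℤ} :
    N ∈ chainsOf n p ↔ Chain n N ∧ N 0 = tupleRow p := by
  induction n generalizing N with
  | zero =>
    simp only [chainsOf, Finset.mem_singleton]
    constructor
    · rintro rfl
      refine ⟨⟨fun _ _ => le_rfl, fun _ _ => le_rfl, fun _ _ => by simp, fun _ _ _ => rfl⟩, ?_⟩
      funext i
      simp [tupleRow]
    · rintro ⟨h, -⟩
      funext k i
      exact h.top k (Nat.zero_le k) i
  | succ n ih =>
    simp only [chainsOf, Finset.mem_biUnion, Finset.mem_image]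
    constructor
    · rintro ⟨b, hb, N', hN', rfl⟩
      have hbm := strictMono_of_interlacing hp hb
      obtain ⟨hc, h0⟩ := (ih hbm).1 hN'
      have hi := (mem_interlacing_iff hp hbm).1 hb
      rw [← h0] at hi
      refine ⟨⟨fun k i => ?_, fun k i => ?_, fun k i => ?_, fun k hk i => ?_⟩, rfl⟩
      · cases k with
        | zero => exact tupleRow_anti p (by omega)
        | succ k => exact hc.anti k i
      · cases k with
        | zero => exact (hi i).1
        | succ k => exact hc.up k i
      · cases k with
        | zero => exact (hi i).2
        | succ k => exact hc.diag k i
      · cases k with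
        | zero => omega
        | succ k => exact hc.top k (by omega) i
    · rintro ⟨hc, h0⟩
      have e0 : tupleRow p = row (Finset.univ.image p) := by
        have hcard : (Finset.univ.image p).card = n + 1 := by
          rw [Finset.card_image_of_injective _ hp.injective]; simp
        rw [← tupleRow_orderEmb _ hcard]
        congr 1
        exact Finset.orderEmbOfFin_unique hcard (fun x => by simp) hp
      have hc' : Chain n fun k => N (k + 1) :=
        ⟨fun k i => hc.anti _ i, fun k i => hc.up _ i, fun k i => hc.diag _ i,
          fun k hk i => hc.top _ (by omega) i⟩
      obtain ⟨B, -, hB, hr⟩ := exists_row (r := N 1) (lo := p 0) (hi := p (Fin.last n)) (n := n)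
        (fun i => hc.anti 1 i) (fun i => hc.slope 1 i) (fun i hi => by
          refine hc.eq_zero_of_left ?_ 1
          rw [h0, e0]
          unfold row
          rw [below_eq_zero, neg_zero]
          intro x hx
          obtain ⟨m, -, rfl⟩ := Finset.mem_image.1 hx
          exact hi.trans (hp.monotone (Fin.zero_le m))) (fun i hi => by
          rw [hc.eq_of_right (k := 1) (i := i)]
          · simp
          · rw [h0, e0]
            unfold row
            rw [below_eq_card, Finset.card_image_of_injective _ hp.injective]
            · simp
            · intro x hx
              obtain ⟨m, -, rfl⟩ := Finset.mem_image.1 hx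
              have := hp.monotone (Fin.le_last m)
              push_cast
              omega)
      have hbm : StrictMono (B.orderEmbOfFin hB) := (B.orderEmbOfFin hB).strictMono
      refine ⟨B.orderEmbOfFin hB, (mem_interlacing_iff hp hbm).2 fun i => ?_,
        fun k => N (k + 1), (ih hbm).2 ⟨hc', ?_⟩, ?_⟩
      · rw [tupleRow_orderEmb, hr, ← h0]
        exact ⟨hc.up 0 i, hc.diag 0 i⟩
      · rw [tupleRow_orderEmb, hr]
      · funext k
        cases k with
        | zero => exact h0.symm
        | succ k => rfl

/-- Each particle lowers the height by one at all points of the window to its right. The volume is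
therefore linear in the positions, which is what turns volume weights into products of powers `q ^ b
i`. -/
lemma sum_tupleRow {n : ℕ} {b : Fin n → ℤ} {lo hi : ℤ} (h : ∀ m, lo ≤ b m ∧ b m ≤ hi) :
    ∑ i ∈ Finset.Ioc lo hi, tupleRow b i = ∑ m, (b m - hi) := by
  have e : ∀ i, tupleRow b i = ∑ m, if b m < i then (-1 : ℤ) else 0 := by
    intro i
    unfold tupleRow
    rw [Finset.sum_ite]
    simp
  simp only [e]
  rw [Finset.sum_comm]
  refine Finset.sum_congr rfl fun m _ => ?_
  rw [← Finset.sum_filter]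
  have : (Finset.Ioc lo hi).filter (b m < ·) = Finset.Ioc (b m) hi := by
    ext i; have := h m; simp only [Finset.mem_filter, Finset.mem_Ioc]; omega
  rw [this]
  simp
  have := h m
  omega

lemma zpow_sum {ι : Type*} {q : ℝ} (hq : q ≠ 0) (s : Finset ι) (f : ι → ℤ) :
    q ^ (∑ i ∈ s, f i) = ∏ i ∈ s, q ^ f i := by
  classical
  induction s using Finset.induction_on with
  | empty => simp
  | insert a s ha ih => rw [Finset.sum_insert ha, Finset.prod_insert ha, zpow_add₀ hq, ih]

-- The bottom row is left out of the volume here; the remaining rows have `n - 1, …, 0` particles.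
-- Each of these particles contributes its position minus `hi`, whence the prefactor.
open Classical in
lemma sum_chainsOf {q : ℝ} (hq : q ≠ 0) {n : ℕ} {p : Fin n → ℤ} (hp : StrictMono p) {lo hi : ℤ}
    (h : ∀ m, lo ≤ p m ∧ p m ≤ hi) :
    ∑ N ∈ chainsOf n p, q ^ (∑ k ∈ Finset.range n, ∑ i ∈ Finset.Ioc lo hi, N (k + 1) i) =
      q ^ (-(hi * ∑ k ∈ Finset.range n, (k : ℤ))) * gtSum q n p := by
  induction n with
  | zero => simp [chainsOf, gtSum]
  | succ n ih =>
    rw [chainsOf, gtSum, Finset.sum_biUnion, Finset.mul_sum]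
    · refine Finset.sum_congr rfl fun b hb => ?_
      have hbm := strictMono_of_interlacing hp hb
      have hbr : ∀ m, lo ≤ b m ∧ b m ≤ hi := fun m => by
        have h1 := mem_interlacing.1 hb m
        have h2 := h m.castSucc
        have h3 := h m.succ
        omega
      rw [Finset.sum_image]
      · have e : ∀ N ∈ chainsOf n b, q ^ (∑ k ∈ Finset.range (n + 1), ∑ i ∈ Finset.Ioc lo hi,
            (Nat.casesOn (k + 1) (tupleRow p) N : ℤ → ℤ) i) = q ^ (∑ m, (b m - hi)) *
            q ^ (∑ k ∈ Finset.range n, ∑ i ∈ Finset.Ioc lo hi, N (k + 1) i) := by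
          intro N hN
          rw [← zpow_add₀ hq, Finset.sum_range_succ', add_comm, ← sum_tupleRow hbr,
            ← ((mem_chainsOf hbm).1 hN).2]
        rw [Finset.sum_congr rfl e, ← Finset.mul_sum, ih hbm hbr, ← mul_assoc, ← mul_assoc]
        congr 1
        rw [← zpow_add₀ hq, ← zpow_sum hq, ← zpow_add₀ hq]
        congr 1
        rw [Finset.sum_sub_distrib, Finset.sum_range_succ]
        simp
        ring
      · intro N _ N' _ he
        funext k
        exact congrFun he (k + 1)
    · intro b hb b' hb' hne
      rw [Function.onFun, Finset.disjoint_left]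
      intro N hN hN'
      obtain ⟨M, hM, rfl⟩ := Finset.mem_image.1 hN
      obtain ⟨M', hM', he⟩ := Finset.mem_image.1 hN'
      have hb1 := strictMono_of_interlacing hp hb
      have hb2 := strictMono_of_interlacing hp hb'
      have := congrFun he 1
      change M' 0 = M 0 at this
      rw [((mem_chainsOf hb1).1 hM).2, ((mem_chainsOf hb2).1 hM').2] at this
      exact hne (tupleRow_injective hb1 hb2 this.symm)

/-- The product of the distances between the elements of `f '' A`. -/
noncomputable def vdm (f : ℤ → ℝ) (A : Finset ℤ) : ℝ :=
  ∏ p ∈ A, ∏ r ∈ A with p < r, |f r - f p|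

lemma abs_det_vandermonde (f : ℤ → ℝ) {A : Finset ℤ} {n : ℕ} (h : A.card = n) :
    |(Matrix.vandermonde fun i => f (A.orderEmbOfFin h i)).det| = vdm f A := by
  have hm := Finset.map_orderEmbOfFin_univ A h
  generalize A.orderEmbOfFin h = e at hm
  subst hm
  rw [Matrix.det_vandermonde, Finset.abs_prod]
  unfold vdm
  rw [Finset.prod_map]
  refine Finset.prod_congr rfl fun i _ => ?_
  rw [Finset.abs_prod, Finset.filter_map, Finset.prod_map]
  refine Finset.prod_congr ?_ fun j _ => rfl
  ext j
  simp

/-- The chains with bottom row `A`. -/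
noncomputable def patFinset (A : Finset ℤ) : Finset (ℕ → ℤ → ℤ) :=
  chainsOf A.card (A.orderEmbOfFin rfl)

lemma mem_patFinset {A : Finset ℤ} {N : ℕ → ℤ → ℤ} : N ∈ patFinset A ↔ N ∈ Pat A := by
  unfold patFinset
  rw [mem_chainsOf (A.orderEmbOfFin rfl).strictMono, tupleRow_orderEmb]
  rfl

/-- Absolute values make the product independent of orientation. They cost nothing, as the sum on
the left is non-negative for `q > 0`. -/
lemma sum_patFinset {q : ℝ} (hq : 0 < q) {A : Finset ℤ} {n : ℕ} (hn : A.card = n) {lo hi : ℤ}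
    (h : A ⊆ Finset.Icc lo hi) :
    (∑ N ∈ patFinset A, q ^ (∑ k ∈ Finset.range n, ∑ i ∈ Finset.Ioc lo hi, N (k + 1) i)) *
        |gtConst q n| =
      q ^ (-(hi * ∑ k ∈ Finset.range n, (k : ℤ))) * vdm (fun p => q ^ p) A := by
  subst hn
  unfold patFinset
  rw [sum_chainsOf hq.ne' (A.orderEmbOfFin rfl).strictMono
    (fun m => Finset.mem_Icc.1 (h (Finset.orderEmbOfFin_mem A rfl m))), mul_assoc]
  congr 1
  rw [← abs_det_vandermonde _ rfl, ← gtSum_mul hq.ne' (A.orderEmbOfFin rfl).strictMono, abs_mul,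
    abs_of_nonneg (gtSum_nonneg hq _)]

end LozengeTiling

/-! ### Vandermonde products of sets and palindromic functions -/

namespace LozengeTiling

/-- The product of the distances between the elements of `f '' A` and those of `f '' B`. -/
noncomputable def cross (f : ℤ → ℝ) (A B : Finset ℤ) : ℝ := ∏ a ∈ A, ∏ b ∈ B, |f a - f b|

lemma cross_comm (f : ℤ → ℝ) (A B : Finset ℤ) : cross f A B = cross f B A := by
  unfold cross
  rw [Finset.prod_comm]
  simp only [abs_sub_comm]

lemma cross_union (f : ℤ → ℝ) (S : Finset ℤ) {A B : Finset ℤ} (h : Disjoint A B) :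
    cross f S (A ∪ B) = cross f S A * cross f S B := by
  unfold cross
  rw [← Finset.prod_mul_distrib]
  exact Finset.prod_congr rfl fun a _ => Finset.prod_union h

lemma vdm_union (f : ℤ → ℝ) {A B : Finset ℤ} (h : Disjoint A B) :
    vdm f (A ∪ B) = vdm f A * vdm f B * cross f A B := by
  have hc : cross f A B = (∏ p ∈ A, ∏ r ∈ B with p < r, |f r - f p|) *
      ∏ p ∈ B, ∏ r ∈ A with p < r, |f r - f p| := by
    have : (∏ p ∈ B, ∏ r ∈ A with p < r, |f r - f p|) =
        ∏ r ∈ A, ∏ p ∈ B with ¬ r < p, |f r - f p| := by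
      refine Finset.prod_comm' fun p r => ?_
      simp only [Finset.mem_filter]
      constructor
      · rintro ⟨h1, h2, h3⟩; exact ⟨⟨h1, by omega⟩, h2⟩
      · rintro ⟨⟨h1, h3⟩, h2⟩
        have : r ≠ p := fun e => Finset.disjoint_left.1 h h2 (e ▸ h1)
        exact ⟨h1, h2, by omega⟩
    rw [this, ← Finset.prod_mul_distrib]
    refine Finset.prod_congr rfl fun p _ => ?_
    rw [← Finset.prod_filter_mul_prod_filter_not B (p < ·)]
    congr 1
    exact Finset.prod_congr rfl fun r _ => abs_sub_comm _ _
  have hs : ∀ p, ∏ r ∈ A ∪ B with p < r, |f r - f p| =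
      (∏ r ∈ A with p < r, |f r - f p|) * ∏ r ∈ B with p < r, |f r - f p| := by
    intro p
    rw [Finset.filter_union, Finset.prod_union (Finset.disjoint_filter_filter h)]
  rw [hc]
  unfold vdm
  rw [Finset.prod_union h]
  simp only [hs, Finset.prod_mul_distrib]
  ring

/-- The number of pairs of an `n`-element set. -/
def pairs (n : ℕ) : ℕ := ∑ i : Fin n, (Finset.Ioi i).card

lemma vdm_mul (f : ℤ → ℝ) {x : ℝ} (hx : 0 < x) (A : Finset ℤ) :
    vdm (fun p => x * f p) A = x ^ pairs A.card * vdm f A := by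
  rw [← abs_det_vandermonde _ rfl, ← abs_det_vandermonde _ rfl, Matrix.det_vandermonde,
    Matrix.det_vandermonde, ← abs_of_pos (pow_pos hx _), ← abs_mul]
  congr 1
  unfold pairs
  rw [← Finset.prod_pow_eq_pow_sum, ← Finset.prod_mul_distrib]
  refine Finset.prod_congr rfl fun i _ => ?_
  rw [Finset.prod_congr rfl fun j _ => (mul_sub x _ _).symm, Finset.prod_mul_distrib,
    Finset.prod_const]

lemma vdm_refl (f : ℤ → ℝ) (A : Finset ℤ) : vdm f (refl A) = vdm (fun p => f (-1 - p)) A := by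
  unfold vdm refl
  have hinj : Function.Injective fun p : ℤ => -1 - p := fun a b h => by simpa using h
  rw [Finset.prod_image hinj.injOn]
  simp only [Finset.filter_image]
  simp only [Finset.prod_image hinj.injOn]
  rw [Finset.prod_comm' (t' := A) (s' := fun r => A.filter (r < ·))]
  · exact Finset.prod_congr rfl fun p _ => Finset.prod_congr rfl fun r _ => abs_sub_comm _ _
  · intro p r
    simp only [Finset.mem_filter]
    constructor
    · rintro ⟨h1, h2, h3⟩; exact ⟨⟨h1, by omega⟩, h2⟩
    · rintro ⟨⟨h1, h3⟩, h2⟩; exact ⟨h1, h2, by omega⟩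

lemma vdm_translate (f : ℤ → ℝ) (A : Finset ℤ) (d : ℤ) :
    vdm f (A.image (· + d)) = vdm (fun p => f (p + d)) A := by
  unfold vdm
  have hinj : Function.Injective fun p : ℤ => p + d := fun a b h => by simpa using h
  rw [Finset.prod_image hinj.injOn]
  simp only [Finset.filter_image]
  simp only [Finset.prod_image hinj.injOn, add_lt_add_iff_right]

lemma zpow_injective {q : ℝ} (hq : 0 < q) (h1 : q ≠ 1) : Function.Injective fun p : ℤ => q ^ p :=
  zpow_right_injective₀ hq h1

lemma vdm_ne_zero {q : ℝ} (hq : 0 < q) (h1 : q ≠ 1) (A : Finset ℤ) : vdm (fun p => q ^ p) A ≠ 0 := by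
  unfold vdm
  refine Finset.prod_ne_zero_iff.2 fun p _ => Finset.prod_ne_zero_iff.2 fun r hr => ?_
  rw [abs_ne_zero, sub_ne_zero]
  exact fun h => (Finset.mem_filter.1 hr).2.ne (zpow_injective hq h1 h).symm

/-- The sum over the positions of `y` particles in `[a, b)`, for fixed particles at `B`. -/
noncomputable def freeSum (a b : ℤ) (y : ℕ) (B : Finset ℤ) (q : ℝ) : ℝ :=
  ∑ S ∈ (Finset.Ico a b).powersetCard y,
    q ^ (∑ p ∈ S, p) * vdm (fun p => q ^ p) S ^ 2 * cross (fun p => q ^ p) S B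

/-- A translation by `d` multiplies every term by the same power of `q`, because all the sets `S`
have `y` elements. -/
lemma freeSum_translate (a b : ℤ) (y : ℕ) (B : Finset ℤ) (d : ℤ) :
    ∃ e : ℤ, ∀ q : ℝ, 0 < q →
      freeSum (a + d) (b + d) y (B.image (· + d)) q = q ^ e * freeSum a b y B q := by
  refine ⟨d * y + d * (pairs y * 2 : ℕ) + d * (B.card * y : ℕ), fun q hq => ?_⟩
  have hinj : Function.Injective fun p : ℤ => p + d := fun a b h => by simpa using h
  have hI : Finset.Ico (a + d) (b + d) = (Finset.Ico a b).map ⟨_, hinj⟩ := by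
    ext p
    simp only [Finset.mem_Ico, Finset.mem_map, Function.Embedding.coeFn_mk]
    constructor
    · intro h; exact ⟨p - d, by omega, by ring⟩
    · rintro ⟨r, hr, rfl⟩; omega
  unfold freeSum
  rw [hI, Finset.powersetCard_map, Finset.sum_map, Finset.mul_sum]
  refine Finset.sum_congr rfl fun S hS => ?_
  have hy := (Finset.mem_powersetCard.1 hS).2
  simp only [Finset.mapEmbedding_apply, RelEmbedding.coe_toEmbedding, Finset.map_eq_image,
    Function.Embedding.coeFn_mk]
  rw [vdm_translate, Finset.sum_image hinj.injOn, Finset.sum_add_distrib, Finset.sum_const, hy]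
  have e1 : (fun p : ℤ => q ^ (p + d)) = fun p => q ^ d * q ^ p := by
    funext p; rw [zpow_add₀ hq.ne', mul_comm]
  have hd : 0 < q ^ d := zpow_pos hq d
  have e2 : cross (fun p => q ^ p) (S.image (· + d)) (B.image (· + d)) =
      (q ^ d) ^ (B.card * y) * cross (fun p => q ^ p) S B := by
    unfold cross
    rw [Finset.prod_image hinj.injOn]
    simp only [Finset.prod_image hinj.injOn]
    rw [pow_mul, ← hy, ← Finset.prod_const, ← Finset.prod_mul_distrib]
    refine Finset.prod_congr rfl fun s _ => ?_
    rw [← Finset.prod_const, ← Finset.prod_mul_distrib]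
    refine Finset.prod_congr rfl fun t _ => ?_
    rw [zpow_add₀ hq.ne', zpow_add₀ hq.ne', ← sub_mul, abs_mul, abs_of_pos hd, mul_comm]
  rw [e1, vdm_mul _ hd, hy, e2, mul_pow, ← pow_mul]
  rw [zpow_add₀ hq.ne', zpow_add₀ hq.ne', zpow_add₀ hq.ne', zpow_mul, zpow_mul, zpow_mul,
    zpow_natCast, zpow_natCast, zpow_natCast, nsmul_eq_mul, mul_comm (y : ℤ) d, zpow_mul,
    zpow_natCast]
  ring

/-- A function is palindromic if inverting the argument multiplies it by a power of the argument. -/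
def Palindromic (f : ℝ → ℝ) : Prop := ∃ k : ℤ, ∀ q, 0 < q → q ≠ 1 → f q⁻¹ = q ^ k * f q

namespace Palindromic
variable {f g : ℝ → ℝ}

lemma mul (hf : Palindromic f) (hg : Palindromic g) : Palindromic fun q => f q * g q := by
  obtain ⟨k, hk⟩ := hf
  obtain ⟨l, hl⟩ := hg
  refine ⟨k + l, fun q hq h1 => ?_⟩
  simp only
  rw [hk q hq h1, hl q hq h1, zpow_add₀ hq.ne']
  ring

lemma zpow (e : ℤ) : Palindromic fun q => q ^ e :=
  ⟨-e - e, fun q hq _ => by simp only; rw [← zpow_add₀ hq.ne', inv_zpow', sub_add_cancel]⟩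

/-- Palindromic factors may be cancelled. The point `q = 1` is excluded throughout because the
Vandermonde factors may vanish there. -/
lemma of_mul (hg : Palindromic g) (h0 : ∀ q, 0 < q → q ≠ 1 → g q ≠ 0)
    (h : Palindromic fun q => f q * g q) : Palindromic f := by
  obtain ⟨k, hk⟩ := h
  obtain ⟨l, hl⟩ := hg
  refine ⟨k - l, fun q hq h1 => ?_⟩
  have e := hk q hq h1
  simp only at e
  rw [hl q hq h1] at e
  have h2 := h0 q hq h1
  have h3 : q ^ l ≠ 0 := (zpow_pos hq l).ne'
  rw [zpow_sub₀ hq.ne']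
  field_simp
  field_simp at e
  linarith

lemma prod {ι : Type*} (s : Finset ι) {f : ι → ℝ → ℝ} (h : ∀ i ∈ s, Palindromic (f i)) :
    Palindromic fun q => ∏ i ∈ s, f i q := by
  classical
  induction s using Finset.induction_on with
  | empty => exact ⟨0, by simp⟩
  | insert a s ha ih =>
    simp only [Finset.prod_insert ha]
    exact (h a (Finset.mem_insert_self a s)).mul (ih fun i hi => h i (Finset.mem_insert_of_mem hi))

lemma congr (hf : Palindromic f) (h : ∀ q, 0 < q → q ≠ 1 → f q = g q) : Palindromic g := by
  obtain ⟨k, hk⟩ := hf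
  refine ⟨k, fun q hq h1 => ?_⟩
  rw [← h q hq h1, ← h _ (inv_pos.2 hq) (by simpa using h1), hk q hq h1]

lemma inv (hf : Palindromic f) : Palindromic fun q => f q⁻¹ := by
  obtain ⟨k, hk⟩ := hf
  refine ⟨-k, fun q hq h1 => ?_⟩
  have := hk q⁻¹ (inv_pos.2 hq) (by simpa using h1)
  simp only
  rw [this, inv_zpow']

end Palindromic

/-- The distance of `q⁻¹ ^ a` and `q⁻¹ ^ b` is `q ^ (-a - b)` times that of `q ^ a` and `q ^ b`. All
products of such distances are therefore palindromic. -/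
lemma palindromic_dist (a b : ℤ) : Palindromic fun q => |q ^ a - q ^ b| := by
  refine ⟨-a - b, fun q hq _ => ?_⟩
  simp only
  rw [← abs_of_pos (zpow_pos hq (-a - b)), ← abs_mul, mul_sub, ← zpow_add₀ hq.ne',
    ← zpow_add₀ hq.ne', abs_sub_comm, inv_zpow', inv_zpow']
  congr 3 <;> ring

lemma palindromic_vdm (A : Finset ℤ) : Palindromic fun q => vdm (fun p => q ^ p) A :=
  Palindromic.prod _ fun _ _ => Palindromic.prod _ fun _ _ => palindromic_dist _ _

lemma palindromic_gtConst (n : ℕ) : Palindromic fun q => |gtConst q n| := by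
  have : ∀ q, |gtConst q n| = ∏ k ∈ Finset.range n, ∏ j : Fin k, |q ^ (((j : ℕ) + 1 : ℕ) : ℤ) - q ^ (0 : ℤ)| := by
    intro q
    unfold gtConst
    rw [Finset.abs_prod]
    refine Finset.prod_congr rfl fun k _ => ?_
    rw [Finset.abs_prod]
    refine Finset.prod_congr rfl fun k _ => ?_
    rw [zpow_natCast, zpow_zero]
  simp only [this]
  exact Palindromic.prod _ fun _ _ => Palindromic.prod _ fun _ _ => palindromic_dist _ _

lemma gtConst_ne_zero {q : ℝ} (hq : 0 < q) (h1 : q ≠ 1) (n : ℕ) : gtConst q n ≠ 0 := by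
  unfold gtConst
  refine Finset.prod_ne_zero_iff.2 fun k _ => Finset.prod_ne_zero_iff.2 fun j _ => ?_
  rw [sub_ne_zero]
  exact fun h => h1 (pow_eq_one_iff_of_nonneg hq.le (by omega) |>.1 h)

lemma sum_row {A : Finset ℤ} {lo hi : ℤ} (h : A ⊆ Finset.Icc lo hi) :
    ∑ i ∈ Finset.Ioc lo hi, row A i = ∑ p ∈ A, (p - hi) := by
  rw [← tupleRow_orderEmb A rfl,
    sum_tupleRow fun m => Finset.mem_Icc.1 (h (Finset.orderEmbOfFin_mem A rfl m))]
  conv_rhs => rw [← Finset.map_orderEmbOfFin_univ A rfl]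
  rw [Finset.sum_map]
  rfl

end LozengeTiling

/-! ### Factorisation of the volume generating function -/

namespace LozengeTiling
namespace IntrudedHexagon
variable {G : IntrudedHexagon}

open Classical in
/-- The pairs of chains of the tilings, as a finite set. -/
noncomputable def modelFinset (U D : Finset ℤ) (a b : ℤ) (y : ℕ) :
    Finset ((ℕ → ℤ → ℤ) × (ℕ → ℤ → ℤ)) :=
  ((Finset.Ico a b).powersetCard y).biUnion fun S => patFinset (U ∪ S) ×ˢ patFinset (refl (D ∪ S))

lemma mem_modelFinset {U D : Finset ℤ} {a b : ℤ} {y : ℕ} {P : (ℕ → ℤ → ℤ) × (ℕ → ℤ → ℤ)} :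
    P ∈ modelFinset U D a b y ↔ P ∈ Model U D a b y := by
  simp only [modelFinset, Model, Finset.mem_biUnion, Finset.mem_powersetCard, Finset.mem_product,
    mem_patFinset, Set.mem_ofPred_eq, and_assoc]

/-- The sum of the heights in a window, up to a constant the volume below a surface. -/
noncomputable def windowVol (n m : ℕ) (L : ℤ) (P : (ℕ → ℤ → ℤ) × (ℕ → ℤ → ℤ)) : ℤ :=
  ∑ i ∈ Finset.Ioc (-L - 1) L, P.1 0 i +
    ∑ k ∈ Finset.range n, ∑ i ∈ Finset.Ioc (-L - 1) L, P.1 (k + 1) i -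
    ∑ k ∈ Finset.range m, ∑ i ∈ Finset.Ioc (-L - 1) L, P.2 (k + 1) i

lemma sum_Icc_axis (f : ℤ → ℤ) (m n : ℕ) : ∑ j ∈ Finset.Icc 0 ((m : ℤ) + n), f j =
    f m + ∑ k ∈ Finset.range n, f (m + (k + 1 : ℕ)) + ∑ k ∈ Finset.range m, f (m - (k + 1 : ℕ)) := by
  induction n with
  | zero =>
    induction m with
    | zero => simp
    | succ m ih =>
      have e : Finset.Icc 0 (((m + 1 : ℕ) : ℤ) + (0 : ℕ)) = insert ((m + 1 : ℕ) : ℤ) (Finset.Icc 0 ((m : ℤ) + (0 : ℕ))) := by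
        ext x; simp only [Finset.mem_Icc, Finset.mem_insert]; push_cast; omega
      rw [e, Finset.sum_insert (by simp), ih, Finset.sum_range_succ']
      simp only [Finset.sum_range_zero, add_zero]
      push_cast
      have : ∀ k : ℕ, (m : ℤ) + 1 - (k + 1 + 1) = m - (k + 1) := fun k => by ring
      simp only [this, add_sub_cancel_right]
      ring
  | succ n ih =>
    have e : Finset.Icc 0 ((m : ℤ) + (n + 1 : ℕ)) = insert ((m : ℤ) + (n + 1 : ℕ)) (Finset.Icc 0 ((m : ℤ) + n)) := by
      ext x; simp only [Finset.mem_Icc, Finset.mem_insert]; push_cast; omega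
    rw [e, Finset.sum_insert (by simp), ih, Finset.sum_range_succ]
    ring

lemma sum_Ioc_neg (f : ℤ → ℤ) (L : ℤ) :
    ∑ i ∈ Finset.Ioc (-L - 1) L, f (-i) = ∑ i ∈ Finset.Ioc (-L - 1) L, f i := by
  refine Finset.sum_nbij' (fun i => -i) (fun i => -i) ?_ ?_ ?_ ?_ ?_ <;> intro i <;>
    simp only [Finset.mem_Ioc] <;> intros <;> first | omega | simp

namespace Spec
variable {U D : Finset ℤ} {y : ℕ} (hG : G.Spec U D y)
include hG

lemma sum_tilings_eq (g : (ℕ → ℤ → ℤ) × (ℕ → ℤ → ℤ) → ℝ) :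
    ∑ T ∈ tilings G.region, g (G.chains T) =
      ∑ S ∈ (Finset.Ico G.tipL G.tipR).powersetCard y,
        ∑ N ∈ patFinset (U ∪ S), ∑ M ∈ patFinset (refl (D ∪ S)), g (N, M) := by
  classical
  have h1 : ∑ T ∈ tilings G.region, g (G.chains T) =
      ∑ P ∈ modelFinset U D G.tipL G.tipR y, g P := by
    refine Finset.sum_nbij G.chains (fun T hT => mem_modelFinset.2 (hG.chains_mem_model hT))
      hG.chains_injOn (fun P hP => ?_) fun _ _ => rfl
    obtain ⟨T, hT, rfl⟩ := hG.exists_chains_eq (mem_modelFinset.1 hP)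
    exact ⟨T, hT, rfl⟩
  rw [h1, modelFinset, Finset.sum_biUnion]
  · simp only [Finset.sum_product]
  · intro S hS S' hS' hne
    rw [Function.onFun, Finset.disjoint_left]
    intro P hP hP'
    simp only [Finset.mem_product, mem_patFinset] at hP hP'
    have e : U ∪ S = U ∪ S' := row_injective (hP.1.2.symm.trans hP'.1.2)
    have d := (hG.free_disjoint (Finset.mem_powersetCard.1 hS).1).1
    have d' := (hG.free_disjoint (Finset.mem_powersetCard.1 hS').1).1
    refine hne ?_
    rw [← Finset.union_sdiff_cancel_left d, e, Finset.union_sdiff_cancel_left d']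

omit hG in
lemma interior_bound {v : Vertex} (hv : G.IsInterior v) :
    0 ≤ v.2 ∧ v.2 ≤ G.sw + G.nw ∧ -(G.sw : ℤ) ≤ v.1 ∧ v.1 ≤ G.s := by
  have h1 := (up_mem_region.1 (isInterior_iff.1 hv).1).1
  omega

/-- Two surfaces differ only at interior vertices, so the difference of volumes may be summed over a
rectangle containing the hexagon, where it splits into complete rows. The window is symmetric about
`0` so that it also serves the rotated rows below the axis. -/
lemma vol_sub {P P' : (ℕ → ℤ → ℤ) × (ℕ → ℤ → ℤ)} (hP : P ∈ Model U D G.tipL G.tipR y)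
    (hP' : P' ∈ Model U D G.tipL G.tipR y) {L : ℤ} (h1 : (G.sw : ℤ) ≤ L) (h2 : (G.s : ℤ) ≤ L) :
    G.vol (shift U D G.tipL y) P - G.vol (shift U D G.tipL y) P' =
      windowVol G.upper.n G.lower.n L P - windowVol G.upper.n G.lower.n L P' := by
  classical
  set c := shift U D G.tipL y with hc
  have a0 := hG.height
  set f : Vertex → ℤ := fun v => G.hgt c P v - G.hgt c P' v with hf
  have hf0 : ∀ v, v ∉ G.interior → f v = 0 := fun v hv => by
    by_contra hne
    exact hv (mem_interior.2 (hG.interior_of_ne hP hP' (inSide_decide v) fun h => hne (by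
      simp only [hf, hgt]; rw [h, sub_self])))
  have hd : ∀ side v, G.InSide side v → f v = G.ht c P side v - G.ht c P' side v := by
    intro side v hs
    by_cases hv : G.IsInterior v
    · simp only [hf, hgt]
      rw [hG.ht_interior hP hv hs, hG.ht_interior hP' hv hs]
    · rw [hf0 v (by rwa [mem_interior])]
      by_contra hne
      exact hv (hG.interior_of_ne hP hP' hs fun h => hne (by rw [h, sub_self]))
  have e1 : G.vol c P - G.vol c P' = ∑ v ∈ G.interior, f v := by
    rw [vol_eq, vol_eq, ← Finset.sum_sub_distrib]
  have e2 : ∑ v ∈ G.interior, f v = ∑ v ∈ Finset.Ioc (-L - 1) L ×ˢ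
      Finset.Icc 0 ((G.lower.n : ℤ) + G.upper.n), f v := by
    refine Finset.sum_subset (fun v hv => ?_) fun v _ hv => hf0 v hv
    have := interior_bound (mem_interior.1 hv)
    simp only [Finset.mem_product, Finset.mem_Ioc, Finset.mem_Icc, lower, upper]
    omega
  rw [e1, e2, Finset.sum_product_right, sum_Icc_axis]
  have r1 : ∀ k : ℕ, ∑ i ∈ Finset.Ioc (-L - 1) L, f (i, (G.lower.n : ℤ) + k) =
      ∑ i ∈ Finset.Ioc (-L - 1) L, P.1 k i - ∑ i ∈ Finset.Ioc (-L - 1) L, P'.1 k i := by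
    intro k
    rw [← Finset.sum_sub_distrib]
    refine Finset.sum_congr rfl fun i _ => ?_
    rw [show (G.lower.n : ℤ) = G.axis from rfl, hd true _ (inSide_upper i k), ht_upper, ht_upper]
  have r2 : ∀ k : ℕ, ∑ i ∈ Finset.Ioc (-L - 1) L, f (i, (G.lower.n : ℤ) - k) =
      ∑ i ∈ Finset.Ioc (-L - 1) L, P'.2 k i - ∑ i ∈ Finset.Ioc (-L - 1) L, P.2 k i := by
    intro k
    rw [← sum_Ioc_neg, ← Finset.sum_sub_distrib]
    refine Finset.sum_congr rfl fun i _ => ?_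
    rw [show (G.lower.n : ℤ) = G.axis from rfl, hd false _ (inSide_lower _ k), ht_lower, ht_lower,
      neg_neg]
    ring
  have r0 := r1 0
  simp only [Nat.cast_zero, add_zero] at r0
  rw [r0]
  simp only [r1, r2, windowVol, Finset.sum_sub_distrib]
  ring

/-- The generating function of the tilings by volume. -/
lemma sum_vol : ∃ e : ℤ, ∀ q : ℝ, 0 < q →
    (∑ T ∈ tilings G.region, q ^ G.vol (shift U D G.tipL y) (G.chains T)) *
        (|gtConst q G.upper.n| * |gtConst q⁻¹ G.lower.n|) =
      q ^ e * (vdm (fun p => q ^ p) U * vdm (fun p => q ^ p) D *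
        freeSum G.tipL G.tipR y (U ∪ D) q) := by
  have a1 := hG.tipR_le
  have a2 := hG.tipR_le'
  have a3 := hG.le_tipL
  have a4 := hG.tips
  have a5 := hG.sw_le
  set n := G.upper.n with hn
  set m := G.lower.n with hm
  set c := shift U D G.tipL y with hc
  obtain ⟨L, hL⟩ : ∃ L : ℤ, L = G.axis + G.sw + G.s + G.se + 1 := ⟨_, rfl⟩
  set P₀ := minPair U D G.tipL y with hP₀
  set σ : ℕ → ℤ := fun n => -(L * ∑ k ∈ Finset.range n, (k : ℤ)) with hσ
  refine ⟨G.vol c P₀ - windowVol n m L P₀ + (∑ p ∈ U, p - n * L) + σ n - σ m + pairs m, fun q hq => ?_⟩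
  have key : ∀ T ∈ tilings G.region, q ^ G.vol c (G.chains T) =
      q ^ (G.vol c P₀ - windowVol n m L P₀) * q ^ windowVol n m L (G.chains T) := by
    intro T hT
    have := hG.vol_sub (hG.chains_mem_model hT) hG.minPair_mem (L := L) (by omega) (by omega)
    rw [← zpow_add₀ hq.ne']
    congr 1
    linarith
  rw [Finset.sum_congr rfl key, ← Finset.mul_sum, hG.sum_tilings_eq fun P => q ^ windowVol n m L P]
  -- For fixed `S` the chains above and below the axis are independent and contribute the
  -- Vandermonde products of `U ∪ S` and `D ∪ S`. Splitting these leaves the square of that of `S`,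
  -- while the cross factors with `U` and `D` merge into one with `U ∪ D`. The bottom row supplies
  -- the power of `q` in the positions of `S`.
  have term : ∀ S ∈ (Finset.Ico G.tipL G.tipR).powersetCard y,
      (∑ N ∈ patFinset (U ∪ S), ∑ M ∈ patFinset (refl (D ∪ S)), q ^ windowVol n m L (N, M)) *
        (|gtConst q n| * |gtConst q⁻¹ m|) =
      q ^ ((∑ p ∈ U, p - n * L) + σ n - σ m + pairs m) *
        (vdm (fun p => q ^ p) U * vdm (fun p => q ^ p) D * (q ^ (∑ p ∈ S, p) *
          vdm (fun p => q ^ p) S ^ 2 * cross (fun p => q ^ p) S (U ∪ D))) := by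
    intro S hS
    obtain ⟨hS, hy⟩ := Finset.mem_powersetCard.1 hS
    obtain ⟨d1, d2⟩ := hG.free_disjoint hS
    obtain ⟨n1, n2⟩ := hG.card_union hS hy
    have w1 : U ∪ S ⊆ Finset.Icc (-L - 1) L := by
      intro p hp
      rw [Finset.mem_Icc]
      rcases Finset.mem_union.1 hp with h | h
      · have := hG.U_range p h; unfold neEnd at this; omega
      · have := Finset.mem_Ico.1 (hS h); omega
    have w2 : refl (D ∪ S) ⊆ Finset.Icc (-L - 1) L := by
      intro p hp
      rw [mem_refl] at hp
      rw [Finset.mem_Icc]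
      rcases Finset.mem_union.1 hp with h | h
      · have := hG.D_range _ h; omega
      · have := Finset.mem_Ico.1 (hS h); omega
    have g1 := sum_patFinset hq n1 w1
    have g2 := sum_patFinset (inv_pos.2 hq) n2 w2
    have e1 : ∀ N ∈ patFinset (U ∪ S), ∀ M ∈ patFinset (refl (D ∪ S)),
        q ^ windowVol n m L (N, M) = q ^ (∑ p ∈ U, p + ∑ p ∈ S, p - n * L) *
          (q ^ (∑ k ∈ Finset.range n, ∑ i ∈ Finset.Ioc (-L - 1) L, N (k + 1) i) *
          q⁻¹ ^ (∑ k ∈ Finset.range m, ∑ i ∈ Finset.Ioc (-L - 1) L, M (k + 1) i)) := by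
      intro N hN M hM
      have h0 : ∑ i ∈ Finset.Ioc (-L - 1) L, N 0 i = ∑ p ∈ U, p + ∑ p ∈ S, p - n * L := by
        rw [(mem_patFinset.1 hN).2, sum_row w1, Finset.sum_sub_distrib, Finset.sum_union d1,
          Finset.sum_const, n1, nsmul_eq_mul]
      rw [inv_zpow', ← zpow_add₀ hq.ne', ← zpow_add₀ hq.ne']
      congr 1
      simp only [windowVol]
      rw [h0]
      ring
    rw [Finset.sum_congr rfl fun N hN => Finset.sum_congr rfl fun M hM => e1 N hN M hM]
    simp only [← Finset.mul_sum]
    rw [← Finset.sum_mul]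
    -- The lower chains enter the volume with a minus sign, hence with `q⁻¹`. Inverting `q` and
    -- reflecting the set cancel up to a power of `q`.
    have e2 : vdm (fun p => q⁻¹ ^ p) (refl (D ∪ S)) = q ^ (pairs m : ℤ) * vdm (fun p => q ^ p) (D ∪ S) := by
      rw [vdm_refl]
      have : (fun p : ℤ => q⁻¹ ^ (-1 - p)) = fun p => q * q ^ p := by
        funext p
        rw [inv_zpow', ← zpow_one_add₀ hq.ne']
        congr 1; ring
      rw [this, vdm_mul _ hq, zpow_natCast, ← card_refl, n2]
    have hdisj := hG.disj
    calc _ = q ^ (∑ p ∈ U, p + ∑ p ∈ S, p - n * L) *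
          ((∑ N ∈ patFinset (U ∪ S), q ^ (∑ k ∈ Finset.range n, ∑ i ∈ Finset.Ioc (-L - 1) L, N (k + 1) i)) *
            |gtConst q n|) *
          ((∑ M ∈ patFinset (refl (D ∪ S)), q⁻¹ ^ (∑ k ∈ Finset.range m, ∑ i ∈ Finset.Ioc (-L - 1) L, M (k + 1) i)) *
            |gtConst q⁻¹ m|) := by ring
      _ = _ := by
        have x1 : q ^ (∑ p ∈ U, p + ∑ p ∈ S, p - n * L : ℤ) =
            q ^ (∑ p ∈ U, p - n * L) * q ^ (∑ p ∈ S, p) := by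
          rw [← zpow_add₀ hq.ne']; congr 1; ring
        have x2 : q ^ ((∑ p ∈ U, p - n * L) + σ n - σ m + pairs m) =
            q ^ (∑ p ∈ U, p - n * L) * q ^ σ n * q ^ (-σ m) * q ^ (pairs m : ℤ) := by
          rw [← zpow_add₀ hq.ne', ← zpow_add₀ hq.ne', ← zpow_add₀ hq.ne']; congr 1
        rw [g1, g2, e2, x1, x2, vdm_union _ d1, vdm_union _ d2, cross_union _ _ hdisj,
          cross_comm _ U S, cross_comm _ D S, inv_zpow']
        ring
  rw [mul_assoc, Finset.sum_mul, Finset.sum_congr rfl term, freeSum, ← Finset.mul_sum, ← Finset.mul_sum]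
  rw [← mul_assoc, ← zpow_add₀ hq.ne']
  congr 2
  ring

/-- The generating function of the tilings is palindromic if and only if that of the positions of
the lozenges on the axis is. -/
lemma palindromic_iff :
    (Palindromic fun q => ∑ T ∈ tilings G.region, q ^ G.vol (shift U D G.tipL y) (G.chains T)) ↔
      Palindromic (freeSum G.tipL G.tipR y (U ∪ D)) := by
  obtain ⟨e, he⟩ := hG.sum_vol
  have c1 : Palindromic fun q => |gtConst q G.upper.n| * |gtConst q⁻¹ G.lower.n| :=
    (palindromic_gtConst _).mul (palindromic_gtConst G.lower.n).inv
  have c2 : Palindromic fun q => q ^ e * (vdm (fun p => q ^ p) U * vdm (fun p => q ^ p) D) :=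
    (Palindromic.zpow e).mul ((palindromic_vdm U).mul (palindromic_vdm D))
  constructor
  · intro h
    refine Palindromic.of_mul c2 (fun q hq h1 => mul_ne_zero (zpow_pos hq e).ne'
      (mul_ne_zero (vdm_ne_zero hq h1 U) (vdm_ne_zero hq h1 D))) ((h.mul c1).congr fun q hq h1 => ?_)
    rw [he q hq]
    ring
  · intro h
    refine Palindromic.of_mul c1 (fun q hq h1 => mul_ne_zero (abs_ne_zero.2 (gtConst_ne_zero hq h1 _))
      (abs_ne_zero.2 (gtConst_ne_zero (inv_pos.2 hq) (by simpa using h1) _)))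
      ((h.mul c2).congr fun q hq h1 => ?_)
    rw [he q hq]
    ring

end Spec
end IntrudedHexagon
end LozengeTiling

namespace LozengeTiling
/-! ### The weights of the extremal tilings -/

/-- The number of elements of `A` to the left of `p`. -/
def lowCard (A : Finset ℤ) (p : ℤ) : ℕ := (A.filter (· < p)).card

/-- The number of elements of `A` to the right of `p`. -/
def highCard (A : Finset ℤ) (p : ℤ) : ℕ := (A.filter (p < ·)).card

lemma below_eq_lowCard (A : Finset ℤ) (p : ℤ) : below A p = lowCard A p := rfl

lemma lowCard_add_highCard {A : Finset ℤ} {p : ℤ} (hp : p ∉ A) :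
    lowCard A p + highCard A p = A.card := by
  unfold lowCard highCard
  rw [← Finset.card_filter_add_card_filter_not (s := A) (· < p)]
  congr 2
  refine Finset.filter_congr fun r hr => ?_
  have : r ≠ p := fun e => hp (e ▸ hr)
  omega

lemma bracket_eq (c d : ℕ) : (bracket (c + d) c : ℤ) = ∑ k ∈ Finset.range d, ((c : ℤ) + k + 1) := by
  induction d with
  | zero => simp [bracket]
  | succ d ih =>
    rw [Finset.sum_range_succ, ← ih]
    unfold bracket
    rw [← add_assoc, Finset.sum_Ioc_succ_top (by omega)]
    push_cast
    ring

lemma sum_bracket_zero {c m : ℕ} (h : c ≤ m) :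
    ∑ k ∈ Finset.range m, (if c ≤ k then ((m : ℤ) - k) else 0) = bracket (m - c) 0 := by
  have := bracket_eq 0 (m - c)
  rw [zero_add] at this
  rw [this, ← Finset.sum_filter]
  refine Finset.sum_bij' (fun k _ => m - 1 - k) (fun k _ => m - 1 - k) ?_ ?_ ?_ ?_ ?_ <;> intro k hk <;>
    simp only [Finset.mem_filter, Finset.mem_range] at * <;> omega

lemma sum_bracket {c a n : ℕ} (h : c ≤ n) :
    ∑ k ∈ Finset.range n, (if k < c then ((a : ℤ) + k + 1) else 0) = bracket (a + c) a := by
  rw [bracket_eq, ← Finset.sum_filter]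
  refine Finset.sum_congr ?_ fun _ _ => rfl
  ext k
  simp only [Finset.mem_filter, Finset.mem_range]
  omega

section counts
variable {B : Finset ℤ} {lo hi : ℤ} (hB : B ⊆ Finset.Ico lo hi)
include hB

lemma below_le_sub {x : ℤ} (hx : lo ≤ x) : below B x ≤ x - lo := by
  have : B.filter (· < x) ⊆ Finset.Ico lo x := fun p hp => by
    rw [Finset.mem_filter] at hp
    have := Finset.mem_Ico.1 (hB hp.1)
    exact Finset.mem_Ico.2 ⟨this.1, hp.2⟩
  have := Finset.card_le_card this
  rw [Int.card_Ico] at this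
  unfold below
  omega

lemma card_sub_below_le {x : ℤ} (hx : x ≤ hi) : (B.card : ℤ) - below B x ≤ hi - x := by
  have h3 := Finset.card_filter_add_card_filter_not (s := B) (· < x)
  have : B.filter (¬ · < x) ⊆ Finset.Ico x hi := fun p hp => by
    rw [Finset.mem_filter] at hp
    have := Finset.mem_Ico.1 (hB hp.1)
    exact Finset.mem_Ico.2 ⟨by omega, this.2⟩
  have := Finset.card_le_card this
  rw [Int.card_Ico] at this
  unfold below
  omega

lemma below_lo : below B lo = 0 := below_eq_zero fun _ hp => (Finset.mem_Ico.1 (hB hp)).1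

lemma below_hi {x : ℤ} (hx : hi ≤ x) : below B x = B.card :=
  below_eq_card fun _ hp => (Finset.mem_Ico.1 (hB hp)).2.trans_le hx

/-- The points with at most `k` particles to their left form an interval from `lo` to the `(k +
1)`-st particle inclusive, which holds exactly `k + 1` particles. Dropping its first `k + 1` points
or dropping its particles leaves equally many. -/
lemma count_left (hle : lo ≤ hi) {k : ℕ} (hk : k < B.card) :
    ∑ p ∈ Finset.Ico lo hi, (if lo + k + 1 ≤ p ∧ below B p ≤ k then (1 : ℤ) else 0) =
      ∑ p ∈ Finset.Ico lo hi, (if p ∉ B ∧ below B p ≤ k then (1 : ℤ) else 0) := by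
  have key : ∀ x, lo ≤ x →
      (below B x ≤ k → (∑ p ∈ Finset.Ico lo x, (if lo + k + 1 ≤ p ∧ below B p ≤ k then (1 : ℤ) else 0)) =
        max 0 (x - lo - k - 1) ∧
        (∑ p ∈ Finset.Ico lo x, (if p ∉ B ∧ below B p ≤ k then (1 : ℤ) else 0)) = x - lo - below B x) ∧
      (k < below B x → ∑ p ∈ Finset.Ico lo x, (if lo + k + 1 ≤ p ∧ below B p ≤ k then (1 : ℤ) else 0) =
        ∑ p ∈ Finset.Ico lo x, (if p ∉ B ∧ below B p ≤ k then (1 : ℤ) else 0)) := by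
    intro x hx
    induction x, hx using Int.leInduction with
    | base => rw [below_lo hB]; simp
    | succ x hx ih =>
      have hs := below_succ B x
      have hb := below_le_sub hB hx
      rw [← Finset.insert_Ico_right_eq_Ico_add_one hx, Finset.sum_insert (by simp),
        Finset.sum_insert (by simp)]
      obtain ⟨ih1, ih2⟩ := ih
      by_cases hxB : x ∈ B
      · simp only [hxB, if_true] at hs
        simp only [hxB, not_true, false_and, if_false]
        constructor
        · intro h
          obtain ⟨e1, e2⟩ := ih1 (by omega)
          rw [e1, e2]
          split_ifs <;> omega
        · intro h
          rcases (show k < below B x ∨ below B x = k by omega) with h' | h'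
          · rw [ih2 h']; split_ifs <;> omega
          · obtain ⟨e1, e2⟩ := ih1 (by omega)
            rw [e1, e2]; split_ifs <;> omega
      · simp only [hxB, if_false] at hs
        simp only [hxB, not_false_eq_true, true_and]
        constructor
        · intro h
          obtain ⟨e1, e2⟩ := ih1 (by omega)
          rw [e1, e2]
          split_ifs <;> omega
        · intro h
          rw [ih2 (by omega)]
          split_ifs <;> omega
  exact (key hi hle).2 (by rw [below_hi hB le_rfl]; exact_mod_cast hk)

/-- The same at the other end: the points with at least `B.card - k` particles to their left form a
final interval with exactly `k` particles, and one drops either these or the last `k` points. -/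
lemma count_right (hle : lo ≤ hi) {k : ℕ} (hk : k < B.card) :
    ∑ p ∈ Finset.Ico lo hi, (if p < hi - k ∧ B.card - k ≤ below B p then (1 : ℤ) else 0) =
      ∑ p ∈ Finset.Ico lo hi, (if p ∉ B ∧ B.card - k ≤ below B p then (1 : ℤ) else 0) := by
  have key : ∀ d : ℕ,
      (B.card - k ≤ below B (hi - d) → (∑ p ∈ Finset.Ico (hi - d) hi, (if p < hi - k ∧ B.card - k ≤ below B p then (1 : ℤ) else 0)) =
        max 0 (d - k) ∧
        (∑ p ∈ Finset.Ico (hi - d) hi, (if p ∉ B ∧ B.card - k ≤ below B p then (1 : ℤ) else 0)) = d - (B.card - below B (hi - d))) ∧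
      (below B (hi - d) < B.card - k → ∑ p ∈ Finset.Ico (hi - d) hi, (if p < hi - k ∧ B.card - k ≤ below B p then (1 : ℤ) else 0) =
        ∑ p ∈ Finset.Ico (hi - d) hi, (if p ∉ B ∧ B.card - k ≤ below B p then (1 : ℤ) else 0)) := by
    intro d
    induction d with
    | zero => simp [below_hi hB le_rfl]
    | succ d ih =>
      obtain ⟨x, hx⟩ : ∃ x, x = hi - ((d + 1 : ℕ) : ℤ) := ⟨_, rfl⟩
      have hx' : hi - (d : ℤ) = x + 1 := by push_cast at hx; omega
      rw [hx'] at ih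
      rw [← hx]
      have hs := below_succ B x
      have hb := card_sub_below_le hB (x := x + 1) (by omega)
      have hI : Finset.Ico x hi = insert x (Finset.Ico (x + 1) hi) := by
        ext p; simp only [Finset.mem_Ico, Finset.mem_insert]; omega
      rw [hI, Finset.sum_insert (by simp), Finset.sum_insert (by simp)]
      obtain ⟨ih1, ih2⟩ := ih
      by_cases hxB : x ∈ B
      · simp only [hxB, if_true] at hs
        simp only [hxB, not_true, false_and, if_false]
        constructor
        · intro h
          obtain ⟨e1, e2⟩ := ih1 (by omega)
          rw [e1, e2]
          split_ifs <;> push_cast <;> omega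
        · intro h
          rcases (show below B (x + 1) < B.card - k ∨ below B (x + 1) = B.card - k by omega) with h' | h'
          · rw [ih2 h']; split_ifs <;> omega
          · obtain ⟨e1, e2⟩ := ih1 (by omega)
            rw [e1, e2]; split_ifs <;> omega
      · simp only [hxB, if_false] at hs
        simp only [hxB, not_false_eq_true, true_and]
        constructor
        · intro h
          obtain ⟨e1, e2⟩ := ih1 (by omega)
          rw [e1, e2]
          split_ifs <;> push_cast <;> omega
        · intro h
          rw [ih2 (by omega)]
          split_ifs <;> omega
  have := (key (hi - lo).toNat).2
  rw [show hi - ((hi - lo).toNat : ℤ) = lo by omega, below_lo hB] at this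
  exact this (by omega)

/-- In the lowest chain the right-tilting lozenges stand in columns over the empty positions: over
`p` they occupy the rows `0, …, highCard B p - 1`, and their weights add up to a bracket. -/
lemma sum_right_low (a : ℕ) :
    ∑ k ∈ Finset.range B.card, ∑ i ∈ Finset.Ico lo hi,
      (low B k (i + 1) + 1 - low B (k + 1) i) * ((a : ℤ) + k + 1) =
    ∑ p ∈ Finset.Ico lo hi \ B, (bracket (a + highCard B p) a : ℤ) := by
  rw [Finset.sum_comm, ← Finset.sum_sdiff hB, Finset.sum_eq_zero (s := B), add_zero]
  · refine Finset.sum_congr rfl fun p hp => ?_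
    have hpB := (Finset.mem_sdiff.1 hp).2
    have hc := lowCard_add_highCard hpB
    rw [← sum_bracket (n := B.card) (by omega)]
    refine Finset.sum_congr rfl fun k hk => ?_
    rw [Finset.mem_range] at hk
    have hs := row_succ B p
    simp only [hpB, if_false] at hs
    have hr : row B p = -(lowCard B p : ℤ) := rfl
    unfold low
    split_ifs with h
    · rw [show max (row B (p + 1)) (-((B.card - k : ℕ) : ℤ)) + 1 - max (row B p) (-((B.card - (k + 1) : ℕ) : ℤ)) = 1 by omega, one_mul]
    · rw [show max (row B (p + 1)) (-((B.card - k : ℕ) : ℤ)) + 1 - max (row B p) (-((B.card - (k + 1) : ℕ) : ℤ)) = 0 by omega, zero_mul]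
  · intro p hp
    refine Finset.sum_eq_zero fun k hk => ?_
    rw [Finset.mem_range] at hk
    have hs := row_succ B p
    simp only [hp, if_true] at hs
    unfold low
    rw [show max (row B (p + 1)) (-((B.card - k : ℕ) : ℤ)) + 1 - max (row B p) (-((B.card - (k + 1) : ℕ) : ℤ)) = 0 by omega, zero_mul]

/-- In the highest chain the left-tilting lozenges run from each empty position `p` along the points
`p - k`, for as many rows as there are particles to the left of `p`. Substituting `p = i + k` makes
this visible. -/
lemma sum_left_high (a : ℕ) :
    ∑ k ∈ Finset.range B.card, ∑ i ∈ Finset.Ico lo (hi - k),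
      (high B (k + 1) i - high B k i) * ((a : ℤ) + k + 1) =
    ∑ p ∈ Finset.Ico lo hi \ B, (bracket (a + lowCard B p) a : ℤ) := by
  have h1 : ∀ k ∈ Finset.range B.card, ∑ i ∈ Finset.Ico lo (hi - k),
      (high B (k + 1) i - high B k i) * ((a : ℤ) + k + 1) =
      ∑ p ∈ Finset.Ico lo hi, if p ∉ B ∧ k < lowCard B p then ((a : ℤ) + k + 1) else 0 := by
    intro k _
    symm
    rw [← Finset.sum_subset (s₁ := Finset.Ico (lo + k) hi)]
    · refine Finset.sum_nbij' (fun p => p - k) (fun i => i + k) ?_ ?_ ?_ ?_ ?_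
      · intro p hp; simp only [Finset.mem_Ico] at hp ⊢; omega
      · intro p hp; simp only [Finset.mem_Ico] at hp ⊢; omega
      · intro p _; ring
      · intro p _; ring
      · intro p hp
        have hs := row_succ B p
        have hr : row B p = -(lowCard B p : ℤ) := rfl
        unfold high
        rw [show p - k + ((k + 1 : ℕ) : ℤ) = p + 1 by push_cast; ring, sub_add_cancel]
        push_cast
        by_cases h2 : p ∈ B
        · rw [if_pos h2] at hs
          rw [if_neg (fun h => h.1 h2),
            show min 0 (row B (p + 1) + ((k : ℤ) + 1)) - min 0 (row B p + k) = 0 by omega, zero_mul]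
        rw [if_neg h2] at hs
        by_cases h3 : k < lowCard B p
        · rw [if_pos ⟨h2, h3⟩,
            show min 0 (row B (p + 1) + ((k : ℤ) + 1)) - min 0 (row B p + k) = 1 by omega, one_mul]
        · rw [if_neg (fun h => h3 h.2),
            show min 0 (row B (p + 1) + ((k : ℤ) + 1)) - min 0 (row B p + k) = 0 by omega, zero_mul]
    · exact Finset.Ico_subset_Ico (by omega) le_rfl
    · intro p hp hp'
      rw [Finset.mem_Ico] at hp
      have : p < lo + k := by by_contra h; exact hp' (Finset.mem_Ico.2 ⟨by omega, hp.2⟩)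
      have hb := below_le_sub hB hp.1
      rw [below_eq_lowCard] at hb
      rw [if_neg]
      omega
  rw [Finset.sum_congr rfl h1, Finset.sum_comm, ← Finset.sum_sdiff hB, Finset.sum_eq_zero (s := B),
    add_zero]
  · refine Finset.sum_congr rfl fun p hp => ?_
    have hpB := (Finset.mem_sdiff.1 hp).2
    have hc := lowCard_add_highCard hpB
    rw [← sum_bracket (n := B.card) (by omega)]
    simp [hpB]
  · intro p hp
    simp [hp]

/-- This is the half below the axis, where the weights decrease with the row. Here the lozenges are
not attributed one by one to empty positions. The weight depends only on the row, and `count_left`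
shows that row `k` has as many right-tilting lozenges as there are empty positions with at most `k`
particles to their left. Position `p` then collects the weights `1, …, highCard B p`. -/
lemma sum_right_high (hle : lo ≤ hi) :
    ∑ k ∈ Finset.range B.card, ∑ i ∈ Finset.Ico lo hi,
      (high B k (i + 1) + 1 - high B (k + 1) i) * ((B.card : ℤ) - k) =
    ∑ p ∈ Finset.Ico lo hi \ B, (bracket (highCard B p) 0 : ℤ) := by
  have h1 : ∀ k ∈ Finset.range B.card, ∑ i ∈ Finset.Ico lo hi,
      (high B k (i + 1) + 1 - high B (k + 1) i) * ((B.card : ℤ) - k) =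
      ∑ p ∈ Finset.Ico lo hi, if p ∉ B ∧ lowCard B p ≤ k then ((B.card : ℤ) - k) else 0 := by
    intro k hk
    rw [Finset.mem_range] at hk
    have e := count_left hB hle hk
    have e1 : ∀ p, (if p ∉ B ∧ lowCard B p ≤ k then ((B.card : ℤ) - k) else 0) =
        (if p ∉ B ∧ below B p ≤ k then (1 : ℤ) else 0) * ((B.card : ℤ) - k) := by
      intro p
      rw [below_eq_lowCard]
      simp only [Nat.cast_le, ite_mul, one_mul, zero_mul]
    simp only [e1]
    rw [← Finset.sum_mul, ← Finset.sum_mul, ← e]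
    congr 1
    symm
    refine Finset.sum_bij_ne_zero (fun p _ _ => p - k - 1) ?_ ?_ ?_ ?_
    · intro p hp hne
      rw [Finset.mem_Ico] at hp ⊢
      rw [ne_eq, ite_eq_right_iff] at hne
      push Not at hne
      have := hne.1
      omega
    · intro p _ _ p' _ _ h; omega
    · intro i hi hne
      rw [Finset.mem_Ico] at hi
      have hlt : below B (i + k + 1) ≤ k := by
        by_contra hc
        refine hne ?_
        unfold high row
        rw [show i + 1 + (k : ℤ) = i + k + 1 by ring, show i + ((k + 1 : ℕ) : ℤ) = i + k + 1 by push_cast; ring]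
        push_cast
        omega
      refine ⟨i + k + 1, ?_, ?_, by ring⟩
      · rw [Finset.mem_Ico]
        refine ⟨by omega, ?_⟩
        by_contra hc
        have := below_hi hB (not_lt.1 hc)
        omega
      · rw [if_pos ⟨by omega, hlt⟩]; simp
    · intro p hp hne
      rw [ne_eq, ite_eq_right_iff] at hne
      push Not at hne
      rw [if_pos hne.1]
      unfold high row
      rw [show p - k - 1 + 1 + (k : ℤ) = p by ring, show p - k - 1 + ((k + 1 : ℕ) : ℤ) = p by push_cast; ring]
      push_cast
      omega
  rw [Finset.sum_congr rfl h1, Finset.sum_comm, ← Finset.sum_sdiff hB, Finset.sum_eq_zero (s := B),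
    add_zero]
  · refine Finset.sum_congr rfl fun p hp => ?_
    have hpB := (Finset.mem_sdiff.1 hp).2
    have hc := lowCard_add_highCard hpB
    rw [show highCard B p = B.card - lowCard B p by omega, ← sum_bracket_zero (by omega)]
    simp [hpB]
  · intro p hp
    simp [hp]

/-- As for `sum_right_high`, with `count_right` providing the number of lozenges in each row. -/
lemma sum_left_low (hle : lo ≤ hi) :
    ∑ k ∈ Finset.range B.card, ∑ i ∈ Finset.Ico lo (hi - k),
      (low B (k + 1) i - low B k i) * ((B.card : ℤ) - k) =
    ∑ p ∈ Finset.Ico lo hi \ B, (bracket (lowCard B p) 0 : ℤ) := by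
  have h1 : ∀ k ∈ Finset.range B.card, ∑ i ∈ Finset.Ico lo (hi - k),
      (low B (k + 1) i - low B k i) * ((B.card : ℤ) - k) =
      ∑ p ∈ Finset.Ico lo hi, if p ∉ B ∧ highCard B p ≤ k then ((B.card : ℤ) - k) else 0 := by
    intro k hk
    rw [Finset.mem_range] at hk
    have e := count_right hB hle hk
    have e1 : ∀ p, (if p ∉ B ∧ highCard B p ≤ k then ((B.card : ℤ) - k) else 0) =
        (if p ∉ B ∧ B.card - k ≤ below B p then (1 : ℤ) else 0) * ((B.card : ℤ) - k) := by
      intro p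
      rw [below_eq_lowCard]
      by_cases hp : p ∈ B
      · simp [hp]
      · have := lowCard_add_highCard hp
        simp only [hp, not_false_eq_true, true_and, ite_mul, one_mul, zero_mul]
        congr 1
        rw [eq_iff_iff]
        omega
    simp only [e1]
    rw [← Finset.sum_mul, ← Finset.sum_mul, ← e]
    congr 1
    simp only [ite_and]
    rw [← Finset.sum_filter]
    have : (Finset.Ico lo hi).filter (· < hi - k) = Finset.Ico lo (hi - k) := by
      ext p; simp only [Finset.mem_filter, Finset.mem_Ico]; omega
    rw [this]
    refine Finset.sum_congr rfl fun i _ => ?_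
    unfold low row
    split_ifs <;> omega
  rw [Finset.sum_congr rfl h1, Finset.sum_comm, ← Finset.sum_sdiff hB, Finset.sum_eq_zero (s := B),
    add_zero]
  · refine Finset.sum_congr rfl fun p hp => ?_
    have hpB := (Finset.mem_sdiff.1 hp).2
    have hc := lowCard_add_highCard hpB
    rw [show lowCard B p = B.card - highCard B p by omega, ← sum_bracket_zero (by omega)]
    simp [hpB]
  · intro p hp
    simp [hp]

end counts
end LozengeTiling

/-! ### The weight of a tiling as a sum over its chains -/

namespace LozengeTiling

lemma sum_lozenges {ι : Type*} {T : Finset Lozenge} {p : Lozenge → Prop} [DecidablePred p]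
    (w : ℤ → ℤ) {s : Finset ι} {f : ι → Lozenge} (hinj : Set.InjOn f s)
    (hsurj : ∀ l ∈ T, p l → ∃ x ∈ s, f x = l) (hp : ∀ x ∈ s, p (f x)) :
    ∑ l ∈ T with p l, w l.j = ∑ x ∈ s, ind T (f x) * w (f x).j := by
  have h1 : ∑ x ∈ s, ind T (f x) * w (f x).j = ∑ l ∈ s.image f, ind T l * w l.j :=
    by
    rw [Finset.sum_image hinj]
  have h2 : ∀ l, ind T l * w l.j = if l ∈ T then w l.j else 0 := by
    intro l; unfold ind; split_ifs <;> simp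
  rw [h1]
  simp only [h2]
  rw [← Finset.sum_filter]
  refine Finset.sum_congr ?_ fun _ _ => rfl
  ext l
  simp only [Finset.mem_filter, Finset.mem_image]
  constructor
  · rintro ⟨h, h'⟩; exact ⟨hsurj l h h', h⟩
  · rintro ⟨⟨x, hx, rfl⟩, h⟩; exact ⟨h, hp x hx⟩

namespace IntrudedHexagon
variable {G : IntrudedHexagon}

lemma expo_split {T : Finset Lozenge} (hT : T ∈ tilings G.region) (c : LozengeKind) :
    (expo c T : ℤ) = ∑ l ∈ T with l.kind = c ∧ (G.axis : ℤ) ≤ l.j, (l.j + 1) +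
      ∑ l ∈ T with l.kind = c ∧ ¬ (G.axis : ℤ) ≤ l.j, (l.j + 1) := by
  rw [← Finset.filter_filter, ← Finset.filter_filter, Finset.sum_filter_add_sum_filter_not]
  unfold expo
  rw [← Finset.sum_filter]
  push_cast
  refine Finset.sum_congr rfl fun l hl => ?_
  have := row_range ((mem_tilings.1 hT).1 l (Finset.mem_filter.1 hl).1).1
  simp only [Lozenge.upTriangle] at this
  omega

namespace Spec
variable {U D : Finset ℤ} {y : ℕ} (hG : G.Spec U D y)
include hG

lemma sum_right {T : Finset Lozenge} (hT : T ∈ tilings G.region) :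
    (expo .right T : ℤ) = ∑ k ∈ Finset.range G.upper.n, ∑ i ∈ Finset.Ico G.upper.lo G.upper.hi,
        ((G.chains T).1 k (i + 1) + 1 - (G.chains T).1 (k + 1) i) * ((G.axis : ℤ) + k + 1) +
      ∑ k ∈ Finset.range G.lower.n, ∑ i ∈ Finset.Ico G.lower.lo G.lower.hi,
        ((G.chains T).2 k (i + 1) + 1 - (G.chains T).2 (k + 1) i) * ((G.axis : ℤ) - k) := by
  obtain ⟨cN, cM, -⟩ := (hG.mem_model_iff (N := (G.chains T).1) (M := (G.chains T).2)).1
    (hG.chains_mem_model hT)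
  have hm := (mem_tilings.1 hT).1
  rw [expo_split hT, ← Finset.sum_product', ← Finset.sum_product']
  congr 1
  · rw [sum_lozenges (fun j => j + 1) (s := Finset.range G.upper.n ×ˢ Finset.Ico G.upper.lo G.upper.hi)
      (f := fun x => ⟨.right, x.2, G.axis + x.1⟩)]
    · refine Finset.sum_congr rfl ?_
      rintro ⟨k, i⟩ hx
      simp only [Finset.mem_product, Finset.mem_range, Finset.mem_Ico] at hx
      by_cases hu : G.upper.UpIn k i
      · simp only [(hG.ind_upper hT hu).1]
      · simp only
        rw [ind_eq_zero.2 fun h => hu (by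
          have h := (hm _ h).1
          simp only [Lozenge.upTriangle] at h
          exact hG.upIn_upper.1 h)]
        -- At the frozen positions in the range of summation the height difference is already zero,
        -- so one may sum over entire rows instead of the triangles of the region.
        rcases cN.frozen hx.1 hu with h | h | h
        · omega
        · rw [show (G.chains T).1 k (i + 1) + 1 - (G.chains T).1 (k + 1) i = 0 by omega]
        · rw [show (G.chains T).1 k (i + 1) + 1 - (G.chains T).1 (k + 1) i = 0 by omega]
    · rintro ⟨k, i⟩ _ ⟨k', i'⟩ _ h
      simp at h
      simp; omega
    · rintro ⟨c, i, j⟩ hl ⟨hc, hj⟩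
      obtain ⟨k, rfl⟩ := exists_upper j hj
      have h := (hm _ hl).1
      simp only [Lozenge.upTriangle] at h
      have := hG.upIn_upper.1 h
      refine ⟨(k, i), ?_, ?_⟩
      · simp only [Finset.mem_product, Finset.mem_range, Finset.mem_Ico]
        exact ⟨this.1, this.2.1, by have := this.2.2.1; omega⟩
      · simp only at hc; simp [hc]
    · rintro ⟨k, i⟩ _; simp
  · rw [sum_lozenges (fun j => j + 1) (s := Finset.range G.lower.n ×ˢ Finset.Ico G.lower.lo G.lower.hi)
      (f := fun x => ⟨.right, -x.2 - 1, G.axis - 1 - x.1⟩)]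
    · refine Finset.sum_congr rfl ?_
      rintro ⟨k, i⟩ hx
      simp only [Finset.mem_product, Finset.mem_range, Finset.mem_Ico] at hx
      by_cases hu : G.lower.UpIn k i
      · simp only [(hG.ind_lower hT hu).1]
        ring
      · simp only
        rw [ind_eq_zero.2 fun h => hu (by
          have h := (hm _ h).2
          simp only [Lozenge.downTriangle] at h
          exact hG.upIn_lower.1 h)]
        rcases cM.frozen hx.1 hu with h | h | h
        · omega
        · rw [show (G.chains T).2 k (i + 1) + 1 - (G.chains T).2 (k + 1) i = 0 by omega]; simp
        · rw [show (G.chains T).2 k (i + 1) + 1 - (G.chains T).2 (k + 1) i = 0 by omega]; simp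
    · rintro ⟨k, i⟩ _ ⟨k', i'⟩ _ h
      simp at h
      simp; omega
    · rintro ⟨c, i, j⟩ hl ⟨hc, hj⟩
      obtain ⟨k, hk⟩ := exists_lower (G := G) (j + 1) (by simp only at hj; omega)
      obtain rfl : j = G.axis - 1 - k := by omega
      simp only at hc
      subst hc
      have h := (hm _ hl).2
      rw [show i = -(-i - 1) - 1 by ring] at h
      have := hG.upIn_lower.1 h
      refine ⟨(k, -i - 1), ?_, ?_⟩
      · simp only [Finset.mem_product, Finset.mem_range, Finset.mem_Ico]
        exact ⟨this.1, this.2.1, by have := this.2.2.1; omega⟩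
      · simp
    · rintro ⟨k, i⟩ _
      simp
      omega

/-- Here row `k` stops at `hi - k`: beyond the right side of the trapezoid the frozen lozenges are
left-tilting and would contribute to the sum. -/
lemma sum_left {T : Finset Lozenge} (hT : T ∈ tilings G.region) :
    (expo .left T : ℤ) = ∑ k ∈ Finset.range G.upper.n,
        ∑ i ∈ Finset.Ico G.upper.lo (G.upper.hi - k),
        ((G.chains T).1 (k + 1) i - (G.chains T).1 k i) * ((G.axis : ℤ) + k + 1) +
      ∑ k ∈ Finset.range G.lower.n, ∑ i ∈ Finset.Ico G.lower.lo (G.lower.hi - k),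
        ((G.chains T).2 (k + 1) i - (G.chains T).2 k i) * ((G.axis : ℤ) - k) := by
  obtain ⟨cN, cM, -⟩ := (hG.mem_model_iff (N := (G.chains T).1) (M := (G.chains T).2)).1
    (hG.chains_mem_model hT)
  have hm := (mem_tilings.1 hT).1
  rw [expo_split hT, Finset.sum_sigma', Finset.sum_sigma']
  congr 1
  · rw [sum_lozenges (fun j => j + 1)
      (s := (Finset.range G.upper.n).sigma fun k => Finset.Ico G.upper.lo (G.upper.hi - k))
      (f := fun x => ⟨.left, x.2, G.axis + x.1⟩)]
    · refine Finset.sum_congr rfl ?_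
      rintro ⟨k, i⟩ hx
      simp only [Finset.mem_sigma, Finset.mem_range, Finset.mem_Ico] at hx
      by_cases hu : G.upper.UpIn k i
      · simp only [(hG.ind_upper hT hu).2.1]
      · simp only
        rw [ind_eq_zero.2 fun h => hu (by
          have h := (hm _ h).1
          simp only [Lozenge.upTriangle] at h
          exact hG.upIn_upper.1 h)]
        rcases cN.frozen hx.1 hu with h | h | h
        · omega
        · omega
        · rw [show (G.chains T).1 (k + 1) i - (G.chains T).1 k i = 0 by omega]
    · rintro ⟨k, i⟩ _ ⟨k', i'⟩ _ h
      simp at h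
      simp; omega
    · rintro ⟨c, i, j⟩ hl ⟨hc, hj⟩
      obtain ⟨k, rfl⟩ := exists_upper j hj
      have h := (hm _ hl).1
      simp only [Lozenge.upTriangle] at h
      have := hG.upIn_upper.1 h
      refine ⟨⟨k, i⟩, ?_, ?_⟩
      · simp only [Finset.mem_sigma, Finset.mem_range, Finset.mem_Ico]
        exact ⟨this.1, this.2.1, by have := this.2.2.1; omega⟩
      · simp only at hc; simp [hc]
    · rintro ⟨k, i⟩ _; simp
  · rw [sum_lozenges (fun j => j + 1)
      (s := (Finset.range G.lower.n).sigma fun k => Finset.Ico G.lower.lo (G.lower.hi - k))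
      (f := fun x => ⟨.left, -x.2, G.axis - 1 - x.1⟩)]
    · refine Finset.sum_congr rfl ?_
      rintro ⟨k, i⟩ hx
      simp only [Finset.mem_sigma, Finset.mem_range, Finset.mem_Ico] at hx
      by_cases hu : G.lower.UpIn k i
      · simp only [(hG.ind_lower hT hu).2.1]
        ring
      · simp only
        rw [ind_eq_zero.2 fun h => hu (by
          have h := (hm _ h).2
          simp only [Lozenge.downTriangle] at h
          exact hG.upIn_lower.1 h)]
        rcases cM.frozen hx.1 hu with h | h | h
        · omega
        · omega
        · rw [show (G.chains T).2 (k + 1) i - (G.chains T).2 k i = 0 by omega]; simp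
    · rintro ⟨k, i⟩ _ ⟨k', i'⟩ _ h
      simp at h
      simp; omega
    · rintro ⟨c, i, j⟩ hl ⟨hc, hj⟩
      obtain ⟨k, hk⟩ := exists_lower (G := G) (j + 1) (by simp only at hj; omega)
      obtain rfl : j = G.axis - 1 - k := by omega
      simp only at hc
      subst hc
      have h := (hm _ hl).2
      simp only [Lozenge.downTriangle] at h
      rw [show i - 1 = -(-i) - 1 by ring] at h
      have := hG.upIn_lower.1 h
      refine ⟨⟨k, -i⟩, ?_, ?_⟩
      · simp only [Finset.mem_sigma, Finset.mem_range, Finset.mem_Ico]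
        exact ⟨this.1, this.2.1, by have := this.2.2.1; omega⟩
      · simp
    · rintro ⟨k, i⟩ _
      simp
      omega

omit hG in
lemma _root_.LozengeTiling.highCard_refl (B : Finset ℤ) (p : ℤ) :
    highCard (refl B) (-1 - p) = lowCard B p := by
  unfold highCard lowCard
  rw [← card_refl]
  congr 1
  ext r
  simp only [mem_refl, Finset.mem_filter]
  rw [show -1 - (-1 - r) = r by ring]
  exact and_congr_right fun _ => by omega

omit hG in
lemma _root_.LozengeTiling.lowCard_refl (B : Finset ℤ) (p : ℤ) :
    lowCard (refl B) (-1 - p) = highCard B p := by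
  rw [← highCard_refl, refl_refl]
  congr 1
  ring

omit hG in
lemma _root_.LozengeTiling.sum_refl_sdiff (B : Finset ℤ) (a b : ℤ) (f : ℤ → ℤ) :
    ∑ p ∈ Finset.Ico a b \ refl B, f p = ∑ p ∈ Finset.Ico (-b) (-a) \ B, f (-1 - p) := by
  refine Finset.sum_nbij' (fun p => -1 - p) (fun p => -1 - p) ?_ ?_ ?_ ?_ ?_
  · intro p hp
    simp only [Finset.mem_sdiff, Finset.mem_Ico, mem_refl] at hp ⊢
    exact ⟨by omega, hp.2⟩
  · intro p hp
    simp only [Finset.mem_sdiff, Finset.mem_Ico, mem_refl, sub_sub_cancel] at hp ⊢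
    exact ⟨by omega, hp.2⟩
  all_goals intros; simp

lemma union_subset_upper {S : Finset ℤ} (hS : S ⊆ Finset.Ico G.tipL G.tipR) :
    U ∪ S ⊆ Finset.Ico G.upper.lo G.upper.hi := by
  have a1 := hG.tipR_le'
  have a2 := hG.le_tipL
  intro p hp
  simp only [upper, Finset.mem_Ico]
  rcases Finset.mem_union.1 hp with h | h
  · exact hG.U_range p h
  · have := Finset.mem_Ico.1 (hS h)
    omega

lemma union_subset_lower {S : Finset ℤ} (hS : S ⊆ Finset.Ico G.tipL G.tipR) :
    refl (D ∪ S) ⊆ Finset.Ico G.lower.lo G.lower.hi := by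
  have a1 := hG.tipR_le
  have a2 := hG.le_tipL
  have a3 := hG.sw_le
  intro p hp
  rw [mem_refl] at hp
  simp only [lower, Finset.mem_Ico]
  rcases Finset.mem_union.1 hp with h | h
  · have := hG.D_range _ h
    omega
  · have := Finset.mem_Ico.1 (hS h)
    omega

omit hG in
lemma lower_lo_le : G.lower.lo ≤ G.lower.hi := by
  simp only [lower]; omega

/-- The weight of the tiling with the lowest surface. -/
lemma expo_right_min {T : Finset Lozenge} (hT : T ∈ tilings G.region)
    (h : G.chains T = minPair U D G.tipL y) {S : Finset ℤ} (hS : S = Finset.Ico G.tipL (G.tipL + y)) :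
    (expo .right T : ℤ) =
      ∑ p ∈ Finset.Ico (-(G.sw : ℤ)) G.neEnd \ (U ∪ S),
          (bracket (G.axis + highCard (U ∪ S) p) G.axis : ℤ) +
        ∑ p ∈ Finset.Ico (-(G.axis : ℤ)) G.s \ (D ∪ S), (bracket (lowCard (D ∪ S) p) 0 : ℤ) := by
  have h0 := hG.tips
  have hS' : S ⊆ Finset.Ico G.tipL G.tipR := hS ▸ Finset.Ico_subset_Ico le_rfl h0
  have hy : S.card = y := by rw [hS]; simp
  have hB := hG.union_subset_upper hS'
  have hB' := hG.union_subset_lower hS'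
  obtain ⟨c1, c2⟩ := hG.card_union hS' hy
  have n1 : G.upper.n = (U ∪ S).card := c1.symm
  have n2 : G.lower.n = (refl (D ∪ S)).card := c2.symm
  have n3 : (G.axis : ℤ) = (refl (D ∪ S)).card := by rw [← n2]; rfl
  rw [hG.sum_right hT, h]
  simp only [minPair, ← hS]
  rw [n1, n2, sum_right_low hB]
  congr 1
  simp only [n3]
  rw [sum_right_high hB' lower_lo_le, sum_refl_sdiff]
  simp only [highCard_refl, ← n3]
  simp [lower]

/-- The weight of the tiling with the highest surface. -/
lemma expo_left_max {T : Finset Lozenge} (hT : T ∈ tilings G.region)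
    (h : G.chains T = maxPair U D G.tipR y) {S : Finset ℤ} (hS : S = Finset.Ico (G.tipR - y) G.tipR) :
    (expo .left T : ℤ) =
      ∑ p ∈ Finset.Ico (-(G.sw : ℤ)) G.neEnd \ (U ∪ S),
          (bracket (G.axis + lowCard (U ∪ S) p) G.axis : ℤ) +
        ∑ p ∈ Finset.Ico (-(G.axis : ℤ)) G.s \ (D ∪ S), (bracket (highCard (D ∪ S) p) 0 : ℤ) := by
  have h0 := hG.tips
  have hS' : S ⊆ Finset.Ico G.tipL G.tipR := hS ▸ Finset.Ico_subset_Ico (by omega) le_rfl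
  have hy : S.card = y := by rw [hS]; simp
  have hB := hG.union_subset_upper hS'
  have hB' := hG.union_subset_lower hS'
  obtain ⟨c1, c2⟩ := hG.card_union hS' hy
  have n1 : G.upper.n = (U ∪ S).card := c1.symm
  have n2 : G.lower.n = (refl (D ∪ S)).card := c2.symm
  have n3 : (G.axis : ℤ) = (refl (D ∪ S)).card := by rw [← n2]; rfl
  rw [hG.sum_left hT, h]
  simp only [maxPair, ← hS]
  rw [n1, n2, sum_left_high hB]
  congr 1
  simp only [n3]
  rw [sum_left_low hB' lower_lo_le, sum_refl_sdiff]
  simp only [lowCard_refl, ← n3]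
  simp [lower]

end Spec
end IntrudedHexagon
end LozengeTiling

namespace LozengeTiling
/-! ### Ferns -/

/-- The segments of the axis covered by the lobes pointing up (`u = true`) or down. -/
noncomputable def covered (u : Bool) : List Lobe → Finset ℤ
  | [] => ∅
  | l :: L => (if l.up = u then Finset.Ico l.left (l.left + l.size) else ∅) ∪ covered u L

lemma mem_covered {u : Bool} {L : List Lobe} {p : ℤ} :
    p ∈ covered u L ↔ ∃ l ∈ L, l.up = u ∧ l.left ≤ p ∧ p < l.left + l.size := by
  induction L with
  | nil => simp [covered]
  | cons l L ih =>
    rw [covered, Finset.mem_union, ih]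
    split_ifs with h <;> simp [h]

lemma entry_cons (c : ℕ) (l : List ℕ) {k : ℕ} (hk : 1 ≤ k) : entry (c :: l) (k + 1) = entry l k := by
  obtain ⟨k, rfl⟩ := Nat.exists_eq_add_of_le' hk
  rfl

lemma sum_Icc_eq (n : ℕ) (f : ℕ → ℕ) : ∑ i ∈ Finset.Icc 1 n, f i = ∑ i ∈ Finset.range n, f (i + 1) := by
  rw [Finset.range_eq_Ico, Finset.sum_Ico_add' f 0 n 1, zero_add]
  rfl

lemma sumOdd_cons (c : ℕ) (l : List ℕ) (f : ℕ → ℕ) :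
    sumOdd (c :: l) f = c * f 1 + sumEven l fun i => f (i + 1) := by
  unfold sumOdd sumEven
  rw [sum_Icc_eq, sum_Icc_eq, List.length_cons, show (l.length + 1 + 1) / 2 = l.length / 2 + 1 by omega,
    Finset.sum_range_succ']
  rw [add_comm]
  refine congrArg₂ _ rfl (Finset.sum_congr rfl fun i _ => ?_)
  rw [show 2 * (i + 1 + 1) - 1 = 2 * (i + 1) + 1 by omega, entry_cons _ _ (by omega)]

lemma sumEven_cons (c : ℕ) (l : List ℕ) (f : ℕ → ℕ) : sumEven (c :: l) f = sumOdd l f := by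
  unfold sumOdd sumEven
  rw [List.length_cons]
  refine Finset.sum_congr rfl fun i hi => ?_
  have := (Finset.mem_Icc.1 hi).1
  conv_lhs => rw [show 2 * i = 2 * i - 1 + 1 by omega]
  rw [entry_cons _ _ (by omega)]

lemma evenPartial_cons (c : ℕ) (l : List ℕ) (i : ℕ) : evenPartial (c :: l) i = oddPartial l i := by
  unfold evenPartial oddPartial
  refine Finset.sum_congr rfl fun i hi => ?_
  have := (Finset.mem_Icc.1 hi).1
  conv_lhs => rw [show 2 * i = 2 * i - 1 + 1 by omega]
  rw [entry_cons _ _ (by omega)]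

lemma oddPartial_cons (c : ℕ) (l : List ℕ) (i : ℕ) :
    oddPartial (c :: l) (i + 1) = c + evenPartial l i := by
  unfold evenPartial oddPartial
  rw [sum_Icc_eq, sum_Icc_eq, Finset.sum_range_succ', add_comm]
  refine congrArg₂ _ rfl (Finset.sum_congr rfl fun i _ => ?_)
  rw [show 2 * (i + 1 + 1) - 1 = 2 * (i + 1) + 1 by omega, entry_cons _ _ (by omega)]

/-- The sum of `g` at the total size of the preceding even-indexed lobes over the unit segments of
the odd-indexed lobes. -/
def oddLobes (l : List ℕ) (g : ℕ → ℕ) : ℕ := sumOdd l fun i => g (evenPartial l (i - 1))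

/-- The sum of `g` at the total size of the preceding odd-indexed lobes over the unit segments of
the even-indexed lobes. -/
def evenLobes (l : List ℕ) (g : ℕ → ℕ) : ℕ := sumEven l fun i => g (oddPartial l i)

/-- Removing the first lobe exchanges odd and even positions. With `evenLobes_cons` this gives a
recursion along the fern. -/
lemma oddLobes_cons (c : ℕ) (l : List ℕ) (g : ℕ → ℕ) :
    oddLobes (c :: l) g = c * g 0 + evenLobes l g := by
  unfold oddLobes evenLobes
  rw [sumOdd_cons]
  simp only [Nat.add_sub_cancel, evenPartial_cons]
  rfl

lemma evenLobes_cons (c : ℕ) (l : List ℕ) (g : ℕ → ℕ) :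
    evenLobes (c :: l) g = oddLobes l fun k => g (c + k) := by
  unfold oddLobes evenLobes
  rw [sumEven_cons]
  unfold sumOdd
  refine Finset.sum_congr rfl fun i hi => ?_
  obtain ⟨k, rfl⟩ := Nat.exists_eq_add_of_le' (Finset.mem_Icc.1 hi).1
  simp only [oddPartial_cons, Nat.add_sub_cancel]

lemma oddLobes_one (l : List ℕ) : oddLobes l (fun _ => 1) = oddSum l := by
  simp [oddLobes, sumOdd, oddSum]

lemma evenLobes_one (l : List ℕ) : evenLobes l (fun _ => 1) = evenSum l := by
  simp [evenLobes, sumEven, evenSum]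

lemma sum_eq_oddSum_add (l : List ℕ) : l.sum = oddSum l + evenSum l := by
  induction l with
  | nil => rfl
  | cons c l ih =>
    have h1 := oddLobes_cons c l fun _ => 1
    have h2 := evenLobes_cons c l fun _ => 1
    rw [oddLobes_one, evenLobes_one] at h1
    rw [oddLobes_one, evenLobes_one] at h2
    rw [List.sum_cons]
    omega

lemma leftFern_range {p : ℤ} {u : Bool} {a : List ℕ} {l : Lobe} (h : l ∈ leftFern p u a) :
    p ≤ l.left ∧ l.left + l.size ≤ p + a.sum := by
  induction a generalizing p u with
  | nil => simp [leftFern] at h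
  | cons c a ih =>
    rw [leftFern, List.mem_cons] at h
    rw [List.sum_cons, Nat.cast_add]
    rcases h with rfl | h
    · simp only; omega
    · have := ih h; omega

lemma mem_covered_leftFern (p : ℤ) (u v : Bool) (a : List ℕ) {r : ℤ} :
    (r ∈ covered v (leftFern p u a) ∨ r ∈ covered (!v) (leftFern p u a)) ↔ p ≤ r ∧ r < p + a.sum := by
  induction a generalizing p u with
  | nil => simp [leftFern, covered]
  | cons c a ih =>
    have := ih (p + c) (!u)
    rw [leftFern, covered, covered, List.sum_cons, Nat.cast_add]
    generalize a.sum = m at this ⊢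
    cases u <;> cases v <;> simp at this ⊢ <;> grind

lemma covered_leftFern_range {p : ℤ} {u v : Bool} {a : List ℕ} {r : ℤ}
    (h : r ∈ covered v (leftFern p u a)) : p ≤ r ∧ r < p + a.sum :=
  (mem_covered_leftFern p u v a).1 (Or.inl h)

lemma covered_leftFern_not (p : ℤ) (u v : Bool) (a : List ℕ) {r : ℤ}
    (h : r ∈ covered v (leftFern p u a)) : r ∉ covered (!v) (leftFern p u a) := by
  induction a generalizing p u with
  | nil => simp [leftFern, covered]
  | cons c a ih =>
    have := ih (p + c) (!u)
    have h1 := fun w => @covered_leftFern_range (p + c) (!u) w a r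
    rw [leftFern, covered] at h ⊢
    have h2 := h1 v
    have h3 := h1 (!v)
    generalize a.sum = m at h2 h3
    cases u <;> cases v <;> simp at this h h2 h3 ⊢ <;> grind

lemma lowCard_of_le {A : Finset ℤ} {p : ℤ} (h : ∀ r ∈ A, p ≤ r) : lowCard A p = 0 := by
  unfold lowCard
  rw [Finset.card_eq_zero, Finset.filter_eq_empty_iff]
  intro r hr
  have := h r hr
  omega

lemma lowCard_of_lt {A : Finset ℤ} {p : ℤ} (h : ∀ r ∈ A, r < p) : lowCard A p = A.card := by
  unfold lowCard
  rw [Finset.filter_true_of_mem h]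

lemma highCard_of_lt {A : Finset ℤ} {p : ℤ} (h : ∀ r ∈ A, p < r) : highCard A p = A.card := by
  unfold highCard
  rw [Finset.filter_true_of_mem h]

lemma highCard_of_le {A : Finset ℤ} {p : ℤ} (h : ∀ r ∈ A, r ≤ p) : highCard A p = 0 := by
  unfold highCard
  rw [Finset.card_eq_zero, Finset.filter_eq_empty_iff]
  intro r hr
  have := h r hr
  omega

lemma lowCard_union {A B : Finset ℤ} (h : Disjoint A B) (p : ℤ) :
    lowCard (A ∪ B) p = lowCard A p + lowCard B p := by
  unfold lowCard
  rw [Finset.filter_union, Finset.card_union_of_disjoint (Finset.disjoint_filter_filter h)]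

lemma highCard_union {A B : Finset ℤ} (h : Disjoint A B) (p : ℤ) :
    highCard (A ∪ B) p = highCard A p + highCard B p := by
  unfold highCard
  rw [Finset.filter_union, Finset.card_union_of_disjoint (Finset.disjoint_filter_filter h)]

/-- On a unit segment of a lobe, the number of segments of the other orientation to its left is the
total size of the preceding lobes of the other parity. The two identities are proved together since
peeling off a lobe swaps them. -/
lemma sum_leftFern (p : ℤ) (u : Bool) (a : List ℕ) (g : ℕ → ℕ) :
    (∑ r ∈ covered u (leftFern p u a), g (lowCard (covered (!u) (leftFern p u a)) r) = oddLobes a g) ∧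
    ∑ r ∈ covered (!u) (leftFern p u a), g (lowCard (covered u (leftFern p u a)) r) = evenLobes a g := by
  induction a generalizing p u g with
  | nil => simp [leftFern, covered, oddLobes, evenLobes, sumOdd, sumEven]
  | cons c a ih =>
    have hr := fun w => @covered_leftFern_range (p + c) (!u) w a
    have hd : ∀ w, Disjoint (Finset.Ico p (p + c)) (covered w (leftFern (p + c) (!u) a)) := by
      intro w
      rw [Finset.disjoint_left]
      intro r h1 h2
      have := hr w h2
      have := Finset.mem_Ico.1 h1
      omega
    rw [oddLobes_cons, evenLobes_cons, leftFern, covered, covered, if_pos rfl,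
      if_neg (by simp), Finset.empty_union]
    constructor
    · rw [Finset.sum_union (hd u)]
      have e := (ih (p + c) (!u) g).2
      rw [Bool.not_not] at e
      rw [e]
      congr 1
      rw [Finset.sum_congr rfl fun r h => by
        rw [lowCard_of_le fun r' h' => by
          have := hr _ h'
          have := Finset.mem_Ico.1 h
          omega]]
      simp
    · rw [← (ih (p + c) (!u) fun k => g (c + k)).1]
      refine Finset.sum_congr rfl fun r h => ?_
      have := hr _ h
      rw [lowCard_union (hd u), lowCard_of_lt (A := Finset.Ico p (p + c)) fun r' h' => by
        have := Finset.mem_Ico.1 h'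
        omega, Bool.not_not]
      simp

lemma card_covered_leftFern (p : ℤ) (u : Bool) (a : List ℕ) :
    (covered u (leftFern p u a)).card = oddSum a ∧ (covered (!u) (leftFern p u a)).card = evenSum a := by
  have := sum_leftFern p u a fun _ => 1
  rw [oddLobes_one, evenLobes_one] at this
  simpa using this

/-- A right fern is the mirror image of a left fern; this reduces all counts to the left ones. -/
lemma mem_rightFern (p : ℤ) (u : Bool) (a : List ℕ) (l : Lobe) :
    l ∈ rightFern p u a ↔ (⟨l.up, -(l.left + l.size), l.size⟩ : Lobe) ∈ leftFern (-p) u a := by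
  induction a generalizing p u with
  | nil => simp [leftFern, rightFern]
  | cons c a ih =>
    obtain ⟨w, i, s⟩ := l
    rw [leftFern, rightFern, List.mem_cons, List.mem_cons, ih,
      show -(p - (c : ℤ)) = -p + c by ring]
    refine or_congr ?_ Iff.rfl
    simp only [Lobe.mk.injEq]
    constructor <;> rintro ⟨rfl, h, rfl⟩ <;> refine ⟨rfl, ?_, rfl⟩ <;> omega

lemma covered_rightFern (p : ℤ) (u v : Bool) (a : List ℕ) :
    covered v (rightFern p u a) = refl (covered v (leftFern (-p) u a)) := by
  ext r
  rw [mem_refl, mem_covered, mem_covered]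
  constructor
  · rintro ⟨l, hl, h1, h2, h3⟩
    exact ⟨_, (mem_rightFern ..).1 hl, h1, by simp only; omega, by simp only; omega⟩
  · rintro ⟨⟨w, i, s⟩, hl, h1, h2, h3⟩
    refine ⟨⟨w, -(i + s), s⟩, (mem_rightFern ..).2 ?_, h1, ?_, ?_⟩
    · simpa using hl
    · simp only at *; omega
    · simp only at *; omega

lemma rightFern_range {p : ℤ} {u : Bool} {a : List ℕ} {l : Lobe} (h : l ∈ rightFern p u a) :
    p - a.sum ≤ l.left ∧ l.left + l.size ≤ p := by
  have := leftFern_range ((mem_rightFern ..).1 h)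
  simp only at this
  omega

lemma mem_covered_rightFern (p : ℤ) (u v : Bool) (a : List ℕ) {r : ℤ} :
    (r ∈ covered v (rightFern p u a) ∨ r ∈ covered (!v) (rightFern p u a)) ↔ p - a.sum ≤ r ∧ r < p := by
  rw [covered_rightFern, covered_rightFern, mem_refl, mem_refl, mem_covered_leftFern]
  omega

lemma covered_rightFern_not (p : ℤ) (u v : Bool) (a : List ℕ) {r : ℤ}
    (h : r ∈ covered v (rightFern p u a)) : r ∉ covered (!v) (rightFern p u a) := by
  rw [covered_rightFern, mem_refl] at *
  exact covered_leftFern_not _ _ _ _ h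

lemma sum_rightFern (p : ℤ) (u : Bool) (a : List ℕ) (g : ℕ → ℕ) :
    (∑ r ∈ covered u (rightFern p u a), g (highCard (covered (!u) (rightFern p u a)) r) = oddLobes a g) ∧
    ∑ r ∈ covered (!u) (rightFern p u a), g (highCard (covered u (rightFern p u a)) r) =
      evenLobes a g := by
  have h : ∀ A B : Finset ℤ, ∑ r ∈ refl A, g (highCard (refl B) r) = ∑ r ∈ A, g (lowCard B r) := by
    intro A B
    refine Finset.sum_nbij' (fun p => -1 - p) (fun p => -1 - p) ?_ ?_ ?_ ?_ ?_
    · intro p hp; simpa using hp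
    · intro p hp; simpa using hp
    · intros; simp
    · intros; simp
    · intro r _
      rw [← highCard_refl, sub_sub_cancel]
  simp only [covered_rightFern, h]
  exact sum_leftFern _ _ _ _

lemma card_covered_rightFern (p : ℤ) (u : Bool) (a : List ℕ) :
    (covered u (rightFern p u a)).card = oddSum a ∧
      (covered (!u) (rightFern p u a)).card = evenSum a := by
  have := sum_rightFern p u a fun _ => 1
  rw [oddLobes_one, evenLobes_one] at this
  simpa using this

end LozengeTiling

/-! ### Hexagons with two ferns at the ends of the axis -/

namespace LozengeTiling
namespace IntrudedHexagon

/-- A hexagon with two ferns that start at the ends of the axis, where the left fern begins with a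
lobe pointing up and the right one with a lobe pointing up if and only if `u` is true. -/
structure HasFerns (G : IntrudedHexagon) (R : ℤ) (u : Bool) (a b : List ℕ) (y : ℕ) : Prop where
  lobes : G.lobes = leftFern (-(G.sw : ℤ)) true a ++ rightFern R u b
  tipL : G.tipL = -(G.sw : ℤ) + a.sum
  tipR : G.tipR = R - b.sum
  tips : G.tipL + y ≤ G.tipR
  sw_le : G.sw ≤ G.axis
  le_s : R ≤ G.s
  le_neEnd : R ≤ G.neEnd
  eq_or : R = G.s ∨ R = G.neEnd
  height : (covered true (leftFern (-(G.sw : ℤ)) true a)).card + (covered true (rightFern R u b)).card +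
    (G.neEnd - G.s).toNat + y + G.axis = G.sw + G.nw
  axis_eq : (covered false (leftFern (-(G.sw : ℤ)) true a)).card +
    (covered false (rightFern R u b)).card + (G.axis - G.sw) + (G.s - G.neEnd).toNat + y = G.axis

namespace HasFerns
variable {G : IntrudedHexagon} {R : ℤ} {u : Bool} {a b : List ℕ} {y : ℕ} (h : G.HasFerns R u a b y)

/-- The segments covered by lobes above the prolonged axis. -/
noncomputable def ups (G : IntrudedHexagon) (R : ℤ) (u : Bool) (a b : List ℕ) : Finset ℤ :=
  covered true (leftFern (-(G.sw : ℤ)) true a) ∪ covered true (rightFern R u b) ∪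
    Finset.Ico (G.s : ℤ) G.neEnd

/-- The segments covered by lobes below the prolonged axis. -/
noncomputable def downs (G : IntrudedHexagon) (R : ℤ) (u : Bool) (a b : List ℕ) : Finset ℤ :=
  covered false (leftFern (-(G.sw : ℤ)) true a) ∪ covered false (rightFern R u b) ∪
    (Finset.Ico (-(G.axis : ℤ)) (-(G.sw : ℤ)) ∪ Finset.Ico G.neEnd (G.s : ℤ))

include h

lemma mem_left (r : ℤ) : (r ∈ covered true (leftFern (-(G.sw : ℤ)) true a) ∨
    r ∈ covered false (leftFern (-(G.sw : ℤ)) true a) ↔ -(G.sw : ℤ) ≤ r ∧ r < G.tipL) ∧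
    ¬ (r ∈ covered true (leftFern (-(G.sw : ℤ)) true a) ∧
      r ∈ covered false (leftFern (-(G.sw : ℤ)) true a)) := by
  rw [h.tipL]
  exact ⟨mem_covered_leftFern _ _ true _, fun hh => covered_leftFern_not _ _ true _ hh.1 hh.2⟩

lemma mem_right (r : ℤ) : (r ∈ covered true (rightFern R u b) ∨ r ∈ covered false (rightFern R u b) ↔
    G.tipR ≤ r ∧ r < R) ∧
    ¬ (r ∈ covered true (rightFern R u b) ∧ r ∈ covered false (rightFern R u b)) := by
  rw [h.tipR]
  exact ⟨mem_covered_rightFern _ _ true _, fun hh => covered_rightFern_not _ _ true _ hh.1 hh.2⟩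

lemma disjoint_left_right (v w : Bool) : Disjoint (covered v (leftFern (-(G.sw : ℤ)) true a))
    (covered w (rightFern R u b)) := by
  rw [Finset.disjoint_left]
  intro r h1 h2
  have := h.mem_left r
  have := h.mem_right r
  have := h.tips
  cases v <;> cases w <;> grind

lemma disjoint_ups : Disjoint (covered true (leftFern (-(G.sw : ℤ)) true a) ∪
    covered true (rightFern R u b)) (Finset.Ico (G.s : ℤ) G.neEnd) := by
  rw [Finset.disjoint_left]
  intro r h1 h2
  have := h.mem_left r
  have := h.mem_right r
  have := h.tips
  have := h.le_s
  have : G.tipR ≤ R := by rw [h.tipR]; omega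
  rw [Finset.mem_union] at h1
  rw [Finset.mem_Ico] at h2
  grind

lemma disjoint_downs : Disjoint (covered false (leftFern (-(G.sw : ℤ)) true a) ∪
    covered false (rightFern R u b))
      (Finset.Ico (-(G.axis : ℤ)) (-(G.sw : ℤ)) ∪ Finset.Ico G.neEnd (G.s : ℤ)) := by
  rw [Finset.disjoint_left]
  intro r h1 h2
  have := h.mem_left r
  have := h.mem_right r
  have := h.tips
  have := h.le_neEnd
  have : G.tipR ≤ R := by rw [h.tipR]; omega
  have : -(G.sw : ℤ) ≤ G.tipL := by rw [h.tipL]; omega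
  rw [Finset.mem_union] at h1 h2
  rw [Finset.mem_Ico, Finset.mem_Ico] at h2
  grind

lemma disjoint_ends : Disjoint (Finset.Ico (-(G.axis : ℤ)) (-(G.sw : ℤ))) (Finset.Ico G.neEnd (G.s : ℤ)) := by
  rw [Finset.disjoint_left]
  intro r h1 h2
  have := h.tips
  have := h.le_neEnd
  have : G.tipR ≤ R := by rw [h.tipR]; omega
  have : -(G.sw : ℤ) ≤ G.tipL := by rw [h.tipL]; omega
  rw [Finset.mem_Ico] at h1 h2
  omega

/-- The blocked segments are those of the lobes together with the parts of the prolonged axis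
outside the hexagon. On the left these always count as blocked below; on the right they count as
blocked above or below according to the order of `s` and `neEnd`. -/
lemma spec : G.Spec (ups G R u a b) (downs G R u a b) y := by
  have m1 := h.mem_left
  have m2 := h.mem_right
  have t1 := h.tips
  have t2 := h.le_neEnd
  have t3 := h.le_s
  have t4 : G.tipR ≤ R := by rw [h.tipR]; omega
  have t5 : -(G.sw : ℤ) ≤ G.tipL := by rw [h.tipL]; omega
  have t6 := h.sw_le
  have t7 := h.eq_or
  have mu : ∀ r, r ∈ ups G R u a b ↔ r ∈ covered true (leftFern (-(G.sw : ℤ)) true a) ∨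
      r ∈ covered true (rightFern R u b) ∨ (G.s ≤ r ∧ r < G.neEnd) := by
    intro r; simp only [ups, Finset.mem_union, Finset.mem_Ico, or_assoc]
  have md : ∀ r, r ∈ downs G R u a b ↔ r ∈ covered false (leftFern (-(G.sw : ℤ)) true a) ∨
      r ∈ covered false (rightFern R u b) ∨ (-(G.axis : ℤ) ≤ r ∧ r < -(G.sw : ℤ)) ∨
        (G.neEnd ≤ r ∧ r < G.s) := by
    intro r; simp only [downs, Finset.mem_union, Finset.mem_Ico, or_assoc]
  have hl : ∀ l, l ∈ G.lobes ↔ l ∈ leftFern (-(G.sw : ℤ)) true a ∨ l ∈ rightFern R u b := by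
    intro l; rw [h.lobes, List.mem_append]
  constructor
  · have := h.height
    unfold ups
    rw [Finset.card_union_of_disjoint h.disjoint_ups,
      Finset.card_union_of_disjoint (h.disjoint_left_right _ _), Int.card_Ico]
    omega
  · have := h.axis_eq
    unfold downs
    rw [Finset.card_union_of_disjoint h.disjoint_downs,
      Finset.card_union_of_disjoint (h.disjoint_left_right _ _),
      Finset.card_union_of_disjoint h.disjoint_ends, Int.card_Ico, Int.card_Ico]
    omega
  · exact t6
  · exact t1
  · exact t5
  · omega
  · omega
  · rw [Finset.disjoint_left]
    intro r h1 h2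
    rw [mu] at h1
    rw [md] at h2
    have := m1 r
    have := m2 r
    grind
  · intro r
    rw [mu, md]
    have := m1 r
    have := m2 r
    grind
  · intro l hl'
    rcases (hl l).1 hl' with h' | h'
    · have := leftFern_range h'
      left
      rw [h.tipL]; exact this
    · have := rightFern_range h'
      right
      rw [h.tipR]; omega
  · intro l hl' hu p h1 h2
    rw [mu]
    rcases (hl l).1 hl' with h' | h'
    · exact Or.inl (mem_covered.2 ⟨l, h', hu, h1, h2⟩)
    · exact Or.inr (Or.inl (mem_covered.2 ⟨l, h', hu, h1, h2⟩))
  · intro l hl' hu p h1 h2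
    rw [md]
    rcases (hl l).1 hl' with h' | h'
    · exact Or.inl (mem_covered.2 ⟨l, h', hu, h1, h2⟩)
    · exact Or.inr (Or.inl (mem_covered.2 ⟨l, h', hu, h1, h2⟩))
  · intro p hp hps
    rw [mu] at hp
    rcases hp with hp | hp | hp
    · obtain ⟨l, h1, h2⟩ := mem_covered.1 hp
      exact ⟨l, (hl l).2 (Or.inl h1), h2⟩
    · obtain ⟨l, h1, h2⟩ := mem_covered.1 hp
      exact ⟨l, (hl l).2 (Or.inr h1), h2⟩
    · omega
  · intro p hp hps hpn
    rw [md] at hp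
    rcases hp with hp | hp | hp
    · obtain ⟨l, h1, h2⟩ := mem_covered.1 hp
      exact ⟨l, (hl l).2 (Or.inl h1), h2⟩
    · obtain ⟨l, h1, h2⟩ := mem_covered.1 hp
      exact ⟨l, (hl l).2 (Or.inr h1), h2⟩
    · omega
  · intro p hp
    rw [mu] at hp
    have := m1 p
    have := m2 p
    grind
  · intro p hp
    rw [md] at hp
    have := m1 p
    have := m2 p
    grind

end HasFerns
end IntrudedHexagon

lemma hasFerns_pHexagon (x y z t : ℕ) (a b : List ℕ) :
    (pHexagon x y z t a b).HasFerns (((z + oddSum a + oddSum b : ℕ) : ℤ) - t) true a b y := by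
  have h1 := card_covered_leftFern (-((y + t + evenSum a + evenSum b : ℕ) : ℤ)) true a
  have h2 := card_covered_rightFern (((z + oddSum a + oddSum b : ℕ) : ℤ) - t) true b
  have h3 := sum_eq_oddSum_add a
  have h4 := sum_eq_oddSum_add b
  have hn : (pHexagon x y z t a b).neEnd = ((z + oddSum a + oddSum b : ℕ) : ℤ) - t := by
    simp only [pHexagon, IntrudedHexagon.neEnd]; push_cast; ring
  simp only [Bool.not_true] at h1 h2
  constructor
  · rfl
  · rfl
  · rfl
  · simp only [pHexagon]; omega
  · simp only [pHexagon]; omega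
  · simp only [pHexagon]; omega
  · rw [hn]
  · rw [hn]; exact Or.inr rfl
  · rw [hn]
    simp only [pHexagon, h1, h2]; omega
  · rw [hn]
    simp only [pHexagon, h1, h2]; omega

lemma hasFerns_qHexagon (x y z t : ℕ) (a b : List ℕ) :
    (qHexagon x y z t a b).HasFerns (z + oddSum a + evenSum b : ℕ) false a b y := by
  have h1 := card_covered_leftFern (-((y + evenSum a + oddSum b : ℕ) : ℤ)) true a
  have h2 := card_covered_rightFern ((z + oddSum a + evenSum b : ℕ) : ℤ) false b
  have h3 := sum_eq_oddSum_add a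
  have h4 := sum_eq_oddSum_add b
  have hn : (qHexagon x y z t a b).neEnd = ((z + oddSum a + evenSum b : ℕ) : ℤ) + t := by
    simp only [qHexagon, IntrudedHexagon.neEnd]; push_cast; ring
  simp only [Bool.not_true, Bool.not_false] at h1 h2
  constructor
  · rfl
  · rfl
  · rfl
  · simp only [qHexagon]; omega
  · simp only [qHexagon]; omega
  · simp only [qHexagon]; omega
  · rw [hn]; omega
  · exact Or.inl rfl
  · rw [hn]
    simp only [qHexagon, h1, h2]; omega
  · rw [hn]
    simp only [qHexagon, h1, h2]; omega

end LozengeTiling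

/-! ### The weights of the extremal tilings in terms of the lobes -/

namespace LozengeTiling

lemma sum_bracket_congr {A : Finset ℤ} {f g : ℤ → ℕ} {c : ℕ} (h : ∀ p ∈ A, f p = g p) :
    ∑ p ∈ A, (bracket (f p) c : ℤ) = ∑ p ∈ A, (bracket (g p) c : ℤ) :=
  Finset.sum_congr rfl fun p hp => by rw [h p hp]

namespace IntrudedHexagon
namespace HasFerns
variable {G : IntrudedHexagon} {R : ℤ} {u : Bool} {a b : List ℕ} {y : ℕ} (h : G.HasFerns R u a b y)
include h

/-- Above the axis, the empty positions are those at the down-pointing lobes and the free ones not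
used by `S`. Below the axis the up-pointing lobes take this role. -/
lemma sum_sdiff_ups {S S' : Finset ℤ} (hS : ∀ p, (p ∈ S ∨ p ∈ S') ↔ G.tipL ≤ p ∧ p < G.tipR)
    (hd : Disjoint S S') (f : ℤ → ℤ) :
    ∑ p ∈ Finset.Ico (-(G.sw : ℤ)) G.neEnd \ (ups G R u a b ∪ S), f p =
      ∑ p ∈ covered false (leftFern (-(G.sw : ℤ)) true a), f p + ∑ p ∈ S', f p +
        ∑ p ∈ covered false (rightFern R u b), f p := by
  have m1 := h.mem_left
  have m2 := h.mem_right
  have t1 := h.tips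
  have t2 := h.le_neEnd
  have t3 := h.le_s
  have t4 : G.tipR ≤ R := by rw [h.tipR]; omega
  have t5 : -(G.sw : ℤ) ≤ G.tipL := by rw [h.tipL]; omega
  have t7 := h.eq_or
  rw [Finset.disjoint_left] at hd
  rw [← Finset.sum_union, ← Finset.sum_union]
  · refine Finset.sum_congr ?_ fun _ _ => rfl
    ext r
    simp only [ups, Finset.mem_union, Finset.mem_Ico, Finset.mem_sdiff]
    have := m1 r
    have := m2 r
    have := hS r
    have := @hd r
    grind
  · rw [Finset.disjoint_left]
    intro r h1 h2
    have := m1 r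
    have := m2 r
    have := hS r
    rw [Finset.mem_union] at h1
    grind
  · rw [Finset.disjoint_left]
    intro r h1 h2
    have := m1 r
    have := hS r
    grind

lemma sum_sdiff_downs {S S' : Finset ℤ} (hS : ∀ p, (p ∈ S ∨ p ∈ S') ↔ G.tipL ≤ p ∧ p < G.tipR)
    (hd : Disjoint S S') (f : ℤ → ℤ) :
    ∑ p ∈ Finset.Ico (-(G.axis : ℤ)) G.s \ (downs G R u a b ∪ S), f p =
      ∑ p ∈ covered true (leftFern (-(G.sw : ℤ)) true a), f p + ∑ p ∈ S', f p +
        ∑ p ∈ covered true (rightFern R u b), f p := by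
  have m1 := h.mem_left
  have m2 := h.mem_right
  have t1 := h.tips
  have t2 := h.le_neEnd
  have t3 := h.le_s
  have t4 : G.tipR ≤ R := by rw [h.tipR]; omega
  have t5 : -(G.sw : ℤ) ≤ G.tipL := by rw [h.tipL]; omega
  have t6 := h.sw_le
  have t7 := h.eq_or
  rw [Finset.disjoint_left] at hd
  rw [← Finset.sum_union, ← Finset.sum_union]
  · refine Finset.sum_congr ?_ fun _ _ => rfl
    ext r
    simp only [downs, Finset.mem_union, Finset.mem_Ico, Finset.mem_sdiff]
    have := m1 r
    have := m2 r
    have := hS r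
    have := @hd r
    grind
  · rw [Finset.disjoint_left]
    intro r h1 h2
    have := m1 r
    have := m2 r
    have := hS r
    rw [Finset.mem_union] at h1
    grind
  · rw [Finset.disjoint_left]
    intro r h1 h2
    have := m1 r
    have := hS r
    grind

lemma card_ups {S : Finset ℤ} (hS : S ⊆ Finset.Ico G.tipL G.tipR) {p : ℤ} (hp : p < R) :
    highCard (ups G R u a b ∪ S) p = highCard (covered true (leftFern (-(G.sw : ℤ)) true a)) p +
      highCard (covered true (rightFern R u b)) p + (G.neEnd - G.s).toNat + highCard S p ∧
    lowCard (ups G R u a b ∪ S) p = lowCard (covered true (leftFern (-(G.sw : ℤ)) true a)) p +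
      lowCard (covered true (rightFern R u b)) p + lowCard S p := by
  have t := h.le_s
  rw [highCard_union (h.spec.free_disjoint hS).1, lowCard_union (h.spec.free_disjoint hS).1]
  unfold ups
  rw [highCard_union h.disjoint_ups, highCard_union (h.disjoint_left_right _ _),
    lowCard_union h.disjoint_ups, lowCard_union (h.disjoint_left_right _ _),
    highCard_of_lt (A := Finset.Ico (G.s : ℤ) G.neEnd) fun r hr => by
      have := Finset.mem_Ico.1 hr; omega,
    lowCard_of_le (A := Finset.Ico (G.s : ℤ) G.neEnd) fun r hr => by
      have := Finset.mem_Ico.1 hr; omega, Int.card_Ico]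
  simp

lemma card_downs {S : Finset ℤ} (hS : S ⊆ Finset.Ico G.tipL G.tipR) {p : ℤ} (hp : p < R)
    (hp' : -(G.sw : ℤ) ≤ p) :
    highCard (downs G R u a b ∪ S) p = highCard (covered false (leftFern (-(G.sw : ℤ)) true a)) p +
      highCard (covered false (rightFern R u b)) p + (G.s - G.neEnd).toNat + highCard S p ∧
    lowCard (downs G R u a b ∪ S) p = lowCard (covered false (leftFern (-(G.sw : ℤ)) true a)) p +
      lowCard (covered false (rightFern R u b)) p + (G.axis - G.sw) + lowCard S p := by
  have t := h.le_neEnd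
  rw [highCard_union (h.spec.free_disjoint hS).2, lowCard_union (h.spec.free_disjoint hS).2]
  unfold downs
  rw [highCard_union h.disjoint_downs, highCard_union (h.disjoint_left_right _ _),
    lowCard_union h.disjoint_downs, lowCard_union (h.disjoint_left_right _ _),
    highCard_union h.disjoint_ends, lowCard_union h.disjoint_ends,
    highCard_of_lt (A := Finset.Ico G.neEnd (G.s : ℤ)) fun r hr => by
      have := Finset.mem_Ico.1 hr; omega,
    lowCard_of_le (A := Finset.Ico G.neEnd (G.s : ℤ)) fun r hr => by
      have := Finset.mem_Ico.1 hr; omega,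
    highCard_of_le (A := Finset.Ico (-(G.axis : ℤ)) (-(G.sw : ℤ))) fun r hr => by
      have := Finset.mem_Ico.1 hr; omega,
    lowCard_of_lt (A := Finset.Ico (-(G.axis : ℤ)) (-(G.sw : ℤ))) fun r hr => by
      have := Finset.mem_Ico.1 hr; omega, Int.card_Ico, Int.card_Ico]
  constructor <;> omega

lemma range_left {v : Bool} {p : ℤ} (hp : p ∈ covered v (leftFern (-(G.sw : ℤ)) true a)) :
    -(G.sw : ℤ) ≤ p ∧ p < G.tipL := by
  rw [h.tipL]; exact covered_leftFern_range hp

lemma range_right {v : Bool} {p : ℤ} (hp : p ∈ covered v (rightFern R u b)) :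
    G.tipR ≤ p ∧ p < R := by
  have := h.mem_right p
  cases v <;> grind

/-- The counts of a fern to the right of a point. -/
lemma low_left {v : Bool} {p : ℤ} (hp : G.tipL ≤ p) :
    lowCard (covered v (leftFern (-(G.sw : ℤ)) true a)) p =
      (covered v (leftFern (-(G.sw : ℤ)) true a)).card ∧
    highCard (covered v (leftFern (-(G.sw : ℤ)) true a)) p = 0 :=
  ⟨lowCard_of_lt fun r hr => by have := h.range_left hr; omega,
    highCard_of_le fun r hr => by have := h.range_left hr; omega⟩

/-- The counts of a fern to the left of a point. -/
lemma high_right {v : Bool} {p : ℤ} (hp : p < G.tipR) :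
    highCard (covered v (rightFern R u b)) p = (covered v (rightFern R u b)).card ∧
    lowCard (covered v (rightFern R u b)) p = 0 :=
  ⟨highCard_of_lt fun r hr => by have := h.range_right hr; omega,
    lowCard_of_le fun r hr => by have := h.range_right hr; omega⟩

omit h in
lemma add_left {v : Bool} {p : ℤ} (hp : p ∈ covered v (leftFern (-(G.sw : ℤ)) true a)) :
    lowCard (covered (!v) (leftFern (-(G.sw : ℤ)) true a)) p +
      highCard (covered (!v) (leftFern (-(G.sw : ℤ)) true a)) p =
      (covered (!v) (leftFern (-(G.sw : ℤ)) true a)).card :=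
  lowCard_add_highCard (covered_leftFern_not _ _ _ _ hp)

omit h in
lemma add_right {v : Bool} {p : ℤ} (hp : p ∈ covered v (rightFern R u b)) :
    lowCard (covered (!v) (rightFern R u b)) p + highCard (covered (!v) (rightFern R u b)) p =
      (covered (!v) (rightFern R u b)).card :=
  lowCard_add_highCard (covered_rightFern_not _ _ _ _ hp)

/-- The weight of the lowest tiling in terms of the ferns. -/
lemma expo_min {T : Finset Lozenge} (hT : T ∈ tilings G.region)
    (hc : G.chains T = minPair (ups G R u a b) (downs G R u a b) G.tipL y) {z : ℕ}
    (hz : G.tipL + y + z = G.tipR) :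
    expo .right T =
      ∑ p ∈ covered true (leftFern (-(G.sw : ℤ)) true a),
        bracket (G.axis - G.sw + lowCard (covered false (leftFern (-(G.sw : ℤ)) true a)) p) 0 +
      z * bracket (G.axis - G.sw + (covered false (leftFern (-(G.sw : ℤ)) true a)).card + y) 0 +
      ∑ p ∈ covered true (rightFern R u b),
        bracket (G.axis - G.sw + (covered false (leftFern (-(G.sw : ℤ)) true a)).card + y +
          (covered false (rightFern R u b)).card - highCard (covered false (rightFern R u b)) p) 0 +
      ∑ p ∈ covered false (leftFern (-(G.sw : ℤ)) true a),
        bracket (G.axis + y + (covered true (leftFern (-(G.sw : ℤ)) true a)).card +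
          (covered true (rightFern R u b)).card + (G.neEnd - G.s).toNat -
            lowCard (covered true (leftFern (-(G.sw : ℤ)) true a)) p) G.axis +
      z * bracket (G.axis + (covered true (rightFern R u b)).card + (G.neEnd - G.s).toNat) G.axis +
      ∑ p ∈ covered false (rightFern R u b),
        bracket (G.axis + (G.neEnd - G.s).toNat + highCard (covered true (rightFern R u b)) p)
          G.axis := by
  have t4 : G.tipR ≤ R := by rw [h.tipR]; omega
  have t5 : -(G.sw : ℤ) ≤ G.tipL := by rw [h.tipL]; omega
  -- For the lowest surface `S` is the leftmost block of the free segment. All `z` unused free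
  -- positions have the left fern and `S` on their left and the right fern on their right, so they
  -- contribute the same brackets; this is the source of the two terms with factor `z`.
  obtain ⟨S, hS⟩ : ∃ S, S = Finset.Ico G.tipL (G.tipL + y) := ⟨_, rfl⟩
  have hS0 : S ⊆ Finset.Ico G.tipL G.tipR := hS ▸ Finset.Ico_subset_Ico le_rfl h.tips
  have hSc : S.card = y := by rw [hS]; simp
  have hSm : ∀ p, p ∈ S ↔ G.tipL ≤ p ∧ p < G.tipL + y := fun p => by rw [hS, Finset.mem_Ico]
  have hSS : ∀ p, (p ∈ S ∨ p ∈ Finset.Ico (G.tipL + y) G.tipR) ↔ G.tipL ≤ p ∧ p < G.tipR := by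
    intro p; rw [hSm, Finset.mem_Ico]; omega
  have hSd : Disjoint S (Finset.Ico (G.tipL + y) G.tipR) := by
    rw [Finset.disjoint_left]
    intro p hp hp'
    have := (hSm p).1 hp
    have := Finset.mem_Ico.1 hp'
    omega
  have key := h.spec.expo_right_min hT hc hS
  rw [h.sum_sdiff_ups hSS hSd, h.sum_sdiff_downs hSS hSd] at key
  zify
  rw [key]
  have e1 : ∀ p ∈ covered false (leftFern (-(G.sw : ℤ)) true a),
      G.axis + highCard (ups G R u a b ∪ S) p =
        G.axis + y + (covered true (leftFern (-(G.sw : ℤ)) true a)).card +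
          (covered true (rightFern R u b)).card + (G.neEnd - G.s).toNat -
            lowCard (covered true (leftFern (-(G.sw : ℤ)) true a)) p := by
    intro p hp
    have hr := h.range_left hp
    have := add_left hp
    rw [(h.card_ups hS0 (by omega)).1, (h.high_right (by omega)).1,
      highCard_of_lt (A := S) fun r hr' => by have := (hSm r).1 hr'; omega, hSc]
    simp only [Bool.not_false] at this
    omega
  have e2 : ∀ p ∈ Finset.Ico (G.tipL + y) G.tipR, G.axis + highCard (ups G R u a b ∪ S) p =
      G.axis + (covered true (rightFern R u b)).card + (G.neEnd - G.s).toNat := by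
    intro p hp
    have hr := Finset.mem_Ico.1 hp
    rw [(h.card_ups hS0 (by omega)).1, (h.high_right (by omega)).1, (h.low_left (by omega)).2,
      highCard_of_le (A := S) fun r hr' => by have := (hSm r).1 hr'; omega]
    omega
  have e3 : ∀ p ∈ covered false (rightFern R u b), G.axis + highCard (ups G R u a b ∪ S) p =
      G.axis + (G.neEnd - G.s).toNat + highCard (covered true (rightFern R u b)) p := by
    intro p hp
    have hr := h.range_right hp
    rw [(h.card_ups hS0 (by omega)).1, (h.low_left (by omega)).2,
      highCard_of_le (A := S) fun r hr' => by have := (hSm r).1 hr'; omega]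
    omega
  have e4 : ∀ p ∈ covered true (leftFern (-(G.sw : ℤ)) true a), lowCard (downs G R u a b ∪ S) p =
      G.axis - G.sw + lowCard (covered false (leftFern (-(G.sw : ℤ)) true a)) p := by
    intro p hp
    have hr := h.range_left hp
    rw [(h.card_downs hS0 (by omega) (by omega)).2, (h.high_right (by omega)).2,
      lowCard_of_le (A := S) fun r hr' => by have := (hSm r).1 hr'; omega]
    omega
  have e5 : ∀ p ∈ Finset.Ico (G.tipL + y) G.tipR, lowCard (downs G R u a b ∪ S) p =
      G.axis - G.sw + (covered false (leftFern (-(G.sw : ℤ)) true a)).card + y := by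
    intro p hp
    have hr := Finset.mem_Ico.1 hp
    rw [(h.card_downs hS0 (by omega) (by omega)).2, (h.high_right (by omega)).2,
      (h.low_left (by omega)).1,
      lowCard_of_lt (A := S) fun r hr' => by have := (hSm r).1 hr'; omega, hSc]
    omega
  have e6 : ∀ p ∈ covered true (rightFern R u b), lowCard (downs G R u a b ∪ S) p =
      G.axis - G.sw + (covered false (leftFern (-(G.sw : ℤ)) true a)).card + y +
          (covered false (rightFern R u b)).card - highCard (covered false (rightFern R u b)) p := by
    intro p hp
    have hr := h.range_right hp
    have := add_right hp
    rw [(h.card_downs hS0 (by omega) (by omega)).2, (h.low_left (by omega)).1,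
      lowCard_of_lt (A := S) fun r hr' => by have := (hSm r).1 hr'; omega, hSc]
    simp only [Bool.not_true] at this
    omega
  rw [sum_bracket_congr e1, sum_bracket_congr e2, sum_bracket_congr e3, sum_bracket_congr e4,
    sum_bracket_congr e5, sum_bracket_congr e6, Finset.sum_const, Finset.sum_const, Int.card_Ico,
    show (G.tipR - (G.tipL + y)).toNat = z by omega]
  simp only [nsmul_eq_mul]
  ring

/-- The weight of the highest tiling in terms of the ferns. -/
lemma expo_max {T : Finset Lozenge} (hT : T ∈ tilings G.region)
    (hc : G.chains T = maxPair (ups G R u a b) (downs G R u a b) G.tipR y) {z : ℕ}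
    (hz : G.tipL + y + z = G.tipR) :
    expo .left T =
      ∑ p ∈ covered true (leftFern (-(G.sw : ℤ)) true a),
        bracket (y + (covered false (leftFern (-(G.sw : ℤ)) true a)).card +
          (covered false (rightFern R u b)).card + (G.s - G.neEnd).toNat -
            lowCard (covered false (leftFern (-(G.sw : ℤ)) true a)) p) 0 +
      z * bracket (y + (covered false (rightFern R u b)).card + (G.s - G.neEnd).toNat) 0 +
      ∑ p ∈ covered true (rightFern R u b),
        bracket ((G.s - G.neEnd).toNat + highCard (covered false (rightFern R u b)) p) 0 +
      ∑ p ∈ covered false (leftFern (-(G.sw : ℤ)) true a),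
        bracket (G.axis + lowCard (covered true (leftFern (-(G.sw : ℤ)) true a)) p) G.axis +
      z * bracket (G.axis + (covered true (leftFern (-(G.sw : ℤ)) true a)).card) G.axis +
      ∑ p ∈ covered false (rightFern R u b),
        bracket (G.axis + y + (covered true (leftFern (-(G.sw : ℤ)) true a)).card +
          (covered true (rightFern R u b)).card - highCard (covered true (rightFern R u b)) p)
          G.axis := by
  have t4 : G.tipR ≤ R := by rw [h.tipR]; omega
  have t5 : -(G.sw : ℤ) ≤ G.tipL := by rw [h.tipL]; omega
  obtain ⟨S, hS⟩ : ∃ S, S = Finset.Ico (G.tipR - y) G.tipR := ⟨_, rfl⟩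
  have hS0 : S ⊆ Finset.Ico G.tipL G.tipR :=
    hS ▸ Finset.Ico_subset_Ico (by have := h.tips; omega) le_rfl
  have hSc : S.card = y := by rw [hS]; simp
  have hSm : ∀ p, p ∈ S ↔ G.tipR - y ≤ p ∧ p < G.tipR := fun p => by rw [hS, Finset.mem_Ico]
  have hSS : ∀ p, (p ∈ S ∨ p ∈ Finset.Ico G.tipL (G.tipR - y)) ↔ G.tipL ≤ p ∧ p < G.tipR := by
    intro p; rw [hSm, Finset.mem_Ico]; omega
  have hSd : Disjoint S (Finset.Ico G.tipL (G.tipR - y)) := by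
    rw [Finset.disjoint_left]
    intro p hp hp'
    have := (hSm p).1 hp
    have := Finset.mem_Ico.1 hp'
    omega
  have key := h.spec.expo_left_max hT hc hS
  rw [h.sum_sdiff_ups hSS hSd, h.sum_sdiff_downs hSS hSd] at key
  zify
  rw [key]
  have e1 : ∀ p ∈ covered false (leftFern (-(G.sw : ℤ)) true a),
      G.axis + lowCard (ups G R u a b ∪ S) p =
        G.axis + lowCard (covered true (leftFern (-(G.sw : ℤ)) true a)) p := by
    intro p hp
    have hr := h.range_left hp
    rw [(h.card_ups hS0 (by omega)).2, (h.high_right (by omega)).2,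
      lowCard_of_le (A := S) fun r hr' => by have := (hSm r).1 hr'; omega]
    omega
  have e2 : ∀ p ∈ Finset.Ico G.tipL (G.tipR - y), G.axis + lowCard (ups G R u a b ∪ S) p =
      G.axis + (covered true (leftFern (-(G.sw : ℤ)) true a)).card := by
    intro p hp
    have hr := Finset.mem_Ico.1 hp
    rw [(h.card_ups hS0 (by omega)).2, (h.high_right (by omega)).2, (h.low_left (by omega)).1,
      lowCard_of_le (A := S) fun r hr' => by have := (hSm r).1 hr'; omega]
    omega
  have e3 : ∀ p ∈ covered false (rightFern R u b), G.axis + lowCard (ups G R u a b ∪ S) p =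
      G.axis + y + (covered true (leftFern (-(G.sw : ℤ)) true a)).card +
          (covered true (rightFern R u b)).card - highCard (covered true (rightFern R u b)) p := by
    intro p hp
    have hr := h.range_right hp
    have := add_right hp
    rw [(h.card_ups hS0 (by omega)).2, (h.low_left (by omega)).1,
      lowCard_of_lt (A := S) fun r hr' => by have := (hSm r).1 hr'; omega, hSc]
    simp only [Bool.not_false] at this
    omega
  have e4 : ∀ p ∈ covered true (leftFern (-(G.sw : ℤ)) true a), highCard (downs G R u a b ∪ S) p =
      y + (covered false (leftFern (-(G.sw : ℤ)) true a)).card +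
          (covered false (rightFern R u b)).card + (G.s - G.neEnd).toNat -
            lowCard (covered false (leftFern (-(G.sw : ℤ)) true a)) p := by
    intro p hp
    have hr := h.range_left hp
    have := add_left hp
    rw [(h.card_downs hS0 (by omega) (by omega)).1, (h.high_right (by omega)).1,
      highCard_of_lt (A := S) fun r hr' => by have := (hSm r).1 hr'; omega, hSc]
    simp only [Bool.not_true] at this
    omega
  have e5 : ∀ p ∈ Finset.Ico G.tipL (G.tipR - y), highCard (downs G R u a b ∪ S) p =
      y + (covered false (rightFern R u b)).card + (G.s - G.neEnd).toNat := by
    intro p hp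
    have hr := Finset.mem_Ico.1 hp
    rw [(h.card_downs hS0 (by omega) (by omega)).1, (h.high_right (by omega)).1,
      (h.low_left (by omega)).2,
      highCard_of_lt (A := S) fun r hr' => by have := (hSm r).1 hr'; omega, hSc]
    omega
  have e6 : ∀ p ∈ covered true (rightFern R u b), highCard (downs G R u a b ∪ S) p =
      (G.s - G.neEnd).toNat + highCard (covered false (rightFern R u b)) p := by
    intro p hp
    have hr := h.range_right hp
    rw [(h.card_downs hS0 (by omega) (by omega)).1, (h.low_left (by omega)).2,
      highCard_of_le (A := S) fun r hr' => by have := (hSm r).1 hr'; omega]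
    omega
  rw [sum_bracket_congr e1, sum_bracket_congr e2, sum_bracket_congr e3, sum_bracket_congr e4,
    sum_bracket_congr e5, sum_bracket_congr e6, Finset.sum_const, Finset.sum_const, Int.card_Ico,
    show (G.tipR - y - G.tipL).toNat = z by omega]
  simp only [nsmul_eq_mul]
  ring

end HasFerns
end IntrudedHexagon

open IntrudedHexagon

lemma expo_min_pHexagon {x y z t : ℕ} {a b : List ℕ} {T : Finset Lozenge}
    (hT : T ∈ tilings (pHexagon x y z t a b).region) {U D : Finset ℤ}
    (hU : U = HasFerns.ups (pHexagon x y z t a b) (((z + oddSum a + oddSum b : ℕ) : ℤ) - t) true a b)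
    (hD : D = HasFerns.downs (pHexagon x y z t a b) (((z + oddSum a + oddSum b : ℕ) : ℤ) - t) true a b)
    (hc : (pHexagon x y z t a b).chains T = minPair U D (pHexagon x y z t a b).tipL y) :
    expo .right T = expA₁ x y z t a b := by
  subst hU hD
  have h1 := card_covered_leftFern (-((y + t + evenSum a + evenSum b : ℕ) : ℤ)) true a
  have h2 := card_covered_rightFern (((z + oddSum a + oddSum b : ℕ) : ℤ) - t) true b
  have h3 := sum_eq_oddSum_add a
  have h4 := sum_eq_oddSum_add b
  have hn : (pHexagon x y z t a b).neEnd = ((z + oddSum a + oddSum b : ℕ) : ℤ) - t := by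
    simp only [pHexagon, IntrudedHexagon.neEnd]; push_cast; ring
  have hs : (pHexagon x y z t a b).s = z + oddSum a + oddSum b := rfl
  have hsw : (pHexagon x y z t a b).sw = y + t + evenSum a + evenSum b := rfl
  have hax : (pHexagon x y z t a b).axis = x + y + t + evenSum a + evenSum b := rfl
  rw [(hasFerns_pHexagon x y z t a b).expo_min hT hc (z := z)
    (by simp only [pHexagon]; omega), hn, hs, hsw, hax]
  have a1 := fun g => sum_leftFern (-((y + t + evenSum a + evenSum b : ℕ) : ℤ)) true a g
  have a2 := fun g => sum_rightFern (((z + oddSum a + oddSum b : ℕ) : ℤ) - t) true b g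
  simp only [Bool.not_true] at h1 h2 a1 a2
  rw [h1.1, h1.2, h2.1, h2.2]
  -- In a `P`-region the northeast line meets the axis `t` units to the left of `s`, so the
  -- truncated difference is zero.
  rw [show (((z + oddSum a + oddSum b : ℕ) : ℤ) - t - (z + oddSum a + oddSum b : ℕ)).toNat = 0 by omega,
    show x + y + t + evenSum a + evenSum b - (y + t + evenSum a + evenSum b) = x by omega]
  rw [(a1 fun k => bracket (x + k) 0).1,
    (a2 fun k => bracket (x + evenSum a + y + evenSum b - k) 0).1,
    (a1 fun k => bracket (x + y + t + evenSum a + evenSum b + y + oddSum a + oddSum b + 0 - k)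
      (x + y + t + evenSum a + evenSum b)).2,
    (a2 fun k => bracket (x + y + t + evenSum a + evenSum b + 0 + k)
      (x + y + t + evenSum a + evenSum b)).2]
  simp only [oddLobes, evenLobes, expA₁, add_zero]
  rw [show x + evenSum a + y = x + y + evenSum a by ring]

end LozengeTiling

namespace LozengeTiling
open IntrudedHexagon

lemma expo_max_pHexagon {x y z t : ℕ} {a b : List ℕ} {T : Finset Lozenge}
    (hT : T ∈ tilings (pHexagon x y z t a b).region) {U D : Finset ℤ}
    (hU : U = HasFerns.ups (pHexagon x y z t a b) (((z + oddSum a + oddSum b : ℕ) : ℤ) - t) true a b)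
    (hD : D = HasFerns.downs (pHexagon x y z t a b) (((z + oddSum a + oddSum b : ℕ) : ℤ) - t) true a b)
    (hc : (pHexagon x y z t a b).chains T = maxPair U D (pHexagon x y z t a b).tipR y) :
    expo .left T = expA₂ x y z t a b := by
  subst hU hD
  have h1 := card_covered_leftFern (-((y + t + evenSum a + evenSum b : ℕ) : ℤ)) true a
  have h2 := card_covered_rightFern (((z + oddSum a + oddSum b : ℕ) : ℤ) - t) true b
  have h3 := sum_eq_oddSum_add a
  have h4 := sum_eq_oddSum_add b
  have hn : (pHexagon x y z t a b).neEnd = ((z + oddSum a + oddSum b : ℕ) : ℤ) - t := by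
    simp only [pHexagon, IntrudedHexagon.neEnd]; push_cast; ring
  have hs : (pHexagon x y z t a b).s = z + oddSum a + oddSum b := rfl
  have hsw : (pHexagon x y z t a b).sw = y + t + evenSum a + evenSum b := rfl
  have hax : (pHexagon x y z t a b).axis = x + y + t + evenSum a + evenSum b := rfl
  rw [(hasFerns_pHexagon x y z t a b).expo_max hT hc (z := z)
    (by simp only [pHexagon]; omega), hn, hs, hsw, hax]
  have a1 := fun g => sum_leftFern (-((y + t + evenSum a + evenSum b : ℕ) : ℤ)) true a g
  have a2 := fun g => sum_rightFern (((z + oddSum a + oddSum b : ℕ) : ℤ) - t) true b g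
  simp only [Bool.not_true] at h1 h2 a1 a2
  rw [h1.1, h1.2, h2.1, h2.2]
  rw [show (((z + oddSum a + oddSum b : ℕ) : ℤ) - (((z + oddSum a + oddSum b : ℕ) : ℤ) - t)).toNat = t
    by omega]
  rw [(a1 fun k => bracket (y + evenSum a + evenSum b + t - k) 0).1,
    (a2 fun k => bracket (t + k) 0).1,
    (a1 fun k => bracket (x + y + t + evenSum a + evenSum b + k)
      (x + y + t + evenSum a + evenSum b)).2,
    (a2 fun k => bracket (x + y + t + evenSum a + evenSum b + y + oddSum a + oddSum b - k)
      (x + y + t + evenSum a + evenSum b)).2]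
  simp only [oddLobes, evenLobes, expA₂]
  rw [show y + evenSum a + evenSum b + t = y + t + evenSum a + evenSum b by ring,
    show y + evenSum b + t = y + t + evenSum b by ring]

lemma expo_min_qHexagon {x y z t : ℕ} {a b : List ℕ} {T : Finset Lozenge}
    (hT : T ∈ tilings (qHexagon x y z t a b).region) {U D : Finset ℤ}
    (hU : U = HasFerns.ups (qHexagon x y z t a b) (z + oddSum a + evenSum b : ℕ) false a b)
    (hD : D = HasFerns.downs (qHexagon x y z t a b) (z + oddSum a + evenSum b : ℕ) false a b)
    (hc : (qHexagon x y z t a b).chains T = minPair U D (qHexagon x y z t a b).tipL y) :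
    expo .right T = expB₁ x y z t a b := by
  subst hU hD
  have h1 := card_covered_leftFern (-((y + evenSum a + oddSum b : ℕ) : ℤ)) true a
  have h2 := card_covered_rightFern ((z + oddSum a + evenSum b : ℕ) : ℤ) false b
  have h3 := sum_eq_oddSum_add a
  have h4 := sum_eq_oddSum_add b
  have hn : (qHexagon x y z t a b).neEnd = ((z + oddSum a + evenSum b : ℕ) : ℤ) + t := by
    simp only [qHexagon, IntrudedHexagon.neEnd]; push_cast; ring
  have hs : (qHexagon x y z t a b).s = z + oddSum a + evenSum b := rfl
  have hsw : (qHexagon x y z t a b).sw = y + evenSum a + oddSum b := rfl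
  have hax : (qHexagon x y z t a b).axis = x + y + evenSum a + oddSum b := rfl
  rw [(hasFerns_qHexagon x y z t a b).expo_min hT hc (z := z)
    (by simp only [qHexagon]; omega), hn, hs, hsw, hax]
  have a1 := fun g => sum_leftFern (-((y + evenSum a + oddSum b : ℕ) : ℤ)) true a g
  have a2 := fun g => sum_rightFern ((z + oddSum a + evenSum b : ℕ) : ℤ) false b g
  simp only [Bool.not_true, Bool.not_false] at h1 h2 a1 a2
  rw [h1.1, h1.2, h2.1, h2.2]
  rw [show (((z + oddSum a + evenSum b : ℕ) : ℤ) + t - (z + oddSum a + evenSum b : ℕ)).toNat = t by omega,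
    show x + y + evenSum a + oddSum b - (y + evenSum a + oddSum b) = x by omega]
  rw [(a1 fun k => bracket (x + k) 0).1,
    (a2 fun k => bracket (x + evenSum a + y + oddSum b - k) 0).2,
    (a1 fun k => bracket (x + y + evenSum a + oddSum b + y + oddSum a + evenSum b + t - k)
      (x + y + evenSum a + oddSum b)).2,
    (a2 fun k => bracket (x + y + evenSum a + oddSum b + t + k)
      (x + y + evenSum a + oddSum b)).1]
  simp only [oddLobes, evenLobes, expB₁]
  rw [show x + evenSum a + y = x + y + evenSum a by ring,
    show x + y + evenSum a + oddSum b + y + oddSum a + evenSum b + t =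
      x + y + evenSum a + oddSum b + y + t + oddSum a + evenSum b by ring,
    show x + y + evenSum a + oddSum b + evenSum b + t = x + y + evenSum a + oddSum b + t + evenSum b by
      ring]

lemma expo_max_qHexagon {x y z t : ℕ} {a b : List ℕ} {T : Finset Lozenge}
    (hT : T ∈ tilings (qHexagon x y z t a b).region) {U D : Finset ℤ}
    (hU : U = HasFerns.ups (qHexagon x y z t a b) (z + oddSum a + evenSum b : ℕ) false a b)
    (hD : D = HasFerns.downs (qHexagon x y z t a b) (z + oddSum a + evenSum b : ℕ) false a b)
    (hc : (qHexagon x y z t a b).chains T = maxPair U D (qHexagon x y z t a b).tipR y) :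
    expo .left T = expB₂ x y z t a b := by
  subst hU hD
  have h1 := card_covered_leftFern (-((y + evenSum a + oddSum b : ℕ) : ℤ)) true a
  have h2 := card_covered_rightFern ((z + oddSum a + evenSum b : ℕ) : ℤ) false b
  have h3 := sum_eq_oddSum_add a
  have h4 := sum_eq_oddSum_add b
  have hn : (qHexagon x y z t a b).neEnd = ((z + oddSum a + evenSum b : ℕ) : ℤ) + t := by
    simp only [qHexagon, IntrudedHexagon.neEnd]; push_cast; ring
  have hs : (qHexagon x y z t a b).s = z + oddSum a + evenSum b := rfl
  have hsw : (qHexagon x y z t a b).sw = y + evenSum a + oddSum b := rfl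
  have hax : (qHexagon x y z t a b).axis = x + y + evenSum a + oddSum b := rfl
  rw [(hasFerns_qHexagon x y z t a b).expo_max hT hc (z := z)
    (by simp only [qHexagon]; omega), hn, hs, hsw, hax]
  have a1 := fun g => sum_leftFern (-((y + evenSum a + oddSum b : ℕ) : ℤ)) true a g
  have a2 := fun g => sum_rightFern ((z + oddSum a + evenSum b : ℕ) : ℤ) false b g
  simp only [Bool.not_true, Bool.not_false] at h1 h2 a1 a2
  rw [h1.1, h1.2, h2.1, h2.2]
  rw [show (((z + oddSum a + evenSum b : ℕ) : ℤ) - (((z + oddSum a + evenSum b : ℕ) : ℤ) + t)).toNat = 0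
    by omega]
  rw [(a1 fun k => bracket (y + evenSum a + oddSum b + 0 - k) 0).1,
    (a2 fun k => bracket (0 + k) 0).2,
    (a1 fun k => bracket (x + y + evenSum a + oddSum b + k) (x + y + evenSum a + oddSum b)).2,
    (a2 fun k => bracket (x + y + evenSum a + oddSum b + y + oddSum a + evenSum b - k)
      (x + y + evenSum a + oddSum b)).1]
  simp only [oddLobes, evenLobes, expB₂, add_zero, zero_add]

end LozengeTiling

namespace LozengeTiling
/-! ### Rotation of a hexagon -/

/-- The rotation by `π` about the centre of a hexagon, for lozenges. -/
def Lozenge.rotate (c H : ℤ) (l : Lozenge) : Lozenge :=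
  match l.kind with
  | .right => ⟨.right, c - 1 - l.i, H - 1 - l.j⟩
  | .left => ⟨.left, c - l.i, H - 1 - l.j⟩
  | .vertical => ⟨.vertical, c - 1 - l.i, H - l.j⟩

lemma Lozenge.rotate_rotate (c H : ℤ) (l : Lozenge) : (l.rotate c H).rotate c H = l := by
  obtain ⟨k, i, j⟩ := l
  cases k <;> simp [Lozenge.rotate]

lemma ind_rotate (c H : ℤ) (T : Finset Lozenge) (l : Lozenge) :
    ind (T.image (Lozenge.rotate c H)) l = ind T (l.rotate c H) := by
  unfold ind
  congr 1
  rw [Finset.mem_image, eq_iff_iff]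
  constructor
  · rintro ⟨l', h, rfl⟩
    rwa [Lozenge.rotate_rotate]
  · intro h
    exact ⟨_, h, Lozenge.rotate_rotate c H l⟩

lemma rotate_mem_tilings {c H : ℤ} {R : Finset UnitTriangle}
    (hR : ∀ i j, (⟨true, i, j⟩ : UnitTriangle) ∈ R ↔
      (⟨false, c - 1 - i, H - 1 - j⟩ : UnitTriangle) ∈ R) {T : Finset Lozenge} (hT : T ∈ tilings R) :
    T.image (Lozenge.rotate c H) ∈ tilings R := by
  obtain ⟨h1, h2, h3⟩ := mem_tilings.1 hT
  have hR' : ∀ i j, (⟨false, i, j⟩ : UnitTriangle) ∈ R ↔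
      (⟨true, c - 1 - i, H - 1 - j⟩ : UnitTriangle) ∈ R := by
    intro i j
    rw [hR]
    simp
  refine mem_tilings.2 ⟨?_, fun i j h => ?_, fun i j h => ?_⟩
  · intro l hl
    obtain ⟨⟨k, i, j⟩, hl', rfl⟩ := Finset.mem_image.1 hl
    obtain ⟨u, d⟩ := h1 _ hl'
    cases k <;> simp only [Lozenge.rotate, Lozenge.upTriangle, Lozenge.downTriangle] at u d ⊢ <;>
      rw [hR] at u <;> rw [hR'] at d
    · exact ⟨d, u⟩
    · refine ⟨by convert d using 2; ring, by convert u using 2; ring⟩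
    · refine ⟨by convert d using 2; ring, by convert u using 2; ring⟩
  · simp only [ind_rotate, Lozenge.rotate]
    have := h3 _ _ ((hR i j).1 h)
    rwa [show c - 1 - i + 1 = c - i by ring, show H - 1 - j + 1 = H - j by ring] at this
  · simp only [ind_rotate, Lozenge.rotate]
    have := h2 _ _ ((hR' i j).1 h)
    convert this using 4 <;> ring_nf

/-- The rotation maps a right-tilting lozenge with top side at height `h` to one with top side at
height `H + 1 - h`. -/
lemma expo_rotate {R : Finset UnitTriangle} {c H : ℤ} (hR : ∀ τ ∈ R, 0 ≤ τ.j ∧ τ.j < H)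
    {T : Finset Lozenge} (hT : T ∈ tilings R) :
    (expo .right (T.image (Lozenge.rotate c H)) : ℤ) =
      (H + 1) * (T.filter fun l => l.kind = .right).card - expo .right T := by
  have h1 := (mem_tilings.1 hT).1
  unfold expo
  rw [Finset.sum_image fun l _ l' _ h => by
    rw [← Lozenge.rotate_rotate c H l, h, Lozenge.rotate_rotate], Finset.card_filter]
  push_cast
  rw [Finset.mul_sum, ← Finset.sum_sub_distrib]
  refine Finset.sum_congr rfl fun l hl => ?_
  have := hR _ (h1 l hl).1
  obtain ⟨k, i, j⟩ := l
  simp only [Lozenge.upTriangle] at this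
  cases k <;> simp [Lozenge.rotate]
  omega

namespace IntrudedHexagon

/-- Without ferns the hexagon is centrally symmetric. The number of right-tilting lozenges is the
same for all tilings, so rotation by π replaces the exponent of `wt₁` by a constant minus itself.
The volume differs from this exponent only by a constant. -/
lemma palindromic_hexagon (x y z t : ℕ) {U D : Finset ℤ}
    (hG : (pHexagon x y z t [] []).Spec U D y) : Palindromic fun q =>
      ∑ T ∈ tilings (pHexagon x y z t [] []).region,
        q ^ (pHexagon x y z t [] []).vol (shift U D (pHexagon x y z t [] []).tipL y)
          ((pHexagon x y z t [] []).chains T) := by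
  obtain ⟨T₀, hT₀, -⟩ := hG.exists_chains_eq hG.minPair_mem
  set V := fun T => (pHexagon x y z t [] []).vol (shift U D (pHexagon x y z t [] []).tipL y)
          ((pHexagon x y z t [] []).chains T) with hV
  set H : ℤ := x + y + t + y with hH
  set c : ℤ := z - (y + t) with hc
  have hrot : ∀ i j, (⟨true, i, j⟩ : UnitTriangle) ∈ (pHexagon x y z t [] []).region ↔
      (⟨false, c - 1 - i, H - 1 - j⟩ : UnitTriangle) ∈ (pHexagon x y z t [] []).region := by
    intro i j
    rw [up_mem_region, down_mem_region]
    have e1 : oddSum [] = 0 := rfl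
    have e2 : evenSum [] = 0 := rfl
    simp only [pHexagon, leftFern, rightFern, e1, e2, List.append_nil, List.not_mem_nil,
      false_imp_iff, implies_true, and_true]
    push_cast
    omega
  have hrange : ∀ τ ∈ (pHexagon x y z t [] []).region, 0 ≤ τ.j ∧ τ.j < H := by
    intro τ hτ
    have := row_range hτ
    have e1 : oddSum [] = 0 := rfl
    have e2 : evenSum [] = 0 := rfl
    simp only [pHexagon, e1, e2] at this
    omega
  have hVe : ∀ T ∈ tilings (pHexagon x y z t [] []).region,
      V T = expo .right T + (V T₀ - expo .right T₀) := by
    intro T hT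
    have := (hG.expo_sub hT hT₀).1
    simp only [hV]
    omega
  have hVr : ∀ T ∈ tilings (pHexagon x y z t [] []).region,
      V (T.image (Lozenge.rotate c H)) = -V T + ((H + 1) * (T₀.filter fun l => l.kind = .right).card +
        2 * (V T₀ - expo .right T₀)) := by
    intro T hT
    rw [hVe _ (rotate_mem_tilings hrot hT), expo_rotate hrange hT, hVe T hT, hG.card_right_eq hT hT₀]
    ring
  refine ⟨-((H + 1) * (T₀.filter fun l => l.kind = .right).card + 2 * (V T₀ - expo .right T₀)),
    fun q hq _ => ?_⟩
  rw [Finset.mul_sum]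
  refine Finset.sum_nbij' (fun T => T.image (Lozenge.rotate c H)) (fun T => T.image (Lozenge.rotate c H))
    (fun T hT => rotate_mem_tilings hrot hT) (fun T hT => rotate_mem_tilings hrot hT) ?_ ?_ ?_
  · intro T _
    simp [Finset.image_image, Function.comp_def, Lozenge.rotate_rotate]
  · intro T _
    simp [Finset.image_image, Function.comp_def, Lozenge.rotate_rotate]
  · intro T hT
    have := hVr T hT
    simp only [hV] at this ⊢
    rw [this, inv_zpow', ← zpow_add₀ hq.ne']
    congr 1
    ring

namespace Spec
variable {G : IntrudedHexagon} {U D : Finset ℤ} {y : ℕ} (hG : G.Spec U D y)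
include hG

/-- The volume generating function is palindromic. -/
lemma palindromic : Palindromic fun q =>
    ∑ T ∈ tilings G.region, q ^ G.vol (shift U D G.tipL y) (G.chains T) := by
  rw [hG.palindromic_iff]
  have t1 := hG.tips
  have t2 := hG.le_tipL
  have t3 := hG.sw_le
  have t4 := hG.tipR_le
  -- The parameters of a hexagon without ferns whose prolonged axis has the same shape: a blocked
  -- part of length `x`, a free segment of length `y + z` and a blocked part of length `t`.
  obtain ⟨x, hx⟩ : ∃ x : ℕ, (x : ℤ) = G.tipL + G.axis := ⟨(G.tipL + G.axis).toNat, by omega⟩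
  obtain ⟨t, ht⟩ : ∃ t : ℕ, (t : ℤ) = max (G.s : ℤ) G.neEnd - G.tipR :=
    ⟨(max (G.s : ℤ) G.neEnd - G.tipR).toNat, by omega⟩
  obtain ⟨z, hz⟩ : ∃ z : ℕ, (z : ℤ) = G.tipR - G.tipL - y := ⟨(G.tipR - G.tipL - y).toNat, by omega⟩
  have h0 := (hasFerns_pHexagon x y z t [] []).spec
  have hp := h0.palindromic_iff.1 (palindromic_hexagon x y z t h0)
  have hm := h0.mem_or
  have e1 : oddSum [] = 0 := rfl
  have e2 : evenSum [] = 0 := rfl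
  generalize HasFerns.ups _ _ _ _ _ = U₀ at hp hm
  generalize HasFerns.downs _ _ _ _ _ = D₀ at hp hm
  simp only [pHexagon, neEnd, e1, e2, List.sum_nil] at hp hm
  -- The left tip of the hexagon without ferns is at `-(y + t)`, which fixes the translation.
  -- Afterwards the free segments and the unions of blocked segments coincide, and `freeSum` depends
  -- on nothing else.
  obtain ⟨e, he⟩ := freeSum_translate (-((y + t + 0 + 0 : ℕ) : ℤ) + (0 : ℕ))
    (((z + 0 + 0 : ℕ) : ℤ) - t - (0 : ℕ)) y (U₀ ∪ D₀) (G.tipL + y + t)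
  refine ((Palindromic.zpow e).mul hp).congr fun q hq _ => ?_
  rw [← he q hq]
  congr 1
  · push_cast; ring
  · push_cast; omega
  · ext p
    have h1 := hm (p - (G.tipL + y + t))
    have h2 := hG.mem_or p
    simp only [Finset.mem_image, Finset.mem_union]
    rw [h2]
    constructor
    · rintro ⟨r, hr, rfl⟩
      rw [add_sub_cancel_right] at h1
      have := h1.1 hr
      push_cast at this
      omega
    · intro h
      refine ⟨p - (G.tipL + y + t), h1.2 ?_, by ring⟩
      push_cast
      omega

end Spec
end IntrudedHexagon

/-! ### From palindromic generating functions to the four identities -/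

lemma coeff_zero_sum_pow {ι : Type*} {s : Finset ι} {f : ι → ℕ} (h : ∃ i ∈ s, f i = 0) :
    (∑ i ∈ s, (X : ℤ[X]) ^ f i).coeff 0 ≠ 0 := by
  obtain ⟨i, hi, h0⟩ := h
  rw [Polynomial.finsetSum_coeff]
  simp only [Polynomial.coeff_X_pow]
  refine ne_of_gt (Finset.sum_pos' (fun _ _ => by split_ifs <;> simp) ⟨i, hi, by simp [h0]⟩)

lemma eq_of_eval_eq {P Q : ℤ[X]}
    (h : ∀ q : ℝ, 0 < q → q ≠ 1 → Polynomial.aeval q P = Polynomial.aeval q Q) : P = Q := by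
  refine Polynomial.map_injective (Int.castRingHom ℝ) Int.cast_injective ?_
  refine Polynomial.eq_of_infinite_eval_eq _ _ ((Set.Ioi_infinite (1 : ℝ)).mono fun q hq => ?_)
  have hq' : (1 : ℝ) < q := hq
  have := h q (by linarith) hq'.ne'
  simpa [Polynomial.eval_map, Polynomial.aeval_def] using this

/-- A palindromic sum of powers agrees with the sum of the complementary powers. -/
lemma sum_pow_eq_of_palindromic {ι : Type*} {s : Finset ι} {V : ι → ℤ} {m M : ℤ}
    (hm : ∀ i ∈ s, m ≤ V i) (hM : ∀ i ∈ s, V i ≤ M) (am : ∃ i ∈ s, V i = m) (aM : ∃ i ∈ s, V i = M)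
    (h : Palindromic fun q => ∑ i ∈ s, q ^ V i) :
    ∑ i ∈ s, (X : ℤ[X]) ^ (V i - m).toNat = ∑ i ∈ s, (X : ℤ[X]) ^ (M - V i).toNat := by
  obtain ⟨k, hk⟩ := h
  have e1 : ∀ q : ℝ, 0 < q → Polynomial.aeval q (∑ i ∈ s, (X : ℤ[X]) ^ (V i - m).toNat) =
      q ^ (-m) * ∑ i ∈ s, q ^ V i := by
    intro q hq
    rw [map_sum, Finset.mul_sum]
    refine Finset.sum_congr rfl fun i hi => ?_
    rw [map_pow, Polynomial.aeval_X, ← zpow_natCast, ← zpow_add₀ hq.ne']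
    congr 1
    have := hm i hi
    omega
  have e2 : ∀ q : ℝ, 0 < q → Polynomial.aeval q (∑ i ∈ s, (X : ℤ[X]) ^ (M - V i).toNat) =
      q ^ M * ∑ i ∈ s, q⁻¹ ^ V i := by
    intro q hq
    rw [map_sum, Finset.mul_sum]
    refine Finset.sum_congr rfl fun i hi => ?_
    rw [map_pow, Polynomial.aeval_X, ← zpow_natCast, inv_zpow', ← zpow_add₀ hq.ne']
    congr 1
    have := hM i hi
    omega
  have c1 := coeff_zero_sum_pow (s := s) (f := fun i => (V i - m).toNat)
    (by obtain ⟨i, hi, h⟩ := am; exact ⟨i, hi, by simp [h]⟩)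
  have c2 := coeff_zero_sum_pow (s := s) (f := fun i => (M - V i).toNat)
    (by obtain ⟨i, hi, h⟩ := aM; exact ⟨i, hi, by simp [h]⟩)
  have e3 : ∀ q : ℝ, 0 < q → q ≠ 1 → Polynomial.aeval q (∑ i ∈ s, (X : ℤ[X]) ^ (M - V i).toNat) =
      q ^ (M + k + m) * Polynomial.aeval q (∑ i ∈ s, (X : ℤ[X]) ^ (V i - m).toNat) := by
    intro q hq h1
    have := hk q hq h1
    simp only at this
    rw [e1 q hq, e2 q hq, this, ← mul_assoc, ← mul_assoc, ← zpow_add₀ hq.ne',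
      ← zpow_add₀ hq.ne']
    congr 2
    ring
  generalize ∑ i ∈ s, (X : ℤ[X]) ^ (V i - m).toNat = P at *
  generalize ∑ i ∈ s, (X : ℤ[X]) ^ (M - V i).toNat = Q at *
  -- The two polynomials agree up to a power of `q`. Both have a non-zero constant coefficient,
  -- because both extreme values are attained, so the power is trivial.
  rcases lt_trichotomy (M + k + m) 0 with he | he | he
  · obtain ⟨n, hn⟩ : ∃ n : ℕ, M + k + m = -((n + 1 : ℕ) : ℤ) := ⟨(-(M + k + m) - 1).toNat, by omega⟩
    have : P = X ^ (n + 1) * Q := eq_of_eval_eq fun q hq h1 => by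
      rw [map_mul, map_pow, Polynomial.aeval_X, e3 q hq h1, hn, zpow_neg, zpow_natCast,
        mul_inv_cancel_left₀ (by positivity)]
    refine absurd ?_ c1
    rw [this, pow_succ', mul_assoc, Polynomial.coeff_X_mul_zero]
  · refine eq_of_eval_eq fun q hq h1 => ?_
    rw [e3 q hq h1, he, zpow_zero, one_mul]
  · obtain ⟨n, hn⟩ : ∃ n : ℕ, M + k + m = ((n + 1 : ℕ) : ℤ) := ⟨(M + k + m - 1).toNat, by omega⟩
    have : Q = X ^ (n + 1) * P := eq_of_eval_eq fun q hq h1 => by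
      rw [map_mul, map_pow, Polynomial.aeval_X, e3 q hq h1, hn, zpow_natCast]
    refine absurd ?_ c2
    rw [this, pow_succ', mul_assoc, Polynomial.coeff_X_mul_zero]

namespace IntrudedHexagon.Spec
variable {G : IntrudedHexagon} {U D : Finset ℤ} {y : ℕ} (hG : G.Spec U D y)
include hG

lemma vol_bounds {T : Finset Lozenge} (hT : T ∈ tilings G.region) (c : ℤ) :
    G.vol c (minPair U D G.tipL y) ≤ G.vol c (G.chains T) ∧
      G.vol c (G.chains T) ≤ G.vol c (maxPair U D G.tipR y) :=
  ⟨Finset.sum_le_sum fun v _ => (hG.ht_bounds (hG.chains_mem_model hT) (inSide_decide v)).1,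
    Finset.sum_le_sum fun v _ => (hG.ht_bounds (hG.chains_mem_model hT) (inSide_decide v)).2⟩

/-- The weighted tilings of the region and the monotone stacks in its augmented box. -/
theorem M_eq {e₁ e₂ : ℕ}
    (h₁ : ∀ T ∈ tilings G.region, G.chains T = minPair U D G.tipL y → expo .right T = e₁)
    (h₂ : ∀ T ∈ tilings G.region, G.chains T = maxPair U D G.tipR y → expo .left T = e₂) :
    M₁ G.region = X ^ e₁ * volumeGF G.augmentedBox ∧
      M₂ G.region = X ^ e₂ * volumeGF G.augmentedBox := by
  obtain ⟨T₀, hT₀, hc₀⟩ := hG.exists_chains_eq hG.minPair_mem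
  obtain ⟨T₁, hT₁, hc₁⟩ := hG.exists_chains_eq hG.maxPair_mem
  have f₁ := h₁ T₀ hT₀ hc₀
  have f₂ := h₂ T₁ hT₁ hc₁
  constructor
  · unfold M₁
    rw [hG.volumeGF_eq, Finset.mul_sum]
    refine Finset.sum_congr rfl fun T hT => ?_
    rw [prod_wt₁, ← pow_add]
    congr 1
    have := (hG.expo_sub hT hT₀).1
    rw [hc₀] at this
    have := (hG.vol_bounds hT (shift U D G.tipL y)).1
    omega
  · unfold M₂
    -- The exponent of `wt₂` decreases as the volume grows, so it is measured from the highest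
    -- tiling. The palindromic symmetry replaces the volume above the lowest surface by the volume
    -- missing to the highest one.
    rw [hG.volumeGF_eq, sum_pow_eq_of_palindromic (fun T hT => (hG.vol_bounds hT _).1)
      (fun T hT => (hG.vol_bounds hT _).2) ⟨T₀, hT₀, by rw [hc₀]⟩ ⟨T₁, hT₁, by rw [hc₁]⟩
      hG.palindromic, Finset.mul_sum]
    refine Finset.sum_congr rfl fun T hT => ?_
    rw [prod_wt₂, ← pow_add]
    congr 1
    have := (hG.expo_sub hT hT₁).2
    rw [hc₁] at this
    have := (hG.vol_bounds hT (shift U D G.tipL y)).2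
    omega

end IntrudedHexagon.Spec
end LozengeTiling

theorem lemma6p7 (x y z t : ℕ) (a b : List ℕ) :
    ((pHexagon x y z t a b).augmentedBox.Finite ∧ (qHexagon x y z t a b).augmentedBox.Finite) ∧
    M₁ (pHexagon x y z t a b).region
      = Polynomial.X ^ expA₁ x y z t a b * volumeGF (pHexagon x y z t a b).augmentedBox ∧
    M₂ (pHexagon x y z t a b).region
      = Polynomial.X ^ expA₂ x y z t a b * volumeGF (pHexagon x y z t a b).augmentedBox ∧
    M₁ (qHexagon x y z t a b).region
      = Polynomial.X ^ expB₁ x y z t a b * volumeGF (qHexagon x y z t a b).augmentedBox ∧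
    M₂ (qHexagon x y z t a b).region
      = Polynomial.X ^ expB₂ x y z t a b * volumeGF (qHexagon x y z t a b).augmentedBox := by
  have hP := hasFerns_pHexagon x y z t a b
  have hQ := hasFerns_qHexagon x y z t a b
  refine ⟨⟨hP.spec.augmentedBox_finite, hQ.spec.augmentedBox_finite⟩, ?_⟩
  obtain ⟨h₁, h₂⟩ := hP.spec.M_eq (fun T hT h => expo_min_pHexagon hT rfl rfl h)
    (fun T hT h => expo_max_pHexagon hT rfl rfl h)
  obtain ⟨h₃, h₄⟩ := hQ.spec.M_eq (fun T hT h => expo_min_qHexagon hT rfl rfl h)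
    (fun T hT h => expo_max_qHexagon hT rfl rfl h)
  exact ⟨h₁, h₂, h₃, h₄⟩
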